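/- Let $\mathcal V$ be a cocomplete closed symmetric monoidal category. For a small $\mathcal V$-category $\mathcal A$ let $E\mathcal A$ be the symmetric $\mathcal V$-multicategory with the same objects and with $(E\mathcal A)_1(a;b)=\mathcal A(a,b)$ and $(E\mathcal A)_n(a_1,\dots,a_n;b)=\emptyset$ (the initial object) for $n\neq 1$; for a symmetric $\mathcal V$-multicategory $\mathrm M$ let $\mathrm M_1$ be its underlying $\mathcal V$-category, $\mathrm M_1(a,b)=\mathrm M_1(a;b)$, and let $\epsilon_{\mathrm M}:E\mathrm M_1\to\mathrm M$ be the counit of the adjunction $E\dashv(-)_1$ (the identity on objects and on unary morphisms). A $\mathcal V$-functor or symmetric $\mathcal V$-multifunctor is a full and faithful inclusion if it is injective on objects and an isomorphism on all $\mathcal V$-objects of morphisms. Let $\mathrm M$ be a small symmetric $\mathcal V$-multicategory, $B$ a small $\mathcal V$-category with $Ob(B)=Ob(\mathrm M)\sqcup\{q\}$, and $i:\mathrm M_1\hookrightarrow B$ a full and faithful inclusion. Then the pushout $$\begin{array}{ccc} E\mathrm M_1 & \xrightarrow{\;Ei\;} & EB\\ {\scriptstyle\epsilon_{\mathrm M}}\downarrow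 & & \downarrow\\ \mathrm M & \longrightarrow & \mathrm N\end{array}$$ exists in the category of small symmetric $\mathcal V$-multicategories, and in every such pushout the map $\mathrm M\to\mathrm N$ is a full and faithful inclusion. Moreover $EB\to \mathrm N$ is bijective on objects (so $Ob(\mathrm N)=Ob(\mathrm M)\sqcup\{q\}$), and the $\mathcal V$-objects of morphisms of $\mathrm N$ are as follows, where the isomorphisms are the canonical ones, induced by composition in $\mathrm N$, and the coends are $\mathcal V$-enriched coends over $\mathrm M_1$. Let $k,s,r\ge 0$ with $k=s+r$, let $(a_1,\dots,a_r)$ be objects of $\mathrm M$, and choose $s$ positions in a $k$-tuple. Write $a^{q}$ for the $k$-tuple with $q$ at the chosen positions and $a_1,\dots,a_r$ at the others, and $a^{x}$ for the $k$-tuple with objects $x_1,\dots,x_s$ of $\mathrm M$ at the chosen positions instead. 1. If $c\in Ob(\mathrm M)$, then $$\mathrm N_k(a^{q};c)\cong\int^{x_1}\!\!\cdots\int^{x_s}\mathrm M_k(a^{x};c)\otimes B(q,x_1)\otimes\cdots\otimes B(q,x_s).$$ 2. If $(k,s)\neq(1,1)$, then $$\mathrm N_k(a^{q};q)\cong\int^{y}\!\int^{x_1}\!\!\cdots\int^{x_s}B(y,q)\otimes\mathrm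 M_k(a^{x};y)\otimes B(q,x_1)\otimes\cdots\otimes B(q,x_s)$$ (for $s=0$ this reads $\mathrm N_k(a_1,\dots,a_k;q)\cong\int^{y}B(y,q)\otimes \mathrm M_k(a_1,\dots,a_k;y)$). 3. The map $B(q,q)\to\mathrm N_1(q;q)$ given by $EB\to\mathrm N$ is an isomorphism. -/

import Mathlib

open CategoryTheory MonoidalCategory Limits

universe v u

set_option linter.unusedSectionVars false
set_option linter.unusedVariables false

noncomputable section

namespace SymMulti

/-- `0` stays in place, the other positions are permuted by `τ`. -/
def consEquiv {k' k : ℕ} (τ : Fin k' ≃ Fin k) : Fin (k' + 1) ≃ Fin (k + 1) :=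
  (finSuccEquiv k').trans (τ.optionCongr.trans (finSuccEquiv k).symm)

/-- The block sum of two bijections. -/
def appendEquiv {l' l k' k : ℕ} (σ : Fin l' ≃ Fin l) (τ : Fin k' ≃ Fin k) :
    Fin (l' + k') ≃ Fin (l + k) :=
  finSumFinEquiv.symm.trans ((σ.sumCongr τ).trans finSumFinEquiv)

/-- Sends `0` to position `m` and preserves the order of the other positions, so that
`(w₁, …, w_m, v, a₁, …, a_r)` is relabelled to `(v, w₁, …, w_m, a₁, …, a_r)`. -/
def frontEquiv (m r : ℕ) : Fin (m + r + 1) ≃ Fin (m + (r + 1)) :=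
  (finSuccEquiv (m + r)).trans
    (finSuccEquiv' (⟨m, by omega⟩ : Fin (m + r + 1))).symm

/-- Exchanges the first two blocks, so that `(b, a, c)` is relabelled to `(a, b, c)`. -/
def blockEquiv (l k m : ℕ) : Fin (l + (k + m)) ≃ Fin (k + (l + m)) :=
  (finSumFinEquiv.symm.trans ((Equiv.refl (Fin l)).sumCongr finSumFinEquiv.symm)).trans
    ((((Equiv.sumAssoc (Fin l) (Fin k) (Fin m)).symm.trans
      ((Equiv.sumComm (Fin l) (Fin k)).sumCongr (Equiv.refl (Fin m)))).trans
      (Equiv.sumAssoc (Fin k) (Fin l) (Fin m))).trans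
    (((Equiv.refl (Fin k)).sumCongr finSumFinEquiv).trans finSumFinEquiv))

section Tuples

variable {α β : Type v}

/-- The tuple `(x, b₁, …, b_k)`. -/
abbrev cons {k : ℕ} (x : α) (b : Fin k → α) : Fin (k + 1) → α :=
  Fin.cons (α := fun _ => α) x b

/-- The tuple `(x)` of length one. -/
abbrev single (x : α) : Fin 1 → α := fun _ => x

/-- The tuple of length zero. -/
abbrev nil : Fin 0 → α := Fin.elim0

theorem cons_consEquiv {k' k : ℕ} (τ : Fin k' ≃ Fin k) (x : α) {b : Fin k → α}
    {b' : Fin k' → α} (h : ∀ i, b' i = b (τ i)) (i : Fin (k' + 1)) :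
    cons x b' i = cons x b (consEquiv τ i) := by
  refine Fin.cases ?_ (fun j => ?_) i
  · simp [consEquiv]
  · simp [consEquiv, h]

theorem append_appendEquiv {l' l k' k : ℕ} (σ : Fin l' ≃ Fin l) (τ : Fin k' ≃ Fin k)
    {a : Fin l → α} {a' : Fin l' → α} {b : Fin k → α} {b' : Fin k' → α}
    (ha : ∀ i, a' i = a (σ i)) (hb : ∀ i, b' i = b (τ i)) (i : Fin (l' + k')) :
    Fin.append a' b' i = Fin.append a b (appendEquiv σ τ i) := by
  refine Fin.addCases (fun j => ?_) (fun j => ?_) i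
  · simp [appendEquiv, ha]
  · simp [appendEquiv, hb]

theorem cons_frontEquiv {m r : ℕ} (w : Fin m → α) (v : α) (a : Fin r → α)
    (i : Fin (m + r + 1)) :
    cons v (Fin.append w a) i = Fin.append w (cons v a) (frontEquiv m r i) := by
  refine Fin.cases ?_ (fun j => ?_) i
  · have : frontEquiv m r 0 = Fin.natAdd m (0 : Fin (r + 1)) := by
      ext; simp [frontEquiv]
    rw [this, Fin.append_right]; rfl
  · refine Fin.addCases (fun j => ?_) (fun j => ?_) j
    · have : frontEquiv m r (Fin.castAdd r j).succ = Fin.castAdd (r + 1) j := by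
        ext
        simp [frontEquiv, Fin.succAbove, Fin.lt_def]
      rw [this, Fin.append_left]; simp [cons]
    · have : frontEquiv m r (Fin.natAdd m j).succ = Fin.natAdd m j.succ := by
        ext
        simp [frontEquiv, Fin.succAbove, Fin.lt_def]
        omega
      rw [this, Fin.append_right]; simp [cons]

theorem append_blockEquiv {l k m : ℕ} (a : Fin l → α) (b : Fin k → α) (c : Fin m → α)
    (i : Fin (l + (k + m))) :
    Fin.append a (Fin.append b c) i =
      Fin.append b (Fin.append a c) (blockEquiv l k m i) := by
  refine Fin.addCases (fun j => ?_) (fun j => ?_) i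
  · simp [blockEquiv]
  · refine Fin.addCases (fun j => ?_) (fun j => ?_) j
    · simp [blockEquiv]
    · simp [blockEquiv]

theorem cons_swap {m : ℕ} (x y : α) (c : Fin m → α) (i : Fin (m + 1 + 1)) :
    cons y (cons x c) i = cons x (cons y c) (Equiv.swap 0 1 i) := by
  refine Fin.cases ?_ (fun j => Fin.cases ?_ (fun j => ?_) j) i
  · simp [cons]
  · simp [cons]
  · rw [Equiv.swap_apply_of_ne_of_ne]
    · rfl
    · exact Fin.succ_ne_zero _
    · intro h
      have := congrArg Fin.val h
      simp at this

theorem append_assoc' {l k m : ℕ} (a : Fin l → α) (b : Fin k → α) (c : Fin m → α)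
    (i : Fin (l + k + m)) :
    Fin.append (Fin.append a b) c i =
      Fin.append a (Fin.append b c) (finCongr (Nat.add_assoc l k m) i) := by
  rw [Fin.append_assoc]; rfl

theorem cons_append' {k m : ℕ} (x : α) (b : Fin k → α) (c : Fin m → α)
    (i : Fin (k + m + 1)) :
    cons x (Fin.append b c) i =
      Fin.append (cons x b) c (finCongr (Nat.succ_add k m).symm i) := by
  rw [show cons x b = Fin.cons (α := fun _ => α) x b from rfl, Fin.append_cons]
  simp

theorem append_single {k : ℕ} (x : α) (b : Fin k → α) (i : Fin (1 + k)) :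
    Fin.append (single x) b i = cons x b (finCongr (Nat.add_comm 1 k) i) := by
  rw [Fin.append_left_eq_cons]; rfl

theorem cons_nil (x : α) (i : Fin 1) : cons x nil i = single x i := by
  rw [Subsingleton.elim i 0]; rfl

theorem append_nil {l : ℕ} (a : Fin l → α) (i : Fin l) : Fin.append a nil i = a i := by
  have := congrFun (Fin.append_elim0 a) i
  exact this

theorem comp_cons {k : ℕ} (f : α → β) (x : α) (b : Fin k → α) (i : Fin (k + 1)) :
    cons (f x) (f ∘ b) i = (f ∘ cons x b) i := by
  refine Fin.cases ?_ (fun j => ?_) i <;> simp [cons]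

theorem comp_append {l k : ℕ} (f : α → β) (a : Fin l → α) (b : Fin k → α)
    (i : Fin (l + k)) :
    Fin.append (f ∘ a) (f ∘ b) i = (f ∘ Fin.append a b) i := by
  refine Fin.addCases (fun j => ?_) (fun j => ?_) i <;> simp

end Tuples

/-- A small symmetric `V`-multigraph: a set of objects, an object
`Hom (a₁, …, a_k) b` of `V` for all objects `a₁, …, a_k, b` (`k ≥ 0`), and a right action
of the symmetric groups.  A bijection `σ : Fin k ≃ Fin l` is nothing but a permutation, since it
forces `k = l`; stating the action for such `σ`, and for any two tuples with `a'_i = a_{σ i}`,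
makes it also carry the identifications along `(k + l) + m = k + (l + m)` etc. -/
structure SymMultigraph (V : Type u) [Category.{v} V] where
  Ob : Type v
  Hom : {k : ℕ} → (Fin k → Ob) → Ob → V
  act : {k l : ℕ} → (σ : Fin k ≃ Fin l) → {a : Fin l → Ob} → {a' : Fin k → Ob} → {b : Ob} →
    (h : ∀ i, a' i = a (σ i)) → (Hom a b ⟶ Hom a' b)
  act_refl : ∀ {k : ℕ} (a : Fin k → Ob) (b : Ob),
    act (Equiv.refl (Fin k)) (a := a) (a' := a) (b := b) (fun _ => rfl) = 𝟙 (Hom a b)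
  act_trans : ∀ {k l m : ℕ} (σ : Fin l ≃ Fin m) (τ : Fin k ≃ Fin l)
    {a : Fin m → Ob} {a' : Fin l → Ob} {a'' : Fin k → Ob} {b : Ob}
    (h : ∀ i, a' i = a (σ i)) (h' : ∀ i, a'' i = a' (τ i)),
    act σ (b := b) h ≫ act τ h' =
      act (τ.trans σ) (fun i => (h' i).trans (h (τ i)))

namespace SymMultigraph

variable {V : Type u} [Category.{v} V] (M : SymMultigraph.{v, u} V)

/-- The identification `Hom a b ⟶ Hom a' b` for equal tuples `a = a'`. -/
def cast {k : ℕ}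
    {a a' : Fin k → M.Ob} {b : M.Ob} (h : ∀ i, a' i = a i) : M.Hom a b ⟶ M.Hom a' b :=
  M.act (Equiv.refl (Fin k)) h

theorem act_id {k : ℕ} (σ : Fin k ≃ Fin k) (hσ : σ = Equiv.refl _) {a : Fin k → M.Ob} {b : M.Ob}
    (h : ∀ i, a i = a (σ i)) : M.act σ (b := b) h = 𝟙 (M.Hom a b) := by
  subst hσ; exact M.act_refl a b

theorem act_congr {k l : ℕ} {σ τ : Fin k ≃ Fin l} (hσ : σ = τ) {a : Fin l → M.Ob}
    {a' : Fin k → M.Ob} {b : M.Ob} (h : ∀ i, a' i = a (σ i)) (h' : ∀ i, a' i = a (τ i)) :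
    M.act σ (b := b) h = M.act τ h' := by
  subst hσ; rfl

theorem cast_refl {k : ℕ} (a : Fin k → M.Ob) (b : M.Ob) (h : ∀ i, a i = a i) :
    M.cast (b := b) h = 𝟙 (M.Hom a b) :=
  M.act_refl a b

theorem cast_trans {k : ℕ} {a a' a'' : Fin k → M.Ob} {b : M.Ob} (h : ∀ i, a' i = a i)
    (h' : ∀ i, a'' i = a' i) :
    M.cast (b := b) h ≫ M.cast h' = M.cast (fun i => (h' i).trans (h i)) :=
  M.act_trans _ _ _ _

theorem act_cast {k l : ℕ} (σ : Fin k ≃ Fin l) {a : Fin l → M.Ob} {a' a'' : Fin k → M.Ob}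
    {b : M.Ob} (h : ∀ i, a' i = a (σ i)) (h' : ∀ i, a'' i = a' i) :
    M.act σ (b := b) h ≫ M.cast h' = M.act σ (fun i => (h' i).trans (h i)) :=
  M.act_trans _ _ _ _

theorem cast_act {k l : ℕ} (σ : Fin k ≃ Fin l) {a a' : Fin l → M.Ob} {a'' : Fin k → M.Ob}
    {b : M.Ob} (h : ∀ i, a' i = a i) (h' : ∀ i, a'' i = a' (σ i)) :
    M.cast (b := b) h ≫ M.act σ h' = M.act σ (fun i => (h' i).trans (h (σ i))) :=
  M.act_trans _ _ _ _

theorem act_eq_cast {k : ℕ} (σ : Fin k ≃ Fin k) (hσ : σ = Equiv.refl _) {a a' : Fin k → M.Ob}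
    {b : M.Ob} (h : ∀ i, a' i = a (σ i)) (h' : ∀ i, a' i = a i) :
    M.act σ (b := b) h = M.cast h' := by
  subst hσ; rfl

end SymMultigraph

/-- A small symmetric `V`-multicategory, presented by its composition operations in the first input
`(f, g) ↦ g ∘₁ f`; composition in the other inputs is obtained from it with the action of the
symmetric groups, and simultaneous composition by iterating.  As in `EnrichedCategory`, the
factors are written in diagrammatic order. -/
structure SymMulticat (V : Type u) [Category.{v} V] [MonoidalCategory V] [SymmetricCategory V]
    extends SymMultigraph V where
  /-- the units -/
  one : ∀ x : Ob, 𝟙_ V ⟶ Hom (single x) x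
  /-- composition `M(a₁, …, a_l; x) ⊗ M(x, b₁, …, b_k; c) ⟶ M(a₁, …, a_l, b₁, …, b_k; c)` -/
  comp : ∀ {l k : ℕ} (a : Fin l → Ob) (x : Ob) (b : Fin k → Ob) (c : Ob),
    Hom a x ⊗ Hom (cons x b) c ⟶ Hom (Fin.append a b) c
  /-- equivariance -/
  act_comp : ∀ {l' l k' k : ℕ} (σ : Fin l' ≃ Fin l) (τ : Fin k' ≃ Fin k)
    {a : Fin l → Ob} {a' : Fin l' → Ob} {b : Fin k → Ob} {b' : Fin k' → Ob} (x c : Ob)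
    (ha : ∀ i, a' i = a (σ i)) (hb : ∀ i, b' i = b (τ i)),
    (act σ ha ⊗ₘ act (consEquiv τ) (cons_consEquiv τ x hb)) ≫ comp a' x b' c =
      comp a x b c ≫ act (appendEquiv σ τ) (append_appendEquiv σ τ ha hb)
  /-- left unit law -/
  one_comp : ∀ {k : ℕ} (x : Ob) (b : Fin k → Ob) (c : Ob),
    one x ▷ Hom (cons x b) c ≫ comp (single x) x b c =
      (λ_ _).hom ≫ act (finCongr (Nat.add_comm 1 k)) (append_single x b)
  /-- right unit law -/
  comp_one : ∀ {l : ℕ} (a : Fin l → Ob) (x : Ob),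
    Hom a x ◁ (one x ≫ toSymMultigraph.cast (cons_nil x)) ≫ comp a x nil x =
      (ρ_ _).hom ≫ toSymMultigraph.cast (append_nil a)
  /-- associativity, for composition one after the other:
  `h ∘ (g ∘ f)` for `f : a ⟶ x`, `g : (x, b) ⟶ y`, `h : (y, c) ⟶ z` -/
  assoc : ∀ {l k m : ℕ} (a : Fin l → Ob) (x : Ob) (b : Fin k → Ob) (y : Ob)
    (c : Fin m → Ob) (z : Ob),
    comp a x b y ▷ Hom (cons y c) z ≫ comp (Fin.append a b) y c z =
      (α_ _ _ _).hom ≫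
        Hom a x ◁ (comp (cons x b) y c z ≫
          act (finCongr (Nat.succ_add k m).symm) (cons_append' x b c)) ≫
        comp a x (Fin.append b c) z ≫
        act (finCongr (Nat.add_assoc l k m)) (append_assoc' a b c)
  /-- associativity, for composition in two different inputs: for `f : a ⟶ x`, `g : b ⟶ y` and
  `h : (x, y, c) ⟶ z` it does not matter which of `f`, `g` is inserted first -/
  comp_comm : ∀ {l k m : ℕ} (a : Fin l → Ob) (x : Ob) (b : Fin k → Ob) (y : Ob)
    (c : Fin m → Ob) (z : Ob),
    Hom a x ◁ (Hom b y ◁ act (Equiv.swap 0 1) (cons_swap x y c) ≫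
        comp b y (cons x c) z ≫ act (frontEquiv k m) (cons_frontEquiv b x c)) ≫
      comp a x (Fin.append b c) z =
    (α_ _ _ _).inv ≫ (β_ (Hom a x) (Hom b y)).hom ▷ _ ≫ (α_ _ _ _).hom ≫
      Hom b y ◁ (comp a x (cons y c) z ≫ act (frontEquiv l m) (cons_frontEquiv a y c)) ≫
      comp b y (Fin.append a c) z ≫ act (blockEquiv l k m) (append_blockEquiv a b c)

variable {V : Type u} [Category.{v} V] [MonoidalCategory V] [SymmetricCategory V]

namespace SymMulticat

/-- A symmetric `V`-multifunctor. -/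
@[ext]
structure Multifunctor (M N : SymMulticat V) where
  obj : M.Ob → N.Ob
  map : {k : ℕ} → (a : Fin k → M.Ob) → (b : M.Ob) → (M.Hom a b ⟶ N.Hom (obj ∘ a) (obj b))
  map_act : ∀ {k l : ℕ} (σ : Fin k ≃ Fin l) {a : Fin l → M.Ob} {a' : Fin k → M.Ob} {b : M.Ob}
    (h : ∀ i, a' i = a (σ i)),
    M.act σ (b := b) h ≫ map a' b = map a b ≫ N.act σ (fun i => congrArg obj (h i))
  map_one : ∀ x : M.Ob, M.one x ≫ map (single x) x = N.one (obj x)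
  map_comp : ∀ {l k : ℕ} (a : Fin l → M.Ob) (x : M.Ob) (b : Fin k → M.Ob) (c : M.Ob),
    M.comp a x b c ≫ map (Fin.append a b) c ≫
        N.cast (comp_append obj a b) =
      (map a x ⊗ₘ (map (cons x b) c ≫ N.cast (comp_cons obj x b))) ≫
        N.comp (obj ∘ a) (obj x) (obj ∘ b) (obj c)

theorem Multifunctor.map_cast {M N : SymMulticat V} (F : Multifunctor M N) {k : ℕ}
    {a a' : Fin k → M.Ob} {b : M.Ob} (h : ∀ i, a' i = a i) :
    M.cast (b := b) h ≫ F.map a' b =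
      F.map a b ≫ N.cast (a := F.obj ∘ a) (a' := F.obj ∘ a') (fun i => congrArg F.obj (h i)) :=
  F.map_act (Equiv.refl _) h

/-- The identity multifunctor. -/
@[simps]
def Multifunctor.id (M : SymMulticat V) : Multifunctor M M where
  obj := fun x => x
  map := fun a b => 𝟙 (M.Hom a b)
  map_act := fun σ _ _ _ h => by simp
  map_one := fun x => by simp
  map_comp := fun a x b c => by
    have h1 := M.cast_refl (Fin.append a b) c (fun _ => rfl)
    have h2 := M.cast_refl (cons x b) c (fun _ => rfl)
    simp only [Category.id_comp]
    erw [h1, h2]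
    rw [MonoidalCategory.id_tensorHom_id, Category.id_comp]
    exact Category.comp_id _

/-- Composition of multifunctors. -/
@[simps]
def Multifunctor.comp {M N P : SymMulticat V} (F : Multifunctor M N) (G : Multifunctor N P) :
    Multifunctor M P where
  obj := G.obj ∘ F.obj
  map := fun a b => F.map a b ≫ G.map (F.obj ∘ a) (F.obj b)
  map_act := fun σ a a' b h => by
    have h1 := G.map_act σ (a := F.obj ∘ a) (a' := F.obj ∘ a') (b := F.obj b)
      (fun i => congrArg F.obj (h i))
    rw [← Category.assoc, F.map_act, Category.assoc, Category.assoc]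
    exact congrArg (F.map a b ≫ ·) h1
  map_one := fun x => by
    have h1 := G.map_one (F.obj x)
    rw [← Category.assoc, F.map_one]
    exact h1
  map_comp := fun a x b c => by
    have e1 : G.map (F.obj ∘ Fin.append a b) (F.obj c) ≫
        P.cast (comp_append (G.obj ∘ F.obj) a b) =
        N.cast (comp_append F.obj a b) ≫ G.map _ _ ≫
          P.cast (comp_append G.obj (F.obj ∘ a) (F.obj ∘ b)) := by
      rw [reassoc_of% (G.map_cast (comp_append F.obj a b)), P.cast_trans]
    have e2 : G.map (F.obj ∘ cons x b) (F.obj c) ≫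
        P.cast (comp_cons (G.obj ∘ F.obj) x b) =
        N.cast (comp_cons F.obj x b) ≫ G.map _ _ ≫
          P.cast (comp_cons G.obj (F.obj x) (F.obj ∘ b)) := by
      rw [reassoc_of% (G.map_cast (comp_cons F.obj x b)), P.cast_trans]
    have h5 := G.map_comp (F.obj ∘ a) (F.obj x) (F.obj ∘ b) (F.obj c)
    have h6 := F.map_comp a x b c
    have lhs : M.comp a x b c ≫ (F.map (Fin.append a b) c ≫
          G.map (F.obj ∘ Fin.append a b) (F.obj c)) ≫
        P.cast (comp_append (G.obj ∘ F.obj) a b) =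
        (M.comp a x b c ≫ F.map (Fin.append a b) c ≫
          N.cast (comp_append F.obj a b)) ≫ G.map _ _ ≫
          P.cast (comp_append G.obj (F.obj ∘ a) (F.obj ∘ b)) := by
      simp only [Category.assoc]
      rw [e1]
    have rhs : (F.map (cons x b) c ≫ G.map (F.obj ∘ cons x b) (F.obj c)) ≫
        P.cast (comp_cons (G.obj ∘ F.obj) x b) =
        (F.map (cons x b) c ≫ N.cast (comp_cons F.obj x b)) ≫ G.map _ _ ≫
          P.cast (comp_cons G.obj (F.obj x) (F.obj ∘ b)) := by
      simp only [Category.assoc]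
      rw [e2]
    refine lhs.trans ?_
    rw [h6, Category.assoc, h5]
    refine Eq.trans ?_ (congrArg (fun t => ((F.map a x ≫ G.map (F.obj ∘ a) (F.obj x)) ⊗ₘ t) ≫
      P.comp (G.obj ∘ F.obj ∘ a) (G.obj (F.obj x)) (G.obj ∘ F.obj ∘ b)
        (G.obj (F.obj c))) rhs.symm)
    rw [← Category.assoc, MonoidalCategory.tensorHom_comp_tensorHom]

instance : Category (SymMulticat.{v, u} V) where
  Hom := Multifunctor
  id := Multifunctor.id
  comp := Multifunctor.comp
  id_comp := fun F => by
    cases F; simp only [Multifunctor.comp, Multifunctor.id, Category.id_comp]; rfl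
  comp_id := fun F => by
    cases F; simp only [Multifunctor.comp, Multifunctor.id, Category.comp_id]; rfl
  assoc := fun F G H => by
    cases F; cases G; cases H; simp only [Multifunctor.comp, Category.assoc]; rfl


section Basic

variable (M : SymMulticat.{v, u} V)

theorem cast_comp_left {l k : ℕ} {a a' : Fin l → M.Ob} (b : Fin k → M.Ob) (x c : M.Ob)
    (ha : ∀ i, a' i = a i) (h : ∀ i, Fin.append a' b i = Fin.append a b i) :
    M.cast (b := x) ha ▷ M.Hom (cons x b) c ≫ M.comp a' x b c = M.comp a x b c ≫ M.cast h := by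
  obtain rfl : a' = a := funext ha
  rw [M.cast_refl, M.cast_refl, MonoidalCategory.id_whiskerRight, Category.id_comp,
    Category.comp_id]

theorem cast_comp_right {l k : ℕ} (a : Fin l → M.Ob) {b b' : Fin k → M.Ob} (x c : M.Ob)
    (hb : ∀ i, b' i = b i) (h : ∀ i, cons x b' i = cons x b i)
    (h' : ∀ i, Fin.append a b' i = Fin.append a b i) :
    M.Hom a x ◁ M.cast (b := c) h ≫ M.comp a x b' c = M.comp a x b c ≫ M.cast h' := by
  obtain rfl : b' = b := funext hb
  rw [M.cast_refl, M.cast_refl, MonoidalCategory.whiskerLeft_id, Category.id_comp,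
    Category.comp_id]

/-- Composition with a unary morphism after:
`M(a₁, …, a_l; y) ⊗ M(y'; z) ⟶ M(a₁, …, a_l; z)` for `y = y'`. -/
def post {l : ℕ} (a : Fin l → M.Ob) {y y' : M.Ob} (h : y = y') (z : M.Ob) :
    M.Hom a y ⊗ M.Hom (single y') z ⟶ M.Hom a z :=
  M.Hom a y ◁ M.cast (fun i => (cons_nil y i).trans h) ≫
    M.comp a y nil z ≫ M.cast (fun i => (append_nil a i).symm)

/-- Composition with a unary morphism before, in one of the inputs:
`M(u; v) ⊗ M(w₁, …, w_m, v, a₁, …, a_r; c) ⟶ M(w₁, …, w_m, u, a₁, …, a_r; c)`. -/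
def preAt {m r : ℕ} (w : Fin m → M.Ob) (u v : M.Ob) (a : Fin r → M.Ob) (c : M.Ob) :
    M.Hom (single u) v ⊗ M.Hom (Fin.append w (cons v a)) c ⟶
      M.Hom (Fin.append w (cons u a)) c :=
  M.Hom (single u) v ◁ M.act (frontEquiv m r) (cons_frontEquiv w v a) ≫
    M.comp (single u) v (Fin.append w a) c ≫
    M.act ((frontEquiv m r).symm.trans (finCongr (Nat.add_comm (m + r) 1)))
      (fun i => by
        have h1 := cons_frontEquiv w u a ((frontEquiv m r).symm i)
        have h2 := append_single u (Fin.append w a)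
          (finCongr (Nat.add_comm (m + r) 1) ((frontEquiv m r).symm i))
        rw [Equiv.apply_symm_apply] at h1
        rw [← h1]
        exact h2.symm)

theorem cast_post {l : ℕ} (a : Fin l → M.Ob) {a' : Fin l → M.Ob} (x : M.Ob) (b : Fin 0 → M.Ob)
    (c : M.Ob) (ha : ∀ i, a' i = a i) (hb : ∀ i : Fin 1, cons x b i = single x i)
    (hab : ∀ i : Fin l, Fin.append a' b i = a i) :
    (M.cast (b := x) ha ⊗ₘ M.cast (b := c) hb) ≫ M.comp a' x b c =
      M.post a rfl c ≫ M.cast (k := l) hab := by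
  obtain rfl : a' = a := funext ha
  obtain rfl : b = nil := funext fun i => i.elim0
  unfold post
  rw [M.cast_refl, MonoidalCategory.id_tensorHom, Category.assoc, Category.assoc, M.cast_trans]
  refine congrArg (M.Hom a' x ◁ M.cast hb ≫ ·) ?_
  refine (Category.comp_id _).symm.trans ?_
  exact congrArg (M.comp a' x nil c ≫ ·) (M.cast_refl _ _ _).symm

theorem one_post (x z : M.Ob) :
    M.one x ▷ M.Hom (single x) z ≫ M.post (single x) rfl z = (λ_ _).hom := by
  have hp : ∀ i : Fin 1, Fin.append (single x) nil i = cons x nil i := fun i =>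
    (append_nil (single x) i).trans (cons_nil x i).symm
  have h : M.one x ▷ M.Hom (cons x nil) z ≫ M.comp (single x) x nil z =
      (λ_ _).hom ≫ M.cast (k := 1) (a := cons x nil) hp := M.one_comp x nil z
  unfold post
  rw [← MonoidalCategory.whisker_exchange_assoc, reassoc_of% h,
    MonoidalCategory.leftUnitor_naturality_assoc, M.cast_trans, M.cast_trans, M.cast_refl,
    Category.comp_id]

theorem post_one {l : ℕ} (a : Fin l → M.Ob) (x : M.Ob) :
    M.Hom a x ◁ M.one x ≫ M.post a rfl x = (ρ_ _).hom := by
  have h := M.comp_one a x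
  unfold post
  rw [← MonoidalCategory.whiskerLeft_comp_assoc, reassoc_of% h, M.cast_trans, M.cast_refl,
    Category.comp_id]

theorem assoc_nil {l : ℕ} (a : Fin l → M.Ob) (x y z : M.Ob)
    (h₁ : ∀ i : Fin 1, cons x nil i = Fin.append (cons x nil) nil i)
    (h₂ : ∀ i : Fin l, Fin.append (Fin.append a nil) nil i = Fin.append a nil i) :
    M.comp a x nil y ▷ M.Hom (cons y nil) z ≫ M.comp (Fin.append a nil) y nil z =
      (α_ _ _ _).hom ≫
        M.Hom a x ◁ (M.comp (cons x nil) y nil z ≫ M.cast (k := 1) h₁) ≫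
        M.comp a x nil z ≫ M.cast (k := l) h₂ := by
  have h0 := M.assoc a x nil y nil z
  have key : ∀ (e : Fin 0 → M.Ob) (he : e = nil)
      (k₁ : ∀ i : Fin 1, cons x e i = Fin.append (cons x nil) nil i)
      (k₂ : ∀ i : Fin l, Fin.append (Fin.append a nil) nil i = Fin.append a e i),
      M.Hom a x ◁ (M.comp (cons x nil) y nil z ≫ M.cast (k := 1) k₁) ≫
        M.comp a x e z ≫ M.cast (k := l) k₂ =
      M.Hom a x ◁ (M.comp (cons x nil) y nil z ≫ M.cast (k := 1) h₁) ≫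
        M.comp a x nil z ≫ M.cast (k := l) h₂ := by
    intro e he k₁ k₂
    subst he
    rfl
  rw [h0, ← key (Fin.append nil nil) (funext fun i => i.elim0)
    (fun i => cons_append' x nil nil i) (fun i => append_assoc' a nil nil i)]
  rfl

theorem post_post {l : ℕ} (a : Fin l → M.Ob) (x y z : M.Ob) :
    M.post a (rfl : x = x) y ▷ M.Hom (single y) z ≫ M.post a rfl z =
      (α_ _ _ _).hom ≫ M.Hom a x ◁ M.post (single x) rfl z ≫ M.post a rfl z := by
  have h₁ : ∀ i : Fin 1, cons x nil i = Fin.append (cons x nil) nil i :=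
    fun i => (append_nil _ i).symm
  have h₂ : ∀ i : Fin l, Fin.append (Fin.append a nil) nil i = Fin.append a nil i :=
    fun i => append_nil _ i
  have h := M.assoc_nil a x y z h₁ h₂
  have h3 := M.cast_comp_left (k := 0) nil y z (fun i => (append_nil a i).symm)
    (fun i => congrFun (congrArg (fun t => Fin.append t nil) (funext (append_nil a))).symm i)
  have h4 := M.cast_comp_left (k := 0) nil y z (cons_nil x)
    (fun i => congrFun (congrArg (fun t => Fin.append t nil) (funext (cons_nil x))) i)
  have e1 : M.post a (rfl : x = x) y ▷ M.Hom (single y) z ≫ M.post a rfl z =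
      (M.Hom a x ◁ M.cast (cons_nil x)) ▷ M.Hom (single y) z ≫
      _ ◁ M.cast (cons_nil y) ≫ M.comp a x nil y ▷ M.Hom (cons y nil) z ≫
      M.comp (Fin.append a nil) y nil z ≫ M.cast (k := l) (fun i =>
        ((append_nil _ i).trans (append_nil a i)).symm) := by
    unfold post
    simp only [MonoidalCategory.comp_whiskerRight, Category.assoc]
    rw [← MonoidalCategory.whisker_exchange_assoc, reassoc_of% h3, M.cast_trans,
      ← MonoidalCategory.whisker_exchange_assoc]
  have e2 : M.Hom a x ◁ M.post (single x) (rfl : y = y) z ≫ M.post a rfl z =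
      M.Hom a x ◁ (M.Hom (single x) y ◁ M.cast (cons_nil y) ≫
        M.cast (cons_nil x) ▷ M.Hom (cons y nil) z ≫ M.comp (cons x nil) y nil z ≫
        M.cast (k := 1) h₁) ≫
      M.comp a x nil z ≫ M.cast (k := l) (fun i => (append_nil a i).symm) := by
    unfold post
    rw [reassoc_of% h4, M.cast_trans, ← MonoidalCategory.whiskerLeft_comp_assoc]
    simp only [Category.assoc]
    rw [M.cast_trans]
  rw [e1, e2, reassoc_of% h, M.cast_trans]
  simp only [MonoidalCategory.whiskerLeft_comp, Category.assoc]
  rw [← MonoidalCategory.whisker_exchange_assoc]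
  simp only [MonoidalCategory.tensor_whiskerLeft, MonoidalCategory.whisker_assoc,
    Category.assoc, Iso.inv_hom_id_assoc]

/-- The object set of a multicategory, as the object set of its underlying `V`-category. -/
abbrev Und : Type v := M.Ob

/-- The underlying `V`-category `M₁` of `M`, with `M₁(x, y) = M(x; y)`. -/
instance : EnrichedCategory V M.Und where
  Hom := fun x y => M.Hom (single (x : M.Ob)) (y : M.Ob)
  id := fun x => M.one x
  comp := fun x y z => M.post (single (x : M.Ob)) (rfl : (y : M.Ob) = y) z
  id_comp := fun x y => by
    rw [M.one_post, Iso.inv_hom_id]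
  comp_id := fun x y => by
    rw [M.post_one, Iso.inv_hom_id]
  assoc := fun w x y z => by
    rw [M.post_post, Iso.inv_hom_id_assoc]

end Basic

section FreeMulticategory

variable [HasInitial V] (C : Type v) [EnrichedCategory V C]

/-- `(E A)(a₁, …, a_n; b)` is `A(a₁, b)` if `n = 1`, and the initial object otherwise. -/
def EHom : {k : ℕ} → (Fin k → C) → C → V
  | 0, _, _ => ⊥_ V
  | 1, a, b => EnrichedCategory.Hom (a 0) b
  | _ + 2, _, _ => ⊥_ V

variable {C}

theorem EHom_eq {k l : ℕ} (σ : Fin k ≃ Fin l) {a : Fin l → C} {a' : Fin k → C} {b : C}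
    (h : ∀ i, a' i = a (σ i)) : EHom (V := V) C a b = EHom C a' b := by
  obtain rfl : k = l := by simpa using Fintype.card_congr σ
  match k, a, a', σ, h with
  | 0, _, _, _, _ => rfl
  | 1, a, a', σ, h =>
    have h0 : a' 0 = a 0 := (h 0).trans (congrArg a (Subsingleton.elim _ _))
    simp only [EHom, h0]
  | _ + 2, _, _, _, _ => rfl

/-- The unique map out of `(E A)(a₁, …, a_k; b)` for `k ≠ 1`. -/
def EHom.elim {k : ℕ} (hk : k ≠ 1) (a : Fin k → C) (b : C) (X : V) : EHom C a b ⟶ X :=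
  match k, hk, a with
  | 0, _, _ => initial.to X
  | 1, hk, _ => absurd rfl hk
  | _ + 2, _, _ => initial.to X

theorem EHom_subsingleton {k : ℕ} (hk : k ≠ 1) (a : Fin k → C) (b : C) (X : V) :
    Subsingleton (EHom C a b ⟶ X) :=
  match k, hk, a with
  | 0, _, _ => ⟨fun f g => initialIsInitial.hom_ext f g⟩
  | 1, hk, _ => absurd rfl hk
  | _ + 2, _, _ => ⟨fun f g => initialIsInitial.hom_ext f g⟩

variable [MonoidalClosed V]

theorem subsingleton_tensor_right {A B : V} (h : ∀ X, Subsingleton (B ⟶ X)) (X : V) :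
    Subsingleton (A ⊗ B ⟶ X) :=
  ⟨fun _ _ => MonoidalClosed.curry_injective ((h _).elim _ _)⟩

theorem subsingleton_tensor_left {A B : V} (h : ∀ X, Subsingleton (A ⟶ X)) (X : V) :
    Subsingleton (A ⊗ B ⟶ X) :=
  ⟨fun f g => by
    have := (subsingleton_tensor_right (A := B) h X).elim ((β_ B A).hom ≫ f) ((β_ B A).hom ≫ g)
    exact (cancel_epi _).1 this⟩

/-- The composition of `E A`; it is that of `A` on unary morphisms. -/
def EComp : {l k : ℕ} → (a : Fin l → C) → (x : C) → (b : Fin k → C) → (c : C) →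
    (EHom (V := V) C a x ⊗ EHom C (cons x b) c ⟶ EHom C (Fin.append a b) c)
  | 1, 0, a, x, b, c => eComp V (a 0) x c
  | 0, _, a, x, b, c => (β_ _ _).hom ≫
      MonoidalClosed.uncurry (EHom.elim (by omega) a x _)
  | _ + 2, _, a, x, b, c => (β_ _ _).hom ≫
      MonoidalClosed.uncurry (EHom.elim (by omega) a x _)
  | 1, _ + 1, a, x, b, c => MonoidalClosed.uncurry (EHom.elim (by omega) (cons x b) c _)

variable (V C)

/-- The symmetric `V`-multicategory `E A` of a `V`-category `A`. -/
def E : SymMulticat.{v, u} V where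
  Ob := C
  Hom := fun a b => EHom C a b
  act := fun σ _ _ _ h => eqToHom (EHom_eq σ h)
  act_refl := fun a b => rfl
  act_trans := fun σ τ _ _ _ _ h h' => eqToHom_trans _ _
  one := fun x => eId V x
  comp := fun a x b c => EComp a x b c
  act_comp := fun {l' l k' k} σ τ {a a' b b'} x c ha hb => by
    obtain rfl : l' = l := by simpa using Fintype.card_congr σ
    obtain rfl : k' = k := by simpa using Fintype.card_congr τ
    by_cases hl : l' = 1
    · by_cases hk : k' = 0
      · subst hl hk
        obtain rfl : σ = Equiv.refl _ := Subsingleton.elim _ _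
        obtain rfl : a' = a := funext ha
        obtain rfl : b' = b := funext fun i => i.elim0
        simp only [eqToHom_refl]
        rw [MonoidalCategory.id_tensorHom_id, Category.id_comp, Category.comp_id]
      · exact (subsingleton_tensor_right (EHom_subsingleton (by omega) _ _) _).elim _ _
    · exact (subsingleton_tensor_left (EHom_subsingleton (by omega) _ _) _).elim _ _
  one_comp := fun {k} x b c => by
    by_cases hk : k = 0
    · subst hk
      have h := e_id_comp (V := V) x c
      rw [Iso.inv_comp_eq] at h
      exact h
    · exact (subsingleton_tensor_right (EHom_subsingleton (by omega) _ _) _).elim _ _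
  comp_one := fun {l} a x => by
    by_cases hl : l = 1
    · subst hl
      have h := e_comp_id (V := V) (a 0) x
      rw [Iso.inv_comp_eq] at h
      refine Eq.trans ?_ (h.trans ?_)
      · exact congrArg (fun t => (a 0 ⟶[V] x) ◁ t ≫ eComp V (a 0) x x)
          (Category.comp_id (eId V x))
      · rfl
    · exact (subsingleton_tensor_left (EHom_subsingleton (by omega) _ _) _).elim _ _
  assoc := fun {l k m} a x b y c z => by
    by_cases hl : l = 1
    · by_cases hk : k = 0
      · by_cases hm : m = 0
        · subst hl hk hm
          have h := e_assoc (V := V) (a 0) x y z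
          rw [Iso.inv_comp_eq] at h
          refine h.trans ?_
          have e1 := congrArg (fun t => (α_ (a 0 ⟶[V] x) (x ⟶[V] y) (y ⟶[V] z)).hom ≫
            ((a 0 ⟶[V] x) ◁ t) ≫ eComp V (a 0) x z) (Category.comp_id (eComp V x y z)).symm
          have e2 := congrArg (fun t => (α_ (a 0 ⟶[V] x) (x ⟶[V] y) (y ⟶[V] z)).hom ≫
            ((a 0 ⟶[V] x) ◁ (eComp V x y z ≫ 𝟙 _)) ≫ t)
            (Category.comp_id (eComp V (a 0) x z)).symm
          exact e1.trans e2
        · exact (subsingleton_tensor_right (EHom_subsingleton (by omega) _ _) _).elim _ _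
      · exact (subsingleton_tensor_left
          (subsingleton_tensor_right (EHom_subsingleton (by omega) _ _)) _).elim _ _
    · exact (subsingleton_tensor_left
        (subsingleton_tensor_left (EHom_subsingleton (by omega) _ _)) _).elim _ _
  comp_comm := fun {l k m} a x b y c z =>
    (subsingleton_tensor_right
      (subsingleton_tensor_right (EHom_subsingleton (by omega) _ _)) _).elim _ _

end FreeMulticategory

section Adjunction

variable [HasInitial V] [MonoidalClosed V] {C : Type v} [EnrichedCategory V C]

/-- On morphisms, the multifunctor `E A ⟶ M` corresponding to a `V`-functor `A ⟶ M₁`. -/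
def descMap (M : SymMulticat.{v, u} V) (F : EnrichedFunctor V C M.Und) :
    {k : ℕ} → (a : Fin k → C) → (b : C) → (EHom (V := V) C a b ⟶ M.Hom (F.obj ∘ a) (F.obj b))
  | 1, a, b => F.map (a 0) b ≫
      M.cast (fun i => congrArg (fun j => F.obj (a j)) (Subsingleton.elim i 0))
  | 0, a, b => EHom.elim (by omega) a b _
  | _ + 2, a, b => EHom.elim (by omega) a b _

theorem descMap_comp (M : SymMulticat.{v, u} V) (F : EnrichedFunctor V C M.Und) (a : Fin 1 → C)
    (x c : C) :
    EComp a x nil c ≫ descMap M F (Fin.append a nil) c ≫ M.cast (comp_append F.obj a nil) =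
      (descMap M F a x ⊗ₘ (descMap M F (cons x nil) c ≫ M.cast (comp_cons F.obj x nil))) ≫
        M.comp (F.obj ∘ a) (F.obj x) (F.obj ∘ nil) (F.obj c) := by
  have hb : ∀ i : Fin 1, cons (F.obj x) (F.obj ∘ nil) i = single (F.obj x) i :=
    fun i => by rw [Subsingleton.elim i 0]; rfl
  have ha : ∀ i : Fin 1, (F.obj ∘ a) i = single (F.obj (a 0)) i :=
    fun i => congrArg (fun j => F.obj (a j)) (Subsingleton.elim i 0)
  have hab : ∀ i : Fin 1, Fin.append (F.obj ∘ a) (F.obj ∘ nil) i =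
      single (F.obj (a 0)) i := fun i => by rw [Subsingleton.elim i 0]; rfl
  have h1 : descMap M F (cons x nil) c ≫ M.cast (comp_cons F.obj x nil) =
      F.map x c ≫ M.cast hb := by
    refine (Category.assoc _ _ _).trans ?_
    exact congrArg (F.map x c ≫ ·) (M.cast_trans _ _)
  have h2 : descMap M F (Fin.append a nil) c ≫ M.cast (comp_append F.obj a nil) =
      F.map (a 0) c ≫ M.cast (k := 1) hab := by
    refine (Category.assoc _ _ _).trans ?_
    exact congrArg (F.map (a 0) c ≫ ·) (M.cast_trans _ _)
  have h3 := M.cast_post (single (F.obj (a 0))) (F.obj x) (F.obj ∘ nil) (F.obj c) ha hb hab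
  have h4 : (descMap M F a x ⊗ₘ (F.map x c ≫ M.cast hb)) =
      (F.map (a 0) x ⊗ₘ F.map x c) ≫ (M.cast ha ⊗ₘ M.cast hb) :=
    (MonoidalCategory.tensorHom_comp_tensorHom _ _ _ _).symm
  have e1 : eComp V (a 0) x c ≫ descMap M F (Fin.append a nil) c ≫
      M.cast (comp_append F.obj a nil) =
      eComp V (a 0) x c ≫ F.map (a 0) c ≫ M.cast (k := 1) hab :=
    congrArg (eComp V (a 0) x c ≫ ·) h2
  have e2 : (eComp V (a 0) x c ≫ F.map (a 0) c) ≫ M.cast (k := 1) hab =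
      (F.map (a 0) x ⊗ₘ F.map x c) ≫
        M.post (single (F.obj (a 0))) rfl (F.obj c) ≫ M.cast (k := 1) hab := by
    exact (congrArg (· ≫ M.cast (k := 1) hab) (F.map_comp (a 0) x c)).trans
      (Category.assoc _ _ _)
  refine e1.trans ((Category.assoc _ _ _).symm.trans (e2.trans ?_))
  rw [← h3, h1]
  exact (Category.assoc _ _ _).symm.trans
    (congrArg (· ≫ M.comp (F.obj ∘ a) (F.obj x) (F.obj ∘ nil) (F.obj c)) h4.symm)

/-- The multifunctor `E A ⟶ M` corresponding to a `V`-functor `A ⟶ M₁` under the adjunction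
`E ⊣ (-)₁`. -/
def desc (M : SymMulticat.{v, u} V) (F : EnrichedFunctor V C M.Und) : E V C ⟶ M where
  obj := F.obj
  map := fun a b => descMap M F a b
  map_act := fun {k l} σ {a a' b} h => by
    obtain rfl : k = l := by simpa using Fintype.card_congr σ
    by_cases hk : k = 1
    · subst hk
      obtain rfl : σ = Equiv.refl _ := Subsingleton.elim _ _
      obtain rfl : a' = a := funext h
      have h1 : (E V C).act (Equiv.refl (Fin 1)) (b := b) h = 𝟙 ((E V C).Hom a' b) := rfl
      refine (congrArg (· ≫ descMap M F a' b) h1).trans ?_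
      refine (Category.id_comp (descMap M F a' b)).trans ?_
      exact ((congrArg (descMap M F a' b ≫ ·) (M.act_refl (F.obj ∘ a') (F.obj b))).trans
        (Category.comp_id _)).symm
    · exact (EHom_subsingleton hk _ _ _).elim _ _
  map_one := fun x => by
    have h := F.map_id x
    have h1 : descMap M F (single x) x = F.map x x := by
      refine Eq.trans ?_ (Category.comp_id _)
      exact congrArg (F.map x x ≫ ·) (M.cast_refl _ _ _)
    refine Eq.trans ?_ h
    exact congrArg (eId V x ≫ ·) h1
  map_comp := fun {l k} a x b c => by
    by_cases hl : l = 1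
    · by_cases hk : k = 0
      · subst hl hk
        obtain rfl : b = nil := funext fun i => i.elim0
        exact descMap_comp M F a x c
      · exact (subsingleton_tensor_right (EHom_subsingleton (by omega) _ _) _).elim _ _
    · exact (subsingleton_tensor_left (EHom_subsingleton (by omega) _ _) _).elim _ _

variable (V C) in
/-- The unit `A ⟶ (E A)₁` of the adjunction `E ⊣ (-)₁`, an identity. -/
def unit : EnrichedFunctor V C (E V C).Und where
  obj := fun x => x
  map := fun x y => 𝟙 (EnrichedCategory.Hom x y : V)
  map_id := fun x => Category.comp_id _
  map_comp := fun x y z => by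
    have h : (E V C).post (single x) (rfl : y = y) z =
        (EnrichedCategory.Hom x y : V) ◁ 𝟙 _ ≫ eComp V x y z ≫ 𝟙 _ := rfl
    have h' : (E V C).post (single x) (rfl : y = y) z = eComp V x y z := by
      rw [h, MonoidalCategory.whiskerLeft_id, Category.id_comp, Category.comp_id]
    refine (Category.comp_id _).trans ?_
    exact ((congrArg (fun t => (𝟙 (EnrichedCategory.Hom x y : V) ⊗ₘ
      𝟙 (EnrichedCategory.Hom y z : V)) ≫ t) h').trans
      ((congrArg (· ≫ eComp V x y z) (MonoidalCategory.id_tensorHom_id _ _)).trans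
        (Category.id_comp _))).symm

/-- The action of `E` on `V`-functors. -/
def E.map {D : Type v} [EnrichedCategory V D] (F : EnrichedFunctor V C D) : E V C ⟶ E V D :=
  desc (E V D) (F.comp V (unit V D))

/-- The counit `E M₁ ⟶ M` of the adjunction `E ⊣ (-)₁`; it is the identity on objects and on
unary morphisms. -/
def counit (M : SymMulticat.{v, u} V) : E V M.Und ⟶ M :=
  desc M (EnrichedFunctor.id V M.Und)

end Adjunction

section TensorPowers

/-- The tensor product `X₁ ⊗ ⋯ ⊗ X_s`. -/
def tens : {s : ℕ} → (Fin s → V) → V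
  | 0, _ => 𝟙_ V
  | s + 1, X => tens (fun t => X (Fin.castSucc t)) ⊗ X (Fin.last s)

/-- The tensor product of morphisms. -/
def tensMap : {s : ℕ} → {X Y : Fin s → V} → ((t : Fin s) → (X t ⟶ Y t)) → (tens X ⟶ tens Y)
  | 0, _, _, _ => 𝟙 _
  | s + 1, _, _, f => tensMap (fun t => f (Fin.castSucc t)) ⊗ₘ f (Fin.last s)

/-- The shuffle `⨂ₜ (X_t ⊗ Y_t) ⟶ (⨂ₜ X_t) ⊗ (⨂ₜ Y_t)`. -/
def tensShuffle : {s : ℕ} → (X Y : Fin s → V) → (tens (fun t => X t ⊗ Y t) ⟶ tens X ⊗ tens Y)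
  | 0, _, _ => (λ_ (𝟙_ V)).inv
  | s + 1, X, Y =>
    (tensShuffle (fun t => X (Fin.castSucc t)) (fun t => Y (Fin.castSucc t)) ▷ _) ≫
      tensorμ _ _ _ _

theorem append_last {α : Type v} {s r : ℕ} (x : Fin (s + 1) → α) (a : Fin r → α)
    (i : Fin (s + 1 + r)) :
    Fin.append x a i =
      Fin.append (fun t => x (Fin.castSucc t)) (cons (x (Fin.last s)) a)
        (finCongr (Nat.succ_add_eq_add_succ s r) i) := by
  have h := Fin.append_left_snoc (fun t => x (Fin.castSucc t)) (x (Fin.last s)) a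
  rw [show Fin.snoc (α := fun _ => α) (fun t => x (Fin.castSucc t)) (x (Fin.last s)) = x from
    Fin.snoc_init_self x] at h
  exact congrFun h i

variable (N : SymMulticat.{v, u} V)

/-- Composition with unary morphisms before, in the first `s` inputs:
`N(u₁; v₁) ⊗ ⋯ ⊗ N(u_s; v_s) ⊗ N(v₁, …, v_s, a₁, …, a_r; c) ⟶ N(u₁, …, u_s, a₁, …, a_r; c)`. -/
def preFirst : {s r : ℕ} → (x y : Fin s → N.Ob) → (a : Fin r → N.Ob) → (c : N.Ob) →
    (tens (fun t => N.Hom (single (x t)) (y t)) ⊗ N.Hom (Fin.append y a) c ⟶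
      N.Hom (Fin.append x a) c)
  | 0, _, x, y, a, c => (λ_ _).hom ≫
      N.cast (fun i => by rw [Subsingleton.elim x y])
  | s + 1, r, x, y, a, c =>
    (α_ _ _ _).hom ≫
      _ ◁ (_ ◁ N.act (finCongr (Nat.succ_add_eq_add_succ s r)).symm
          (fun i => by
            have h := append_last y a ((finCongr (Nat.succ_add_eq_add_succ s r)).symm i)
            rw [Equiv.apply_symm_apply] at h
            exact h.symm) ≫
        N.preAt (fun t => y (Fin.castSucc t)) (x (Fin.last s)) (y (Fin.last s)) a c) ≫
      preFirst (fun t => x (Fin.castSucc t)) (fun t => y (Fin.castSucc t))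
        (cons (x (Fin.last s)) a) c ≫
      N.act (finCongr (Nat.succ_add_eq_add_succ s r)) (append_last x a)

/-- Composition with unary morphisms before, in `s` inputs at arbitrary positions; a tuple of
length `k` with `s` distinguished positions is written as `(y₁, …, y_s, a₁, …, a_r) ∘ σ`
with a bijection `σ`. -/
def pre {s r k : ℕ} (σ : Fin k ≃ Fin (s + r)) (x y : Fin s → N.Ob) (a : Fin r → N.Ob)
    (c : N.Ob) :
    tens (fun t => N.Hom (single (x t)) (y t)) ⊗ N.Hom (Fin.append y a ∘ σ) c ⟶
      N.Hom (Fin.append x a ∘ σ) c :=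
  _ ◁ N.act σ.symm (fun i => by simp) ≫ N.preFirst x y a c ≫ N.act σ (fun _ => rfl)

end TensorPowers

section Coends

variable [HasInitial V] [MonoidalClosed V] {M N : SymMulticat.{v, u} V}
  {B : Type v} [EnrichedCategory V B]

/-- A `V`-functor is a full and faithful inclusion. -/
def IsFullFaithfulInclusion {A : Type v} [EnrichedCategory V A] (i : EnrichedFunctor V A B) :
    Prop :=
  Function.Injective i.obj ∧ ∀ x y : A, IsIso (i.map x y)

/-- A symmetric `V`-multifunctor is a full and faithful inclusion. -/
def Multifunctor.IsFullFaithfulInclusion (j : Multifunctor M N) : Prop :=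
  Function.Injective j.obj ∧
    ∀ (k : ℕ) (a : Fin k → M.Ob) (b : M.Ob), IsIso (j.map a b)

/-- The value of a multifunctor `E B ⟶ N` on unary morphisms. -/
def unary (g : E V B ⟶ N) (b b' : B) :
    (b ⟶[V] b') ⟶ N.Hom (single (Multifunctor.obj g b)) (Multifunctor.obj g b') :=
  Multifunctor.map g (single b) b'

variable (i : EnrichedFunctor V M.Und B) (q : B) {s r k : ℕ} (σ : Fin k ≃ Fin (s + r))
  (a : Fin r → M.Ob)

/-- `B(q, x₁) ⊗ ⋯ ⊗ B(q, x_s) ⊗ M((x₁, …, x_s, a₁, …, a_r) ∘ σ; c)`. -/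
def coendObj (c : M.Ob) (x : Fin s → M.Ob) : V :=
  tens (fun t => (q ⟶[V] i.obj (x t))) ⊗ M.Hom (Fin.append x a ∘ σ) c

/-- `⨂ₜ (B(q, x_t) ⊗ M₁(x_t, x'_t)) ⊗ M((x'₁, …, x'_s, a₁, …, a_r) ∘ σ; c)`. -/
def coendRel (c : M.Ob) (x x' : Fin s → M.Ob) : V :=
  tens (fun t => (q ⟶[V] i.obj (x t)) ⊗ M.Hom (single (x t)) (x' t)) ⊗
    M.Hom (Fin.append x' a ∘ σ) c

/-- The action of `M₁` on `B(q, -)`. -/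
def coendFst (c : M.Ob) (x x' : Fin s → M.Ob) :
    coendRel i q σ a c x x' ⟶ coendObj i q σ a c x' :=
  tensMap (fun t => _ ◁ i.map (x t) (x' t) ≫ eComp V q (i.obj (x t)) (i.obj (x' t))) ▷ _

/-- The action of `M₁` on the inputs of `M`. -/
def coendSnd (c : M.Ob) (x x' : Fin s → M.Ob) :
    coendRel i q σ a c x x' ⟶ coendObj i q σ a c x :=
  tensShuffle _ _ ▷ _ ≫ (α_ _ _ _).hom ≫ _ ◁ M.pre σ x x' a c

/-- The diagram whose colimit is the iterated coend
`∫^{x₁} ⋯ ∫^{x_s} M((x₁, …, x_s, a₁, …, a_r) ∘ σ; c) ⊗ B(q, x₁) ⊗ ⋯ ⊗ B(q, x_s)`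
over the `V`-category `M₁`, in all variables at once; dinaturality in each variable separately is
the case where all other `x'_t` are `x_t` and the units are inserted. -/
def coendDiagram (c : M.Ob) :
    MultispanIndex
      { L := (Fin s → M.Ob) × (Fin s → M.Ob)
        R := Fin s → M.Ob
        fst := fun p => p.2
        snd := fun p => p.1 } V where
  left := fun p => coendRel i q σ a c p.1 p.2
  right := fun x => coendObj i q σ a c x
  fst := fun p => coendFst i q σ a c p.1 p.2
  snd := fun p => coendSnd i q σ a c p.1 p.2

/-- The diagram whose colimit is the iterated coend
`∫^y ∫^{x₁} ⋯ ∫^{x_s} B(y, q) ⊗ M((x₁, …, x_s, a₁, …, a_r) ∘ σ; y) ⊗ B(q, x₁) ⊗ ⋯ ⊗ B(q, x_s)`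
over the `V`-category `M₁`. -/
def coendDiagram' :
    MultispanIndex
      { L := ((Fin s → M.Ob) × M.Ob) × ((Fin s → M.Ob) × M.Ob)
        R := (Fin s → M.Ob) × M.Ob
        fst := fun p => (p.2.1, p.1.2)
        snd := fun p => (p.1.1, p.2.2) } V where
  left := fun p => coendRel i q σ a p.1.2 p.1.1 p.2.1 ⊗
    (M.Hom (single p.1.2) p.2.2 ⊗ (i.obj p.2.2 ⟶[V] q))
  right := fun p => coendObj i q σ a p.2 p.1 ⊗ (i.obj p.2 ⟶[V] q)
  fst := fun p => coendFst i q σ a p.1.2 p.1.1 p.2.1 ⊗ₘ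
    (i.map p.1.2 p.2.2 ▷ _ ≫ eComp V (i.obj p.1.2) (i.obj p.2.2) q)
  snd := fun p => coendSnd i q σ a p.1.2 p.1.1 p.2.1 ▷ _ ≫
    (α_ _ _ _).inv ≫ ((α_ _ _ _).hom ≫ _ ◁ M.post _ rfl p.2.2) ▷ _

variable {i} (g : E V B ⟶ N) (j : M ⟶ N)

theorem obj_eq (w : E.map i ≫ g = counit M ≫ j) (x : M.Ob) :
    Multifunctor.obj g (i.obj x) = Multifunctor.obj j x :=
  congrFun (congrArg Multifunctor.obj w) x

/-- The `k`-tuple `(q, …, q, a₁, …, a_r) ∘ σ` of objects of `N`. -/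
def insertQ : Fin k → N.Ob :=
  Fin.append (fun _ : Fin s => Multifunctor.obj g q) (Multifunctor.obj j ∘ a) ∘ σ

/-- The canonical maps from
`B(q, x₁) ⊗ ⋯ ⊗ B(q, x_s) ⊗ M((x₁, …, x_s, a₁, …, a_r) ∘ σ; c)` to
`N((q, …, q, a₁, …, a_r) ∘ σ; c)`, given by composition in `N`. -/
def coendπ (w : E.map i ≫ g = counit M ≫ j) (c : M.Ob) (x : Fin s → M.Ob) :
    coendObj i q σ a c x ⟶ N.Hom (insertQ q σ a g j) (Multifunctor.obj j c) :=
  (tensMap (fun t => unary g q (i.obj (x t))) ⊗ₘ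
    (Multifunctor.map j (Fin.append x a ∘ σ) c ≫
      N.cast (a' := Fin.append (fun t => Multifunctor.obj g (i.obj (x t)))
        (Multifunctor.obj j ∘ a) ∘ σ)
        (fun l => (congrArg
          (fun f : Fin s → N.Ob => Fin.append f (Multifunctor.obj j ∘ a) (σ l))
          (funext fun t => obj_eq g j w (x t))).trans
            (comp_append (Multifunctor.obj j) x a (σ l))))) ≫
    N.pre σ (fun _ => Multifunctor.obj g q) (fun t => Multifunctor.obj g (i.obj (x t)))
      (Multifunctor.obj j ∘ a) (Multifunctor.obj j c)

/-- The canonical maps from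
`B(q, x₁) ⊗ ⋯ ⊗ B(q, x_s) ⊗ M((x₁, …, x_s, a₁, …, a_r) ∘ σ; y) ⊗ B(y, q)` to
`N((q, …, q, a₁, …, a_r) ∘ σ; q)`, given by composition in `N`. -/
def coendπ' (w : E.map i ≫ g = counit M ≫ j) (p : (Fin s → M.Ob) × M.Ob) :
    coendObj i q σ a p.2 p.1 ⊗ (i.obj p.2 ⟶[V] q) ⟶
      N.Hom (insertQ q σ a g j) (Multifunctor.obj g q) :=
  (coendπ q σ a g j w p.2 p.1 ⊗ₘ unary g (i.obj p.2) q) ≫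
    N.post _ (obj_eq g j w p.2).symm (Multifunctor.obj g q)

/-- The family `π` exhibits `P` as the colimit of the diagram `I`. -/
def IsCoend {J : MultispanShape.{v, v}} (I : MultispanIndex J V) {P : V}
    (π : ∀ x, I.right x ⟶ P) : Prop :=
  ∃ h : ∀ p, I.fst p ≫ π (J.fst p) = I.snd p ≫ π (J.snd p),
    Nonempty (IsColimit (Multicofork.ofπ I P π h))

end Coends

end SymMulticat
end SymMulti
end

open SymMulti

noncomputable section

namespace SymMulti

/-- A shuffle of two lists. -/
inductive Merge {α : Type u} : List α → List α → List α → Type u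
  | nil : Merge [] [] []
  | left (a : α) {l l' n : List α} : Merge l l' n → Merge (a :: l) l' (a :: n)
  | right (a : α) {l l' n : List α} : Merge l l' n → Merge l (a :: l') (a :: n)

namespace Merge

variable {α : Type u}

def swap : {l l' n : List α} → Merge l l' n → Merge l' l n
  | _, _, _, .nil => Merge.nil
  | _, _, _, .left a μ => Merge.right a (swap μ)
  | _, _, _, .right a μ => Merge.left a (swap μ)

def nilLeft : (l : List α) → Merge [] l l
  | [] => .nil
  | a :: l => .right a (nilLeft l)

theorem perm : {l l' n : List α} → Merge l l' n → List.Perm n (l ++ l')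
  | _, _, _, .nil => .refl _
  | _, _, _, .left a μ => (perm μ).cons a
  | _, _, _, .right a μ => ((perm μ).cons a).trans List.perm_middle.symm

theorem sublist_left : {l l' n : List α} → Merge l l' n → List.Sublist l n
  | _, _, _, .nil => .slnil
  | _, _, _, .left a μ => (sublist_left μ).cons_cons a
  | _, _, _, .right a μ => (sublist_left μ).cons a

theorem sublist_right : {l l' n : List α} → Merge l l' n → List.Sublist l' n
  | _, _, _, .nil => .slnil
  | _, _, _, .left a μ => (sublist_right μ).cons a
  | _, _, _, .right a μ => (sublist_right μ).cons_cons a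

theorem eq_of_nodup {l l' n : List α} (h : n.Nodup) (μ ν : Merge l l' n) : μ = ν := by
  induction μ with
  | nil => cases ν; rfl
  | left a μ ih =>
    cases ν with
    | left _ ν => rw [ih (List.nodup_cons.1 h).2 ν]
    | right _ ν =>
      exact absurd (μ.sublist_right.subset List.mem_cons_self) (List.nodup_cons.1 h).1
  | right a μ ih =>
    cases ν with
    | right _ ν => rw [ih (List.nodup_cons.1 h).2 ν]
    | left _ ν =>
      exact absurd (μ.sublist_left.subset List.mem_cons_self) (List.nodup_cons.1 h).1

theorem exists_of_disjoint [LinearOrder α] : (l l' : List α) → l.Pairwise (· < ·) →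
    l'.Pairwise (· < ·) → (∀ a ∈ l, a ∉ l') →
    ∃ n : List α, n.Pairwise (· < ·) ∧ Nonempty (Merge l l' n)
  | [], l', _, h', _ => ⟨l', h', ⟨nilLeft l'⟩⟩
  | a :: l, [], h, _, _ => ⟨a :: l, h, ⟨Merge.swap (nilLeft (a :: l))⟩⟩
  | a :: l, b :: l', h, h', hd => by
    rcases lt_trichotomy a b with hab | hab | hab
    · obtain ⟨n, hn, ⟨μ⟩⟩ := exists_of_disjoint l (b :: l') (List.pairwise_cons.1 h).2 h'
        (fun c hc => hd c (List.mem_cons_of_mem _ hc))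
      refine ⟨a :: n, List.pairwise_cons.2 ⟨fun c hc => ?_, hn⟩, ⟨Merge.left a μ⟩⟩
      rcases List.mem_append.1 (μ.perm.subset hc) with hc | hc
      · exact (List.pairwise_cons.1 h).1 c hc
      · rcases List.mem_cons.1 hc with rfl | hc
        · exact hab
        · exact hab.trans ((List.pairwise_cons.1 h').1 c hc)
    · exact absurd (hab ▸ List.mem_cons_self) (hd a List.mem_cons_self)
    · obtain ⟨n, hn, ⟨μ⟩⟩ := exists_of_disjoint (a :: l) l' h (List.pairwise_cons.1 h').2
        (fun c hc hc' => hd c hc (List.mem_cons_of_mem _ hc'))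
      refine ⟨b :: n, List.pairwise_cons.2 ⟨fun c hc => ?_, hn⟩, ⟨Merge.right b μ⟩⟩
      rcases List.mem_append.1 (μ.perm.subset hc) with hc | hc
      · rcases List.mem_cons.1 hc with rfl | hc
        · exact hab
        · exact hab.trans ((List.pairwise_cons.1 h).1 c hc)
      · exact (List.pairwise_cons.1 h').1 c hc

end Merge

variable {V : Type u} [Category.{v} V] [MonoidalCategory V] [SymmetricCategory V]

section Coherence

variable {A L L' L'' K K' N : V}

theorem whiskerLeft_split_swap (s : N ⟶ L ⊗ L') :
    A ◁ (s ≫ (β_ L L').hom) ≫ (α_ _ _ _).inv ≫ (β_ A L').hom ▷ L ≫ (α_ _ _ _).hom =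
      (A ◁ s ≫ (α_ A L L').inv) ≫ (β_ _ _).hom := by
  simp [BraidedCategory.braiding_tensor_left_hom]

theorem whiskerLeft_split_swap' (s : N ⟶ L ⊗ L') :
    A ◁ (s ≫ (β_ L L').hom) ≫ (α_ A L' L).inv =
      (A ◁ s ≫ (α_ A L L').inv ≫ (β_ A L).hom ▷ L' ≫ (α_ _ _ _).hom) ≫ (β_ _ _).hom := by
  have h : (β_ A L).hom ▷ L' ≫ (β_ L A).hom ▷ L' = 𝟙 _ := by
    rw [← MonoidalCategory.comp_whiskerRight, SymmetricCategory.symmetry,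
      MonoidalCategory.id_whiskerRight]
  simp [BraidedCategory.braiding_tensor_right_hom, reassoc_of% h]

theorem split_unit : (λ_ (𝟙_ V)).inv ≫ (λ_ (𝟙_ V)).inv ▷ 𝟙_ V ≫ (α_ _ _ _).hom =
    (λ_ (𝟙_ V)).inv ≫ 𝟙_ V ◁ (λ_ (𝟙_ V)).inv := by
  monoidal

theorem whiskerLeft_split_assoc_left {s : N ⟶ K ⊗ L''} {t : K ⟶ L ⊗ L'} {s' : N ⟶ L ⊗ K'}
    {t' : K' ⟶ L' ⊗ L''} (h : s ≫ t ▷ _ ≫ (α_ _ _ _).hom = s' ≫ _ ◁ t') :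
    (A ◁ s ≫ (α_ _ _ _).inv) ≫ (A ◁ t ≫ (α_ _ _ _).inv) ▷ _ ≫ (α_ _ _ _).hom =
      (A ◁ s' ≫ (α_ _ _ _).inv) ≫ _ ◁ t' := by
  have h' := congrArg (fun t => A ◁ t) h
  simp only [MonoidalCategory.whiskerLeft_comp] at h'
  simp only [Category.assoc, MonoidalCategory.comp_whiskerRight]
  rw [← MonoidalCategory.associator_inv_naturality_right, ← reassoc_of% h']
  simp

theorem whiskerLeft_split_assoc_middle {s : N ⟶ K ⊗ L''} {t : K ⟶ L ⊗ L'} {s' : N ⟶ L ⊗ K'}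
    {t' : K' ⟶ L' ⊗ L''} (h : s ≫ t ▷ _ ≫ (α_ _ _ _).hom = s' ≫ _ ◁ t') :
    (A ◁ s ≫ (α_ _ _ _).inv) ≫
        (A ◁ t ≫ (α_ _ _ _).inv ≫ (β_ A L).hom ▷ _ ≫ (α_ _ _ _).hom) ▷ _ ≫ (α_ _ _ _).hom =
      (A ◁ s' ≫ (α_ _ _ _).inv ≫ (β_ A L).hom ▷ _ ≫ (α_ _ _ _).hom) ≫
        _ ◁ (A ◁ t' ≫ (α_ _ _ _).inv) := by
  have h' := congrArg (fun t => A ◁ t) h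
  simp only [MonoidalCategory.whiskerLeft_comp] at h'
  have e : A ◁ s' ≫ (α_ _ _ _).inv ≫ (β_ A L).hom ▷ _ ≫ (α_ _ _ _).hom ≫
      _ ◁ A ◁ t' = A ◁ s' ≫ A ◁ L ◁ t' ≫ (α_ _ _ _).inv ≫ (β_ A L).hom ▷ _ ≫ (α_ _ _ _).hom := by
    rw [← MonoidalCategory.associator_naturality_right, ← MonoidalCategory.whisker_exchange_assoc,
      MonoidalCategory.associator_inv_naturality_right_assoc]
  simp only [Category.assoc, MonoidalCategory.comp_whiskerRight,
    MonoidalCategory.whiskerLeft_comp]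
  rw [reassoc_of% e, ← reassoc_of% h']
  simp

theorem whiskerLeft_split_assoc_right {s : N ⟶ K ⊗ L''} {t : K ⟶ L ⊗ L'} {s' : N ⟶ L ⊗ K'}
    {t' : K' ⟶ L' ⊗ L''} (h : s ≫ t ▷ _ ≫ (α_ _ _ _).hom = s' ≫ _ ◁ t') :
    (A ◁ s ≫ (α_ _ _ _).inv ≫ (β_ A K).hom ▷ _ ≫ (α_ _ _ _).hom) ≫ t ▷ _ ≫ (α_ _ _ _).hom =
      (A ◁ s' ≫ (α_ _ _ _).inv ≫ (β_ A L).hom ▷ _ ≫ (α_ _ _ _).hom) ≫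
        _ ◁ (A ◁ t' ≫ (α_ _ _ _).inv ≫ (β_ A L').hom ▷ _ ≫ (α_ _ _ _).hom) := by
  have h' := congrArg (fun t => A ◁ t) h
  simp only [MonoidalCategory.whiskerLeft_comp] at h'
  have e : A ◁ s' ≫ (α_ _ _ _).inv ≫ (β_ A L).hom ▷ _ ≫ (α_ _ _ _).hom ≫
      _ ◁ A ◁ t' = A ◁ s' ≫ A ◁ L ◁ t' ≫ (α_ _ _ _).inv ≫ (β_ A L).hom ▷ _ ≫ (α_ _ _ _).hom := by
    rw [← MonoidalCategory.associator_naturality_right, ← MonoidalCategory.whisker_exchange_assoc,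
      MonoidalCategory.associator_inv_naturality_right_assoc]
  have e' : (α_ A K L'').inv ≫ (β_ A K).hom ▷ _ ≫ (α_ _ _ _).hom ≫ t ▷ (A ⊗ L'') =
      A ◁ t ▷ _ ≫ (α_ _ _ _).inv ≫ (β_ A _).hom ▷ _ ≫ (α_ _ _ _).hom := by
    rw [← MonoidalCategory.associator_naturality_left,
      MonoidalCategory.associator_inv_naturality_middle_assoc,
      ← MonoidalCategory.comp_whiskerRight_assoc, ← MonoidalCategory.comp_whiskerRight_assoc,
      BraidedCategory.braiding_naturality_right]
  simp only [Category.assoc, MonoidalCategory.whiskerLeft_comp]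
  rw [reassoc_of% e, ← reassoc_of% h', reassoc_of% e']
  simp [BraidedCategory.braiding_tensor_right_hom]

end Coherence

variable (V) in
/-- Labels of formal variables: infinitely many for each object of `V`. -/
structure Label : Type u where
  obj : V
  idx : ℕ

open Classical in
instance : LinearOrder (Label V) := linearOrderOfSTO (WellOrderingRel (α := Label V))

/-- The tensor product of the objects of a list of labels. -/
def tensL : List (Label V) → V
  | [] => 𝟙_ V
  | a :: l => a.obj ⊗ tensL l

namespace Merge

/-- The symmetry isomorphism given by a shuffle. -/
def split : {l l' n : List (Label V)} → Merge l l' n → (tensL n ⟶ tensL l ⊗ tensL l')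
  | _, _, _, .nil => (λ_ (𝟙_ V)).inv
  | _, _, _, .left a (l := l) (l' := l') μ =>
    a.obj ◁ split μ ≫ (α_ a.obj (tensL l) (tensL l')).inv
  | _, _, _, .right a (l := l) (l' := l') μ =>
    a.obj ◁ split μ ≫ (α_ a.obj (tensL l) (tensL l')).inv ≫ (β_ a.obj (tensL l)).hom ▷ tensL l' ≫
      (α_ (tensL l) a.obj (tensL l')).hom

theorem isIso_split : {l l' n : List (Label V)} → (μ : Merge l l' n) → IsIso (split μ)
  | _, _, _, .nil => inferInstanceAs (IsIso (λ_ (𝟙_ V)).inv)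
  | _, _, _, .left a (l := l) (l' := l') μ => by
    have := isIso_split μ
    exact inferInstanceAs (IsIso (a.obj ◁ split μ ≫ (α_ a.obj (tensL l) (tensL l')).inv))
  | _, _, _, .right a (l := l) (l' := l') μ => by
    have := isIso_split μ
    exact inferInstanceAs (IsIso (a.obj ◁ split μ ≫ (α_ a.obj (tensL l) (tensL l')).inv ≫
      (β_ a.obj (tensL l)).hom ▷ tensL l' ≫ (α_ (tensL l) a.obj (tensL l')).hom))

theorem split_swap : {l l' n : List (Label V)} → (μ : Merge l l' n) →
    split μ.swap = split μ ≫ (β_ _ _).hom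
  | _, _, _, .nil => by
    have : (λ_ (𝟙_ V)).inv = (λ_ (𝟙_ V)).inv ≫ (β_ (𝟙_ V) (𝟙_ V)).hom := by
      simp [← MonoidalCategory.unitors_equal]
    exact this
  | _, _, _, .left a μ => by
    simp only [swap, split, split_swap μ]
    exact whiskerLeft_split_swap _
  | _, _, _, .right a μ => by
    simp only [swap, split, split_swap μ]
    exact whiskerLeft_split_swap' _

theorem split_nilLeft : (l : List (Label V)) → (nilLeft l).split = (λ_ (tensL l)).inv
  | [] => rfl
  | a :: l => by
    simp only [nilLeft, split, split_nilLeft l]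
    have : a.obj ◁ (λ_ (tensL l)).inv ≫ (α_ _ _ _).inv ≫ (β_ a.obj (𝟙_ V)).hom ▷ _ ≫
      (α_ _ _ _).hom = (λ_ (a.obj ⊗ tensL l)).inv := by
      rw [← cancel_mono (λ_ _).hom]
      simp
    exact this

theorem split_assoc : {l l' l'' m n : List (Label V)} → (μ : Merge l l' m) →
    (ν : Merge m l'' n) → ∃ (m' : List (Label V)) (μ' : Merge l' l'' m') (ν' : Merge l m' n),
      split ν ≫ split μ ▷ _ ≫ (α_ _ _ _).hom = split ν' ≫ _ ◁ split μ'
  | _, _, _, _, _, .nil, .nil => ⟨_, .nil, .nil, split_unit⟩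
  | _, _, _, _, _, .left a μ, .left _ ν => by
    obtain ⟨m', μ', ν', h⟩ := split_assoc μ ν
    exact ⟨m', μ', .left a ν', whiskerLeft_split_assoc_left h⟩
  | _, _, _, _, _, .right a μ, .left _ ν => by
    obtain ⟨m', μ', ν', h⟩ := split_assoc μ ν
    exact ⟨a :: m', .left a μ', .right a ν', whiskerLeft_split_assoc_middle h⟩
  | _, _, _, _, _, μ, .right a ν => by
    obtain ⟨m', μ', ν', h⟩ := split_assoc μ ν
    exact ⟨a :: m', .right a μ', .right a ν', whiskerLeft_split_assoc_right h⟩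

end Merge

/-- Generalized elements of `Y`: multilinear maps to `Y` in finitely many distinct labelled
variables, and an absorbing element `none` for the products in which a variable is repeated. -/
def Elt (Y : V) : Type (max u v) :=
  Option (Σ l : {l : List (Label V) // l.Pairwise (· < ·)}, (tensL l.1 ⟶ Y))

namespace Elt

variable {X Y Z X' Y' : V}

def mk (l : List (Label V)) (hl : l.Pairwise (· < ·)) (f : tensL l ⟶ Y) : Elt Y :=
  some ⟨⟨l, hl⟩, f⟩

/-- The image of an element under a morphism. -/
def ap (φ : Y ⟶ Z) (e : Elt Y) : Elt Z :=
  Option.map (fun p => ⟨p.1, p.2 ≫ φ⟩) e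

scoped infixr:75 " ⋄ " => Elt.ap

open Classical in
/-- The product of two elements. -/
def tmul (x : Elt X) (y : Elt Y) : Elt (X ⊗ Y) :=
  x.bind fun p => y.bind fun p' =>
    if h : ∃ n : List (Label V), n.Pairwise (· < ·) ∧ Nonempty (Merge p.1.1 p'.1.1 n) then
      mk h.choose h.choose_spec.1 (h.choose_spec.2.some.split ≫ (p.2 ⊗ₘ p'.2))
    else none

scoped infixr:80 " ⊙ " => Elt.tmul

/-- The element of the unit object. -/
def unit : Elt (𝟙_ V) := mk [] List.Pairwise.nil (𝟙 _)

theorem mk_ne_none {l : List (Label V)} {hl : l.Pairwise (· < ·)} {f : tensL l ⟶ Y} :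
    mk l hl f ≠ none := Option.some_ne_none _

theorem mk_inj {l : List (Label V)} {hl : l.Pairwise (· < ·)} {f f' : tensL l ⟶ Y}
    (h : mk l hl f = mk l hl f') : f = f' := by
  have h' := Option.some.inj h
  exact eq_of_heq (Sigma.mk.inj h').2

theorem ap_mk {l : List (Label V)} {hl : l.Pairwise (· < ·)} {f : tensL l ⟶ Y} (φ : Y ⟶ Z) :
    φ ⋄ mk l hl f = mk l hl (f ≫ φ) := rfl

theorem ap_none (φ : Y ⟶ Z) : φ ⋄ (none : Elt Y) = none := rfl

theorem ap_eq_none {φ : Y ⟶ Z} {e : Elt Y} : φ ⋄ e = none ↔ e = none := Option.map_eq_none_iff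

theorem none_tmul (y : Elt Y) : (none : Elt X) ⊙ y = none := rfl

theorem tmul_none (x : Elt X) : x ⊙ (none : Elt Y) = none := by
  cases x <;> rfl

theorem mk_tmul_mk {l l' n : List (Label V)} (μ : Merge l l' n) (hn : n.Pairwise (· < ·))
    {hl : l.Pairwise (· < ·)} {hl' : l'.Pairwise (· < ·)} (f : tensL l ⟶ X) (f' : tensL l' ⟶ Y) :
    mk l hl f ⊙ mk l' hl' f' = mk n hn (μ.split ≫ (f ⊗ₘ f')) := by
  have h : ∃ n : List (Label V), n.Pairwise (· < ·) ∧ Nonempty (Merge l l' n) := ⟨n, hn, ⟨μ⟩⟩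
  have e : mk l hl f ⊙ mk l' hl' f' =
      mk h.choose h.choose_spec.1 (h.choose_spec.2.some.split ≫ (f ⊗ₘ f')) := dif_pos h
  rw [e]
  have key : ∀ (m : List (Label V)) (hm : m.Pairwise (· < ·)) (ν : Merge l l' m),
      mk m hm (ν.split ≫ (f ⊗ₘ f')) = mk n hn (μ.split ≫ (f ⊗ₘ f')) := by
    intro m hm ν
    obtain rfl : m = n := (ν.perm.trans μ.perm.symm).eq_of_pairwise
      (fun a b _ _ h1 h2 => absurd h2 (lt_asymm h1)) hm hn
    rw [Merge.eq_of_nodup (hm.imp ne_of_lt) ν μ]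
  exact key _ _ _

theorem mk_tmul_mk_cases {l l' : List (Label V)}
    (hl : l.Pairwise (· < ·)) (hl' : l'.Pairwise (· < ·)) (f : tensL l ⟶ X) (f' : tensL l' ⟶ Y) :
    mk l hl f ⊙ mk l' hl' f' = none ∨
      ∃ n, n.Pairwise (· < ·) ∧ Nonempty (Merge l l' n) := by
  by_cases h : ∃ n : List (Label V), n.Pairwise (· < ·) ∧ Nonempty (Merge l l' n)
  · exact Or.inr h
  · exact Or.inl (dif_neg h)

@[elab_as_elim]
theorem ind {p : Elt Y → Prop} (h0 : p none) (h : ∀ l hl f, p (mk l hl f)) (e : Elt Y) : p e := by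
  rcases e with _ | ⟨⟨l, hl⟩, f⟩
  · exact h0
  · exact h l hl f

@[simp] theorem id_ap (e : Elt Y) : 𝟙 Y ⋄ e = e := by
  induction e using ind with
  | h0 => rfl
  | h l hl f => rw [ap_mk, Category.comp_id]

@[simp] theorem comp_ap (φ : X ⟶ Y) (ψ : Y ⟶ Z) (e : Elt X) : (φ ≫ ψ) ⋄ e = ψ ⋄ φ ⋄ e := by
  induction e using ind with
  | h0 => rfl
  | h l hl f => simp only [ap_mk, Category.assoc]

@[simp] theorem tensorHom_ap (φ : X ⟶ X') (ψ : Y ⟶ Y') (x : Elt X) (y : Elt Y) :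
    (φ ⊗ₘ ψ) ⋄ (x ⊙ y) = (φ ⋄ x) ⊙ (ψ ⋄ y) := by
  induction x using ind with
  | h0 => rfl
  | h l hl f =>
  induction y using ind with
  | h0 => rfl
  | h l' hl' f' =>
    rcases mk_tmul_mk_cases hl hl' f f' with h | ⟨n, hn, ⟨μ⟩⟩
    · rcases mk_tmul_mk_cases hl hl' (f ≫ φ) (f' ≫ ψ) with h' | ⟨n, hn, ⟨μ⟩⟩
      · rw [h, ap_mk, ap_mk, h']; rfl
      · rw [mk_tmul_mk μ hn] at h
        exact absurd h mk_ne_none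
    · rw [mk_tmul_mk μ hn, ap_mk, ap_mk, ap_mk, mk_tmul_mk μ hn, Category.assoc,
        MonoidalCategory.tensorHom_comp_tensorHom]

@[simp] theorem whiskerLeft_ap (φ : Y ⟶ Y') (x : Elt X) (y : Elt Y) :
    (X ◁ φ) ⋄ (x ⊙ y) = x ⊙ (φ ⋄ y) := by
  rw [← MonoidalCategory.id_tensorHom, tensorHom_ap, id_ap]

@[simp] theorem whiskerRight_ap (φ : X ⟶ X') (x : Elt X) (y : Elt Y) :
    (φ ▷ Y) ⋄ (x ⊙ y) = (φ ⋄ x) ⊙ y := by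
  rw [← MonoidalCategory.tensorHom_id, tensorHom_ap, id_ap]

@[simp] theorem braiding_ap (x : Elt X) (y : Elt Y) : (β_ X Y).hom ⋄ (x ⊙ y) = y ⊙ x := by
  induction x using ind with
  | h0 => rw [none_tmul, tmul_none]; rfl
  | h l hl f =>
  induction y using ind with
  | h0 => rfl
  | h l' hl' f' =>
    rcases mk_tmul_mk_cases hl hl' f f' with h | ⟨n, hn, ⟨μ⟩⟩
    · rcases mk_tmul_mk_cases hl' hl f' f with h' | ⟨n, hn, ⟨μ⟩⟩
      · rw [h, h']; rfl
      · rw [mk_tmul_mk μ.swap hn] at h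
        exact absurd h mk_ne_none
    · rw [mk_tmul_mk μ hn, ap_mk, mk_tmul_mk μ.swap hn, Merge.split_swap, Category.assoc,
        Category.assoc, BraidedCategory.braiding_naturality]

theorem associator_ap_of_ne_none (x : Elt X) (y : Elt Y) (z : Elt Z)
    (h : (x ⊙ y) ⊙ z ≠ none) : (α_ X Y Z).hom ⋄ ((x ⊙ y) ⊙ z) = x ⊙ y ⊙ z := by
  induction x using ind with
  | h0 => exact absurd rfl h
  | h l hl f =>
  induction y using ind with
  | h0 => exact absurd rfl h
  | h l' hl' f' =>
  induction z using ind with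
  | h0 => exact absurd (tmul_none _) h
  | h l'' hl'' f'' =>
    rcases mk_tmul_mk_cases hl hl' f f' with h' | ⟨m, hm, ⟨μ⟩⟩
    · rw [h'] at h; exact absurd rfl h
    rw [mk_tmul_mk μ hm] at h ⊢
    rcases mk_tmul_mk_cases hm hl'' (μ.split ≫ (f ⊗ₘ f')) f'' with h' | ⟨n, hn, ⟨ν⟩⟩
    · exact absurd h' h
    obtain ⟨m', μ', ν', e⟩ := Merge.split_assoc μ ν
    rw [mk_tmul_mk ν hn, mk_tmul_mk μ' (hn.sublist ν'.sublist_right), mk_tmul_mk ν' hn, ap_mk]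
    congr 1
    have e1 : ((μ.split ≫ (f ⊗ₘ f')) ⊗ₘ f'') = μ.split ▷ _ ≫ ((f ⊗ₘ f') ⊗ₘ f'') := by
      rw [← MonoidalCategory.tensorHom_id, MonoidalCategory.tensorHom_comp_tensorHom,
        Category.id_comp]
    have e2 : (f ⊗ₘ (μ'.split ≫ (f' ⊗ₘ f''))) = _ ◁ μ'.split ≫ (f ⊗ₘ (f' ⊗ₘ f'')) := by
      rw [← MonoidalCategory.id_tensorHom, MonoidalCategory.tensorHom_comp_tensorHom,
        Category.id_comp]
    rw [e1, e2, ← reassoc_of% e, Category.assoc, Category.assoc,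
      MonoidalCategory.associator_naturality]

@[simp] theorem associator_hom_ap (x : Elt X) (y : Elt Y) (z : Elt Z) :
    (α_ X Y Z).hom ⋄ ((x ⊙ y) ⊙ z) = x ⊙ y ⊙ z := by
  by_cases h : (x ⊙ y) ⊙ z = none
  · rw [h, ap_none]
    by_contra h'
    have h1 : (y ⊙ z) ⊙ x ≠ none := fun e => h' (by rw [← braiding_ap, e, ap_none])
    have h2 : (z ⊙ y) ⊙ x ≠ none := fun e =>
      h1 (by rw [← braiding_ap z y, ← whiskerRight_ap, e, ap_none])
    have h3 : z ⊙ y ⊙ x ≠ none := fun e => h2 (by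
      have := associator_ap_of_ne_none z y x h2
      rw [e, ap_eq_none] at this
      exact this)
    exact h3 (by rw [← braiding_ap, ← braiding_ap x y, ← whiskerRight_ap, h, ap_none, ap_none])
  · exact associator_ap_of_ne_none x y z h

@[simp] theorem associator_inv_ap (x : Elt X) (y : Elt Y) (z : Elt Z) :
    (α_ X Y Z).inv ⋄ (x ⊙ y ⊙ z) = (x ⊙ y) ⊙ z := by
  rw [← associator_hom_ap, ← comp_ap, Iso.hom_inv_id, id_ap]

@[simp] theorem leftUnitor_inv_ap (x : Elt X) : (λ_ X).inv ⋄ x = unit ⊙ x := by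
  induction x using ind with
  | h0 => rfl
  | h l hl f =>
    have e : mk [] List.Pairwise.nil (Y := 𝟙_ V) (𝟙 (𝟙_ V)) ⊙ mk l hl f =
        mk l hl ((λ_ (tensL l)).inv ≫ (𝟙 (𝟙_ V) ⊗ₘ f)) := by
      rw [← Merge.split_nilLeft]
      exact mk_tmul_mk (Merge.nilLeft l) hl _ _
    refine Eq.trans ?_ e.symm
    rw [ap_mk, MonoidalCategory.leftUnitor_inv_naturality, MonoidalCategory.id_tensorHom]

@[simp] theorem leftUnitor_hom_ap (x : Elt X) : (λ_ X).hom ⋄ (unit ⊙ x) = x := by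
  rw [← leftUnitor_inv_ap, ← comp_ap, Iso.inv_hom_id, id_ap]

@[simp] theorem rightUnitor_hom_ap (x : Elt X) : (ρ_ X).hom ⋄ (x ⊙ unit) = x := by
  rw [← braiding_leftUnitor, comp_ap, braiding_ap, leftUnitor_hom_ap]

@[simp] theorem rightUnitor_inv_ap (x : Elt X) : (ρ_ X).inv ⋄ x = x ⊙ unit := by
  rw [← rightUnitor_hom_ap x, ← comp_ap, Iso.hom_inv_id, id_ap, rightUnitor_hom_ap]

@[simp] theorem tensorμ_ap (x : Elt X) (y : Elt Y) (x' : Elt X') (y' : Elt Y') :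
    tensorμ X Y X' Y' ⋄ ((x ⊙ y) ⊙ x' ⊙ y') = (x ⊙ x') ⊙ y ⊙ y' := by
  simp [tensorμ]

end Elt

section Spans

open Elt

variable {X Y Z : V}

/-- Morphisms out of `Y` are determined by their values on the elements in `P`, even on those that
do not involve a given finite set of labels. -/
def Spans (P : Elt Y → Prop) : Prop :=
  ∀ (F : List (Label V)) ⦃Z : V⦄ (φ ψ : Y ⟶ Z),
    (∀ l hl (f : tensL l ⟶ Y), (∀ a ∈ l, a ∉ F) → P (Elt.mk l hl f) → f ≫ φ = f ≫ ψ) → φ = ψ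

theorem Spans.ext {P : Elt Y → Prop} (h : Spans P) {φ ψ : Y ⟶ Z}
    (h' : ∀ e, P e → φ ⋄ e = ψ ⋄ e) : φ = ψ :=
  h [] φ ψ fun _ _ _ _ hf => Elt.mk_inj (h' _ hf)

theorem Spans.mono {P Q : Elt Y → Prop} (h : Spans P) (h' : ∀ e, P e → Q e) : Spans Q :=
  fun F _ φ ψ hQ => h F φ ψ fun l hl f ha hf => hQ l hl f ha (h' _ hf)

theorem spans_top (Y : V) : Spans (fun _ : Elt Y => True) := by
  intro F Z φ ψ h
  have hn : ∀ a ∈ F, a.idx < (F.map Label.idx).sum + 1 := fun a ha =>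
    Nat.lt_succ_of_le (List.le_sum_of_mem (List.mem_map_of_mem ha))
  have e := h [⟨Y, (F.map Label.idx).sum + 1⟩] (List.pairwise_singleton _ _) (ρ_ Y).hom
    (fun a ha hF => by
      obtain rfl := List.mem_singleton.1 ha
      exact lt_irrefl _ (hn _ hF)) trivial
  exact (cancel_epi (ρ_ Y).hom).1 e

variable [MonoidalClosed V]

theorem spans_unit : Spans (fun e : Elt (𝟙_ V) => e = Elt.unit) := by
  intro F Z φ ψ h
  have := h [] List.Pairwise.nil (𝟙 (𝟙_ V)) (by simp) rfl
  exact (cancel_epi (𝟙 (𝟙_ V))).1 this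

theorem hom_ext_whiskerLeft {A Y Z : V} {ι : Sort*} {D : ι → V} (f : ∀ j, D j ⟶ Y)
    (hf : ∀ ⦃Z : V⦄ (φ ψ : Y ⟶ Z), (∀ j, f j ≫ φ = f j ≫ ψ) → φ = ψ) {φ ψ : A ⊗ Y ⟶ Z}
    (h : ∀ j, A ◁ f j ≫ φ = A ◁ f j ≫ ψ) : φ = ψ := by
  apply MonoidalClosed.curry_injective
  apply hf
  intro j
  rw [← MonoidalClosed.curry_natural_left, ← MonoidalClosed.curry_natural_left, h]

theorem hom_ext_whiskerRight {A Y Z : V} {ι : Sort*} {D : ι → V} (f : ∀ j, D j ⟶ Y)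
    (hf : ∀ ⦃Z : V⦄ (φ ψ : Y ⟶ Z), (∀ j, f j ≫ φ = f j ≫ ψ) → φ = ψ) {φ ψ : Y ⊗ A ⟶ Z}
    (h : ∀ j, f j ▷ A ≫ φ = f j ▷ A ≫ ψ) : φ = ψ := by
  rw [← cancel_epi (β_ A Y).hom]
  refine hom_ext_whiskerLeft f hf fun j => ?_
  rw [BraidedCategory.braiding_naturality_right_assoc,
    BraidedCategory.braiding_naturality_right_assoc, h]

theorem Spans.tensor {P : Elt X → Prop} {Q : Elt Y → Prop} (hP : Spans P) (hQ : Spans Q) :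
    Spans (fun e : Elt (X ⊗ Y) => ∃ x y, P x ∧ Q y ∧ e = x ⊙ y) := by
  intro F Z φ ψ h
  refine hom_ext_whiskerRight
    (ι := {p : Σ l : {l : List (Label V) // l.Pairwise (· < ·)}, (tensL l.1 ⟶ X) //
      (∀ a ∈ p.1.1, a ∉ F) ∧ P (Elt.mk p.1.1 p.1.2 p.2)})
    (fun p => p.1.2) (fun Z φ ψ h => hP F φ ψ fun l hl f ha hf => h ⟨⟨⟨l, hl⟩, f⟩, ha, hf⟩) ?_
  rintro ⟨⟨⟨l, hl⟩, f⟩, ha, hf⟩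
  refine hom_ext_whiskerLeft
    (ι := {p : Σ l : {l : List (Label V) // l.Pairwise (· < ·)}, (tensL l.1 ⟶ Y) //
      (∀ a ∈ p.1.1, a ∉ F ++ l) ∧ Q (Elt.mk p.1.1 p.1.2 p.2)})
    (fun p => p.1.2)
    (fun Z φ ψ h => hQ (F ++ l) φ ψ fun l hl f ha hf => h ⟨⟨⟨l, hl⟩, f⟩, ha, hf⟩) ?_
  rintro ⟨⟨⟨l', hl'⟩, f'⟩, ha', hf'⟩
  dsimp only at ha ha' hf hf' ⊢
  obtain ⟨n, hn, ⟨μ⟩⟩ := Merge.exists_of_disjoint l l' hl hl'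
    (fun a h1 h2 => ha' a h2 (List.mem_append_right _ h1))
  have e := h n hn (μ.split ≫ (f ⊗ₘ f')) (fun a han => ?_)
    ⟨_, _, hf, hf', (Elt.mk_tmul_mk μ hn f f').symm⟩
  · have := μ.isIso_split
    rw [Category.assoc, Category.assoc, cancel_epi, MonoidalCategory.tensorHom_def'] at e
    simpa using e
  · rcases List.mem_append.1 (μ.perm.subset han) with h1 | h1
    · exact ha a h1
    · exact fun h2 => ha' a h1 (List.mem_append_left _ h2)

theorem Spans.of_jointly_epi {ι : Type*} {D : ι → V} (π : ∀ j, D j ⟶ Y)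
    (hπ : ∀ ⦃Z : V⦄ (φ ψ : Y ⟶ Z), (∀ j, π j ≫ φ = π j ≫ ψ) → φ = ψ)
    {P : ∀ j, Elt (D j) → Prop} (hP : ∀ j, Spans (P j)) :
    Spans (fun e : Elt Y => ∃ j x, P j x ∧ e = π j ⋄ x) := by
  intro F Z φ ψ h
  refine hπ φ ψ fun j => hP j F _ _ fun l hl f ha hf => ?_
  simpa using h l hl (f ≫ π j) ha ⟨j, _, hf, rfl⟩

end Spans

open Elt

/-- The elements of the objects of `k`-ary morphisms of `G` with target `y`. -/
abbrev Op (G : SymMultigraph.{v, u} V) (k : ℕ) (y : G.Ob) : Type (max u v) :=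
  Σ x : Fin k → G.Ob, Elt (G.Hom x y)

namespace Op

section Multigraph

variable {G : SymMultigraph.{v, u} V} {k l m : ℕ} {x y z c : G.Ob}

/-- The action of bijections on elements. -/
def act (σ : Fin k ≃ Fin l) (q : Op G l y) : Op G k y :=
  ⟨q.1 ∘ σ, G.act σ (fun _ => rfl) ⋄ q.2⟩

@[simp] theorem act_fst (σ : Fin k ≃ Fin l) (q : Op G l y) : (act σ q).1 = q.1 ∘ σ := rfl

theorem mk_act (σ : Fin k ≃ Fin l) {a : Fin l → G.Ob} {a' : Fin k → G.Ob}
    (h : ∀ i, a' i = a (σ i)) (e : Elt (G.Hom a y)) :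
    (⟨a', G.act σ h ⋄ e⟩ : Op G k y) = act σ ⟨a, e⟩ := by
  obtain rfl : a' = a ∘ σ := funext h
  rfl

theorem mk_congr {a : Fin k → G.Ob} {e e' : Elt (G.Hom a y)} (h : e = e') :
    (⟨a, e⟩ : Op G k y) = ⟨a, e'⟩ := by rw [h]

theorem act_refl (q : Op G k y) : act (Equiv.refl _) q = q := by
  obtain ⟨a, e⟩ := q
  have : G.act (Equiv.refl (Fin k)) (a := a) (a' := a) (b := y) (fun _ => rfl) ⋄ e = e := by
    rw [G.act_refl, id_ap]
  exact mk_congr this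

theorem act_act (τ : Fin k ≃ Fin l) (σ : Fin l ≃ Fin m) (q : Op G m y) :
    act τ (act σ q) = act (τ.trans σ) q := by
  have := congrArg (fun φ => φ ⋄ q.2) (G.act_trans σ τ (a := q.1) (a' := q.1 ∘ σ)
    (a'' := (q.1 ∘ σ) ∘ τ) (b := y) (fun _ => rfl) (fun _ => rfl))
  simp only [comp_ap] at this
  exact mk_congr this

theorem act_congr {σ τ : Fin k ≃ Fin l} (h : ∀ i, (σ i : ℕ) = τ i) (q : Op G l y) :
    act σ q = act τ q := by
  obtain rfl : σ = τ := Equiv.ext fun i => Fin.ext (h i)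
  rfl

theorem act_id {σ : Fin k ≃ Fin k} (h : ∀ i, (σ i : ℕ) = i) (q : Op G k y) : act σ q = q :=
  (act_congr h q).trans (act_refl q)

theorem act_eq_iff (σ : Fin k ≃ Fin l) (q : Op G l y) (q' : Op G k y) :
    act σ q = q' ↔ q = act σ.symm q' := by
  constructor
  · rintro rfl; rw [act_act, Equiv.symm_trans_self, act_refl]
  · rintro rfl; rw [act_act, Equiv.self_trans_symm, act_refl]

theorem mk_cast {a a' : Fin k → G.Ob} (h : ∀ i, a' i = a i) (e : Elt (G.Hom a y)) :
    (⟨a', G.cast h ⋄ e⟩ : Op G k y) = ⟨a, e⟩ :=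
  (mk_act _ h e).trans (act_refl _)

/-- The underlying element, over an equal tuple. -/
def elt (q : Op G k y) {a : Fin k → G.Ob} (h : ∀ i, a i = q.1 i) : Elt (G.Hom a y) :=
  G.cast h ⋄ q.2

theorem mk_elt (q : Op G k y) {a : Fin k → G.Ob} (h : ∀ i, a i = q.1 i) :
    (⟨a, elt q h⟩ : Op G k y) = q := mk_cast h q.2

theorem elt_mk {a : Fin k → G.Ob} (e : Elt (G.Hom a y)) (h : ∀ i, a i = a i) :
    elt (⟨a, e⟩ : Op G k y) h = e := by
  show G.cast h ⋄ e = e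
  rw [G.cast_refl, id_ap]

theorem mk_inj {a : Fin k → G.Ob} {e e' : Elt (G.Hom a y)}
    (h : (⟨a, e⟩ : Op G k y) = ⟨a, e'⟩) : e = e' :=
  eq_of_heq (Sigma.mk.inj h).2

theorem exists_cons (g : Op G (k + 1) c) :
    ∃ (b : Fin k → G.Ob) (e : Elt (G.Hom (cons (g.1 0) b) c)), g = ⟨cons (g.1 0) b, e⟩ :=
  ⟨Fin.tail g.1, elt g (fun i => congrFun (Fin.cons_self_tail g.1) i), (mk_elt g _).symm⟩

variable (G) in
/-- The type of composition operations in the first input. -/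
abbrev CompData : Type v := ∀ {l k : ℕ} (a : Fin l → G.Ob) (x : G.Ob) (b : Fin k → G.Ob)
    (c : G.Ob), G.Hom a x ⊗ G.Hom (cons x b) c ⟶ G.Hom (Fin.append a b) c

/-- Composition of elements in the first input. -/
def compOf (κ : CompData G) (f : Op G l x) (g : Op G (k + 1) c) (h : g.1 0 = x) :
    Op G (l + k) c :=
  ⟨Fin.append f.1 (Fin.tail g.1), κ f.1 x (Fin.tail g.1) c ⋄ (f.2 ⊙ elt g (by
    subst h; exact fun i => congrFun (Fin.cons_self_tail g.1) i))⟩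

theorem mk_compOf (κ : CompData G) {a : Fin l → G.Ob} {b : Fin k → G.Ob} (f : Elt (G.Hom a x))
    (g : Elt (G.Hom (cons x b) c)) : (⟨Fin.append a b, κ a x b c ⋄ (f ⊙ g)⟩ : Op G (l + k) c) =
      compOf κ ⟨a, f⟩ ⟨cons x b, g⟩ rfl := by
  refine congrArg (fun t => (⟨Fin.append a b, κ a x b c ⋄ (f ⊙ t)⟩ : Op G (l + k) c)) ?_
  exact (elt_mk g _).symm

end Multigraph

section Multicat

variable {P : SymMulticat.{v, u} V} {k l m l' k' : ℕ} {x y z c : P.Ob}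

/-- Composition of elements in the first input. -/
def comp (f : Op P.toSymMultigraph l x) (g : Op P.toSymMultigraph (k + 1) c) (h : g.1 0 = x) :
    Op P.toSymMultigraph (l + k) c :=
  compOf (fun a x b c => P.comp a x b c) f g h

theorem mk_comp {a : Fin l → P.Ob} {b : Fin k → P.Ob} (f : Elt (P.Hom a x))
    (g : Elt (P.Hom (cons x b) c)) :
    (⟨Fin.append a b, P.comp a x b c ⋄ (f ⊙ g)⟩ : Op P.toSymMultigraph (l + k) c) =
      comp ⟨a, f⟩ ⟨cons x b, g⟩ rfl := mk_compOf _ f g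

theorem comp_fst (f : Op P.toSymMultigraph l x) (g : Op P.toSymMultigraph (k + 1) c)
    (h : g.1 0 = x) : (comp f g h).1 = Fin.append f.1 (Fin.tail g.1) := rfl

variable (P) in
/-- The units. -/
def one (x : P.Ob) : Op P.toSymMultigraph 1 x := ⟨single x, P.one x ⋄ unit⟩

theorem act_comp (σ : Fin l' ≃ Fin l) (τ : Fin k' ≃ Fin k) (f : Op P.toSymMultigraph l x)
    (g : Op P.toSymMultigraph (k + 1) c) (h : g.1 0 = x)
    (h' : (act (consEquiv τ) g).1 0 = x) :
    comp (act σ f) (act (consEquiv τ) g) h' = act (appendEquiv σ τ) (comp f g h) := by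
  obtain ⟨a, f⟩ := f
  obtain ⟨b, g, rfl⟩ : ∃ (b : Fin k → P.Ob) (e : Elt (P.Hom (cons x b) c)),
      g = ⟨cons x b, e⟩ := by subst h; exact exists_cons g
  have e := congrArg (fun φ => φ ⋄ (f ⊙ g)) (P.act_comp σ τ x c (a := a) (a' := a ∘ σ) (b := b)
    (b' := b ∘ τ) (fun _ => rfl) (fun _ => rfl))
  simp only [comp_ap, tensorHom_ap] at e
  have e' := mk_congr (a := (Fin.append (a ∘ σ) (b ∘ τ))) e
  refine Eq.trans ?_ (e'.trans ?_)
  · refine Eq.trans ?_ (mk_comp _ _).symm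
    have : act (consEquiv τ) (⟨cons x b, g⟩ : Op P.toSymMultigraph (k + 1) c) =
      ⟨cons x (b ∘ τ), P.act (consEquiv τ) (cons_consEquiv τ x (fun _ => rfl)) ⋄ g⟩ :=
      (mk_act _ _ _).symm
    simp only [this]
    rfl
  · exact (mk_act _ _ _).trans (congrArg _ (mk_comp f g))

theorem one_comp (g : Op P.toSymMultigraph (k + 1) c) (h : g.1 0 = x) :
    comp (one P x) g h = act (finCongr (Nat.add_comm 1 k)) g := by
  obtain ⟨b, g, rfl⟩ : ∃ (b : Fin k → P.Ob) (e : Elt (P.Hom (cons x b) c)),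
      g = ⟨cons x b, e⟩ := by subst h; exact exists_cons g
  have e := congrArg (fun φ => φ ⋄ (unit ⊙ g)) (P.one_comp x b c)
  simp only [comp_ap, whiskerRight_ap, leftUnitor_hom_ap] at e
  have e' := mk_congr (a := (Fin.append (single x) b)) e
  exact (mk_comp _ _).symm.trans (e'.trans (mk_act _ _ _))

theorem comp_one (f : Op P.toSymMultigraph l x) (h : (one P x).1 0 = x) :
    comp f (one P x) h = f := by
  obtain ⟨a, f⟩ := f
  have e := congrArg (fun φ => φ ⋄ (f ⊙ unit)) (P.comp_one a x)
  simp only [comp_ap, whiskerLeft_ap, rightUnitor_hom_ap] at e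
  have e' := mk_congr (a := (Fin.append a nil)) e
  refine Eq.trans ?_ (e'.trans (mk_cast _ _))
  refine Eq.trans ?_ (mk_comp _ _).symm
  have : (⟨cons x nil, P.cast (cons_nil x) ⋄ P.one x ⋄ unit⟩ : Op P.toSymMultigraph 1 x) =
    one P x := mk_cast _ _
  simp only [this]

theorem assoc (f : Op P.toSymMultigraph l x) (g : Op P.toSymMultigraph (k + 1) y)
    (h : Op P.toSymMultigraph (m + 1) z) (h₁ : g.1 0 = x) (h₂ : h.1 0 = y)
    (h₃ : (act (finCongr (Nat.succ_add k m).symm) (comp g h h₂)).1 0 = x) :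
    comp (comp f g h₁) h h₂ = act (finCongr (Nat.add_assoc l k m))
      (comp f (act (finCongr (Nat.succ_add k m).symm) (comp g h h₂)) h₃) := by
  obtain ⟨a, f⟩ := f
  obtain ⟨b, g, rfl⟩ : ∃ (b : Fin k → P.Ob) (e : Elt (P.Hom (cons x b) y)),
      g = ⟨cons x b, e⟩ := by subst h₁; exact exists_cons g
  obtain ⟨c, h, rfl⟩ : ∃ (b : Fin m → P.Ob) (e : Elt (P.Hom (cons y b) z)),
      h = ⟨cons y b, e⟩ := by subst h₂; exact exists_cons h
  have e := congrArg (fun φ => φ ⋄ ((f ⊙ g) ⊙ h)) (P.assoc a x b y c z)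
  simp only [comp_ap, whiskerRight_ap, associator_hom_ap, whiskerLeft_ap] at e
  have e' := mk_congr (a := (Fin.append (Fin.append a b) c)) e
  refine Eq.trans ?_ (e'.trans ?_)
  · refine Eq.trans ?_ (mk_comp _ _).symm
    simp only [mk_comp]
  · refine (mk_act _ _ _).trans (congrArg _ ((mk_comp _ _).trans ?_))
    have : (⟨cons x (Fin.append b c), P.act (finCongr (Nat.succ_add k m).symm)
        (cons_append' x b c) ⋄ P.comp (cons x b) y c z ⋄ (g ⊙ h)⟩ : Op P.toSymMultigraph _ z) =
        act (finCongr (Nat.succ_add k m).symm) (comp ⟨cons x b, g⟩ ⟨cons y c, h⟩ rfl) :=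
      (mk_act _ _ _).trans (congrArg _ (mk_comp _ _))
    simp only [this]

theorem comp_comm (f : Op P.toSymMultigraph l x) (g : Op P.toSymMultigraph k y)
    (h : Op P.toSymMultigraph (m + 1 + 1) z) (h₁ : h.1 0 = x)
    (h₂ : (act (Equiv.swap 0 1) h).1 0 = y)
    (h₃ : (act (frontEquiv k m) (comp g (act (Equiv.swap 0 1) h) h₂)).1 0 = x)
    (h₄ : (act (frontEquiv l m) (comp f h h₁)).1 0 = y) :
    comp f (act (frontEquiv k m) (comp g (act (Equiv.swap 0 1) h) h₂)) h₃ =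
      act (blockEquiv l k m) (comp g (act (frontEquiv l m) (comp f h h₁)) h₄) := by
  obtain ⟨a, f⟩ := f
  obtain ⟨b, g⟩ := g
  obtain ⟨c, h, rfl⟩ : ∃ (c : Fin m → P.Ob) (e : Elt (P.Hom (cons x (cons y c)) z)),
      h = ⟨cons x (cons y c), e⟩ := by
    obtain ⟨c, h, rfl⟩ : ∃ (b : Fin (m + 1) → P.Ob) (e : Elt (P.Hom (cons x b) z)),
      h = ⟨cons x b, e⟩ := by subst h₁; exact exists_cons h
    have h₂' : c 0 = y := by simpa [cons, act] using h₂
    obtain ⟨d, rfl⟩ : ∃ d, c = cons y d := ⟨Fin.tail c, by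
      subst h₂'; exact (Fin.cons_self_tail c).symm⟩
    exact ⟨d, h, rfl⟩
  have e := congrArg (fun φ => φ ⋄ (f ⊙ g ⊙ h)) (P.comp_comm a x b y c z)
  simp only [comp_ap, whiskerRight_ap, associator_hom_ap, associator_inv_ap, braiding_ap,
    whiskerLeft_ap] at e
  have e' := mk_congr (a := (Fin.append a (Fin.append b c))) e
  refine Eq.trans ?_ (e'.trans ?_)
  · refine Eq.trans ?_ (mk_comp _ _).symm
    have e1 : (⟨cons y (cons x c), P.act (Equiv.swap 0 1) (cons_swap x y c) ⋄ h⟩ :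
        Op P.toSymMultigraph _ z) = act (Equiv.swap 0 1) ⟨cons x (cons y c), h⟩ := mk_act _ _ _
    have e2 : (⟨cons x (Fin.append b c), P.act (frontEquiv k m) (cons_frontEquiv b x c) ⋄
        P.comp b y (cons x c) z ⋄ (g ⊙ (P.act (Equiv.swap 0 1) (cons_swap x y c) ⋄ h))⟩ :
        Op P.toSymMultigraph _ z) = act (frontEquiv k m) (comp ⟨b, g⟩
          (act (Equiv.swap 0 1) ⟨cons x (cons y c), h⟩) h₂) := by
      refine (mk_act _ _ _).trans (congrArg _ ((mk_comp _ _).trans ?_))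
      simp only [e1]
    simp only [e2]
  · refine (mk_act _ _ _).trans (congrArg _ ((mk_comp _ _).trans ?_))
    have e1 : (⟨cons y (Fin.append a c), P.act (frontEquiv l m) (cons_frontEquiv a y c) ⋄
        P.comp a x (cons y c) z ⋄ (f ⊙ h)⟩ :
        Op P.toSymMultigraph _ z) = act (frontEquiv l m) (comp ⟨a, f⟩ ⟨cons x (cons y c), h⟩ rfl) :=
      (mk_act _ _ _).trans (congrArg _ (mk_comp _ _))
    simp only [e1]

/-- The image of an element under a multifunctor. -/
def map {Q : SymMulticat.{v, u} V} (F : SymMulticat.Multifunctor P Q)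
    (q : Op P.toSymMultigraph k y) : Op Q.toSymMultigraph k (F.obj y) :=
  ⟨F.obj ∘ q.1, F.map q.1 y ⋄ q.2⟩

variable {Q : SymMulticat.{v, u} V} (F : SymMulticat.Multifunctor P Q)

theorem map_act (σ : Fin k ≃ Fin l) (q : Op P.toSymMultigraph l y) :
    map F (act σ q) = act σ (map F q) := by
  have e := congrArg (fun φ => φ ⋄ q.2) (F.map_act σ (a := q.1) (a' := q.1 ∘ σ) (b := y)
    (fun _ => rfl))
  simp only [comp_ap] at e
  exact mk_congr (a := (F.obj ∘ q.1 ∘ σ)) e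

theorem map_one (x : P.Ob) : map F (one P x) = one Q (F.obj x) := by
  have e := congrArg (fun φ => φ ⋄ unit) (F.map_one x)
  simp only [comp_ap] at e
  exact mk_congr (a := (single (F.obj x))) e

theorem map_comp (f : Op P.toSymMultigraph l x) (g : Op P.toSymMultigraph (k + 1) c)
    (h : g.1 0 = x) (h' : (map F g).1 0 = F.obj x) :
    map F (comp f g h) = comp (map F f) (map F g) h' := by
  obtain ⟨a, f⟩ := f
  obtain ⟨b, g, rfl⟩ : ∃ (b : Fin k → P.Ob) (e : Elt (P.Hom (cons x b) c)),
      g = ⟨cons x b, e⟩ := by subst h; exact exists_cons g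
  have e := congrArg (fun φ => φ ⋄ (f ⊙ g)) (F.map_comp a x b c)
  simp only [comp_ap, tensorHom_ap] at e
  have e' := mk_congr (a := (Fin.append (F.obj ∘ a) (F.obj ∘ b))) e
  refine Eq.trans ?_ (e'.trans ?_)
  · refine Eq.trans ?_ (mk_cast _ _).symm
    rw [← mk_comp]
    rfl
  · refine (mk_comp _ _).trans ?_
    have : (⟨cons (F.obj x) (F.obj ∘ b), Q.cast (comp_cons F.obj x b) ⋄ F.map (cons x b) c ⋄ g⟩ :
        Op Q.toSymMultigraph _ _) = map F ⟨cons x b, g⟩ := mk_cast _ _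
    simp only [this]
    rfl

end Multicat

end Op

@[simp] theorem consEquiv_zero {k l : ℕ} (τ : Fin k ≃ Fin l) : consEquiv τ 0 = 0 := by
  simp [consEquiv]

@[simp] theorem consEquiv_succ {k l : ℕ} (τ : Fin k ≃ Fin l) (j : Fin k) :
    consEquiv τ j.succ = (τ j).succ := by
  simp [consEquiv]

theorem consEquiv_symm {k l : ℕ} (τ : Fin k ≃ Fin l) :
    (consEquiv τ).symm = consEquiv τ.symm := by
  refine Equiv.ext fun i => ((consEquiv τ).symm_apply_eq).2 ?_
  refine Fin.cases ?_ (fun j => ?_) i <;> simp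

theorem consEquiv_refl (k : ℕ) : consEquiv (Equiv.refl (Fin k)) = Equiv.refl _ := by
  ext i
  refine Fin.cases ?_ (fun j => ?_) i <;> simp

theorem exists_consEquiv {k l : ℕ} (e : Fin (k + 1) ≃ Fin (l + 1)) (h : e 0 = 0) :
    ∃ τ, e = consEquiv τ := by
  have h' : ∀ j : Fin k, e j.succ ≠ 0 := fun j hj =>
    Fin.succ_ne_zero j (e.injective (hj.trans h.symm))
  have h'' : ∀ j : Fin l, e.symm j.succ ≠ 0 := fun j hj => by
    rw [Equiv.symm_apply_eq, h] at hj
    exact Fin.succ_ne_zero j hj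
  refine ⟨⟨fun j => (e j.succ).pred (h' j), fun j => (e.symm j.succ).pred (h'' j),
    fun j => by simp, fun j => by simp⟩, ?_⟩
  ext i
  refine Fin.cases ?_ (fun j => ?_) i <;> simp [h]

@[simp] theorem appendEquiv_castAdd {l' l k' k : ℕ} (σ : Fin l' ≃ Fin l) (τ : Fin k' ≃ Fin k)
    (i : Fin l') : appendEquiv σ τ (Fin.castAdd k' i) = Fin.castAdd k (σ i) := by
  simp [appendEquiv]

@[simp] theorem appendEquiv_natAdd {l' l k' k : ℕ} (σ : Fin l' ≃ Fin l) (τ : Fin k' ≃ Fin k)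
    (i : Fin k') : appendEquiv σ τ (Fin.natAdd l' i) = Fin.natAdd l (τ i) := by
  simp [appendEquiv]

@[simp] theorem frontEquiv_zero (m r : ℕ) : frontEquiv m r 0 = Fin.natAdd m (0 : Fin (r + 1)) := by
  ext; simp [frontEquiv]

@[simp] theorem frontEquiv_succ_castAdd (m r : ℕ) (j : Fin m) :
    frontEquiv m r (Fin.castAdd r j).succ = Fin.castAdd (r + 1) j := by
  ext
  simp [frontEquiv, Fin.succAbove, Fin.lt_def]

@[simp] theorem frontEquiv_succ_natAdd (m r : ℕ) (j : Fin r) :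
    frontEquiv m r (Fin.natAdd m j).succ = Fin.natAdd m j.succ := by
  ext
  simp [frontEquiv, Fin.succAbove, Fin.lt_def]
  omega

@[simp] theorem blockEquiv_castAdd (l k m : ℕ) (j : Fin l) :
    blockEquiv l k m (Fin.castAdd _ j) = Fin.natAdd k (Fin.castAdd m j) := by
  simp [blockEquiv]

@[simp] theorem blockEquiv_natAdd_castAdd (l k m : ℕ) (j : Fin k) :
    blockEquiv l k m (Fin.natAdd l (Fin.castAdd m j)) = Fin.castAdd _ j := by
  simp [blockEquiv]

@[simp] theorem blockEquiv_natAdd_natAdd (l k m : ℕ) (j : Fin m) :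
    blockEquiv l k m (Fin.natAdd l (Fin.natAdd k j)) = Fin.natAdd k (Fin.natAdd l j) := by
  simp [blockEquiv]

/-- The elements of the objects of unary morphisms of `P`. -/
structure UArr (P : SymMulticat.{v, u} V) where
  src : P.Ob
  tgt : P.Ob
  el : Elt (P.Hom (single src) tgt)

namespace UArr

variable {P : SymMulticat.{v, u} V}

def op (f : UArr P) : Op P.toSymMultigraph 1 f.tgt := ⟨single f.src, f.el⟩

def ofOp {y : P.Ob} (q : Op P.toSymMultigraph 1 y) : UArr P :=
  ⟨q.1 0, y, Op.elt q fun i => by rw [Subsingleton.elim i 0]⟩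

@[simp] theorem op_ofOp {y : P.Ob} (q : Op P.toSymMultigraph 1 y) : (ofOp q).op = q :=
  Op.mk_elt q _

@[simp] theorem ofOp_op (f : UArr P) : ofOp f.op = f := by
  obtain ⟨x, y, e⟩ := f
  exact congrArg (UArr.mk x y) (Op.elt_mk e _)

variable (P) in
abbrev one (x : P.Ob) : UArr P := ⟨x, x, P.one x ⋄ unit⟩

theorem op_one (x : P.Ob) : (one P x).op = Op.one P x := rfl

def comp (f g : UArr P) (h : g.src = f.tgt) : UArr P :=
  ofOp (Op.comp (k := 0) f.op g.op h)

@[simp] theorem comp_src (f g : UArr P) (h : g.src = f.tgt) : (comp f g h).src = f.src := rfl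
@[simp] theorem comp_tgt (f g : UArr P) (h : g.src = f.tgt) : (comp f g h).tgt = g.tgt := rfl

theorem op_comp (f g : UArr P) (h : g.src = f.tgt) :
    (comp f g h).op = Op.comp (k := 0) f.op g.op h := op_ofOp _

end UArr

namespace Op

variable {P : SymMulticat.{v, u} V} {k l m n l' k' : ℕ} {x y z c : P.Ob}

theorem comp_act_left (σ : Fin l' ≃ Fin l) (f : Op P.toSymMultigraph l x)
    (g : Op P.toSymMultigraph (k + 1) c) (h : g.1 0 = x) :
    comp (act σ f) g h = act (appendEquiv σ (Equiv.refl _)) (comp f g h) := by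
  rw [← act_comp σ (Equiv.refl _) f g h (by simpa using h)]
  congr 1
  rw [consEquiv_refl, act_refl]

theorem comp_act_right (τ : Fin k' ≃ Fin k) (f : Op P.toSymMultigraph l x)
    (g : Op P.toSymMultigraph (k + 1) c) (h : g.1 0 = x)
    (h' : (act (consEquiv τ) g).1 0 = x) :
    comp f (act (consEquiv τ) g) h' = act (appendEquiv (Equiv.refl _) τ) (comp f g h) := by
  rw [← act_comp (Equiv.refl _) τ f g h h']
  simp only [act_refl]

/-- Composition with a unary morphism in the first input. -/
def preZero (f : UArr P) (q : Op P.toSymMultigraph (n + 1) c) (h : q.1 0 = f.tgt) :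
    Op P.toSymMultigraph (n + 1) c :=
  act (finCongr (Nat.add_comm n 1)) (comp f.op q h)

theorem preZero_fst_zero (f : UArr P) (q : Op P.toSymMultigraph (n + 1) c) (h : q.1 0 = f.tgt) :
    (preZero f q h).1 0 = f.src := rfl

theorem preZero_fst_succ (f : UArr P) (q : Op P.toSymMultigraph (n + 1) c) (h : q.1 0 = f.tgt)
    (j : Fin n) : (preZero f q h).1 j.succ = q.1 j.succ := by
  have : finCongr (Nat.add_comm n 1) j.succ = Fin.natAdd 1 j := by
    ext; simp [Nat.add_comm]
  show Fin.append f.op.1 (Fin.tail q.1) (finCongr (Nat.add_comm n 1) j.succ) = _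
  rw [this, Fin.append_right]; rfl

theorem preZero_act (τ : Fin k ≃ Fin n) (f : UArr P) (q : Op P.toSymMultigraph (n + 1) c)
    (h : q.1 0 = f.tgt) (h' : (act (consEquiv τ) q).1 0 = f.tgt) :
    preZero f (act (consEquiv τ) q) h' = act (consEquiv τ) (preZero f q h) := by
  unfold preZero
  rw [comp_act_right τ f.op q h h', act_act, act_act]
  refine act_congr (fun i => ?_) _
  refine Fin.cases ?_ (fun j => ?_) i
  · have : finCongr (Nat.add_comm k 1) 0 = Fin.castAdd k (0 : Fin 1) := rfl
    simp [this]
  · have : finCongr (Nat.add_comm k 1) j.succ = Fin.natAdd 1 j := by ext; simp [Nat.add_comm]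
    simp only [Equiv.trans_apply, this, appendEquiv_natAdd, consEquiv_succ]
    simp [Nat.add_comm]

/-- Composition with a unary morphism in the input `τ 0`. -/
def preBy (τ : Fin (n + 1) ≃ Fin k) (f : UArr P) (q : Op P.toSymMultigraph k c)
    (h : q.1 (τ 0) = f.tgt) : Op P.toSymMultigraph k c :=
  act τ.symm (preZero f (act τ q) h)

theorem preBy_congr (τ : Fin (n + 1) ≃ Fin k) (τ' : Fin (m + 1) ≃ Fin k) (f : UArr P)
    (q : Op P.toSymMultigraph k c) (h : q.1 (τ 0) = f.tgt) (h' : q.1 (τ' 0) = f.tgt)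
    (e : τ 0 = τ' 0) : preBy τ f q h = preBy τ' f q h' := by
  obtain ⟨ρ, hρ⟩ := exists_consEquiv (τ'.trans τ.symm) (by simp [← e])
  obtain rfl : τ' = (consEquiv ρ).trans τ := by rw [← hρ]; ext i; simp
  unfold preBy
  have e1 : act ((consEquiv ρ).trans τ) q = act (consEquiv ρ) (act τ q) := (act_act _ _ _).symm
  simp only [e1]
  rw [preZero_act ρ f (act τ q) h, act_act]
  refine act_congr (fun i => ?_) _
  simp

/-- A bijection that takes `0` to `t`. -/
def posEquiv (t : Fin k) : Fin (k - 1 + 1) ≃ Fin k :=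
  (finCongr (Nat.sub_add_cancel (Nat.succ_le_of_lt t.pos))).trans
    (Equiv.swap ⟨0, t.pos⟩ t)

@[simp] theorem posEquiv_zero (t : Fin k) : posEquiv t 0 = t := by
  have : finCongr (Nat.sub_add_cancel (Nat.succ_le_of_lt t.pos)) 0 = ⟨0, t.pos⟩ := by
    ext; simp
  simp only [posEquiv, Equiv.trans_apply, this, Equiv.swap_apply_left]

/-- Composition with a unary morphism in the input `t`. -/
def pre (t : Fin k) (f : UArr P) (q : Op P.toSymMultigraph k c) (h : q.1 t = f.tgt) :
    Op P.toSymMultigraph k c :=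
  preBy (posEquiv t) f q (by simpa using h)

theorem pre_eq (τ : Fin (n + 1) ≃ Fin k) {t : Fin k} (e : τ 0 = t) (f : UArr P)
    (q : Op P.toSymMultigraph k c) (h : q.1 t = f.tgt) :
    pre t f q h = act τ.symm (preZero f (act τ q) (by simpa [e] using h)) :=
  preBy_congr _ τ _ _ _ (by simpa [e] using h) (by simp [e])

theorem exists_pos (t : Fin k) : ∃ (n : ℕ) (τ : Fin (n + 1) ≃ Fin k), τ 0 = t :=
  ⟨_, posEquiv t, posEquiv_zero t⟩

theorem pre_zero (f : UArr P) (q : Op P.toSymMultigraph (n + 1) c) (h : q.1 0 = f.tgt) :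
    pre 0 f q h = preZero f q h := by
  rw [pre_eq (t := 0) (Equiv.refl _) rfl]
  simp only [act_refl, Equiv.refl_symm]

theorem pre_act (σ : Fin k ≃ Fin l) (t : Fin k) (f : UArr P) (q : Op P.toSymMultigraph l c)
    (h : (act σ q).1 t = f.tgt) (h' : q.1 (σ t) = f.tgt) :
    pre t f (act σ q) h = act σ (pre (σ t) f q h') := by
  obtain ⟨n, τ, e⟩ := exists_pos t
  rw [pre_eq τ e, pre_eq (τ.trans σ) (by simp [e])]
  simp only [act_act]
  refine act_congr (fun i => ?_) _
  simp

theorem pre_fst_self (t : Fin k) (f : UArr P) (q : Op P.toSymMultigraph k c)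
    (h : q.1 t = f.tgt) : (pre t f q h).1 t = f.src := by
  obtain ⟨n, τ, e⟩ := exists_pos t
  rw [pre_eq τ e]
  have : τ.symm t = 0 := by rw [← e]; simp
  simp [this, preZero_fst_zero]

theorem pre_fst_of_ne {t s : Fin k} (hs : s ≠ t) (f : UArr P) (q : Op P.toSymMultigraph k c)
    (h : q.1 t = f.tgt) : (pre t f q h).1 s = q.1 s := by
  obtain ⟨n, τ, rfl⟩ := exists_pos t
  obtain ⟨j, rfl⟩ : ∃ j : Fin n, s = τ j.succ := by
    obtain ⟨i, rfl⟩ := τ.surjective s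
    have : i ≠ 0 := fun hi => hs (by rw [hi])
    exact ⟨i.pred this, by simp⟩
  rw [pre_eq τ rfl]
  simp [preZero_fst_succ]

theorem _root_.SymMulti.appendEquiv_finCongr_val {l' l k' k : ℕ} (h : l' = l) (h' : k' = k)
    (i : Fin (l' + k')) : (appendEquiv (finCongr h) (finCongr h') i : ℕ) = i := by
  subst h h'
  refine Fin.addCases (fun j => ?_) (fun j => ?_) i
  · rw [appendEquiv_castAdd]; rfl
  · rw [appendEquiv_natAdd]; rfl

/-- Composition with a unary morphism after. -/
def post (m : Op P.toSymMultigraph l x) (f : UArr P) (h : f.src = x) :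
    Op P.toSymMultigraph l f.tgt :=
  comp (k := 0) m f.op h

theorem comp_preZero_left (f : UArr P) (q : Op P.toSymMultigraph (n + 1) x) (h : q.1 0 = f.tgt)
    (q' : Op P.toSymMultigraph (k + 1) c) (h' : q'.1 0 = x)
    (h'' : (comp q q' h').1 (Fin.castAdd k 0) = f.tgt) :
    comp (preZero f q h) q' h' = pre (Fin.castAdd k 0) f (comp q q' h') h'' := by
  rw [pre_eq (finCongr (Nat.succ_add n k).symm) (t := Fin.castAdd k 0) rfl]
  unfold preZero
  have h₃ : (act (finCongr (Nat.succ_add n k).symm) (comp q q' h')).1 0 = f.tgt := h''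
  rw [comp_act_left, assoc f.op q q' h h' h₃, act_act, act_act]
  refine act_congr (fun i => ?_) _
  have := appendEquiv_finCongr_val (Nat.add_comm n 1) (rfl : k = k) i
  simpa using this

theorem comp_pre_left (t : Fin l) (f : UArr P) (q : Op P.toSymMultigraph l x) (h : q.1 t = f.tgt)
    (q' : Op P.toSymMultigraph (k + 1) c) (h' : q'.1 0 = x)
    (h'' : (comp q q' h').1 (Fin.castAdd k t) = f.tgt) :
    comp (pre t f q h) q' h' = pre (Fin.castAdd k t) f (comp q q' h') h'' := by
  obtain ⟨n, τ, rfl⟩ := exists_pos t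
  rw [pre_eq τ rfl, comp_act_left]
  have e : comp (act τ q) q' h' = act (appendEquiv τ (Equiv.refl _)) (comp q q' h') :=
    comp_act_left _ _ _ _
  have e1 : (act (appendEquiv τ (Equiv.refl _)) (comp q q' h')).1 (Fin.castAdd k 0) = f.tgt := by
    rw [act_fst, Function.comp_apply, appendEquiv_castAdd]; exact h''
  rw [comp_preZero_left _ _ _ _ _ (by rw [e]; exact e1)]
  simp only [e]
  rw [pre_act _ _ _ _ e1 (by rw [appendEquiv_castAdd]; exact h''), act_act]
  simp only [appendEquiv_castAdd]
  refine act_id (fun i => ?_) _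
  refine Fin.addCases (fun j => ?_) (fun j => ?_) i <;> simp

theorem comp_pre_one (f : UArr P) (q : Op P.toSymMultigraph l x)
    (q' : Op P.toSymMultigraph (n + 1 + 1) c) (h' : q'.1 0 = x) (h : q'.1 1 = f.tgt)
    (h₁ : (pre 1 f q' h).1 0 = x)
    (h₂ : (comp q q' h').1 (Fin.natAdd l 0) = f.tgt) :
    comp q (pre 1 f q' h) h₁ = pre (Fin.natAdd l 0) f (comp q q' h') h₂ := by
  have hs : (act (Equiv.swap 0 1) q').1 0 = f.tgt := by simpa using h
  have e : pre 1 f q' h = act (consEquiv (finCongr (Nat.add_comm n 1)))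
      (act (frontEquiv 1 n) (comp f.op (act (Equiv.swap 0 1) q') hs)) := by
    rw [pre_eq (Equiv.swap 0 1) (t := 1) (by simp)]
    unfold preZero
    rw [act_act, act_act]
    refine act_congr (fun i => ?_) _
    refine Fin.cases ?_ (fun i => Fin.cases ?_ (fun j => ?_) i) i
    · simp
    · have : finCongr (Nat.add_comm n 1) 0 = Fin.castAdd n (0 : Fin 1) := rfl
      rw [Equiv.trans_apply, Equiv.trans_apply, consEquiv_succ, this, frontEquiv_succ_castAdd]
      simp
    · have : finCongr (Nat.add_comm n 1) j.succ = Fin.natAdd 1 j := by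
        ext; simp [Nat.add_comm]
      rw [Equiv.trans_apply, Equiv.trans_apply, consEquiv_succ, this, frontEquiv_succ_natAdd]
      rw [Equiv.symm_swap, Equiv.swap_apply_of_ne_of_ne]
      · simp [Nat.add_comm]
      · exact Fin.succ_ne_zero _
      · intro hj
        have := congrArg Fin.val hj
        simp at this
  have h₄ : (act (frontEquiv l n) (comp q q' h')).1 0 = f.tgt := by
    simpa using h₂
  have h₃ : (act (frontEquiv 1 n) (comp f.op (act (Equiv.swap 0 1) q') hs)).1 0 = x := by
    rw [e] at h₁
    simpa using h₁
  simp only [e]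
  rw [comp_act_right _ _ _ h₃, comp_comm q f.op q' h' hs h₃ h₄,
    pre_eq (frontEquiv l n) (frontEquiv_zero l n)]
  unfold preZero
  rw [act_act, act_act]
  refine act_congr (fun i => ?_) _
  obtain ⟨i, rfl⟩ := (frontEquiv l n).surjective i
  simp only [Equiv.trans_apply, Equiv.symm_apply_apply]
  refine Fin.cases ?_ (fun i => Fin.addCases (fun j => ?_) (fun j => ?_) i) i
  · have : finCongr (Nat.add_comm n 1) 0 = Fin.castAdd n (0 : Fin 1) := rfl
    simp [this]
  · simp [Nat.add_comm]
  · have : finCongr (Nat.add_comm n 1) j.succ = Fin.natAdd 1 j := by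
      ext; simp [Nat.add_comm]
    simp only [frontEquiv_succ_natAdd, appendEquiv_natAdd, this]
    simp
    omega

theorem comp_pre_right (t : Fin k) (f : UArr P) (q : Op P.toSymMultigraph l x)
    (q' : Op P.toSymMultigraph (k + 1) c) (h : q'.1 t.succ = f.tgt) (h' : q'.1 0 = x)
    (h₁ : (pre t.succ f q' h).1 0 = x) (h'' : (comp q q' h').1 (Fin.natAdd l t) = f.tgt) :
    comp q (pre t.succ f q' h) h₁ = pre (Fin.natAdd l t) f (comp q q' h') h'' := by
  obtain ⟨n, τ, rfl⟩ := exists_pos t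
  obtain ⟨p, hp⟩ : ∃ p, p = act (consEquiv τ) q' := ⟨_, rfl⟩
  obtain rfl : q' = act (consEquiv τ.symm) p := by
    rw [hp, act_act, ← consEquiv_symm, Equiv.symm_trans_self, act_refl]
  have hp0 : p.1 0 = x := by simpa using h'
  have hp1 : p.1 1 = f.tgt := by simpa using h
  have e : pre (τ 0).succ f (act (consEquiv τ.symm) p) h =
      act (consEquiv τ.symm) (pre 1 f p hp1) := by
    rw [pre_act _ _ _ _ _ (by simpa using hp1)]
    simp
  have hp2 : (pre 1 f p hp1).1 0 = x := by
    rw [pre_fst_of_ne (by simp)]; exact hp0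
  simp only [e]
  rw [comp_act_right _ _ _ hp2, comp_pre_one _ _ _ hp0]
  · have e1 : comp q (act (consEquiv τ.symm) p) h' =
        act (appendEquiv (Equiv.refl _) τ.symm) (comp q p hp0) := comp_act_right _ _ _ _ _
    simp only [e1]
    rw [pre_act]
    · simp
    · rw [e1] at h''
      simpa using h''
  · rw [comp_fst, Fin.append_right]
    exact hp1

theorem comp_preZero_right (m : Op P.toSymMultigraph l x) (f : UArr P)
    (q : Op P.toSymMultigraph (n + 1) c) (h : q.1 0 = f.tgt) (h' : f.src = x) :
    comp m (preZero f q h) h' = comp (post m f h') q h := by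
  have e := assoc (k := 0) m f.op q h' h h'
  refine Eq.trans ?_ e.symm
  have e1 : act (finCongr (Nat.succ_add 0 n).symm) (comp (l := 0 + 1) f.op q h) =
      act (consEquiv (finCongr (Nat.zero_add n))) (preZero f q h) := by
    unfold preZero
    rw [act_act]
    refine act_congr (fun i => ?_) _
    refine Fin.cases ?_ (fun j => ?_) i <;> simp
  simp only [e1]
  rw [comp_act_right _ _ _ h', act_act]
  symm
  refine act_id (fun i => ?_) _
  exact appendEquiv_finCongr_val (rfl : l = l) (Nat.zero_add n) _

theorem comp_pre_zero (m : Op P.toSymMultigraph l x) (f : UArr P)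
    (q : Op P.toSymMultigraph (n + 1) c) (h : q.1 0 = f.tgt) (h' : f.src = x)
    (h'' : (pre 0 f q h).1 0 = x) :
    comp m (pre 0 f q h) h'' = comp (post m f h') q h := by
  simp only [pre_zero]
  exact comp_preZero_right m f q h h'

theorem pre_pre (t : Fin k) (f g : UArr P) (q : Op P.toSymMultigraph k c) (h : q.1 t = g.tgt)
    (h' : (pre t g q h).1 t = f.tgt) (hfg : g.src = f.tgt) :
    pre t f (pre t g q h) h' = pre t (f.comp g hfg) q h := by
  obtain ⟨n, τ, rfl⟩ := exists_pos t
  have hq : (act τ q).1 0 = g.tgt := h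
  have e : act τ (pre (τ 0) g q h) = preZero g (act τ q) hq := by
    rw [pre_eq τ rfl, act_act, Equiv.self_trans_symm, act_refl]
  refine (pre_eq τ rfl _ _ _).trans (Eq.trans ?_ (pre_eq τ rfl _ _ _).symm)
  simp only [e]
  refine congrArg (act τ.symm) (congrArg (act _) ?_)
  refine (comp_preZero_right f.op g (act τ q) hq hfg).trans ?_
  have : (f.comp g hfg).op = post f.op g hfg := UArr.op_comp _ _ _
  simp only [this]
  rfl

theorem pre_one (t : Fin k) (q : Op P.toSymMultigraph k c) (h : q.1 t = x) :
    pre t (UArr.one P x) q h = q := by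
  obtain ⟨n, τ, rfl⟩ := exists_pos t
  refine (pre_eq τ rfl _ _ _).trans ?_
  have e := one_comp (act τ q) h
  refine (congrArg (fun t => act τ.symm (act (finCongr (Nat.add_comm n 1)) t)) e).trans ?_
  rw [act_act, act_act, act_act]
  exact act_id (fun i => by simp) q

theorem pre_comm {s t : Fin k} (hst : s ≠ t) (f g : UArr P) (q : Op P.toSymMultigraph k c)
    (hs : q.1 s = f.tgt) (ht : q.1 t = g.tgt) (hs' : (pre t g q ht).1 s = f.tgt)
    (ht' : (pre s f q hs).1 t = g.tgt) :
    pre s f (pre t g q ht) hs' = pre t g (pre s f q hs) ht' := by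
  obtain ⟨n, τ, rfl⟩ := exists_pos s
  obtain ⟨j, rfl⟩ : ∃ j : Fin n, t = τ j.succ := by
    obtain ⟨i, rfl⟩ := τ.surjective t
    have : i ≠ 0 := fun hi => hst (by rw [hi])
    exact ⟨i.pred this, by simp⟩
  have hq : (act τ q).1 0 = f.tgt := hs
  have hq' : (act τ q).1 j.succ = g.tgt := ht
  have e : act τ (pre (τ j.succ) g q ht) = pre j.succ g (act τ q) hq' :=
    (pre_act _ _ _ _ _ _).symm
  have h1 : (pre j.succ g (act τ q) hq').1 0 = f.tgt := by
    rw [pre_fst_of_ne (Fin.succ_ne_zero j).symm]; exact hq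
  have h2 : (preZero f (act τ q) hq).1 j.succ = g.tgt := by
    rw [preZero_fst_succ]; exact hq'
  have e1 : preZero f (pre j.succ g (act τ q) hq') h1 = pre j.succ g (preZero f (act τ q) hq) h2 := by
    unfold preZero
    have h3 : (comp f.op (act τ q) hq).1 (Fin.natAdd 1 j) = g.tgt := by
      rw [comp_fst, Fin.append_right]; exact hq'
    rw [comp_pre_right _ _ _ _ _ hq _ h3]
    have : finCongr (Nat.add_comm n 1) j.succ = Fin.natAdd 1 j := by
      ext; simp [Nat.add_comm]
    refine Eq.trans ?_ (pre_act _ _ _ _ _ (by rw [this]; exact h3)).symm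
    simp only [this]
  have e2 : pre (τ 0) f q hs = act τ.symm (preZero f (act τ q) hq) := pre_eq τ rfl _ _ _
  have h4 : (act τ.symm (preZero f (act τ q) hq)).1 (τ j.succ) = g.tgt := by
    rw [← e2]; exact ht'
  rw [pre_eq τ rfl]
  simp only [e, e1, e2]
  rw [pre_act _ _ _ _ h4 (by simpa using h2)]
  simp

variable {Q : SymMulticat.{v, u} V} (F : SymMulticat.Multifunctor P Q)

/-- The image of a unary element under a multifunctor. -/
def _root_.SymMulti.UArr.map (f : UArr P) : UArr Q := UArr.ofOp (Op.map F f.op)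

theorem _root_.SymMulti.UArr.op_map (f : UArr P) : (f.map F).op = Op.map F f.op :=
  UArr.op_ofOp _

theorem map_pre (t : Fin k) (f : UArr P) (q : Op P.toSymMultigraph k c) (h : q.1 t = f.tgt)
    (h' : (map F q).1 t = F.obj f.tgt) :
    map F (pre t f q h) = pre t (f.map F) (map F q) h' := by
  obtain ⟨n, τ, rfl⟩ := exists_pos t
  refine (congrArg (map F) (pre_eq τ rfl _ _ _)).trans (Eq.trans ?_ (pre_eq τ rfl _ _ _).symm)
  unfold preZero
  have hq : (map F (act τ q)).1 0 = F.obj f.tgt := h'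
  rw [map_act]
  rw [map_act, map_comp F _ _ _ hq]
  simp only [map_act, ← UArr.op_map]
  rfl

theorem map_post (m : Op P.toSymMultigraph l x) (f : UArr P) (h : f.src = x)
    (h' : (f.map F).src = F.obj x) : map F (post m f h) = post (map F m) (f.map F) h' := by
  unfold post
  rw [map_comp F m f.op h (congrArg F.obj h)]
  simp only [← UArr.op_map]
  rfl

theorem post_post (m : Op P.toSymMultigraph l x) (f g : UArr P) (h : f.src = x)
    (h' : g.src = f.tgt) : post (post m f h) g h' = post m (f.comp g h') h := by
  have e : (f.comp g h').op = preZero (n := 0) f g.op h' := by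
    rw [UArr.op_comp]
    symm
    exact act_id (σ := finCongr rfl) (fun i => rfl) _
  unfold post
  simp only [e]
  exact (comp_preZero_right m f g.op h' h).symm

theorem post_one (m : Op P.toSymMultigraph l x) (h : (UArr.one P x).src = x) :
    post m (UArr.one P x) h = m := comp_one m _

theorem post_comp (f : Op P.toSymMultigraph l x) (q : Op P.toSymMultigraph (k + 1) y)
    (g : UArr P) (h : q.1 0 = x) (h' : g.src = y) :
    post (comp f q h) g h' = comp f (post q g h') h := by
  have e := assoc (m := 0) f q g.op h h' h
  refine e.trans ?_
  refine (act_id (σ := finCongr (Nat.add_assoc l k 0)) (fun i => rfl) _).trans ?_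
  have e1 : act (finCongr (Nat.succ_add k 0).symm) (comp (k := 0) q g.op h') = post q g h' :=
    act_id (σ := finCongr (Nat.succ_add k 0).symm) (fun i => rfl) _
  simp only [e1]

section PreAll

variable (F G : Fin k → UArr P)

open Classical in
/-- Composition with `F t` in the input `t`, if possible. -/
def step {k : ℕ} (F : Fin k → UArr P) (t : Fin k) (q : Op P.toSymMultigraph k c) :
    Op P.toSymMultigraph k c :=
  if h : q.1 t = (F t).tgt then pre t (F t) q h else q

theorem step_eq {t : Fin k} {q : Op P.toSymMultigraph k c} (h : q.1 t = (F t).tgt) :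
    step F t q = pre t (F t) q h := dif_pos h

theorem step_of_ne {t : Fin k} {q : Op P.toSymMultigraph k c} (h : q.1 t ≠ (F t).tgt) :
    step F t q = q := dif_neg h

theorem step_fst_of_ne {t s : Fin k} (hs : s ≠ t) (q : Op P.toSymMultigraph k c) :
    (step F t q).1 s = q.1 s := by
  by_cases h : q.1 t = (F t).tgt
  · rw [step_eq F h, pre_fst_of_ne hs]
  · rw [step_of_ne F h]

theorem step_comm {s t : Fin k} (hst : s ≠ t) (q : Op P.toSymMultigraph k c) :
    step F s (step G t q) = step G t (step F s q) := by
  by_cases hs : q.1 s = (F s).tgt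
  · have hs' : (step G t q).1 s = (F s).tgt := by rw [step_fst_of_ne G hst]; exact hs
    by_cases ht : q.1 t = (G t).tgt
    · have ht' : (step F s q).1 t = (G t).tgt := by rw [step_fst_of_ne F hst.symm]; exact ht
      rw [step_eq F hs', step_eq G ht']
      simp only [step_eq F hs, step_eq G ht] at hs' ht' ⊢
      exact pre_comm hst _ _ _ _ _ _ _
    · have ht' : (step F s q).1 t ≠ (G t).tgt := by rw [step_fst_of_ne F hst.symm]; exact ht
      rw [step_of_ne G ht', step_of_ne G ht]
  · have hs' : (step G t q).1 s ≠ (F s).tgt := by rw [step_fst_of_ne G hst]; exact hs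
    rw [step_of_ne F hs, step_of_ne F hs']

/-- Composition with the `F t` in the inputs in a list. -/
def preList (L : List (Fin k)) (q : Op P.toSymMultigraph k c) : Op P.toSymMultigraph k c :=
  L.foldr (step F) q

/-- Composition with unary morphisms in all inputs. -/
def preAll (q : Op P.toSymMultigraph k c) : Op P.toSymMultigraph k c :=
  preList F (List.finRange k) q

@[simp] theorem preList_nil (q : Op P.toSymMultigraph k c) : preList F [] q = q := rfl

@[simp] theorem preList_cons (t : Fin k) (L : List (Fin k)) (q : Op P.toSymMultigraph k c) :
    preList F (t :: L) q = step F t (preList F L q) := rfl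

theorem preList_append (L L' : List (Fin k)) (q : Op P.toSymMultigraph k c) :
    preList F (L ++ L') q = preList F L (preList F L' q) := List.foldr_append

theorem preList_fst_of_notMem {L : List (Fin k)} {t : Fin k} (ht : t ∉ L)
    (q : Op P.toSymMultigraph k c) : (preList F L q).1 t = q.1 t := by
  induction L with
  | nil => rfl
  | cons s L ih =>
    rw [List.mem_cons, not_or] at ht
    rw [preList_cons, step_fst_of_ne F ht.1, ih ht.2]

theorem preList_fst_of_mem {L : List (Fin k)} (hL : L.Nodup) {t : Fin k} (ht : t ∈ L)
    (q : Op P.toSymMultigraph k c) (h : q.1 t = (F t).tgt) : (preList F L q).1 t = (F t).src := by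
  induction L with
  | nil => simp at ht
  | cons s L ih =>
    rw [List.nodup_cons] at hL
    rw [preList_cons]
    rcases eq_or_ne t s with rfl | hts
    · rw [step_eq F (by rw [preList_fst_of_notMem F hL.1]; exact h), pre_fst_self]
    · rw [step_fst_of_ne F hts, ih hL.2 ((List.mem_cons.1 ht).resolve_left hts)]

theorem preAll_fst {q : Op P.toSymMultigraph k c} (h : ∀ t, q.1 t = (F t).tgt) (t : Fin k) :
    (preAll F q).1 t = (F t).src :=
  preList_fst_of_mem F (List.nodup_finRange k) (List.mem_finRange t) q (h t)

variable {F G} in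
theorem preList_perm {L L' : List (Fin k)} (h : L.Perm L') (q : Op P.toSymMultigraph k c) :
    preList F L q = preList F L' q := by
  refine h.foldr_eq' (fun s _ t _ q => ?_) q
  rcases eq_or_ne t s with rfl | hts
  · rfl
  · exact step_comm F F hts q

theorem step_act (σ : Fin k ≃ Fin l) (F : Fin l → UArr P) (t : Fin k)
    (q : Op P.toSymMultigraph l c) : step (F ∘ σ) t (act σ q) = act σ (step F (σ t) q) := by
  by_cases h : q.1 (σ t) = (F (σ t)).tgt
  · rw [step_eq F h, step_eq (F ∘ σ) (q := act σ q) h]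
    exact pre_act _ _ _ _ _ _
  · rw [step_of_ne F h, step_of_ne (F ∘ σ) (q := act σ q) h]

theorem preList_act (σ : Fin k ≃ Fin l) (F : Fin l → UArr P) (L : List (Fin k))
    (q : Op P.toSymMultigraph l c) :
    preList (F ∘ σ) L (act σ q) = act σ (preList F (L.map σ) q) := by
  induction L with
  | nil => rfl
  | cons s L ih => rw [preList_cons, ih, step_act]; rfl

theorem preAll_act (σ : Fin k ≃ Fin l) (F : Fin l → UArr P) (q : Op P.toSymMultigraph l c) :
    preAll (F ∘ σ) (act σ q) = act σ (preAll F q) := by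
  unfold preAll
  rw [preList_act]
  refine congrArg _ (preList_perm ?_ q)
  refine (List.perm_ext_iff_of_nodup ((List.nodup_finRange k).map σ.injective)
    (List.nodup_finRange l)).2 fun t => ?_
  simp only [List.mem_map, List.mem_finRange, true_and, iff_true]
  exact σ.surjective t

theorem preList_comp (F : Fin l → UArr P) (G : Fin (l + k) → UArr P) (L : List (Fin l))
    (hFG : ∀ t ∈ L, G (Fin.castAdd k t) = F t) (q : Op P.toSymMultigraph l x)
    (q' : Op P.toSymMultigraph (k + 1) c) (h : q'.1 0 = x) :
    comp (preList F L q) q' h = preList G (L.map (Fin.castAdd k)) (comp q q' h) := by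
  induction L with
  | nil => rfl
  | cons s L ih =>
    rw [preList_cons, List.map_cons, preList_cons,
      ← ih fun t ht => hFG t (List.mem_cons_of_mem _ ht)]
    have hs := hFG s List.mem_cons_self
    generalize preList F L q = r
    have e : (comp r q' h).1 (Fin.castAdd k s) = r.1 s := by rw [comp_fst, Fin.append_left]
    by_cases h1 : r.1 s = (F s).tgt
    · have h2 : (comp r q' h).1 (Fin.castAdd k s) = (G (Fin.castAdd k s)).tgt := by
        rw [e, hs]; exact h1
      rw [step_eq F h1, step_eq G h2]
      simp only [hs]
      exact comp_pre_left _ _ _ _ _ _ _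
    · have h2 : (comp r q' h).1 (Fin.castAdd k s) ≠ (G (Fin.castAdd k s)).tgt := by
        rw [e, hs]; exact h1
      rw [step_of_ne F h1, step_of_ne G h2]

theorem comp_preList (F : Fin (k + 1) → UArr P) (G : Fin (l + k) → UArr P) (L : List (Fin k))
    (hFG : ∀ t ∈ L, G (Fin.natAdd l t) = F t.succ) (q : Op P.toSymMultigraph l x)
    (q' : Op P.toSymMultigraph (k + 1) c) (h : q'.1 0 = x)
    (h' : (preList F (L.map Fin.succ) q').1 0 = x) :
    comp q (preList F (L.map Fin.succ) q') h' =
      preList G (L.map (Fin.natAdd l)) (comp q q' h) := by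
  induction L with
  | nil => rfl
  | cons s L ih =>
    have h0 : ∀ L : List (Fin k), (preList F (L.map Fin.succ) q').1 0 = x := fun L => by
      rw [preList_fst_of_notMem F (by simp [Fin.succ_ne_zero])]; exact h
    simp only [List.map_cons, preList_cons]
    rw [← ih (fun t ht => hFG t (List.mem_cons_of_mem _ ht)) (h0 L)]
    have hs := hFG s List.mem_cons_self
    have key : ∀ (r : Op P.toSymMultigraph (k + 1) c) (h0' : r.1 0 = x)
        (h1' : (step F s.succ r).1 0 = x),
        comp q (step F s.succ r) h1' = step G (Fin.natAdd l s) (comp q r h0') := by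
      intro r h0' h1'
      have e : (comp q r h0').1 (Fin.natAdd l s) = r.1 s.succ := by
        rw [comp_fst, Fin.append_right]; rfl
      by_cases h1 : r.1 s.succ = (F s.succ).tgt
      · have h2 : (comp q r h0').1 (Fin.natAdd l s) = (G (Fin.natAdd l s)).tgt := by
          rw [e, hs]; exact h1
        rw [step_eq G h2]
        simp only [step_eq F h1, hs]
        exact comp_pre_right _ _ _ _ _ _ _ _
      · have h2 : (comp q r h0').1 (Fin.natAdd l s) ≠ (G (Fin.natAdd l s)).tgt := by
          rw [e, hs]; exact h1
        rw [step_of_ne G h2]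
        simp only [step_of_ne F h1]
    exact key _ _ _

theorem post_preList (L : List (Fin k)) (q : Op P.toSymMultigraph k x) (g : UArr P)
    (h : g.src = x) : post (preList F L q) g h = preList F L (post q g h) := by
  have e := preList_comp (k := 0) F F L (fun _ _ => rfl) q g.op h
  rw [show L.map (Fin.castAdd 0) = L from List.map_id L] at e
  exact e

theorem post_preAll (q : Op P.toSymMultigraph k x) (g : UArr P)
    (h : g.src = x) : post (preAll F q) g h = preAll F (post q g h) :=
  post_preList F _ q g h

theorem preAll_comp_preAll (F : Fin l → UArr P) (F' : Fin (k + 1) → UArr P)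
    (q : Op P.toSymMultigraph l x) (q' : Op P.toSymMultigraph (k + 1) c)
    (h : q'.1 0 = (F' 0).tgt) (h' : (F' 0).src = x) (h'' : (preAll F' q').1 0 = x) :
    comp (preAll F q) (preAll F' q') h'' =
      preAll (Fin.append F (Fin.tail F')) (comp (post q (F' 0) h') q' h) := by
  have h0 : (preList F' ((List.finRange k).map Fin.succ) q').1 0 = (F' 0).tgt := by
    rw [preList_fst_of_notMem F' (by simp [Fin.succ_ne_zero])]; exact h
  have e : preAll F' q' = pre 0 (F' 0) (preList F' ((List.finRange k).map Fin.succ) q') h0 := by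
    unfold preAll
    rw [List.finRange_succ, preList_cons, step_eq F' h0]
  simp only [e]
  rw [comp_pre_zero _ _ _ _ h', comp_preList F' (Fin.append F (Fin.tail F')) _
    (fun t _ => by rw [Fin.append_right]; rfl) _ _ h, post_preAll]
  unfold preAll
  rw [preList_comp F (Fin.append F (Fin.tail F')) _ (fun t _ => by rw [Fin.append_left]),
    ← preList_append]
  refine preList_perm ?_ _
  refine (List.perm_ext_iff_of_nodup (List.Nodup.append ?_ ?_ ?_)
    (List.nodup_finRange _)).2 fun t => ?_
  · exact (List.nodup_finRange k).map (Fin.natAdd_injective k l)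
  · exact (List.nodup_finRange l).map (Fin.castAdd_injective l k)
  · intro t h1 h2
    simp only [List.mem_map, List.mem_finRange, true_and] at h1 h2
    obtain ⟨i, rfl⟩ := h1
    obtain ⟨j, hj⟩ := h2
    have := congrArg Fin.val hj
    simp at this
    omega
  · simp only [List.mem_append, List.mem_map, List.mem_finRange, true_and, iff_true]
    refine Fin.addCases (fun j => ?_) (fun j => ?_) t
    · exact Or.inr ⟨j, rfl⟩
    · exact Or.inl ⟨j, rfl⟩

theorem preAll_preAll (hFG : ∀ t, (G t).src = (F t).tgt) (q : Op P.toSymMultigraph k c)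
    (h : ∀ t, q.1 t = (G t).tgt) :
    preAll F (preAll G q) = preAll (fun t => (F t).comp (G t) (hFG t)) q := by
  unfold preAll
  have key : ∀ L : List (Fin k), L.Nodup → preList F L (preList G L q) =
      preList (fun t => (F t).comp (G t) (hFG t)) L q := by
    intro L hL
    induction L with
    | nil => rfl
    | cons s L ih =>
      rw [List.nodup_cons] at hL
      have comm : ∀ (L' : List (Fin k)), s ∉ L' → ∀ r : Op P.toSymMultigraph k c,
          preList F L' (step G s r) = step G s (preList F L' r) := by
        intro L' hs r
        induction L' with
        | nil => rfl
        | cons t L' ih' =>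
          rw [List.mem_cons, not_or] at hs
          rw [preList_cons, ih' hs.2, step_comm F G (Ne.symm hs.1), preList_cons]
      rw [preList_cons, preList_cons, preList_cons, comm L hL.1, ih hL.2]
      have e : (preList (fun t => (F t).comp (G t) (hFG t)) L q).1 s = (G s).tgt := by
        rw [preList_fst_of_notMem _ hL.1]; exact h s
      generalize preList (fun t => (F t).comp (G t) (hFG t)) L q = r at e
      rw [step_eq (fun t => (F t).comp (G t) (hFG t)) (q := r) e]
      have e' : (step G s r).1 s = (F s).tgt := by
        rw [step_eq G e, pre_fst_self]; exact hFG s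
      rw [step_eq F e']
      simp only [step_eq G e]
      exact pre_pre _ _ _ _ _ _ _
  exact key _ (List.nodup_finRange k)

theorem preList_one (L : List (Fin k)) (q : Op P.toSymMultigraph k c)
    (h : ∀ t ∈ L, F t = UArr.one P (q.1 t)) : preList F L q = q := by
  induction L with
  | nil => rfl
  | cons s L ih =>
    rw [preList_cons, ih fun t ht => h t (List.mem_cons_of_mem _ ht)]
    have hs := h s List.mem_cons_self
    rw [step_eq F (by rw [hs])]
    simp only [hs]
    exact pre_one _ _ _

theorem preAll_one (q : Op P.toSymMultigraph k c) (h : ∀ t, F t = UArr.one P (q.1 t)) :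
    preAll F q = q := preList_one F _ q fun t _ => h t

theorem preAll_op (F : Fin 1 → UArr P) (g : UArr P) (h : g.src = (F 0).tgt) :
    preAll F g.op = ((F 0).comp g h).op := by
  have e : preAll F g.op = step F 0 g.op := by
    unfold preAll
    rw [List.finRange_succ]
    rfl
  have h' : g.op.1 0 = (F 0).tgt := h
  rw [e, step_eq F h', pre_zero, UArr.op_comp]
  exact act_id (σ := finCongr rfl) (fun i => rfl) _

theorem map_preList {Q : SymMulticat.{v, u} V} (Φ : SymMulticat.Multifunctor P Q)
    {L : List (Fin k)} (hL : L.Nodup)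
    (q : Op P.toSymMultigraph k c) (h : ∀ t ∈ L, q.1 t = (F t).tgt) :
    map Φ (preList F L q) = preList (fun t => (F t).map Φ) L (map Φ q) := by
  induction L with
  | nil => rfl
  | cons s L ih =>
    rw [List.nodup_cons] at hL
    have e : (preList F L q).1 s = (F s).tgt := by
      rw [preList_fst_of_notMem _ hL.1]; exact h s List.mem_cons_self
    rw [preList_cons, preList_cons, ← ih hL.2 fun t ht => h t (List.mem_cons_of_mem _ ht),
      step_eq F e]
    have e' : (map Φ (preList F L q)).1 s = ((F s).map Φ).tgt := congrArg Φ.obj e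
    rw [step_eq (fun t => (F t).map Φ) e']
    exact map_pre _ _ _ _ _ _

theorem map_preAll {Q : SymMulticat.{v, u} V} (Φ : SymMulticat.Multifunctor P Q)
    (q : Op P.toSymMultigraph k c) (h : ∀ t, q.1 t = (F t).tgt) :
    map Φ (preAll F q) = preAll (fun t => (F t).map Φ) (map Φ q) :=
  map_preList F Φ (List.nodup_finRange k) q fun t _ => h t

end PreAll

end Op

open SymMulticat

/-- The product of finitely many elements. -/
def tensEl : {s : ℕ} → {X : Fin s → V} → (∀ t, Elt (X t)) → Elt (tens X)
  | 0, _, _ => Elt.unit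
  | s + 1, _, e => tensEl (fun t => e (Fin.castSucc t)) ⊙ e (Fin.last s)

theorem tensEl_succ {s : ℕ} {X : Fin (s + 1) → V} (e : ∀ t, Elt (X t)) :
    tensEl e = tensEl (fun t => e (Fin.castSucc t)) ⊙ e (Fin.last s) := rfl

@[simp] theorem tensMap_ap {s : ℕ} {X Y : Fin s → V} (f : ∀ t, X t ⟶ Y t)
    (e : ∀ t, Elt (X t)) : tensMap f ⋄ tensEl e = tensEl fun t => f t ⋄ e t := by
  induction s with
  | zero => exact id_ap _
  | succ s ih =>
    refine (tensorHom_ap _ _ _ _).trans ?_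
    rw [ih]; rfl

@[simp] theorem tensShuffle_ap {s : ℕ} {X Y : Fin s → V} (e : ∀ t, Elt (X t))
    (e' : ∀ t, Elt (Y t)) :
    tensShuffle X Y ⋄ tensEl (fun t => e t ⊙ e' t) = tensEl e ⊙ tensEl e' := by
  induction s with
  | zero => exact leftUnitor_inv_ap _
  | succ s ih =>
    refine (comp_ap _ _ _).trans ?_
    refine (congrArg _ (whiskerRight_ap _ _ _)).trans ?_
    rw [ih]
    exact tensorμ_ap _ _ _ _

theorem spans_tens [MonoidalClosed V] {s : ℕ} {X : Fin s → V} {P : ∀ t, Elt (X t) → Prop}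
    (h : ∀ t, Spans (P t)) :
    Spans (fun e : Elt (tens X) => ∃ f : ∀ t, Elt (X t), (∀ t, P t (f t)) ∧ e = tensEl f) := by
  induction s with
  | zero => exact spans_unit.mono fun e he => ⟨fun t => t.elim0, fun t => t.elim0, he⟩
  | succ s ih =>
    refine ((ih fun t => h (Fin.castSucc t)).tensor (h (Fin.last s))).mono ?_
    rintro _ ⟨_, y, ⟨f, hf, rfl⟩, hy, rfl⟩
    refine ⟨Fin.lastCases y f, fun t => ?_, ?_⟩
    · refine Fin.lastCases ?_ (fun t => ?_) t
      · simpa using hy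
      · simpa using hf t
    · rw [tensEl_succ]
      simp only [Fin.lastCases_castSucc, Fin.lastCases_last]
      rfl

theorem exists_whisker_swap {P A Q : V} (φ : P ⊗ A ⟶ Q) (hφ : IsIso φ) (Z : V) :
    ∃ ψ : (P ⊗ Z) ⊗ A ⟶ Q ⊗ Z, IsIso ψ ∧
      ∀ (p : Elt P) (a : Elt A) (z : Elt Z), ψ ⋄ ((p ⊙ z) ⊙ a) = (φ ⋄ (p ⊙ a)) ⊙ z :=
  ⟨(α_ _ _ _).hom ≫ _ ◁ (β_ _ _).hom ≫ (α_ _ _ _).inv ≫ φ ▷ _, inferInstance,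
    fun p a z => by simp⟩

theorem exists_whisker_assoc {P A Q : V} (φ : P ⊗ A ⟶ Q) (hφ : IsIso φ) (Z : V) :
    ∃ ψ : P ⊗ A ⊗ Z ⟶ Q ⊗ Z, IsIso ψ ∧
      ∀ (p : Elt P) (a : Elt A) (z : Elt Z), ψ ⋄ (p ⊙ a ⊙ z) = (φ ⋄ (p ⊙ a)) ⊙ z :=
  ⟨(α_ _ _ _).inv ≫ φ ▷ _, inferInstance, fun p a z => by simp⟩

theorem exists_insert {k : ℕ} (X : Fin (k + 1) → V) (t : Fin (k + 1)) :
    ∃ φ : tens (fun j => X (t.succAbove j)) ⊗ X t ⟶ tens X, IsIso φ ∧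
      ∀ e : ∀ t, Elt (X t), φ ⋄ (tensEl (fun j => e (t.succAbove j)) ⊙ e t) = tensEl e := by
  induction k with
  | zero =>
    obtain rfl : t = Fin.last 0 := Subsingleton.elim (α := Fin 1) _ _
    exact ⟨𝟙 (tens X), IsIso.id _, fun e => id_ap _⟩
  | succ k ih =>
    refine Fin.lastCases ?_ (fun s => ?_) t
    · rw [Fin.succAbove_last]
      exact ⟨𝟙 (tens X), IsIso.id (tens X), fun e => id_ap (tensEl e)⟩
    · obtain ⟨φ, hφ, h⟩ := ih (fun t => X (Fin.castSucc t)) s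
      have key : ∀ (p : Fin k → Fin (k + 2)) (z : Fin (k + 2)),
          p = (fun j => Fin.castSucc (s.succAbove j)) → z = Fin.last (k + 1) →
          ∃ φ : (tens (fun j => X (p j)) ⊗ X z) ⊗ X (Fin.castSucc s) ⟶ tens X, IsIso φ ∧
            ∀ e : ∀ t, Elt (X t), φ ⋄ ((tensEl (fun j => e (p j)) ⊙ e z) ⊙ e (Fin.castSucc s)) =
              tensEl e := by
        rintro _ _ rfl rfl
        obtain ⟨ψ, hψ, h'⟩ := exists_whisker_swap φ hφ (X (Fin.last (k + 1)))
        exact ⟨ψ, hψ, fun e => (h' _ _ _).trans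
          (congrArg (· ⊙ e (Fin.last (k + 1))) (h fun t => e (Fin.castSucc t)))⟩
      exact key (fun j => (Fin.castSucc s).succAbove (Fin.castSucc j))
        ((Fin.castSucc s).succAbove (Fin.last k))
        (funext fun j => by simp)
        (by simp)

theorem exists_perm {k l : ℕ} (σ : Fin k ≃ Fin l) (X : Fin l → V) :
    ∃ φ : tens (fun t => X (σ t)) ⟶ tens X, IsIso φ ∧
      ∀ e : ∀ t, Elt (X t), φ ⋄ tensEl (fun t => e (σ t)) = tensEl e := by
  obtain rfl : k = l := by simpa using Fintype.card_congr σ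
  induction k with
  | zero => exact ⟨𝟙 (tens X), IsIso.id _, fun e => id_ap _⟩
  | succ k ih =>
    obtain ⟨φ, hφ, h⟩ := exists_insert X (σ (Fin.last k))
    obtain ⟨τ, hτ⟩ : ∃ τ : Fin k ≃ Fin k,
        ∀ j, σ (Fin.castSucc j) = (σ (Fin.last k)).succAbove (τ j) := by
      have hne : ∀ j : Fin k, σ (Fin.castSucc j) ≠ σ (Fin.last k) := fun j h =>
        (Fin.castSucc_lt_last j).ne (σ.injective h)
      choose τ hτ using fun j => Fin.exists_succAbove_eq (hne j)
      have hi : Function.Injective τ := fun i j hij => by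
        have := (hτ i).symm.trans ((congrArg _ hij).trans (hτ j))
        exact Fin.castSucc_injective _ (σ.injective this)
      exact ⟨Equiv.ofBijective τ (Finite.injective_iff_bijective.1 hi), fun j => (hτ j).symm⟩
    obtain ⟨ψ, hψ, h'⟩ := ih τ fun j => X ((σ (Fin.last k)).succAbove j)
    have key : ∀ p : Fin k → Fin (k + 1), p = (fun j => (σ (Fin.last k)).succAbove (τ j)) →
        ∃ φ : tens (fun j => X (p j)) ⊗ X (σ (Fin.last k)) ⟶ tens X, IsIso φ ∧
          ∀ e : ∀ t, Elt (X t), φ ⋄ (tensEl (fun j => e (p j)) ⊙ e (σ (Fin.last k))) =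
            tensEl e := by
      rintro _ rfl
      refine ⟨ψ ▷ _ ≫ φ, inferInstance, fun e => ?_⟩
      rw [comp_ap, whiskerRight_ap, h' fun j => e ((σ (Fin.last k)).succAbove j), h]
    exact key (fun j => σ (Fin.castSucc j)) (funext hτ)

/-- Permutation of the factors. -/
def permTens {k l : ℕ} (σ : Fin k ≃ Fin l) (X : Fin l → V) :
    tens X ⟶ tens (fun t => X (σ t)) :=
  have := (exists_perm σ X).choose_spec.1
  inv (exists_perm σ X).choose

@[simp] theorem permTens_ap {k l : ℕ} (σ : Fin k ≃ Fin l) (X : Fin l → V) (e : ∀ t, Elt (X t)) :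
    permTens σ X ⋄ tensEl e = tensEl (fun t => e (σ t)) := by
  have := (exists_perm σ X).choose_spec.1
  rw [← (exists_perm σ X).choose_spec.2 e, ← comp_ap]
  unfold permTens
  rw [IsIso.hom_inv_id, id_ap]

theorem exists_append {k l : ℕ} (X : Fin (l + k) → V) :
    ∃ φ : tens (fun j => X (Fin.castAdd k j)) ⊗ tens (fun j => X (Fin.natAdd l j)) ⟶ tens X,
      IsIso φ ∧ ∀ e : ∀ t, Elt (X t), φ ⋄ (tensEl (fun j => e (Fin.castAdd k j)) ⊙
        tensEl (fun j => e (Fin.natAdd l j))) = tensEl e := by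
  induction k with
  | zero => exact ⟨(ρ_ (tens X)).hom, (ρ_ (tens X)).isIso_hom, fun e => rightUnitor_hom_ap _⟩
  | succ k ih =>
    obtain ⟨φ, hφ, h⟩ := ih fun t => X (Fin.castSucc t)
    obtain ⟨ψ, hψ, h'⟩ := exists_whisker_assoc φ hφ (X (Fin.last (l + k)))
    exact ⟨ψ, hψ, fun e => (h' _ _ _).trans
      (congrArg (· ⊙ e (Fin.last (l + k))) (h fun t => e (Fin.castSucc t)))⟩

/-- Concatenation. -/
def appendTens {k l : ℕ} (X : Fin (l + k) → V) :
    tens (fun j => X (Fin.castAdd k j)) ⊗ tens (fun j => X (Fin.natAdd l j)) ⟶ tens X :=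
  (exists_append X).choose

instance {k l : ℕ} (X : Fin (l + k) → V) : IsIso (appendTens X) :=
  (exists_append X).choose_spec.1

@[simp] theorem appendTens_ap {k l : ℕ} (X : Fin (l + k) → V) (e : ∀ t, Elt (X t)) :
    appendTens X ⋄ (tensEl (fun j => e (Fin.castAdd k j)) ⊙ tensEl (fun j => e (Fin.natAdd l j))) =
      tensEl e := (exists_append X).choose_spec.2 e

@[simp] theorem inv_appendTens_ap {k l : ℕ} (X : Fin (l + k) → V) (e : ∀ t, Elt (X t)) :
    inv (appendTens X) ⋄ tensEl e =
      tensEl (fun j => e (Fin.castAdd k j)) ⊙ tensEl (fun j => e (Fin.natAdd l j)) := by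
  rw [← appendTens_ap, ← comp_ap, IsIso.hom_inv_id, id_ap]

theorem exists_uncons {k : ℕ} (X : Fin (k + 1) → V) :
    ∃ φ : tens X ⟶ X 0 ⊗ tens (fun j => X j.succ),
      ∀ e : ∀ t, Elt (X t), φ ⋄ tensEl e = e 0 ⊙ tensEl (fun j => e j.succ) := by
  have h := exists_insert X 0
  rw [Fin.succAbove_zero] at h
  obtain ⟨φ, hφ, h⟩ := h
  refine ⟨inv φ ≫ (β_ _ _).hom, fun e => ?_⟩
  rw [← h e, ← comp_ap, IsIso.hom_inv_id_assoc, braiding_ap]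

/-- Separation of the first factor. -/
def unconsTens {k : ℕ} (X : Fin (k + 1) → V) :
    tens X ⟶ X 0 ⊗ tens (fun j => X j.succ) := (exists_uncons X).choose

@[simp] theorem unconsTens_ap {k : ℕ} (X : Fin (k + 1) → V) (e : ∀ t, Elt (X t)) :
    unconsTens X ⋄ tensEl e = e 0 ⊙ tensEl (fun j => e j.succ) :=
  (exists_uncons X).choose_spec e

namespace Op

variable {P : SymMulticat.{v, u} V} {k l m n r s : ℕ} {x y z c : P.Ob}

theorem preAll_eq_preList (F : Fin (s + r) → UArr P) (q : Op P.toSymMultigraph (s + r) c)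
    (h : ∀ t, F (Fin.natAdd s t) = UArr.one P (q.1 (Fin.natAdd s t))) :
    preAll F q = preList F ((List.finRange s).map (Fin.castAdd r)) q := by
  unfold preAll
  have e : preList F ((List.finRange r).map (Fin.natAdd s)) q = q := by
    refine preList_one F _ q fun t ht => ?_
    simp only [List.mem_map, List.mem_finRange, true_and] at ht
    obtain ⟨j, rfl⟩ := ht
    exact h j
  conv_rhs => rw [← e, ← preList_append]
  · refine preList_perm ?_ _
    refine (List.perm_ext_iff_of_nodup (List.nodup_finRange _)
      (List.Nodup.append ?_ ?_ ?_)).2 fun t => ?_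
    · exact (List.nodup_finRange s).map (Fin.castAdd_injective s r)
    · exact (List.nodup_finRange r).map (Fin.natAdd_injective r s)
    · intro t h1 h2
      simp only [List.mem_map, List.mem_finRange, true_and] at h1 h2
      obtain ⟨i, rfl⟩ := h1
      obtain ⟨j, hj⟩ := h2
      have := congrArg Fin.val hj
      simp at this
      omega
    · simp only [List.mem_append, List.mem_map, List.mem_finRange, true_and, true_iff]
      refine Fin.addCases (fun j => ?_) (fun j => ?_) t
      · exact Or.inl ⟨j, rfl⟩
      · exact Or.inr ⟨j, rfl⟩

theorem mk_post {a : Fin l → P.Ob} {y' : P.Ob} (h : y = y') (m : Elt (P.Hom a y))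
    (f : Elt (P.Hom (single y') z)) :
    (⟨a, P.post a h z ⋄ (m ⊙ f)⟩ : Op P.toSymMultigraph l z) = post ⟨a, m⟩ ⟨y', z, f⟩ h.symm := by
  subst h
  unfold SymMulticat.post
  simp only [comp_ap, whiskerLeft_ap]
  refine (mk_cast (k := l) _ _).trans ((mk_comp _ _).trans ?_)
  simp only [mk_cast]
  rfl

theorem mk_preAt {m r : ℕ} {w : Fin m → P.Ob} {u v : P.Ob} {a : Fin r → P.Ob}
    (f : Elt (P.Hom (single u) v)) (q : Elt (P.Hom (Fin.append w (cons v a)) c))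
    (h : Fin.append w (cons v a) (Fin.natAdd m 0) = v) :
    (⟨Fin.append w (cons u a), P.preAt w u v a c ⋄ (f ⊙ q)⟩ : Op P.toSymMultigraph _ c) =
      pre (Fin.natAdd m 0) ⟨u, v, f⟩ ⟨_, q⟩ h := by
  unfold SymMulticat.preAt
  simp only [comp_ap, whiskerLeft_ap]
  refine (mk_act _ _ _).trans ?_
  rw [pre_eq (frontEquiv m r) (frontEquiv_zero m r)]
  have e : (⟨cons v (Fin.append w a), P.act (frontEquiv m r) (cons_frontEquiv w v a) ⋄ q⟩ :
      Op P.toSymMultigraph _ c) = act (frontEquiv m r) ⟨_, q⟩ := mk_act _ _ _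
  rw [← act_act]
  refine congrArg _ (congrArg _ ((mk_comp _ _).trans ?_))
  simp only [e]
  rfl

theorem preFirst_zero_ap {r : ℕ} {x y : Fin 0 → P.Ob} {a : Fin r → P.Ob}
    (f : ∀ t, Elt (P.Hom (single (x t)) (y t))) (q : Elt (P.Hom (Fin.append y a) c)) :
    P.preFirst x y a c ⋄ (tensEl f ⊙ q) =
      P.cast (fun i => by rw [Subsingleton.elim x y]) ⋄ q := by
  refine (comp_ap _ _ _).trans (congrArg _ ?_)
  exact leftUnitor_hom_ap _

theorem _root_.SymMulti.Elt.associator_hom_whiskerLeft_ap {A B C D E F G : V} (φ : C ⟶ D)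
    (ψ : B ⊗ D ⟶ E) (χ : A ⊗ E ⟶ F) (θ : F ⟶ G) (a : Elt A) (b : Elt B) (e : Elt C) :
    ((α_ A B C).hom ≫ A ◁ (B ◁ φ ≫ ψ) ≫ χ ≫ θ) ⋄ ((a ⊙ b) ⊙ e) =
      θ ⋄ χ ⋄ (a ⊙ (ψ ⋄ (b ⊙ (φ ⋄ e)))) := by
  simp

theorem mk_preFirst {s r : ℕ} {x y : Fin s → P.Ob} {a : Fin r → P.Ob}
    (f : ∀ t, Elt (P.Hom (single (x t)) (y t))) (q : Elt (P.Hom (Fin.append y a) c))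
    (F : Fin (s + r) → UArr P) (hF : ∀ t, F (Fin.castAdd r t) = ⟨x t, y t, f t⟩) :
    (⟨Fin.append x a, P.preFirst x y a c ⋄ (tensEl f ⊙ q)⟩ : Op P.toSymMultigraph _ c) =
      preList F ((List.finRange s).map (Fin.castAdd r)) ⟨_, q⟩ := by
  induction s generalizing r with
  | zero =>
    rw [preFirst_zero_ap]
    exact mk_cast _ _
  | succ s ih =>
    let σ : Fin (s + 1 + r) ≃ Fin (s + (r + 1)) := finCongr (Nat.succ_add_eq_add_succ s r)
    have e : σ.symm (Fin.natAdd s 0) = Fin.castAdd r (Fin.last s) := rfl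
    refine (mk_congr (Elt.associator_hom_whiskerLeft_ap _ _ _ _ _ _ _)).trans ?_
    refine (mk_act _ _ _).trans ?_
    rw [act_eq_iff]
    refine (ih (a := cons (x (Fin.last s)) a) (fun t => f (Fin.castSucc t)) _ (F ∘ σ.symm)
      (fun t => hF (Fin.castSucc t))).trans ?_
    have hq : (⟨Fin.append y a, q⟩ : Op P.toSymMultigraph _ c).1 (Fin.castAdd r (Fin.last s)) =
        (F (Fin.castAdd r (Fin.last s))).tgt := by
      rw [hF]; exact Fin.append_left _ _ _
    have e1 : preList F ((List.finRange (s + 1)).map (Fin.castAdd r)) ⟨Fin.append y a, q⟩ =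
        preList F (((List.finRange s).map (Fin.castAdd (r + 1))).map σ.symm)
          (pre (Fin.castAdd r (Fin.last s)) (F (Fin.castAdd r (Fin.last s)))
            ⟨Fin.append y a, q⟩ hq) := by
      rw [List.finRange_succ_last, List.map_append, preList_append, List.map_map, List.map_map,
        List.map_cons, List.map_nil, preList_cons, preList_nil, step_eq F hq]
      rfl
    rw [e1]
    refine Eq.trans ?_ (preList_act _ _ _ _)
    refine congrArg _ ?_
    refine (mk_preAt _ _ (Fin.append_right _ _ _)).trans ?_
    refine Eq.trans ?_ (pre_act σ.symm (Fin.natAdd s 0) (F (Fin.castAdd r (Fin.last s)))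
      ⟨Fin.append y a, q⟩ hq hq)
    simp only [hF]
    have e2 : (⟨Fin.append (fun t => y (Fin.castSucc t)) (cons (y (Fin.last s)) a),
        P.act σ.symm (fun i => by
            have h := append_last y a (σ.symm i)
            rw [Equiv.apply_symm_apply] at h
            exact h.symm) ⋄ q⟩ : Op P.toSymMultigraph _ c) =
        act σ.symm ⟨Fin.append y a, q⟩ := mk_act _ _ _
    simp only [← e2]
    rfl

theorem mk_preMany {s r k : ℕ} (σ : Fin k ≃ Fin (s + r)) {x y : Fin s → P.Ob} {a : Fin r → P.Ob}
    (f : ∀ t, Elt (P.Hom (single (x t)) (y t))) (q : Elt (P.Hom (Fin.append y a ∘ σ) c))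
    (F : Fin (s + r) → UArr P) (hF : ∀ t, F (Fin.castAdd r t) = ⟨x t, y t, f t⟩)
    (hF' : ∀ t, F (Fin.natAdd s t) = UArr.one P (a t)) :
    (⟨Fin.append x a ∘ σ, P.pre σ x y a c ⋄ (tensEl f ⊙ q)⟩ : Op P.toSymMultigraph _ c) =
      preAll (F ∘ σ) ⟨_, q⟩ := by
  unfold SymMulticat.pre
  simp only [comp_ap, whiskerLeft_ap]
  refine (mk_act _ _ _).trans ?_
  rw [act_eq_iff, ← preAll_act]
  refine (mk_preFirst f _ F hF).trans ?_
  have e : (⟨Fin.append y a, P.act σ.symm (fun i => by simp) ⋄ q⟩ : Op P.toSymMultigraph _ c) =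
      act σ.symm ⟨Fin.append y a ∘ σ, q⟩ := mk_act _ _ _
  have e' : (F ∘ σ) ∘ σ.symm = F := by ext; simp
  rw [e', ← e, preAll_eq_preList]
  intro t
  rw [hF']
  simp

end Op

namespace UArr

variable {P Q : SymMulticat.{v, u} V}

/-- The underlying element, over equal objects. -/
def elt (f : UArr P) {x y : P.Ob} (hx : f.src = x) (hy : f.tgt = y) : Elt (P.Hom (single x) y) :=
  hx ▸ hy ▸ f.el

theorem mk_elt (f : UArr P) {x y : P.Ob} (hx : f.src = x) (hy : f.tgt = y) :
    (⟨x, y, elt f hx hy⟩ : UArr P) = f := by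
  subst hx hy; rfl

theorem mk_comp {x y z : P.Ob} (f : Elt (P.Hom (single x) y)) (g : Elt (P.Hom (single y) z)) :
    (⟨x, z, P.post (single x) rfl z ⋄ (f ⊙ g)⟩ : UArr P) =
      comp ⟨x, y, f⟩ ⟨y, z, g⟩ rfl := by
  rw [← ofOp_op ⟨x, z, _⟩]
  exact congrArg ofOp (Op.mk_post rfl f g)

theorem comp_congr {f f' g g' : UArr P} (hf : f = f') (hg : g = g') (h : g.src = f.tgt)
    (h' : g'.src = f'.tgt) : comp f g h = comp f' g' h' := by
  subst hf hg; rfl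

theorem comp_assoc (f g h : UArr P) (hg : g.src = f.tgt) (hh : h.src = g.tgt)
    (hh' : h.src = (comp f g hg).tgt) (hg' : (comp g h hh).src = f.tgt) :
    comp (comp f g hg) h hh' = comp f (comp g h hh) hg' := by
  have := Op.post_post f.op g h hg hh
  refine congrArg ofOp (Eq.trans ?_ this)
  have e := op_comp f g hg
  show Op.comp (k := 0) (comp f g hg).op h.op hh' = Op.post (Op.post f.op g hg) h hh
  simp only [e]
  rfl

theorem comp_one (f : UArr P) {y : P.Ob} (h : y = f.tgt) : comp f (one P y) h = f := by
  subst h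
  exact (congrArg ofOp (Op.post_one f.op rfl)).trans (ofOp_op f)

theorem one_comp (f : UArr P) {x : P.Ob} (h : f.src = x) : comp (one P x) f h = f := by
  refine (congrArg ofOp ?_).trans (ofOp_op f)
  refine (Op.one_comp f.op h).trans ?_
  exact Op.act_id (fun i => by simp) _

theorem map_comp (F : Multifunctor P Q) (f g : UArr P) (h : g.src = f.tgt)
    (h' : (g.map F).src = (f.map F).tgt) :
    (comp f g h).map F = comp (f.map F) (g.map F) h' := by
  refine congrArg ofOp ?_
  have h'' : (Op.map F g.op).1 0 = F.obj f.tgt := congrArg F.obj h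
  have e := Op.map_comp F f.op g.op h h''
  have e' := congrArg (Op.map F) (op_comp f g h)
  refine e'.trans (e.trans ?_)
  have e1 := op_map F f
  have e2 := op_map F g
  simp only [← e1, ← e2]
  rfl

theorem map_one (F : Multifunctor P Q) (x : P.Ob) : (one P x).map F = one Q (F.obj x) :=
  (congrArg ofOp (Op.map_one F x)).trans (ofOp_op (one Q (F.obj x)))

end UArr

/-- A full and faithful inclusion of the category of unary morphisms of `M` into that of `A`. -/
structure UnaryInclusion (M A : SymMulticat.{v, u} V) where
  obj : M.Ob → A.Ob
  injective : Function.Injective obj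
  map : ∀ x y : M.Ob, M.Hom (single x) y ⟶ A.Hom (single (obj x)) (obj y)
  isIso : ∀ x y : M.Ob, IsIso (map x y)
  map_one : ∀ x : M.Ob, M.one x ≫ map x x = A.one (obj x)
  map_comp : ∀ x y z : M.Ob, M.post (single x) (rfl : y = y) z ≫ map x z =
    (map x y ⊗ₘ map y z) ≫ A.post (single (obj x)) (rfl : obj y = obj y) (obj z)

namespace UnaryInclusion

variable {M A : SymMulticat.{v, u} V} (i : UnaryInclusion M A)

/-- The action on arrows. -/
def arr (f : UArr M) : UArr A := ⟨i.obj f.src, i.obj f.tgt, i.map f.src f.tgt ⋄ f.el⟩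

@[simp] theorem arr_src (f : UArr M) : (i.arr f).src = i.obj f.src := rfl
@[simp] theorem arr_tgt (f : UArr M) : (i.arr f).tgt = i.obj f.tgt := rfl

theorem arr_comp (f g : UArr M) (h : g.src = f.tgt) (h' : (i.arr g).src = (i.arr f).tgt) :
    i.arr (f.comp g h) = (i.arr f).comp (i.arr g) h' := by
  obtain ⟨x, y, f⟩ := f
  obtain ⟨y', z, g⟩ := g
  dsimp only at h
  subst h
  rw [← UArr.mk_comp]
  refine Eq.trans ?_ (UArr.mk_comp _ _)
  have e := congrArg (fun φ => φ ⋄ (f ⊙ g)) (i.map_comp x y' z)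
  simp only [comp_ap, tensorHom_ap] at e
  exact congrArg (UArr.mk _ _) e

theorem arr_one (x : M.Ob) : i.arr (UArr.one M x) = UArr.one A (i.obj x) := by
  have e := congrArg (fun φ => φ ⋄ Elt.unit) (i.map_one x)
  simp only [comp_ap] at e
  exact congrArg (UArr.mk _ _) e

theorem arr_injective {f g : UArr M} (h : i.arr f = i.arr g) : f = g := by
  obtain ⟨x, y, f⟩ := f
  obtain ⟨x', y', g⟩ := g
  obtain rfl : x = x' := i.injective (congrArg UArr.src h)
  obtain rfl : y = y' := i.injective (congrArg UArr.tgt h)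
  refine congrArg (UArr.mk _ _) ?_
  have e : i.map x y ⋄ f = i.map x y ⋄ g := by
    injection h with h1 h2 h3
  have := i.isIso x y
  simpa only [← comp_ap, IsIso.hom_inv_id, id_ap] using congrArg (ap (inv (i.map x y))) e

/-- The inverse of `map`. -/
def inv (x y : M.Ob) : A.Hom (single (i.obj x)) (i.obj y) ⟶ M.Hom (single x) y :=
  have := i.isIso x y
  CategoryTheory.inv (i.map x y)

theorem map_inv_ap (x y : M.Ob) (e : Elt (A.Hom (single (i.obj x)) (i.obj y))) :
    i.map x y ⋄ i.inv x y ⋄ e = e := by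
  have := i.isIso x y
  rw [← comp_ap]
  unfold inv
  rw [IsIso.inv_hom_id, id_ap]

/-- The arrow of `M` that is mapped to a given arrow of `A`. -/
def lift {x y : M.Ob} (f : UArr A) (hx : f.src = i.obj x) (hy : f.tgt = i.obj y) : UArr M :=
  ⟨x, y, i.inv x y ⋄ f.elt hx hy⟩

@[simp] theorem lift_src {x y : M.Ob} (f : UArr A) (hx : f.src = i.obj x)
    (hy : f.tgt = i.obj y) : (i.lift f hx hy).src = x := rfl
@[simp] theorem lift_tgt {x y : M.Ob} (f : UArr A) (hx : f.src = i.obj x)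
    (hy : f.tgt = i.obj y) : (i.lift f hx hy).tgt = y := rfl

@[simp] theorem arr_lift {x y : M.Ob} (f : UArr A) (hx : f.src = i.obj x)
    (hy : f.tgt = i.obj y) : i.arr (i.lift f hx hy) = f :=
  (congrArg (UArr.mk _ _) (i.map_inv_ap x y _)).trans (f.mk_elt hx hy)

theorem lift_eq {x y : M.Ob} {f : UArr A} {hx : f.src = i.obj x}
    {hy : f.tgt = i.obj y} {g : UArr M} (h : f = i.arr g) : i.lift f hx hy = g :=
  i.arr_injective ((i.arr_lift f hx hy).trans h)

end UnaryInclusion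

/-- Composition with unary morphisms in all inputs. -/
def preHom {M : SymMulticat.{v, u} V} {k : ℕ} (x x' : Fin k → M.Ob) (y : M.Ob) :
    tens (fun t => M.Hom (single (x t)) (x' t)) ⊗ M.Hom x' y ⟶ M.Hom x y :=
  _ ◁ M.cast (a' := Fin.append x' nil ∘ Equiv.refl (Fin k)) (fun t => append_nil x' t) ≫
    M.pre (Equiv.refl (Fin (k + 0))) x x' nil y ≫ M.cast (fun t => (append_nil x t).symm)

theorem mk_preHom {M : SymMulticat.{v, u} V} {k : ℕ} {x x' : Fin k → M.Ob} {y : M.Ob}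
    (f : ∀ t, Elt (M.Hom (single (x t)) (x' t))) (m : Elt (M.Hom x' y)) :
    (⟨x, preHom x x' y ⋄ (tensEl f ⊙ m)⟩ : Op M.toSymMultigraph k y) =
      Op.preAll (fun t => ⟨x t, x' t, f t⟩) ⟨x', m⟩ := by
  unfold preHom
  simp only [comp_ap, whiskerLeft_ap]
  refine (Op.mk_cast _ _).trans ((Op.mk_preMany (r := 0) (Equiv.refl (Fin (k + 0))) f _
    (fun t : Fin k => ⟨x t, x' t, f t⟩) (fun t => rfl) (fun t => t.elim0)).trans ?_)
  exact congrArg (Op.preAll fun t : Fin k => (⟨x t, x' t, f t⟩ : UArr M)) (Op.mk_cast _ _)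

/-- The only position in a tuple of length one. -/
abbrev pos {k : ℕ} (h : k = 1) : Fin k := ⟨0, by omega⟩

namespace UnaryInclusion

variable {M A : SymMulticat.{v, u} V} (i : UnaryInclusion M A)

/-- `⨂ₜ A(b_t, x_t) ⊗ M(x; y) ⊗ A(y, d)` -/
abbrev genObj {k : ℕ} (b : Fin k → A.Ob) (d : A.Ob) (p : (Fin k → M.Ob) × M.Ob) : V :=
  tens (fun t => A.Hom (single (b t)) (i.obj (p.1 t))) ⊗
    (M.Hom p.1 p.2 ⊗ A.Hom (single (i.obj p.2)) d)

/-- `⨂ₜ (A(b_t, x_t) ⊗ M(x_t, x'_t)) ⊗ M(x'; y) ⊗ M(y, y') ⊗ A(y', d)` -/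
abbrev relObj {k : ℕ} (b : Fin k → A.Ob) (d : A.Ob) (p p' : (Fin k → M.Ob) × M.Ob) : V :=
  tens (fun t => A.Hom (single (b t)) (i.obj (p.1 t)) ⊗ M.Hom (single (p.1 t)) (p'.1 t)) ⊗
    (M.Hom p'.1 p.2 ⊗ (M.Hom (single p.2) p'.2 ⊗ A.Hom (single (i.obj p'.2)) d))

/-- The action of unary morphisms of `M` on the arrows of `A`. -/
def relFst {k : ℕ} (b : Fin k → A.Ob) (d : A.Ob) (p p' : (Fin k → M.Ob) × M.Ob) :
    i.relObj b d p p' ⟶ i.genObj b d (p'.1, p.2) :=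
  tensMap (fun t => _ ◁ i.map (p.1 t) (p'.1 t) ≫ A.post (single (b t)) rfl (i.obj (p'.1 t))) ⊗ₘ
    (_ ◁ (i.map p.2 p'.2 ▷ _ ≫ A.post (single (i.obj p.2)) rfl d))

/-- The action of unary morphisms of `M` on the morphisms of `M`. -/
def relSnd {k : ℕ} (b : Fin k → A.Ob) (d : A.Ob) (p p' : (Fin k → M.Ob) × M.Ob) :
    i.relObj b d p p' ⟶ i.genObj b d (p.1, p'.2) :=
  tensShuffle _ _ ▷ _ ≫ (α_ _ _ _).hom ≫
    _ ◁ ((α_ _ _ _).inv ≫ preHom p.1 p'.1 p.2 ▷ _ ≫ (α_ _ _ _).inv ≫ M.post p.1 rfl p'.2 ▷ _)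

/-- Composition in `A`, for `k = 1`. -/
def collapse {k : ℕ} (h : k = 1) (b : Fin k → A.Ob) (d : A.Ob) (p : (Fin k → M.Ob) × M.Ob) :
    i.genObj b d p ⟶ A.Hom (single (b (pos h))) d :=
  match k, h with
  | 1, h => (λ_ _).hom ▷ _ ≫
    _ ◁ ((M.cast (fun t => congrArg p.1 (Subsingleton.elim 0 t)) ≫ i.map (p.1 0) p.2) ▷ _) ≫
    (α_ _ _ _).inv ≫ A.post (single (b 0)) rfl (i.obj p.2) ▷ _ ≫ A.post (single (b 0)) rfl d

/-- The diagram that defines the multimorphisms of the pushout: formal composites, and the arrows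
of `A` if `k = 1`. -/
def diagram {k : ℕ} (b : Fin k → A.Ob) (d : A.Ob) : MultispanIndex
    { L := (((Fin k → M.Ob) × M.Ob) × ((Fin k → M.Ob) × M.Ob)) ⊕
        (((Fin k → M.Ob) × M.Ob) × PLift (k = 1))
      R := ((Fin k → M.Ob) × M.Ob) ⊕ ULift.{v} (PLift (k = 1))
      fst := Sum.elim (fun p => Sum.inl (p.2.1, p.1.2)) (fun p => Sum.inl p.1)
      snd := Sum.elim (fun p => Sum.inl (p.1.1, p.2.2)) (fun p => Sum.inr ⟨p.2⟩) } V where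
  left := Sum.elim (fun p => i.relObj b d p.1 p.2) (fun p => i.genObj b d p.1)
  right := Sum.elim (i.genObj b d) (fun h => A.Hom (single (b (pos h.down.down))) d)
  fst := Sum.rec (fun p => i.relFst b d p.1 p.2) (fun p => 𝟙 _)
  snd := Sum.rec (fun p => i.relSnd b d p.1 p.2) (fun p => i.collapse p.2.down b d p.1)

variable [HasColimits V]

/-- The multimorphisms of the pushout. -/
def NHom {k : ℕ} (b : Fin k → A.Ob) (d : A.Ob) : V := multicoequalizer (i.diagram b d)

/-- Formal composites. -/
def ι {k : ℕ} (b : Fin k → A.Ob) (d : A.Ob) (p : (Fin k → M.Ob) × M.Ob) :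
    i.genObj b d p ⟶ i.NHom b d := Multicoequalizer.π (i.diagram b d) (Sum.inl p)

/-- Arrows of `A`. -/
def κ {k : ℕ} (h : k = 1) (b : Fin k → A.Ob) (d : A.Ob) :
    A.Hom (single (b (pos h))) d ⟶ i.NHom b d :=
  Multicoequalizer.π (i.diagram b d) (Sum.inr ⟨⟨h⟩⟩)

variable {k : ℕ} {b : Fin k → A.Ob} {d : A.Ob}

theorem relFst_ι (p p' : (Fin k → M.Ob) × M.Ob) :
    i.relFst b d p p' ≫ i.ι b d (p'.1, p.2) = i.relSnd b d p p' ≫ i.ι b d (p.1, p'.2) :=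
  Multicoequalizer.condition (i.diagram b d) (Sum.inl (p, p'))

theorem collapse_κ (h : k = 1) (p : (Fin k → M.Ob) × M.Ob) :
    i.collapse h b d p ≫ i.κ h b d = i.ι b d p :=
  (Multicoequalizer.condition (i.diagram b d) (Sum.inr (p, ⟨h⟩))).symm.trans (Category.id_comp _)

theorem nhom_hom_ext ⦃Z : V⦄ (φ ψ : i.NHom b d ⟶ Z) (h : ∀ p, i.ι b d p ≫ φ = i.ι b d p ≫ ψ)
    (h' : ∀ h, i.κ h b d ≫ φ = i.κ h b d ≫ ψ) : φ = ψ :=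
  Multicoequalizer.hom_ext _ _ _ (by
    rintro (p | h₀)
    · exact h p
    · exact h' h₀.down.down)

theorem exists_desc {Z : V} (φ : ∀ p, i.genObj b d p ⟶ Z)
    (ψ : ∀ h : k = 1, A.Hom (single (b (pos h))) d ⟶ Z)
    (h₁ : ∀ p p', i.relFst b d p p' ≫ φ (p'.1, p.2) = i.relSnd b d p p' ≫ φ (p.1, p'.2))
    (h₂ : ∀ h p, i.collapse h b d p ≫ ψ h = φ p) :
    ∃ χ : i.NHom b d ⟶ Z, (∀ p, i.ι b d p ≫ χ = φ p) ∧ ∀ h, i.κ h b d ≫ χ = ψ h :=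
  let K : ∀ r, (i.diagram b d).right r ⟶ Z := fun r => match r with
    | Sum.inl p => φ p
    | Sum.inr h => ψ h.down.down
  have hK : ∀ l, (i.diagram b d).fst l ≫ K _ = (i.diagram b d).snd l ≫ K _ := fun l => match l with
    | Sum.inl p => h₁ p.1 p.2
    | Sum.inr p => (Category.id_comp _).trans (h₂ p.2.down p.1).symm
  ⟨Multicoequalizer.desc (i.diagram b d) Z K hK,
    fun p => Multicoequalizer.π_desc (i.diagram b d) Z K hK (Sum.inl p),
    fun h => Multicoequalizer.π_desc (i.diagram b d) Z K hK (Sum.inr (ULift.up (PLift.up h)))⟩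

/-- The elements of the multimorphisms of the pushout. -/
abbrev RawOp (k : ℕ) (d : A.Ob) : Type (max u v) := Σ b : Fin k → A.Ob, Elt (i.NHom b d)

variable {y : M.Ob}

/-- The formal composite of `U₁, …, U_k`, `m` and `v`. -/
def tt (U : Fin k → UArr A) (m : Op M.toSymMultigraph k y) (v : UArr A)
    (hU : ∀ t, (U t).tgt = i.obj (m.1 t)) (hv : v.src = i.obj y) (hd : v.tgt = d) : i.RawOp k d :=
  ⟨fun t => (U t).src, i.ι _ d (m.1, y) ⋄ (tensEl (X := fun t =>
    A.Hom (single (U t).src) (i.obj (m.1 t))) (fun t => (U t).elt rfl (hU t)) ⊙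
      (m.2 ⊙ v.elt hv hd))⟩

/-- An arrow of `A`. -/
def bb (h : k = 1) (w : UArr A) (hd : w.tgt = d) : i.RawOp k d :=
  ⟨fun _ => w.src, i.κ h _ d ⋄ w.elt rfl hd⟩

theorem tt_eq (U : Fin k → UArr A) (m : Op M.toSymMultigraph k y) (v : UArr A)
    (hb : ∀ t, (U t).src = b t) (hU : ∀ t, (U t).tgt = i.obj (m.1 t)) (hv : v.src = i.obj y)
    (hd : v.tgt = d) :
    i.tt U m v hU hv hd = ⟨b, i.ι b d (m.1, y) ⋄ (tensEl (X := fun t =>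
      A.Hom (single (b t)) (i.obj (m.1 t))) (fun t => (U t).elt (hb t) (hU t)) ⊙
        (m.2 ⊙ v.elt hv hd))⟩ := by
  obtain rfl : (fun t => (U t).src) = b := funext hb
  rfl

theorem bb_eq (h : k = 1) (w : UArr A) (hb : w.src = b (pos h)) (hd : w.tgt = d) :
    i.bb h w hd = ⟨b, i.κ h b d ⋄ w.elt hb hd⟩ := by
  obtain rfl : (fun _ => w.src) = b := funext fun t => by
    rw [hb]; congr 1; ext; simp; omega
  rfl

theorem mk_ι {p : (Fin k → M.Ob) × M.Ob}
    (U : ∀ t, Elt (A.Hom (single (b t)) (i.obj (p.1 t)))) (m : Elt (M.Hom p.1 p.2))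
    (v : Elt (A.Hom (single (i.obj p.2)) d)) :
    (⟨b, i.ι b d p ⋄ (tensEl U ⊙ (m ⊙ v))⟩ : i.RawOp k d) =
      i.tt (fun t => ⟨b t, i.obj (p.1 t), U t⟩) ⟨p.1, m⟩ ⟨i.obj p.2, d, v⟩ (fun _ => rfl) rfl rfl :=
  rfl

theorem mk_κ (h : k = 1) (w : Elt (A.Hom (single (b (pos h))) d)) :
    (⟨b, i.κ h b d ⋄ w⟩ : i.RawOp k d) = i.bb h ⟨b (pos h), d, w⟩ rfl :=
  (i.bb_eq h ⟨b (pos h), d, w⟩ rfl rfl).symm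

theorem _root_.SymMulti.UArr.exists_family {P : SymMulticat.{v, u} V} (U : Fin k → UArr P)
    {z : Fin k → P.Ob} (h : ∀ t, (U t).tgt = z t) :
    ∃ (a : Fin k → P.Ob) (e : ∀ t, Elt (P.Hom (single (a t)) (z t))),
      U = fun t => ⟨a t, z t, e t⟩ :=
  ⟨fun t => (U t).src, fun t => (U t).elt rfl (h t), funext fun t => ((U t).mk_elt _ _).symm⟩

theorem _root_.SymMulti.UArr.exists_src_tgt {P : SymMulticat.{v, u} V} (f : UArr P)
    {x y : P.Ob} (hx : f.src = x) (hy : f.tgt = y) :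
    ∃ e : Elt (P.Hom (single x) y), f = ⟨x, y, e⟩ :=
  ⟨f.elt hx hy, (f.mk_elt _ _).symm⟩

theorem relFst_ap {p p' : (Fin k → M.Ob) × M.Ob}
    (U : ∀ t, Elt (A.Hom (single (b t)) (i.obj (p.1 t))))
    (F : ∀ t, Elt (M.Hom (single (p.1 t)) (p'.1 t))) (m : Elt (M.Hom p'.1 p.2))
    (f : Elt (M.Hom (single p.2) p'.2)) (v : Elt (A.Hom (single (i.obj p'.2)) d)) :
    i.relFst b d p p' ⋄ (tensEl (fun t => U t ⊙ F t) ⊙ (m ⊙ f ⊙ v)) =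
      tensEl (fun t => A.post (single (b t)) rfl (i.obj (p'.1 t)) ⋄ (U t ⊙ (i.map _ _ ⋄ F t))) ⊙
        (m ⊙ (A.post (single (i.obj p.2)) rfl d ⋄ ((i.map _ _ ⋄ f) ⊙ v))) := by
  unfold relFst
  simp

theorem relSnd_ap {p p' : (Fin k → M.Ob) × M.Ob}
    (U : ∀ t, Elt (A.Hom (single (b t)) (i.obj (p.1 t))))
    (F : ∀ t, Elt (M.Hom (single (p.1 t)) (p'.1 t))) (m : Elt (M.Hom p'.1 p.2))
    (f : Elt (M.Hom (single p.2) p'.2)) (v : Elt (A.Hom (single (i.obj p'.2)) d)) :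
    i.relSnd b d p p' ⋄ (tensEl (fun t => U t ⊙ F t) ⊙ (m ⊙ f ⊙ v)) =
      tensEl U ⊙ ((M.post p.1 rfl p'.2 ⋄ ((preHom p.1 p'.1 p.2 ⋄ (tensEl F ⊙ m)) ⊙ f)) ⊙ v) := by
  unfold relSnd
  simp

theorem ι_rel {p p' : (Fin k → M.Ob) × M.Ob}
    (U : ∀ t, Elt (A.Hom (single (b t)) (i.obj (p.1 t))))
    (F : ∀ t, Elt (M.Hom (single (p.1 t)) (p'.1 t))) (m : Elt (M.Hom p'.1 p.2))
    (f : Elt (M.Hom (single p.2) p'.2)) (v : Elt (A.Hom (single (i.obj p'.2)) d)) :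
    i.ι b d (p'.1, p.2) ⋄ (tensEl (fun t =>
        A.post (single (b t)) rfl (i.obj (p'.1 t)) ⋄ (U t ⊙ (i.map _ _ ⋄ F t))) ⊙
        (m ⊙ (A.post (single (i.obj p.2)) rfl d ⋄ ((i.map _ _ ⋄ f) ⊙ v)))) =
      i.ι b d (p.1, p'.2) ⋄ (tensEl U ⊙
        ((M.post p.1 rfl p'.2 ⋄ ((preHom p.1 p'.1 p.2 ⋄ (tensEl F ⊙ m)) ⊙ f)) ⊙ v)) := by
  rw [← relFst_ap, ← relSnd_ap, ← comp_ap, ← comp_ap, relFst_ι]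

theorem tt_rel (U : Fin k → UArr A) (F : Fin k → UArr M) (m : Op M.toSymMultigraph k y)
    (f : UArr M) (v : UArr A) (hUF : ∀ t, (i.arr (F t)).src = (U t).tgt)
    (hF : ∀ t, m.1 t = (F t).tgt) (hf : f.src = y) (hv : v.src = (i.arr f).tgt) (hd : v.tgt = d)
    (h₁ : ∀ t, ((U t).comp (i.arr (F t)) (hUF t)).tgt = i.obj (m.1 t))
    (h₂ : ((i.arr f).comp v hv).src = i.obj y)
    (h₂' : ((i.arr f).comp v hv).tgt = d)
    (h₃ : ∀ t, (U t).tgt = i.obj ((Op.post (Op.preAll F m) f hf).1 t)) :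
    i.tt (fun t => (U t).comp (i.arr (F t)) (hUF t)) m ((i.arr f).comp v hv) h₁ h₂ h₂' =
      i.tt U (Op.post (Op.preAll F m) f hf) v h₃ hv hd := by
  obtain ⟨x', m⟩ := m
  obtain ⟨b, U, rfl⟩ := UArr.exists_family U (z := fun t => i.obj (F t).src) fun t => (hUF t).symm
  obtain rfl : (fun t => (F t).tgt) = x' := funext fun t => (hF t).symm
  obtain ⟨y, y', f⟩ := f
  obtain rfl : y = _ := hf
  obtain ⟨v, rfl⟩ := v.exists_src_tgt hv hd
  have e := congrArg (fun z => (⟨b, z⟩ : i.RawOp k d)) (i.ι_rel (b := b)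
    (p := (fun t => (F t).src, y)) (p' := (fun t => (F t).tgt, y')) U (fun t => (F t).el) m f v)
  refine Eq.trans ?_ ((i.mk_ι (p := (fun t => (F t).tgt, y)) _ _ _).symm.trans
    (e.trans ((i.mk_ι (p := (fun t => (F t).src, y')) _ _ _).trans ?_)))
  · have e1 := fun t => UArr.mk_comp (U t) (i.map (F t).src (F t).tgt ⋄ (F t).el)
    have e2 := UArr.mk_comp (i.map y y' ⋄ f) v
    simp only [e1, e2]
    rfl
  · have : (⟨fun t => (F t).src, M.post (fun t => (F t).src) rfl y' ⋄
        ((preHom (fun t => (F t).src) (fun t => (F t).tgt) y ⋄ (tensEl (fun t => (F t).el) ⊙ m))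
          ⊙ f)⟩ : Op M.toSymMultigraph k y') =
        Op.post (Op.preAll F ⟨fun t => (F t).tgt, m⟩) ⟨y, y', f⟩ rfl := by
      rw [Op.mk_post]
      simp only [mk_preHom]
    simp only [this]
    rfl

theorem _root_.SymMulti.Elt.unit_collapse_ap {X C D F G H : V} (φ : C ⟶ F) (ψ : X ⊗ F ⟶ G)
    (χ : G ⊗ D ⟶ H) (x : Elt X) (m : Elt C) (v : Elt D) :
    ((λ_ X).hom ▷ (C ⊗ D) ≫ X ◁ (φ ▷ D) ≫ (α_ X F D).inv ≫ ψ ▷ D ≫ χ) ⋄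
      ((Elt.unit ⊙ x) ⊙ (m ⊙ v)) = χ ⋄ ((ψ ⋄ (x ⊙ (φ ⋄ m))) ⊙ v) := by
  simp

theorem collapse_ap (h : k = 1) {p : (Fin k → M.Ob) × M.Ob}
    (U : ∀ t, Elt (A.Hom (single (b t)) (i.obj (p.1 t)))) (m : Elt (M.Hom p.1 p.2))
    (v : Elt (A.Hom (single (i.obj p.2)) d)) :
    (⟨b (pos h), d, i.collapse h b d p ⋄ (tensEl U ⊙ (m ⊙ v))⟩ : UArr A) =
      ((UArr.mk _ _ (U (pos h))).comp (i.arr (UArr.ofOp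
        (Op.act (finCongr h.symm) ⟨p.1, m⟩))) rfl).comp ⟨_, _, v⟩ rfl := by
  subst h
  have e : i.collapse rfl b d p ⋄ (tensEl U ⊙ (m ⊙ v)) = A.post (single (b 0)) rfl d ⋄
      ((A.post (single (b 0)) rfl (i.obj p.2) ⋄ (U 0 ⊙ (i.map _ _ ⋄
        M.cast (a' := single (p.1 0)) (fun t => congrArg p.1 (Subsingleton.elim 0 t)) ⋄ m))) ⊙
          v) := by
    refine (Elt.unit_collapse_ap _ _ _ _ _ _).trans ?_
    rw [comp_ap]
    rfl
  refine (congrArg (UArr.mk _ _) e).trans ((UArr.mk_comp _ _).trans ?_)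
  have e1 := UArr.mk_comp (U 0) (i.map _ _ ⋄
        M.cast (a' := single (p.1 0)) (fun t => congrArg p.1 (Subsingleton.elim 0 t)) ⋄ m)
  have e' : (Op.act (finCongr (Eq.symm rfl)) ⟨p.1, m⟩ : Op M.toSymMultigraph 1 p.2) = ⟨p.1, m⟩ :=
    Op.act_id (fun _ => rfl) _
  refine UArr.comp_congr (e1.trans (UArr.comp_congr rfl ?_ _ _)) rfl _ _
  simp only [e']
  rfl

theorem tt_congr {U U' : Fin k → UArr A} {m m' : Op M.toSymMultigraph k y} {v v' : UArr A}
    (eU : U = U') (em : m = m') (ev : v = v') (hU : ∀ t, (U t).tgt = i.obj (m.1 t))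
    (hv : v.src = i.obj y) (hd : v.tgt = d) (hU' : ∀ t, (U' t).tgt = i.obj (m'.1 t))
    (hv' : v'.src = i.obj y) (hd' : v'.tgt = d) :
    i.tt U m v hU hv hd = i.tt U' m' v' hU' hv' hd' := by
  subst eU em ev; rfl

theorem bb_congr {w w' : UArr A} (e : w = w') (h h' : k = 1) (hd : w.tgt = d) (hd' : w'.tgt = d) :
    i.bb h w hd = i.bb h' w' hd' := by
  subst e; rfl

theorem tt_pre (U : Fin k → UArr A) (F : Fin k → UArr M) (m : Op M.toSymMultigraph k y)
    (v : UArr A) (hUF : ∀ t, (i.arr (F t)).src = (U t).tgt)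
    (hF : ∀ t, m.1 t = (F t).tgt) (hv : v.src = i.obj y) (hd : v.tgt = d)
    (h₁ : ∀ t, ((U t).comp (i.arr (F t)) (hUF t)).tgt = i.obj (m.1 t))
    (h₃ : ∀ t, (U t).tgt = i.obj ((Op.preAll F m).1 t)) :
    i.tt (fun t => (U t).comp (i.arr (F t)) (hUF t)) m v h₁ hv hd =
      i.tt U (Op.preAll F m) v h₃ hv hd := by
  have e : ((i.arr (UArr.one M y)).comp v hv) = v := by
    have := UArr.one_comp v hv
    simpa only [arr_one] using this
  have e' := Op.post_one (Op.preAll F m) rfl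
  have h := i.tt_rel U F m (UArr.one M y) v hUF hF rfl hv hd h₁ rfl hd (by rwa [e'])
  exact (i.tt_congr rfl rfl e.symm _ _ _ _ _ _).trans (h.trans (i.tt_congr rfl e' rfl _ _ _ _ _ _))

theorem tt_post (U : Fin k → UArr A) (m : Op M.toSymMultigraph k y) (f : UArr M)
    (v : UArr A) (hf : f.src = y) (hv : v.src = (i.arr f).tgt) (hd : v.tgt = d)
    (h₁ : ∀ t, (U t).tgt = i.obj (m.1 t)) (h₂ : ((i.arr f).comp v hv).src = i.obj y)
    (h₂' : ((i.arr f).comp v hv).tgt = d)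
    (h₃ : ∀ t, (U t).tgt = i.obj ((Op.post m f hf).1 t)) :
    i.tt U m ((i.arr f).comp v hv) h₁ h₂ h₂' = i.tt U (Op.post m f hf) v h₃ hv hd := by
  have e : ∀ t, (U t).comp (i.arr (UArr.one M (m.1 t))) (h₁ t).symm = U t := fun t => by
    simp only [arr_one]
    exact UArr.comp_one _ _
  have e' : Op.preAll (fun t => UArr.one M (m.1 t)) m = m := Op.preAll_one _ _ fun _ => rfl
  have h := i.tt_rel U (fun t => UArr.one M (m.1 t)) m f v (fun t => (h₁ t).symm) (fun t => rfl)
    hf hv hd (fun t => rfl) h₂ h₂' (by simpa only [e'] using h₃)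
  refine (i.tt_congr (funext fun t => (e t).symm) rfl rfl _ _ _ _ _ _).trans
    (h.trans (i.tt_congr rfl ?_ rfl _ _ _ _ _ _))
  simp only [e']

theorem tt_collapse (h : k = 1) (U : Fin k → UArr A) (m : Op M.toSymMultigraph k y) (v : UArr A)
    (hU : ∀ t, (U t).tgt = i.obj (m.1 t)) (hv : v.src = i.obj y) (hd : v.tgt = d)
    (h₁ : (i.arr (UArr.ofOp (Op.act (finCongr h.symm) m))).src = (U (pos h)).tgt)
    (h₂ : v.src = ((U (pos h)).comp _ h₁).tgt) (hd' : (((U (pos h)).comp _ h₁).comp v h₂).tgt = d) :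
    i.tt U m v hU hv hd = i.bb h (((U (pos h)).comp _ h₁).comp v h₂) hd' := by
  obtain ⟨x, m⟩ := m
  obtain ⟨b, U, rfl⟩ := UArr.exists_family U hU
  obtain ⟨v, rfl⟩ := v.exists_src_tgt hv hd
  have e : i.ι b d (x, y) ⋄ (tensEl U ⊙ (m ⊙ v)) =
      i.κ h b d ⋄ i.collapse h b d (x, y) ⋄ (tensEl U ⊙ (m ⊙ v)) := by
    rw [← comp_ap, collapse_κ]
  refine (i.mk_ι (p := (x, y)) U m v).symm.trans ((congrArg (Sigma.mk b) e).trans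
    ((i.mk_κ h _).trans ?_))
  exact i.bb_congr (i.collapse_ap h (p := (x, y)) U m v) _ _ _ _

end UnaryInclusion

theorem UArr.mk_cast {P : SymMulticat.{v, u} V} {x x' y : P.Ob} (h : ∀ t, single x' t = single x t)
    (e : Elt (P.Hom (single x) y)) : (⟨x', y, P.cast h ⋄ e⟩ : UArr P) = ⟨x, y, e⟩ :=
  congrArg UArr.ofOp (Op.mk_cast (k := 1) h e) |>.trans (UArr.ofOp_op ⟨x, y, e⟩) |>.symm ▸
    (UArr.ofOp_op _).symm

theorem Op.act_post {P : SymMulticat.{v, u} V} {k l : ℕ} {x : P.Ob} (σ : Fin k ≃ Fin l)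
    (q : Op P.toSymMultigraph l x) (f : UArr P) (h : f.src = x) :
    Op.post (Op.act σ q) f h = Op.act σ (Op.post q f h) := by
  refine (Op.comp_act_left σ q f.op h).trans (Op.act_congr (fun t => ?_) _)
  exact congrArg Fin.val (appendEquiv_castAdd σ (Equiv.refl (Fin 0)) t)

@[simp] theorem Op.post_fst {P : SymMulticat.{v, u} V} {l : ℕ} {x : P.Ob}
    (q : Op P.toSymMultigraph l x) (f : UArr P) (h : f.src = x) (t : Fin l) :
    (Op.post q f h).1 t = q.1 t :=
  Fin.append_left (n := 0) q.1 (Fin.tail f.op.1) t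

namespace UnaryInclusion

variable {M A : SymMulticat.{v, u} V} (i : UnaryInclusion M A)

/-- The generators of the multimorphisms of the pushout. -/
inductive Gen {k : ℕ} (b : Fin k → A.Ob) (d : A.Ob) : Type (max u v)
  | tt {y : M.Ob} (U : Fin k → UArr A) (m : Op M.toSymMultigraph k y) (v : UArr A)
      (hb : ∀ t, (U t).src = b t) (hU : ∀ t, (U t).tgt = i.obj (m.1 t)) (hv : v.src = i.obj y)
      (hd : v.tgt = d) : Gen b d
  | bb (h : k = 1) (w : UArr A) (hb : w.src = b (pos h)) (hd : w.tgt = d) : Gen b d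

variable [HasColimits V]

namespace Gen

variable {i} {k l : ℕ} {b : Fin k → A.Ob} {d : A.Ob}

/-- The element given by a generator. -/
def el : i.Gen b d → Elt (i.NHom b d)
  | tt (y := y) U m v hb hU hv hd => i.ι b d (m.1, y) ⋄ (tensEl (X := fun t =>
      A.Hom (single (b t)) (i.obj (m.1 t))) (fun t => (U t).elt (hb t) (hU t)) ⊙
        (m.2 ⊙ v.elt hv hd))
  | bb h w hb hd => i.κ h b d ⋄ w.elt hb hd

/-- The operation given by a generator. -/
def op : i.Gen b d → i.RawOp k d
  | tt U m v hb hU hv hd => i.tt U m v hU hv hd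
  | bb h w hb hd => i.bb h w hd

theorem tt_congr {y : M.Ob} {U U' : Fin k → UArr A} {m m' : Op M.toSymMultigraph k y}
    {v v' : UArr A} (eU : U = U') (em : m = m') (ev : v = v') (hb : ∀ t, (U t).src = b t)
    (hU : ∀ t, (U t).tgt = i.obj (m.1 t)) (hv : v.src = i.obj y) (hd : v.tgt = d)
    (hb' : ∀ t, (U' t).src = b t) (hU' : ∀ t, (U' t).tgt = i.obj (m'.1 t))
    (hv' : v'.src = i.obj y) (hd' : v'.tgt = d) :
    (tt U m v hb hU hv hd : i.Gen b d) = tt U' m' v' hb' hU' hv' hd' := by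
  subst eU em ev; rfl

theorem bb_congr {w w' : UArr A} (e : w = w') (h h' : k = 1) (hb : w.src = b (pos h))
    (hd : w.tgt = d) (hb' : w'.src = b (pos h')) (hd' : w'.tgt = d) :
    (bb h w hb hd : i.Gen b d) = bb h' w' hb' hd' := by
  subst e; rfl

theorem mk_el (g : i.Gen b d) : (⟨b, g.el⟩ : i.RawOp k d) = g.op := by
  cases g with
  | tt U m v hb hU hv hd => exact (i.tt_eq U m v hb hU hv hd).symm
  | bb h w hb hd => exact (i.bb_eq h w hb hd).symm

end Gen

variable {k : ℕ} {b : Fin k → A.Ob} {d : A.Ob} [MonoidalClosed V]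

theorem spans_gen : Spans (fun e : Elt (i.NHom b d) => ∃ g : i.Gen b d, e = g.el) := by
  have h := Spans.of_jointly_epi (Y := i.NHom b d)
    (ι := ((Fin k → M.Ob) × M.Ob) ⊕ PLift (k = 1))
    (D := Sum.elim (i.genObj b d) fun h => A.Hom (single (b (pos h.down))) d)
    (fun j => match j with
      | Sum.inl p => i.ι b d p
      | Sum.inr h => i.κ h.down b d)
    (fun Z φ ψ h => i.nhom_hom_ext φ ψ (fun p => h (Sum.inl p)) (fun h' => h (Sum.inr ⟨h'⟩)))
    (P := fun j => match j with
      | Sum.inl p => fun e => ∃ x y, (∃ f : ∀ t, Elt (A.Hom (single (b t)) (i.obj (p.1 t))),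
          (∀ t, True) ∧ x = tensEl f) ∧ (∃ z w, True ∧ True ∧ y = z ⊙ w) ∧ e = x ⊙ y
      | Sum.inr h => fun _ => True)
    (fun j => match j with
      | Sum.inl p => (spans_tens fun t => spans_top _).tensor
          ((spans_top _).tensor (spans_top _))
      | Sum.inr h => spans_top _)
  refine h.mono ?_
  rintro _ ⟨p | h, x, hx, rfl⟩
  · obtain ⟨_, _, ⟨U, -, rfl⟩, ⟨m, w, -, -, rfl⟩, rfl⟩ := hx
    exact ⟨Gen.tt (fun t => ⟨b t, i.obj (p.1 t), U t⟩) ⟨p.1, m⟩ ⟨i.obj p.2, d, w⟩ (fun _ => rfl)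
      (fun _ => rfl) rfl rfl, rfl⟩
  · exact ⟨Gen.bb h.down ⟨b (pos h.down), d, x⟩ rfl rfl, rfl⟩

/-- Invariance of a function on formal composites under moving arrows of `M`. -/
structure Balanced {α : Type*} (Φ : i.Gen b d → α) : Prop where
  rel : ∀ {y : M.Ob} (U : Fin k → UArr A) (F : Fin k → UArr M) (m : Op M.toSymMultigraph k y)
    (f : UArr M) (v : UArr A) (hUF : ∀ t, (i.arr (F t)).src = (U t).tgt)
    (hF : ∀ t, m.1 t = (F t).tgt) (hf : f.src = y) (hv : v.src = (i.arr f).tgt) (hd : v.tgt = d)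
    (h₁ : ∀ t, ((U t).comp (i.arr (F t)) (hUF t)).tgt = i.obj (m.1 t))
    (h₂ : ((i.arr f).comp v hv).src = i.obj y)
    (h₂' : ((i.arr f).comp v hv).tgt = d)
    (h₃ : ∀ t, (U t).tgt = i.obj ((Op.post (Op.preAll F m) f hf).1 t))
    (hb : ∀ t, (U t).src = b t) (hb' : ∀ t, ((U t).comp (i.arr (F t)) (hUF t)).src = b t),
    Φ (Gen.tt (fun t => (U t).comp (i.arr (F t)) (hUF t)) m ((i.arr f).comp v hv) hb' h₁ h₂ h₂') =
      Φ (Gen.tt U (Op.post (Op.preAll F m) f hf) v hb h₃ hv hd)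

/-- Invariance of a function on generators under the relations of the multimorphisms. -/
structure Compat {α : Type*} (Φ : i.Gen b d → α) : Prop extends i.Balanced Φ where
  collapse : ∀ {y : M.Ob} (h : k = 1) (U : Fin k → UArr A) (m : Op M.toSymMultigraph k y)
    (v : UArr A) (hU : ∀ t, (U t).tgt = i.obj (m.1 t)) (hv : v.src = i.obj y) (hd : v.tgt = d)
    (h₁ : (i.arr (UArr.ofOp (Op.act (finCongr h.symm) m))).src = (U (pos h)).tgt)
    (h₂ : v.src = ((U (pos h)).comp _ h₁).tgt) (hd' : (((U (pos h)).comp _ h₁).comp v h₂).tgt = d)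
    (hb : ∀ t, (U t).src = b t) (hb' : (((U (pos h)).comp _ h₁).comp v h₂).src = b (pos h)),
    Φ (Gen.tt U m v hb hU hv hd) = Φ (Gen.bb h (((U (pos h)).comp _ h₁).comp v h₂) hb' hd')

theorem exists_desc_right {W Z : V} {ε α : Type*} (el : ε → Elt W)
    (hel : Spans fun e => ∃ s, e = el s) (c : Elt Z → α) (hc : Function.Injective c)
    (Φ : ε → i.Gen b d → α) (hΦ : ∀ s, i.Compat (Φ s))
    (φ : ∀ p, W ⊗ i.genObj b d p ⟶ Z) (ψ : ∀ h : k = 1, W ⊗ A.Hom (single (b (pos h))) d ⟶ Z)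
    (hφ : ∀ s p (U : ∀ t, Elt (A.Hom (single (b t)) (i.obj (p.1 t)))) (m : Elt (M.Hom p.1 p.2))
      (v : Elt (A.Hom (single (i.obj p.2)) d)), c (φ p ⋄ (el s ⊙ (tensEl U ⊙ (m ⊙ v)))) =
        Φ s (Gen.tt (fun t => ⟨b t, _, U t⟩) ⟨p.1, m⟩ ⟨_, d, v⟩ (fun _ => rfl) (fun _ => rfl)
          rfl rfl))
    (hψ : ∀ s h (w : Elt (A.Hom (single (b (pos h))) d)), c (ψ h ⋄ (el s ⊙ w)) =
      Φ s (Gen.bb h ⟨_, d, w⟩ rfl rfl)) :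
    ∃ χ : W ⊗ i.NHom b d ⟶ Z, ∀ s (g : i.Gen b d), c (χ ⋄ (el s ⊙ g.el)) = Φ s g := by
  obtain ⟨χ, h1, h2⟩ := i.exists_desc (b := b) (d := d)
    (fun p => MonoidalClosed.curry (φ p)) (fun h => MonoidalClosed.curry (ψ h)) (by
      intro p p'
      rw [← MonoidalClosed.curry_natural_left, ← MonoidalClosed.curry_natural_left]
      congr 1
      refine (hel.tensor ((spans_tens fun t => (spans_top _).tensor (spans_top _)).tensor
        ((spans_top _).tensor ((spans_top _).tensor (spans_top _))))).ext ?_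
      rintro _ ⟨_, _, ⟨s, rfl⟩, ⟨_, _, ⟨z, hz, rfl⟩, ⟨m, _, -, ⟨f, w, -, -, rfl⟩, rfl⟩, rfl⟩, rfl⟩
      choose U F _ _ hz using hz
      obtain rfl : z = fun t => U t ⊙ F t := funext hz
      rw [comp_ap, comp_ap, whiskerLeft_ap, whiskerLeft_ap, relFst_ap, relSnd_ap]
      refine hc ((hφ s (p'.1, p.2) _ _ _).trans (Eq.trans ?_ (hφ s (p.1, p'.2) _ _ _).symm))
      have e := (hΦ s).rel (fun t => ⟨b t, _, U t⟩) (fun t => ⟨p.1 t, p'.1 t, F t⟩) ⟨p'.1, m⟩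
        ⟨p.2, p'.2, f⟩ ⟨_, d, w⟩ (fun _ => rfl) (fun _ => rfl) rfl rfl rfl (fun _ => rfl) rfl rfl
        (fun t => by
          rw [Op.post_fst, Op.preAll_fst _ (fun _ => rfl)]) (fun _ => rfl) (fun _ => rfl)
      refine Eq.trans (congrArg (Φ s) (Gen.tt_congr ?_ rfl ?_ _ _ _ _ _ _ _ _)) (e.trans
        (congrArg (Φ s) (Gen.tt_congr rfl ?_ rfl _ _ _ _ _ _ _ _)))
      · exact funext fun t => UArr.mk_comp _ _
      · exact UArr.mk_comp _ _
      · rw [Op.mk_post]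
        simp only [mk_preHom])
    (by
      intro h p
      rw [← MonoidalClosed.curry_natural_left]
      congr 1
      refine (hel.tensor ((spans_tens fun t => spans_top _).tensor
        ((spans_top _).tensor (spans_top _)))).ext ?_
      rintro _ ⟨_, _, ⟨s, rfl⟩, ⟨_, _, ⟨U, -, rfl⟩, ⟨m, w, -, -, rfl⟩, rfl⟩, rfl⟩
      rw [comp_ap, whiskerLeft_ap]
      refine hc ((hψ s h _).trans (Eq.trans ?_ (hφ s p _ _ _).symm))
      have e := (hΦ s).collapse h (fun t => ⟨b t, _, U t⟩) ⟨p.1, m⟩ ⟨_, d, w⟩ (fun _ => rfl) rfl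
        rfl rfl rfl rfl (fun _ => rfl) rfl
      refine Eq.trans (congrArg (Φ s) (Gen.bb_congr ?_ _ _ _ _ _ _)) e.symm
      exact i.collapse_ap h U m w)
  have h1' : ∀ p, W ◁ i.ι b d p ≫ MonoidalClosed.uncurry χ = φ p := fun p => by
    rw [← MonoidalClosed.uncurry_natural_left, h1, MonoidalClosed.uncurry_curry]
  have h2' : ∀ h, W ◁ i.κ h b d ≫ MonoidalClosed.uncurry χ = ψ h := fun h => by
    rw [← MonoidalClosed.uncurry_natural_left, h2, MonoidalClosed.uncurry_curry]
  refine ⟨MonoidalClosed.uncurry χ, fun s g => ?_⟩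
  cases g with
  | @tt y U m v hb hU hv hd =>
    have e := hφ s (m.1, y) (fun t => (U t).elt (hb t) (hU t)) m.2 (v.elt hv hd)
    rw [← h1', comp_ap, whiskerLeft_ap] at e
    refine e.trans (congrArg (Φ s) (Gen.tt_congr ?_ rfl ?_ _ _ _ _ _ _ _ _))
    · exact funext fun t => (U t).mk_elt _ _
    · exact v.mk_elt _ _
  | bb h w hb hd =>
    have e := hψ s h (w.elt hb hd)
    rw [← h2', comp_ap, whiskerLeft_ap] at e
    exact e.trans (congrArg (Φ s) (Gen.bb_congr (w.mk_elt _ _) _ _ _ _ _ _))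

theorem exists_desc_left {W Z : V} {ε α : Type*} (el : ε → Elt W)
    (hel : Spans fun e => ∃ s, e = el s) (c : Elt Z → α) (hc : Function.Injective c)
    (Φ : ε → i.Gen b d → α) (hΦ : ∀ s, i.Compat (Φ s))
    (φ : ∀ p, i.genObj b d p ⊗ W ⟶ Z) (ψ : ∀ h : k = 1, A.Hom (single (b (pos h))) d ⊗ W ⟶ Z)
    (hφ : ∀ s p (U : ∀ t, Elt (A.Hom (single (b t)) (i.obj (p.1 t)))) (m : Elt (M.Hom p.1 p.2))
      (v : Elt (A.Hom (single (i.obj p.2)) d)), c (φ p ⋄ ((tensEl U ⊙ (m ⊙ v)) ⊙ el s)) =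
        Φ s (Gen.tt (fun t => ⟨b t, _, U t⟩) ⟨p.1, m⟩ ⟨_, d, v⟩ (fun _ => rfl) (fun _ => rfl)
          rfl rfl))
    (hψ : ∀ s h (w : Elt (A.Hom (single (b (pos h))) d)), c (ψ h ⋄ (w ⊙ el s)) =
      Φ s (Gen.bb h ⟨_, d, w⟩ rfl rfl)) :
    ∃ χ : i.NHom b d ⊗ W ⟶ Z, ∀ s (g : i.Gen b d), c (χ ⋄ (g.el ⊙ el s)) = Φ s g := by
  obtain ⟨χ, h⟩ := i.exists_desc_right el hel c hc Φ hΦ (fun p => (β_ _ _).hom ≫ φ p)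
    (fun h => (β_ _ _).hom ≫ ψ h)
    (fun s p U m v => by rw [comp_ap, braiding_ap]; exact hφ s p U m v)
    (fun s h w => by rw [comp_ap, braiding_ap]; exact hψ s h w)
  exact ⟨(β_ _ _).hom ≫ χ, fun s g => by rw [comp_ap, braiding_ap]; exact h s g⟩

theorem exists_desc_gen {Z : V} {α : Type*} (c : Elt Z → α) (hc : Function.Injective c)
    (Φ : i.Gen b d → α) (hΦ : i.Compat Φ)
    (φ : ∀ p, i.genObj b d p ⟶ Z) (ψ : ∀ h : k = 1, A.Hom (single (b (pos h))) d ⟶ Z)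
    (hφ : ∀ p (U : ∀ t, Elt (A.Hom (single (b t)) (i.obj (p.1 t)))) (m : Elt (M.Hom p.1 p.2))
      (v : Elt (A.Hom (single (i.obj p.2)) d)), c (φ p ⋄ (tensEl U ⊙ (m ⊙ v))) =
        Φ (Gen.tt (fun t => ⟨b t, _, U t⟩) ⟨p.1, m⟩ ⟨_, d, v⟩ (fun _ => rfl) (fun _ => rfl)
          rfl rfl))
    (hψ : ∀ h (w : Elt (A.Hom (single (b (pos h))) d)), c (ψ h ⋄ w) =
      Φ (Gen.bb h ⟨_, d, w⟩ rfl rfl)) :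
    ∃ χ : i.NHom b d ⟶ Z, ∀ g : i.Gen b d, c (χ ⋄ g.el) = Φ g := by
  obtain ⟨χ, h⟩ := i.exists_desc_right (ε := PUnit.{1}) (fun _ => Elt.unit)
    (spans_unit.mono fun e he => ⟨⟨⟩, he⟩) c hc (fun _ => Φ) (fun _ => hΦ)
    (fun p => (λ_ _).hom ≫ φ p) (fun h => (λ_ _).hom ≫ ψ h)
    (fun s p U m v => by rw [comp_ap, leftUnitor_hom_ap]; exact hφ p U m v)
    (fun s h w => by rw [comp_ap, leftUnitor_hom_ap]; exact hψ h w)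
  exact ⟨(λ_ _).inv ≫ χ, fun g => by rw [comp_ap, leftUnitor_inv_ap]; exact h ⟨⟩ g⟩

end UnaryInclusion

theorem append_fun {α : Type*} {β : Type*} {l k : ℕ} (f : α → β) {U : Fin l → α} {U' : Fin k → α}
    {a : Fin l → β} {a' : Fin k → β} (h : ∀ t, f (U t) = a t) (h' : ∀ t, f (U' t) = a' t)
    (t : Fin (l + k)) : f (Fin.append U U' t) = Fin.append a a' t := by
  refine Fin.addCases (fun t => ?_) (fun t => ?_) t
  · rw [Fin.append_left, Fin.append_left, h]
  · rw [Fin.append_right, Fin.append_right, h']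

/-- The inclusion `Fin (l + k) ≃ Fin (k + 1)` for `l = 1`. -/
abbrev oneAddEquiv {l : ℕ} (h : l = 1) (k : ℕ) : Fin (l + k) ≃ Fin (k + 1) :=
  finCongr (by omega)

theorem cons_oneAddEquiv {α : Type*} {l k : ℕ} (h : l = 1) (a : Fin l → α) (b : Fin k → α)
    (t : Fin (l + k)) :
    Fin.append a b t = (Fin.cons (a (pos h)) b : Fin (k + 1) → α) (oneAddEquiv h k t) := by
  subst h
  refine Fin.addCases (fun t => ?_) (fun t => ?_) t
  · rw [Fin.append_left]
    have : oneAddEquiv rfl k (Fin.castAdd k t) = 0 := by ext; simp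
    rw [this, Fin.cons_zero]
    congr 1
    exact Subsingleton.elim (α := Fin 1) _ _
  · rw [Fin.append_right]
    have : oneAddEquiv rfl k (Fin.natAdd 1 t) = t.succ := by ext; simp
    rw [this, Fin.cons_succ]

theorem cons_fun {α : Type*} {β : Type*} {k : ℕ} (f : α → β) {u : α} {U : Fin k → α}
    {b : Fin (k + 1) → β} (h : f u = b 0) (h' : ∀ t, f (U t) = b t.succ) (t : Fin (k + 1)) :
    f ((Fin.cons u U : Fin (k + 1) → α) t) = b t :=
  Fin.cases h h' t

theorem append_zero {α : Type*} {l k : ℕ} (h : l + k = l) (a : Fin l → α) (b : Fin k → α)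
    (t : Fin (l + k)) : Fin.append a b t = a (finCongr h t) := by
  refine Fin.addCases (fun t => ?_) (fun t => ?_) t
  · rw [Fin.append_left]; rfl
  · exact absurd t.isLt (by omega)

namespace UnaryInclusion

variable {M A : SymMulticat.{v, u} V} {i : UnaryInclusion M A}

namespace Gen

/-- The action of bijections on generators. -/
def act {k l : ℕ} {a : Fin l → A.Ob} {a' : Fin k → A.Ob} {d : A.Ob} (σ : Fin k ≃ Fin l)
    (h : ∀ t, a' t = a (σ t)) : i.Gen a d → i.Gen a' d
  | tt U m v hb hU hv hd => tt (U ∘ σ) (Op.act σ m) v (fun t => (hb (σ t)).trans (h t).symm)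
      (fun t => hU (σ t)) hv hd
  | bb hl w hb hd =>
    have hk : k = 1 := by rw [← hl]; simpa using Fintype.card_congr σ
    bb hk w (hb.trans ((h (pos hk)).trans (congrArg a (by
      subst hl; exact Subsingleton.elim (α := Fin 1) _ _))).symm) hd

/-- The morphism of `M` in the composite of two generators. -/
def mid {l k : ℕ} {y y' : M.Ob} (m : Op M.toSymMultigraph l y) (v u : UArr A)
    (m' : Op M.toSymMultigraph (k + 1) y') (h : u.src = v.tgt) (hv : v.src = i.obj y)
    (hu : u.tgt = i.obj (m'.1 0)) : Op M.toSymMultigraph (l + k) y' :=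
  Op.comp (Op.post m (i.lift (v.comp u h) hv hu) rfl) m' rfl

theorem mid_fst {l k : ℕ} {y y' : M.Ob} (m : Op M.toSymMultigraph l y) (v u : UArr A)
    (m' : Op M.toSymMultigraph (k + 1) y') (h : u.src = v.tgt) (hv : v.src = i.obj y)
    (hu : u.tgt = i.obj (m'.1 0)) (t : Fin (l + k)) :
    (mid m v u m' h hv hu).1 t = Fin.append m.1 (Fin.tail m'.1) t :=
  append_fun id (Op.post_fst m _ rfl) (fun _ => rfl) t

/-- Composition of generators. -/
def comp {l k : ℕ} {a : Fin l → A.Ob} {x : A.Ob} {b : Fin k → A.Ob} {c : A.Ob} :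
    i.Gen a x → i.Gen (cons x b) c → i.Gen (Fin.append a b) c
  | tt U m v hb hU hv hd, tt U' m' v' hb' hU' hv' hd' =>
    tt (Fin.append U (Fin.tail U')) (mid m v (U' 0) m' ((hb' 0).trans hd.symm) hv (hU' 0))
      v' (append_fun UArr.src hb fun t => hb' t.succ)
      (fun t => (append_fun UArr.tgt hU (fun t => hU' t.succ) t).trans
          ((comp_append i.obj m.1 (Fin.tail m'.1) t).trans (by rw [Function.comp, mid_fst])))
      hv' hd'
  | tt U m v hb hU hv hd, bb h w hb' hd' =>
    tt (U ∘ finCongr (by omega)) (Op.act (finCongr (by omega)) m) (v.comp w (hb'.trans hd.symm))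
      (fun t => (hb _).trans (append_zero (by omega) a b t).symm) (fun t => hU _) hv hd'
  | bb h w hb hd, tt U' m' v' hb' hU' hv' hd' =>
    tt ((Fin.cons (w.comp (U' 0) ((hb' 0).trans hd.symm)) (Fin.tail U') : Fin (k + 1) → UArr A) ∘
        oneAddEquiv h k) (Op.act (oneAddEquiv h k) m') v'
      (fun t => (cons_fun UArr.src (u := w.comp (U' 0) ((hb' 0).trans hd.symm))
        (U := Fin.tail U') (b := (Fin.cons (a (pos h)) b : Fin (k + 1) → A.Ob)) hb
        (fun t => hb' t.succ) (oneAddEquiv h k t)).trans (cons_oneAddEquiv h a b t).symm)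
      (fun t => cons_fun UArr.tgt (u := w.comp (U' 0) ((hb' 0).trans hd.symm))
        (U := Fin.tail U') (b := fun t => i.obj (m'.1 t)) (hU' 0) (fun t => hU' t.succ)
        (oneAddEquiv h k t))
      hv' hd'
  | bb h w hb hd, bb h' w' hb' hd' =>
    bb (by omega) (w.comp w' (hb'.trans hd.symm))
      (hb.trans (by
        rw [cons_oneAddEquiv h a b]; rfl)) hd'

end Gen

end UnaryInclusion

namespace UnaryInclusion

variable {M A : SymMulticat.{v, u} V} {i : UnaryInclusion M A} [HasColimits V]

theorem tt_arrow_congr {k : ℕ} {d : A.Ob} {y : M.Ob} {U U' : Fin k → UArr A}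
    {m m' : Op M.toSymMultigraph k y} {v v' : UArr A}
    {hU : ∀ t, (U t).tgt = i.obj (m.1 t)} {hv : v.src = i.obj y} {hd : v.tgt = d}
    {hU' : ∀ t, (U' t).tgt = i.obj (m'.1 t)} {hv' : v'.src = i.obj y} {hd' : v'.tgt = d}
    (eU : ∀ t, U t = U' t) (em : m = m') (ev : v = v') :
    i.tt U m v hU hv hd = i.tt U' m' v' hU' hv' hd' :=
  i.tt_congr (funext eU) em ev _ _ _ _ _ _

theorem rawOp_injective {k : ℕ} (b : Fin k → A.Ob) (d : A.Ob) :
    Function.Injective fun e : Elt (i.NHom b d) => (⟨b, e⟩ : i.RawOp k d) :=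
  fun _ _ h => eq_of_heq (Sigma.mk.inj h).2

namespace Gen

variable {k l : ℕ} {a : Fin l → A.Ob} {a' : Fin k → A.Ob} {d : A.Ob}

theorem el_eq {g g' : i.Gen a d} (h : g.op = g'.op) : g.el = g'.el :=
  rawOp_injective a d (g.mk_el.trans (h.trans g'.mk_el.symm))

variable [MonoidalClosed V]

theorem compat_act (σ : Fin k ≃ Fin l) (h : ∀ t, a' t = a (σ t)) :
    i.Compat (fun g : i.Gen a d => (g.act σ h).op) where
  rel := fun U F m f v hUF hF hf hv hd h₁ h₂ h₂' h₃ _ _ => by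
    refine (i.tt_rel (U ∘ σ) (F ∘ σ) (Op.act σ m) f v (fun t => hUF (σ t)) (fun t => hF (σ t)) hf
      hv hd (fun t => h₁ (σ t)) h₂ h₂' (fun t => ?_)).trans (tt_arrow_congr (fun _ => rfl) ?_ rfl)
    · rw [Op.preAll_act, Op.act_post]
      exact h₃ (σ t)
    · rw [Op.preAll_act, Op.act_post]
  collapse := fun hl U m v hU hv hd h₁ h₂ hd' hb hb' => by
    have hk : k = 1 := by rw [← hl]; simpa using Fintype.card_congr σ
    subst hl hk
    have e1 : Op.act (finCongr (Eq.symm rfl)) (Op.act σ m) =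
        Op.act (finCongr (Eq.symm rfl)) m := by
      rw [Op.act_act]
      exact Op.act_congr (fun t => by omega) _
    have e2 : σ (pos rfl) = pos rfl := Subsingleton.elim (α := Fin 1) _ _
    have e3 : (i.arr (UArr.ofOp (Op.act (finCongr (Eq.symm rfl)) (Op.act σ m)))).src =
        ((U ∘ σ) (pos rfl)).tgt := by
      simp only [e1, Function.comp, e2]; exact h₁
    have e4 := UArr.comp_congr (congrArg U e2)
      (congrArg (fun q => i.arr (UArr.ofOp q)) e1) e3 h₁
    have e5 : v.src = (((U ∘ σ) (pos rfl)).comp _ e3).tgt := by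
      rw [h₂]; exact congrArg UArr.tgt e4.symm
    refine (i.tt_collapse rfl (U ∘ σ) (Op.act σ m) v (fun t => hU (σ t)) hv hd e3 e5 hd).trans ?_
    exact i.bb_congr (UArr.comp_congr e4 rfl _ _) _ _ _ _

end Gen

variable [MonoidalClosed V] {k l : ℕ} {a : Fin l → A.Ob} {a' : Fin k → A.Ob} {d : A.Ob}

theorem exists_act (σ : Fin k ≃ Fin l) (h : ∀ t, a' t = a (σ t)) :
    ∃ χ : i.NHom a d ⟶ i.NHom a' d, ∀ g : i.Gen a d, χ ⋄ g.el = (g.act σ h).el := by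
  obtain rfl : a' = a ∘ σ := funext h
  have hk : ∀ hl : l = 1, k = 1 := fun hl => by rw [← hl]; simpa using Fintype.card_congr σ
  have hp : ∀ hl : l = 1, σ (pos (hk hl)) = pos hl := fun hl => by
    subst hl; exact Subsingleton.elim (α := Fin 1) _ _
  obtain ⟨χ, hχ⟩ := i.exists_desc_gen _ (rawOp_injective (a ∘ σ) d)
    (fun g : i.Gen a d => (g.act σ h).op) (Gen.compat_act σ h)
    (fun p => (permTens σ (fun t => A.Hom (single (a t)) (i.obj (p.1 t))) ⊗ₘ
      (M.act σ (a' := p.1 ∘ σ) (fun _ => rfl) ▷ _)) ≫ i.ι (a ∘ σ) d (p.1 ∘ σ, p.2))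
    (fun hl => A.cast (fun _ => congrArg a (hp hl)) ≫ i.κ (hk hl) (a ∘ σ) d)
    (fun p U m v => by
      simp only [comp_ap, tensorHom_ap, permTens_ap, whiskerRight_ap]
      rfl)
    (fun hl w => by
      rw [comp_ap]
      exact (i.mk_κ (b := a ∘ σ) (hk hl) _).trans (i.bb_congr (UArr.mk_cast _ _) _ _ _ _))
  exact ⟨χ, fun g => rawOp_injective _ _ ((hχ g).trans (Gen.mk_el _).symm)⟩

/-- The action of bijections on the multimorphisms of the pushout. -/
def actHom (i : UnaryInclusion M A) (σ : Fin k ≃ Fin l) (h : ∀ t, a' t = a (σ t)) :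
    i.NHom a d ⟶ i.NHom a' d :=
  (i.exists_act σ h).choose

@[simp] theorem actHom_el (σ : Fin k ≃ Fin l) (h : ∀ t, a' t = a (σ t)) (g : i.Gen a d) :
    i.actHom σ h ⋄ g.el = (g.act σ h).el :=
  (i.exists_act σ h).choose_spec g

theorem Gen.act_op_congr (σ : Fin k ≃ Fin l) (h : ∀ t, a' t = a (σ t)) {g g' : i.Gen a d}
    (e : g.op = g'.op) : (g.act σ h).op = (g'.act σ h).op := by
  rw [← Gen.mk_el, ← Gen.mk_el, ← actHom_el, ← actHom_el, Gen.el_eq e]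

theorem actHom_refl (h : ∀ t, a t = a (Equiv.refl (Fin l) t)) :
    i.actHom (d := d) (Equiv.refl (Fin l)) h = 𝟙 (i.NHom a d) := by
  refine i.spans_gen.ext ?_
  rintro _ ⟨g, rfl⟩
  rw [actHom_el, id_ap]
  refine Gen.el_eq ?_
  cases g with
  | tt U m v hb hU hv hd => exact tt_arrow_congr (fun _ => rfl) (Op.act_refl m) rfl
  | bb h w hb hd => rfl

theorem actHom_trans {m : ℕ} {a'' : Fin m → A.Ob} (σ : Fin k ≃ Fin l) (τ : Fin m ≃ Fin k)
    (h : ∀ t, a' t = a (σ t)) (h' : ∀ t, a'' t = a' (τ t)) (h'' : ∀ t, a'' t = a (τ.trans σ t)) :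
    i.actHom (d := d) σ h ≫ i.actHom τ h' = i.actHom (τ.trans σ) h'' := by
  refine i.spans_gen.ext ?_
  rintro _ ⟨g, rfl⟩
  rw [comp_ap, actHom_el, actHom_el, actHom_el]
  refine Gen.el_eq ?_
  cases g with
  | tt U m v hb hU hv hd => exact tt_arrow_congr (fun _ => rfl) (Op.act_act τ σ m) rfl
  | bb h w hb hd => rfl

variable (i) in
/-- The multigraph underlying the pushout. -/
abbrev graph : SymMultigraph.{v, u} V where
  Ob := A.Ob
  Hom := fun b d => i.NHom b d
  act := fun σ _ _ _ h => i.actHom σ h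
  act_refl := fun _ _ => i.actHom_refl _
  act_trans := fun σ τ _ _ _ _ h h' => i.actHom_trans σ τ h h' _

end UnaryInclusion

namespace UnaryInclusion

variable {M A : SymMulticat.{v, u} V} {i : UnaryInclusion M A}

variable [HasColimits V] {k : ℕ} {d : A.Ob} {y : M.Ob}

section Eq

variable {U U' : Fin k → UArr A} {m : Op M.toSymMultigraph k y} {v v' : UArr A}
  {hU : ∀ t, (U t).tgt = i.obj (m.1 t)} {hv : v.src = i.obj y} {hd : v.tgt = d}
  {hd' : v'.tgt = d}

theorem tt_rel_eq (F : Fin k → UArr M) (f : UArr M) {m' : Op M.toSymMultigraph k f.tgt}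
    {hU' : ∀ t, (U' t).tgt = i.obj (m'.1 t)} {hv' : v'.src = i.obj f.tgt}
    (hUF : ∀ t, (i.arr (F t)).src = (U' t).tgt) (hF : ∀ t, m.1 t = (F t).tgt) (hf : f.src = y)
    (eU : ∀ t, U t = (U' t).comp (i.arr (F t)) (hUF t))
    (em : m' = Op.post (Op.preAll F m) f hf) (ev : v = (i.arr f).comp v' hv') :
    i.tt U m v hU hv hd = i.tt U' m' v' hU' hv' hd' := by
  subst em ev
  obtain rfl := funext eU
  exact i.tt_rel U' F m f v' hUF hF hf hv' hd' _ _ _ _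

theorem tt_pre_eq (F : Fin k → UArr M) {m' : Op M.toSymMultigraph k y}
    {hU' : ∀ t, (U' t).tgt = i.obj (m'.1 t)} {hv' : v'.src = i.obj y}
    (hUF : ∀ t, (i.arr (F t)).src = (U' t).tgt) (hF : ∀ t, m.1 t = (F t).tgt)
    (eU : ∀ t, U t = (U' t).comp (i.arr (F t)) (hUF t))
    (em : m' = Op.preAll F m) (ev : v = v') :
    i.tt U m v hU hv hd = i.tt U' m' v' hU' hv' hd' := by
  subst em ev
  obtain rfl := funext eU
  exact i.tt_pre U' F m v hUF hF hv hd _ _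

theorem tt_post_eq (f : UArr M) {m' : Op M.toSymMultigraph k f.tgt}
    {hU' : ∀ t, (U' t).tgt = i.obj (m'.1 t)} {hv' : v'.src = i.obj f.tgt} (hf : f.src = y)
    (eU : ∀ t, U t = U' t) (em : m' = Op.post m f hf) (ev : v = (i.arr f).comp v' hv') :
    i.tt U m v hU hv hd = i.tt U' m' v' hU' hv' hd' := by
  subst em ev
  obtain rfl := funext eU
  exact i.tt_post U m f v' hf hv' hd' hU _ _ _

theorem tt_collapse_eq (h : k = 1) {w : UArr A} {hw : w.tgt = d}
    (h₁ : (i.arr (UArr.ofOp (Op.act (finCongr h.symm) m))).src = (U (pos h)).tgt)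
    (h₂ : v.src = ((U (pos h)).comp _ h₁).tgt) (e : w = ((U (pos h)).comp _ h₁).comp v h₂) :
    i.tt U m v hU hv hd = i.bb h w hw := by
  subst e
  exact i.tt_collapse h U m v hU hv hd h₁ h₂ hw

end Eq

end UnaryInclusion

namespace Op

variable {P : SymMulticat.{v, u} V} {k l : ℕ} {x c : P.Ob}

theorem comp_congr {f f' : Op P.toSymMultigraph l x} {g g' : Op P.toSymMultigraph (k + 1) c}
    (hf : f = f') (hg : g = g') (h : g.1 0 = x) (h' : g'.1 0 = x) : comp f g h = comp f' g' h' := by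
  subst hf hg; rfl

theorem comp_preAll (F : Fin (k + 1) → UArr P) (q : Op P.toSymMultigraph l x)
    (q' : Op P.toSymMultigraph (k + 1) c) (h : q'.1 0 = (F 0).tgt) (h' : (F 0).src = x)
    (h'' : (preAll F q').1 0 = x) :
    comp q (preAll F q') h'' = preAll (Fin.append (fun t => UArr.one P (q.1 t)) (Fin.tail F))
      (comp (post q (F 0) h') q' h) := by
  have e := preAll_comp_preAll (fun t => UArr.one P (q.1 t)) F q q' h h' h''
  rwa [preAll_one _ q fun _ => rfl] at e

theorem preAll_comp (F : Fin l → UArr P) (q : Op P.toSymMultigraph l x)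
    (q' : Op P.toSymMultigraph (k + 1) c) (h : q'.1 0 = x) :
    comp (preAll F q) q' h =
      preAll (Fin.append F (fun t => UArr.one P (q'.1 t.succ))) (comp q q' h) := by
  have e := preAll_comp_preAll F (fun t => UArr.one P (q'.1 t)) q q' rfl h (by
    rw [preAll_one _ q' fun _ => rfl]; exact h)
  simp only [preAll_one _ q' fun _ => rfl] at e
  rw [e]
  subst h
  have e' := post_one q (x := q'.1 0) rfl
  simp only [e']
  rfl

theorem preAll_cons_ones (f : UArr P) (q : Op P.toSymMultigraph (k + 1) c) (h : q.1 0 = f.tgt) :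
    preAll (Fin.cons f (fun t => UArr.one P (q.1 t.succ)) : Fin (k + 1) → UArr P) q =
      preZero f q h := by
  unfold preAll
  rw [List.finRange_succ, preList_cons, preList_one]
  · exact (step_eq (F := (Fin.cons f (fun t => UArr.one P (q.1 t.succ)) : Fin (k + 1) → UArr P))
      h).trans (pre_zero f q h)
  · intro t ht
    obtain ⟨j, -, rfl⟩ := List.mem_map.1 ht
    rfl

theorem comp_op (f : UArr P) (q : Op P.toSymMultigraph (k + 1) c) (h : q.1 0 = f.tgt) :
    comp f.op q h = act (finCongr (Nat.add_comm 1 k)) (preZero f q h) := by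
  unfold preZero
  rw [act_act]
  exact (act_id (fun _ => rfl) _).symm

end Op

theorem UArr.comp_comp_comp {P : SymMulticat.{v, u} V} (w u a v : UArr P) (h₁ : a.src = u.tgt)
    (h₂ : v.src = (u.comp a h₁).tgt) (h₃ : ((u.comp a h₁).comp v h₂).src = w.tgt)
    (h₁' : u.src = w.tgt) (h₂' : a.src = (w.comp u h₁').tgt)
    (h₃' : v.src = ((w.comp u h₁').comp a h₂').tgt) :
    w.comp ((u.comp a h₁).comp v h₂) h₃ = ((w.comp u h₁').comp a h₂').comp v h₃' := by
  rw [← UArr.comp_assoc w (u.comp a h₁) v h₁' h₂ h₂ h₃]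
  exact UArr.comp_congr (UArr.comp_assoc w u a h₁' h₁ h₂' h₁').symm rfl _ _

namespace UnaryInclusion

variable {M A : SymMulticat.{v, u} V} {i : UnaryInclusion M A} [HasColimits V]

namespace Gen

variable {l k : ℕ} {a : Fin l → A.Ob} {x : A.Ob} {b : Fin k → A.Ob} {c : A.Ob}

theorem mid_eq {y y' : M.Ob} (m : Op M.toSymMultigraph l y) (v u : UArr A)
    (m' : Op M.toSymMultigraph (k + 1) y') (h : u.src = v.tgt) (hv : v.src = i.obj y)
    (hu : u.tgt = i.obj (m'.1 0)) (g : UArr M) (e : v.comp u h = i.arr g) (hg : g.src = y)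
    (hm : m'.1 0 = g.tgt) : mid m v u m' h hv hu = Op.comp (Op.post m g hg) m' hm := by
  obtain ⟨s, t, g⟩ := g
  obtain rfl : s = y := hg
  obtain rfl : _ = t := hm
  have : i.lift (v.comp u h) hv hu = ⟨s, m'.1 0, g⟩ := i.lift_eq e
  unfold mid
  have key : ∀ (g' : UArr M) (h₁ : g'.src = s) (h₂ : m'.1 0 = g'.tgt), g' = ⟨s, m'.1 0, g⟩ →
      Op.comp (Op.post m g' h₁) m' h₂ = Op.comp (Op.post m ⟨s, m'.1 0, g⟩ rfl) m' rfl := by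
    rintro _ _ _ rfl; rfl
  exact key _ _ _ this

theorem mid_rel {y y' : M.Ob} (m : Op M.toSymMultigraph l y) (v u : UArr A)
    (F : Fin (k + 1) → UArr M) (m' : Op M.toSymMultigraph (k + 1) y') (f : UArr M)
    (hF : ∀ t, m'.1 t = (F t).tgt) (huF : (i.arr (F 0)).src = u.tgt)
    (h₁ : (u.comp (i.arr (F 0)) huF).src = v.tgt) (hv : v.src = i.obj y)
    (h₂ : (u.comp (i.arr (F 0)) huF).tgt = i.obj (m'.1 0)) (hf : f.src = y') (hu : u.src = v.tgt)
    (h₃ : u.tgt = i.obj ((Op.post (Op.preAll F m') f hf).1 0)) :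
    mid m v u (Op.post (Op.preAll F m') f hf) hu hv h₃ =
      Op.post (Op.preAll (Fin.append (fun t => UArr.one M (m.1 t)) (Fin.tail F))
        (mid m v (u.comp (i.arr (F 0)) huF) m' h₁ hv h₂)) f hf := by
  have hL := i.arr_lift (v.comp u hu) hv huF.symm
  have hL' : (i.lift (v.comp u hu) hv huF.symm).tgt = (F 0).src := rfl
  have hL'' : (i.lift (v.comp u hu) hv huF.symm).src = y := rfl
  generalize i.lift (v.comp u hu) hv huF.symm = L at hL hL' hL''
  have h0 : (Op.preAll F m').1 0 = (F 0).src := Op.preAll_fst F hF 0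
  rw [mid_eq m v u _ _ _ _ L hL.symm hL'' ((Op.post_fst _ f hf 0).trans (h0.trans hL'.symm)),
    mid_eq m v _ m' _ _ _ (L.comp (F 0) hL'.symm) (by
      rw [i.arr_comp L (F 0) hL'.symm (by rw [hL]; exact huF)]
      simp only [hL]
      exact (UArr.comp_assoc _ _ _ _ _ _ _).symm) hL'' (hF 0),
    ← Op.post_comp _ _ f (h0.trans hL'.symm) hf,
    Op.comp_preAll F _ m' (hF 0) hL'.symm]
  have e := Op.post_post m L (F 0) hL'' hL'.symm
  simp only [Op.post_fst]
  exact congrArg (fun q => Op.post (Op.preAll (Fin.append (fun t => UArr.one M (m.1 t))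
    (Fin.tail F)) q) f hf) (Op.comp_congr e rfl _ _)

theorem compat_comp_tt {y : M.Ob} (U : Fin l → UArr A) (m : Op M.toSymMultigraph l y) (v : UArr A)
    (hb : ∀ t, (U t).src = a t) (hU : ∀ t, (U t).tgt = i.obj (m.1 t)) (hv : v.src = i.obj y)
    (hd : v.tgt = x) : i.Compat (fun g' : i.Gen (cons x b) c =>
      ((tt U m v hb hU hv hd : i.Gen a x).comp g').op) where
  rel := fun U' F m' f v' hUF hF hf hv' hd' h₁ h₂ h₂' h₃ hb' hb'' => by
    refine tt_rel_eq (Fin.append (fun t => UArr.one M (m.1 t)) (Fin.tail F)) f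
      (fun t => Fin.addCases (fun t => ?_) (fun t => ?_) t)
      (fun t => Fin.addCases (fun t => ?_) (fun t => ?_) t) hf
      (fun t => Fin.addCases (fun t => ?_) (fun t => ?_) t) (mid_rel (hF := hF) ..) rfl
    · simp only [Fin.append_left]; exact (hU t).symm
    · simp only [Fin.append_right]; exact hUF t.succ
    · rw [mid_fst]; simp only [Fin.append_left]
    · rw [mid_fst]; simp only [Fin.append_right]; exact hF t.succ
    · simp only [Fin.append_left]
      refine (UArr.comp_one (U t) (hU t).symm).symm.trans (UArr.comp_congr rfl ?_ _ _)
      exact (i.arr_one _).symm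
    · simp only [Fin.append_right]
      rfl
  collapse := fun h U' m' v' hU' hv' hd' h₁ h₂ hd'' hb' hb'' => by
    obtain rfl : k = 0 := by omega
    have hu : (U' 0).src = v.tgt := (hb' 0).trans hd.symm
    have hL := i.arr_lift (v.comp (U' 0) hu) hv (hU' 0)
    have hL' : (i.lift (v.comp (U' 0) hu) hv (hU' 0)).tgt = m'.1 0 := rfl
    have hL'' : (i.lift (v.comp (U' 0) hu) hv (hU' 0)).src = y := rfl
    generalize i.lift (v.comp (U' 0) hu) hv (hU' 0) = L at hL hL' hL''
    have e : Op.act (finCongr h.symm) m' = m' := Op.act_id (fun _ => rfl) m'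
    refine Eq.symm (tt_post_eq (L.comp (UArr.ofOp m') hL'.symm) hL'' (fun t => ?_) ?_ ?_)
    · exact (append_zero (by omega) U (Fin.tail U') t).symm
    · have e1 : Op.act (finCongr (by omega)) m = m := Op.act_id (fun _ => rfl) m
      rw [mid_eq m v _ m' _ _ _ L hL.symm hL'' hL'.symm]
      have e2 := Op.post_post m L (UArr.ofOp m') hL'' hL'.symm
      have e3 : Op.post (Op.post m L hL'') (UArr.ofOp m') hL'.symm =
          Op.comp (Op.post m L hL'') m' hL'.symm := by
        unfold Op.post
        simp only [UArr.op_ofOp]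
        rfl
      exact e3.symm.trans (e2.trans
        (congrArg (fun q => Op.post q (L.comp (UArr.ofOp m') hL'.symm) hL'') e1.symm))
    · refine Eq.trans (UArr.comp_comp_comp _ _ _ _ _ _ _ hu h₁ h₂)
        (UArr.comp_congr (Eq.trans ?_ (i.arr_comp L (UArr.ofOp m') hL'.symm
          (by rw [hL, ← e]; exact h₁)).symm) rfl _ _)
      simp only [hL, e]

theorem compat_comp_bb [MonoidalClosed V] (h : l = 1) (w : UArr A) (hb : w.src = a (pos h))
    (hd : w.tgt = x) : i.Compat (fun g' : i.Gen (cons x b) c =>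
      ((bb h w hb hd : i.Gen a x).comp g').op) where
  rel := fun U' F m' f v' hUF hF hf hv' hd' h₁ h₂ h₂' h₃ hb' hb'' => by
    have hw : (U' 0).src = w.tgt := (hb' 0).trans hd.symm
    refine act_op_congr (oneAddEquiv h k) (cons_oneAddEquiv h a b) (a := cons (a (pos h)) b)
      (g := tt (cons (w.comp ((U' 0).comp (i.arr (F 0)) (hUF 0)) hw) (fun t => (U' t.succ).comp
        (i.arr (F t.succ)) (hUF t.succ)) : Fin (k + 1) → UArr A) m' ((i.arr f).comp v' hv')
        (Fin.cases hb fun t => hb'' t.succ) (Fin.cases (h₁ 0) fun t => h₁ t.succ) h₂ h₂')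
      (g' := tt (cons (w.comp (U' 0) hw) (Fin.tail U') : Fin (k + 1) → UArr A)
        (Op.post (Op.preAll F m') f hf) v' (Fin.cases hb fun t => hb' t.succ)
        (Fin.cases (h₃ 0) fun t => h₃ t.succ) hv' hd') ?_
    refine tt_rel_eq F f (Fin.cases (hUF 0) fun t => hUF t.succ) hF hf
      (Fin.cases ?_ fun t => rfl) rfl rfl
    exact (UArr.comp_assoc _ _ _ _ _ _ _).symm
  collapse := fun h' U' m' v' hU' hv' hd' h₁ h₂ hd'' hb' hb'' => by
    obtain rfl : k = 0 := by omega
    subst h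
    have hw : (U' 0).src = w.tgt := (hb' 0).trans hd.symm
    have e : Op.act (finCongr h'.symm) m' = m' := Op.act_id (fun _ => rfl) m'
    have e' : Op.act (finCongr h'.symm) (Op.act (oneAddEquiv rfl 0) m') = m' :=
      (Op.act_act _ _ _).trans (Op.act_id (fun _ => rfl) m')
    refine tt_collapse_eq h' ?_ ?_ ?_
    · simp only [e']; rw [← e]; exact h₁
    · exact h₂
    · refine Eq.trans (UArr.comp_comp_comp _ _ _ _ _ _ _ hw h₁ h₂)
        (UArr.comp_congr ?_ rfl _ _)
      simp only [e]
      rfl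

theorem compat_comp_right_tt {y' : M.Ob} (U' : Fin (k + 1) → UArr A)
    (m' : Op M.toSymMultigraph (k + 1) y') (v' : UArr A) (hb' : ∀ t, (U' t).src = cons x b t)
    (hU' : ∀ t, (U' t).tgt = i.obj (m'.1 t)) (hv' : v'.src = i.obj y') (hd' : v'.tgt = c) :
    i.Compat (fun g : i.Gen a x =>
      (g.comp (tt U' m' v' hb' hU' hv' hd' : i.Gen (cons x b) c)).op) where
  rel := fun U F m f v hUF hF hf hv hd h₁ h₂ h₂' h₃ hb hb'' => by
    have hu : (U' 0).src = v.tgt := (hb' 0).trans hd.symm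
    have hL := i.arr_lift (x := f.tgt) (v.comp (U' 0) hu) hv (hU' 0)
    have hL' : (i.lift (x := f.tgt) (v.comp (U' 0) hu) hv (hU' 0)).tgt = m'.1 0 := rfl
    have hL'' : (i.lift (x := f.tgt) (v.comp (U' 0) hu) hv (hU' 0)).src = f.tgt := rfl
    generalize i.lift (x := f.tgt) (v.comp (U' 0) hu) hv (hU' 0) = L at hL hL' hL''
    have hUF' : ∀ t, (i.arr (Fin.append F (fun t => UArr.one M (m'.1 t.succ)) t)).src =
        (Fin.append U (Fin.tail U') t).tgt := fun t => by
      refine Fin.addCases (fun t => ?_) (fun t => ?_) t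
      · simp only [Fin.append_left]; exact hUF t
      · simp only [Fin.append_right]; exact (hU' t.succ).symm
    refine tt_pre_eq (Fin.append F (fun t => UArr.one M (m'.1 t.succ))) hUF'
      (fun t => ?_) (fun t => ?_) ?_ rfl
    · rw [mid_fst]
      refine Fin.addCases (fun t => ?_) (fun t => ?_) t
      · simp only [Fin.append_left]; exact hF t
      · simp only [Fin.append_right]; rfl
    · refine Fin.addCases (fun t => ?_) (fun t => ?_) t
      · simp only [Fin.append_left]
      · simp only [Fin.append_right]
        refine (UArr.comp_one (U' t.succ) (hU' t.succ).symm).symm.trans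
          (UArr.comp_congr rfl ?_ _ _)
        exact (i.arr_one _).symm
    · have hfL : ((i.arr f).comp v hv).comp (U' 0) hu = i.arr (f.comp L hL'') := by
        refine Eq.trans ?_ (i.arr_comp f L hL'' (by rw [hL]; exact hv)).symm
        simp only [hL]
        exact UArr.comp_assoc _ _ _ _ _ _ _
      refine (mid_eq _ v _ _ _ _ _ L hL.symm hL'' hL'.symm).trans (Eq.trans ?_
        (congrArg _ (mid_eq m _ _ m' _ _ _ (f.comp L hL'') hfL hf hL'.symm).symm))
      refine Eq.trans ?_ (Op.preAll_comp F (Op.post m (f.comp L hL'') hf) m' hL'.symm)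
      refine Op.comp_congr ?_ rfl _ _
      rw [Op.post_post]
      exact Op.post_preAll F m (f.comp L hL'') hf
  collapse := fun {y} h U m v hU hv hd h₁ h₂ hd'' hb hb'' => by
    subst h
    have hu : (U' 0).src = v.tgt := (hb' 0).trans hd.symm
    have hL := i.arr_lift (v.comp (U' 0) hu) hv (hU' 0)
    have hL' : (i.lift (v.comp (U' 0) hu) hv (hU' 0)).tgt = m'.1 0 := rfl
    have hL'' : (i.lift (v.comp (U' 0) hu) hv (hU' 0)).src = y := rfl
    generalize i.lift (v.comp (U' 0) hu) hv (hU' 0) = L at hL hL' hL''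
    have hm : Op.act (finCongr (Eq.symm rfl)) m = m := Op.act_id (fun _ => rfl) m
    have hmL : L.src = (UArr.ofOp m).tgt := hL''
    have hg : m'.1 0 = ((UArr.ofOp m).comp L hmL).tgt := hL'.symm
    have hUF : ∀ t, (i.arr ((Fin.cons ((UArr.ofOp m).comp L hmL) (fun t => UArr.one M
        (m'.1 t.succ)) : Fin (k + 1) → UArr M) t)).src =
        ((Fin.cons (U 0) (Fin.tail U') : Fin (k + 1) → UArr A) t).tgt :=
      Fin.cases (hU 0).symm fun t => (hU' t.succ).symm
    have hUF' : ∀ t, (i.arr ((Fin.cons ((UArr.ofOp m).comp L hmL) (fun t => UArr.one M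
        (m'.1 t.succ)) : Fin (k + 1) → UArr M) (oneAddEquiv rfl k t))).src =
        (Fin.append U (Fin.tail U') t).tgt := fun t => by
      rw [cons_oneAddEquiv rfl]; exact hUF _
    have hW : (U' 0).src = (((U (pos rfl)).comp _ h₁).comp v h₂).tgt := hu
    have key : ∀ s, (Fin.cons ((((U (pos rfl)).comp _ h₁).comp v h₂).comp (U' 0) hW)
        (Fin.tail U') : Fin (k + 1) → UArr A) s =
        ((Fin.cons (U 0) (Fin.tail U') : Fin (k + 1) → UArr A) s).comp (i.arr ((Fin.cons
          ((UArr.ofOp m).comp L hmL) (fun t => UArr.one M (m'.1 t.succ)) :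
            Fin (k + 1) → UArr M) s)) (hUF s) := by
      refine Fin.cases ?_ (fun t => ?_)
      · refine (UArr.comp_assoc _ v (U' 0) h₂ hu hu h₂).trans ?_
        refine (UArr.comp_assoc (U (pos rfl)) _ (v.comp (U' 0) hu) h₁ h₂ h₂ h₁).trans
          (UArr.comp_congr rfl ?_ _ _)
        refine Eq.trans ?_ (i.arr_comp (UArr.ofOp m) L hmL (by rw [hL]; exact hv)).symm
        simp only [hL, hm]
      · refine (UArr.comp_one (U' t.succ) (hU' t.succ).symm).symm.trans
          (UArr.comp_congr rfl ?_ _ _)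
        exact (i.arr_one _).symm
    refine Eq.symm (tt_pre_eq ((Fin.cons ((UArr.ofOp m).comp L hmL) (fun t => UArr.one M
      (m'.1 t.succ)) : Fin (k + 1) → UArr M) ∘ oneAddEquiv rfl k) (fun t => hUF' t) (fun t => ?_)
      (fun t => ?_) ?_ rfl)
    · exact (Fin.cases hg (fun t => rfl) : ∀ t, m'.1 t = ((Fin.cons ((UArr.ofOp m).comp L hmL)
        (fun t => UArr.one M (m'.1 t.succ)) : Fin (k + 1) → UArr M) t).tgt) (oneAddEquiv rfl k t)
    · refine Eq.trans (key (oneAddEquiv rfl k t))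
        (UArr.comp_congr (cons_oneAddEquiv rfl U (Fin.tail U') t).symm rfl _ _)
    · rw [Op.preAll_act, Op.preAll_cons_ones _ _ hg]
      refine Eq.trans ?_ (Op.comp_op _ m' hg)
      refine (mid_eq m v _ m' _ _ _ L hL.symm hL'' hL'.symm).trans (Op.comp_congr ?_ rfl _ _)
      rw [UArr.op_comp]
      simp only [UArr.op_ofOp]
      rfl

theorem compat_comp_right_bb [MonoidalClosed V] (h : k + 1 = 1) (w : UArr A)
    (hb' : w.src = cons x b (pos h)) (hd' : w.tgt = c) : i.Compat (fun g : i.Gen a x =>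
      (g.comp (bb h w hb' hd' : i.Gen (cons x b) c)).op) where
  rel := fun U F m f v hUF hF hf hv hd h₁ h₂ h₂' h₃ hb hb'' => by
    have hw : w.src = v.tgt := hb'.trans hd.symm
    refine act_op_congr (finCongr (by omega)) (append_zero (by omega) a b)
      (g := tt (fun t => (U t).comp (i.arr (F t)) (hUF t)) m
        (((i.arr f).comp v hv).comp w hw) hb'' h₁ h₂ hd')
      (g' := tt U (Op.post (Op.preAll F m) f hf) (v.comp w hw) hb h₃ hv hd') ?_
    exact tt_rel_eq F f hUF hF hf (fun _ => rfl) rfl (UArr.comp_assoc _ _ _ _ _ _ _)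
  collapse := fun h' U m v hU hv hd h₁ h₂ hd'' hb hb'' => by
    have hw : w.src = v.tgt := hb'.trans hd.symm
    refine act_op_congr (finCongr (by omega)) (append_zero (by omega) a b)
      (g := tt U m (v.comp w hw) hb hU hv hd')
      (g' := bb h' ((((U (pos h')).comp _ h₁).comp v h₂).comp w hw) hb'' hd') ?_
    exact tt_collapse_eq h' h₁ h₂ (UArr.comp_assoc _ _ _ _ _ _ _)

end Gen

end UnaryInclusion

/-- Composition in the middle of two products of three factors. -/
def splice {T m v T' m' v' u R w n o Q : V} (un : T' ⟶ u ⊗ R) (pv : v ⊗ u ⟶ w) (po : m ⊗ w ⟶ n)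
    (co : n ⊗ m' ⟶ o) (ap : T ⊗ R ⟶ Q) : (T ⊗ (m ⊗ v)) ⊗ (T' ⊗ (m' ⊗ v')) ⟶ Q ⊗ (o ⊗ v') :=
  _ ◁ ((un ≫ (β_ _ _).hom) ▷ _ ≫ (α_ _ _ _).hom) ≫ tensorμ _ _ _ _ ≫
    (ap ⊗ₘ ((α_ _ _ _).inv ≫ ((α_ _ _ _).hom ≫ m ◁ pv ≫ po) ▷ _ ≫ (α_ _ _ _).inv ≫ co ▷ _))

theorem splice_ap {T m v T' m' v' u R w n o Q : V} (un : T' ⟶ u ⊗ R) (pv : v ⊗ u ⟶ w)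
    (po : m ⊗ w ⟶ n) (co : n ⊗ m' ⟶ o) (ap : T ⊗ R ⟶ Q) (eT : Elt T) (em : Elt m) (ev : Elt v)
    (eT' : Elt T') (em' : Elt m') (ev' : Elt v') (eu : Elt u) (eR : Elt R)
    (h : un ⋄ eT' = eu ⊙ eR) :
    splice un pv po co ap ⋄ ((eT ⊙ (em ⊙ ev)) ⊙ (eT' ⊙ (em' ⊙ ev'))) =
      (ap ⋄ (eT ⊙ eR)) ⊙ ((co ⋄ ((po ⋄ (em ⊙ (pv ⋄ (ev ⊙ eu)))) ⊙ em')) ⊙ ev') := by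
  simp [splice, h]

/-- Composition in the first factor. -/
def spliceLeft {w T' v' u R n Q : V} (un : T' ⟶ u ⊗ R) (pv : w ⊗ u ⟶ n)
    (ap : n ⊗ R ⟶ Q) : w ⊗ (T' ⊗ v') ⟶ Q ⊗ v' :=
  w ◁ (un ▷ v' ≫ (α_ _ _ _).hom) ≫ (α_ _ _ _).inv ≫ pv ▷ _ ≫ (α_ _ _ _).inv ≫ ap ▷ _

theorem spliceLeft_ap {w T' v' u R n Q : V} (un : T' ⟶ u ⊗ R) (pv : w ⊗ u ⟶ n)
    (ap : n ⊗ R ⟶ Q) (ew : Elt w) (eT' : Elt T') (ev' : Elt v') (eu : Elt u) (eR : Elt R)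
    (h : un ⋄ eT' = eu ⊙ eR) :
    spliceLeft un pv ap ⋄ (ew ⊙ (eT' ⊙ ev')) = (ap ⋄ ((pv ⋄ (ew ⊙ eu)) ⊙ eR)) ⊙ ev' := by
  simp [spliceLeft, h]

/-- Composition in the last factor. -/
def spliceRight {T m v w n : V} (pv : v ⊗ w ⟶ n) : (T ⊗ (m ⊗ v)) ⊗ w ⟶ T ⊗ (m ⊗ n) :=
  (α_ _ _ _).hom ≫ T ◁ ((α_ _ _ _).hom ≫ m ◁ pv)

theorem spliceRight_ap {T m v w n : V} (pv : v ⊗ w ⟶ n) (eT : Elt T) (em : Elt m) (ev : Elt v)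
    (ew : Elt w) : spliceRight pv ⋄ ((eT ⊙ (em ⊙ ev)) ⊙ ew) = eT ⊙ (em ⊙ (pv ⋄ (ev ⊙ ew))) := by
  simp [spliceRight]

theorem exists_consTens {k : ℕ} (X : Fin (k + 1) → V) :
    ∃ φ : X 0 ⊗ tens (fun j => X j.succ) ⟶ tens X,
      ∀ e : ∀ t, Elt (X t), φ ⋄ (e 0 ⊙ tensEl (fun j => e j.succ)) = tensEl e := by
  have h := exists_insert X 0
  rw [Fin.succAbove_zero] at h
  obtain ⟨φ, hφ, h⟩ := h
  exact ⟨(β_ _ _).hom ≫ φ, fun e => by rw [comp_ap, braiding_ap, h e]⟩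

/-- Addition of a first factor. -/
def consTens {k : ℕ} (X : Fin (k + 1) → V) :
    X 0 ⊗ tens (fun j => X j.succ) ⟶ tens X := (exists_consTens X).choose

@[simp] theorem consTens_ap {k : ℕ} (X : Fin (k + 1) → V) (e : ∀ t, Elt (X t)) :
    consTens X ⋄ (e 0 ⊙ tensEl (fun j => e j.succ)) = tensEl e :=
  (exists_consTens X).choose_spec e

theorem UArr.mk_eqToHom {P : SymMulticat.{v, u} V} {x x' y y' : P.Ob} (hx : x = x') (hy : y = y')
    (h : P.Hom (single x) y = P.Hom (single x') y') (e : Elt (P.Hom (single x) y)) :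
    (⟨x', y', eqToHom h ⋄ e⟩ : UArr P) = ⟨x, y, e⟩ := by
  subst hx hy
  rw [eqToHom_refl, id_ap]

/-- Concatenation of families of arrows. -/
def appendArr {P : SymMulticat.{v, u} V} {l k : ℕ} (a x : Fin l → P.Ob) (b y : Fin k → P.Ob)
    (z : Fin (l + k) → P.Ob) (hx : ∀ t, x t = z (Fin.castAdd k t))
    (hy : ∀ t, y t = z (Fin.natAdd l t)) :
    tens (fun t => P.Hom (single (a t)) (x t)) ⊗ tens (fun t => P.Hom (single (b t)) (y t)) ⟶
      tens (fun t => P.Hom (single (Fin.append a b t)) (z t)) :=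
  (tensMap (fun t => eqToHom (by rw [Fin.append_left, hx])) ⊗ₘ
    tensMap (fun t => eqToHom (by rw [Fin.append_right, hy]))) ≫ appendTens _

theorem exists_appendArr {P : SymMulticat.{v, u} V} {l k : ℕ} {a x : Fin l → P.Ob}
    {b y : Fin k → P.Ob} {z : Fin (l + k) → P.Ob} (hx : ∀ t, x t = z (Fin.castAdd k t))
    (hy : ∀ t, y t = z (Fin.natAdd l t)) (e : ∀ t, Elt (P.Hom (single (a t)) (x t)))
    (e' : ∀ t, Elt (P.Hom (single (b t)) (y t))) :
    ∃ f : ∀ t, Elt (P.Hom (single (Fin.append a b t)) (z t)),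
      appendArr a x b y z hx hy ⋄ (tensEl e ⊙ tensEl e') = tensEl f ∧
      ∀ t, (⟨_, _, f t⟩ : UArr P) =
        Fin.append (fun t => (⟨_, _, e t⟩ : UArr P)) (fun t => ⟨_, _, e' t⟩) t := by
  refine ⟨Fin.addCases (fun t => eqToHom (by rw [Fin.append_left, hx]) ⋄ e t)
    (fun t => eqToHom (by rw [Fin.append_right, hy]) ⋄ e' t), ?_, fun t => ?_⟩
  · rw [← appendTens_ap]
    unfold appendArr
    simp only [comp_ap, tensorHom_ap, tensMap_ap, Fin.addCases_left, Fin.addCases_right]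
  · refine Fin.addCases (fun t => ?_) (fun t => ?_) t
    · refine (congrArg (UArr.mk _ _) (Fin.addCases_left t)).trans (Eq.trans ?_
        (Fin.append_left _ _ _).symm)
      exact UArr.mk_eqToHom (Fin.append_left _ _ _).symm (hx t) _ _
    · refine (congrArg (UArr.mk _ _) (Fin.addCases_right t)).trans (Eq.trans ?_
        (Fin.append_right _ _ _).symm)
      exact UArr.mk_eqToHom (Fin.append_right _ _ _).symm (hy t) _ _

namespace UnaryInclusion

variable {M A : SymMulticat.{v, u} V} (i : UnaryInclusion M A) [HasColimits V]

theorem mk_comp_ap {k : ℕ} {b : Fin k → A.Ob} {d : A.Ob} {Y Z : V} (φ : Y ⟶ Z)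
    (ψ : Z ⟶ i.NHom b d) {e : Elt Y} {e' : Elt Z} (h : φ ⋄ e = e') :
    (⟨b, (φ ≫ ψ) ⋄ e⟩ : i.RawOp k d) = ⟨b, ψ ⋄ e'⟩ := by
  rw [comp_ap, h]

variable [MonoidalClosed V]
  {l k : ℕ} (a : Fin l → A.Ob) (x : A.Ob) (b : Fin k → A.Ob) (c : A.Ob)

/-- Composition of formal composites. -/
def compFormal (p : (Fin l → M.Ob) × M.Ob) (p' : (Fin (k + 1) → M.Ob) × M.Ob) :
    i.genObj a x p ⊗ i.genObj (cons x b) c p' ⟶ i.NHom (Fin.append a b) c :=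
  splice (unconsTens _) (A.post (single (i.obj p.2)) rfl (i.obj (p'.1 0)) ≫ i.inv p.2 (p'.1 0))
    (M.post p.1 rfl (p'.1 0))
    (_ ◁ M.cast (a' := cons (p'.1 0) (Fin.tail p'.1))
      (fun t => congrFun (Fin.cons_self_tail p'.1) t) ≫ M.comp p.1 (p'.1 0) (Fin.tail p'.1) p'.2)
    (appendArr a (fun t => i.obj (p.1 t)) b (fun t => i.obj (p'.1 t.succ))
      (fun t => i.obj (Fin.append p.1 (Fin.tail p'.1) t))
      (fun t => by rw [Fin.append_left]) (fun t => by rw [Fin.append_right]; rfl)) ≫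
    i.ι (Fin.append a b) c (Fin.append p.1 (Fin.tail p'.1), p'.2)

variable {i a x b c}

theorem compFormal_ap {p : (Fin l → M.Ob) × M.Ob} {p' : (Fin (k + 1) → M.Ob) × M.Ob}
    (U : ∀ t, Elt (A.Hom (single (a t)) (i.obj (p.1 t)))) (m : Elt (M.Hom p.1 p.2))
    (v : Elt (A.Hom (single (i.obj p.2)) x))
    (U' : ∀ t, Elt (A.Hom (single (cons x b t)) (i.obj (p'.1 t)))) (m' : Elt (M.Hom p'.1 p'.2))
    (v' : Elt (A.Hom (single (i.obj p'.2)) c)) :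
    (⟨_, i.compFormal a x b c p p' ⋄ ((tensEl U ⊙ (m ⊙ v)) ⊙ (tensEl U' ⊙ (m' ⊙ v')))⟩ :
        i.RawOp (l + k) c) =
      ((Gen.tt (fun t => ⟨a t, _, U t⟩) ⟨p.1, m⟩ ⟨_, _, v⟩ (fun _ => rfl) (fun _ => rfl)
        rfl rfl : i.Gen a x).comp (Gen.tt (fun t => ⟨cons x b t, _, U' t⟩) ⟨p'.1, m'⟩ ⟨_, _, v'⟩
        (fun _ => rfl) (fun _ => rfl) rfl rfl : i.Gen (cons x b) c)).op := by
  obtain ⟨f, hf, hf'⟩ := exists_appendArr (a := a) (b := b)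
    (z := fun t => i.obj (Fin.append p.1 (Fin.tail p'.1) t))
    (fun t => by rw [Fin.append_left]) (fun t => by rw [Fin.append_right]; rfl) U
    (fun t => U' t.succ)
  refine (i.mk_comp_ap _ _ ((splice_ap _ _ _ _ _ _ _ _ _ _ _ (U' 0) (tensEl fun t => U' t.succ)
      (unconsTens_ap _ U')).trans (congrArg₂ Elt.tmul hf rfl))).trans ?_
  refine (i.mk_ι (p := (Fin.append p.1 (Fin.tail p'.1), p'.2)) _ _ _).trans
    (tt_arrow_congr hf' ?_ rfl)
  have e : ∀ z, (⟨_, (_ ◁ M.cast (a' := cons (p'.1 0) (Fin.tail p'.1))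
      (fun t => congrFun (Fin.cons_self_tail p'.1) t) ≫
      M.comp p.1 (p'.1 0) (Fin.tail p'.1) p'.2) ⋄ (z ⊙ m')⟩ : Op M.toSymMultigraph (l + k) p'.2) =
      Op.comp ⟨p.1, z⟩ ⟨p'.1, m'⟩ rfl := fun z => by
    simp only [comp_ap, whiskerLeft_ap]
    rfl
  refine (e _).trans (Eq.trans (Op.comp_congr (Op.mk_post _ _ _) rfl _ _) (Gen.mid_eq _ _ _ _ _ _ _
    ⟨p.2, p'.1 0, (A.post (single (i.obj p.2)) rfl (i.obj (p'.1 0)) ≫ i.inv p.2 (p'.1 0)) ⋄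
      (v ⊙ U' 0)⟩ ?_ rfl rfl).symm)
  refine (UArr.mk_comp v (U' 0)).symm.trans (congrArg (UArr.mk _ _) ?_)
  rw [comp_ap]
  exact (i.map_inv_ap _ _ _).symm

theorem mk_actHom_ap {a' : Fin k → A.Ob} (σ : Fin k ≃ Fin l) (h : ∀ t, a' t = a (σ t))
    (g : i.Gen a c) {e : Elt (i.NHom a c)} (he : e = g.el) :
    (⟨a', i.actHom σ h ⋄ e⟩ : i.RawOp k c) = (g.act σ h).op := by
  rw [he, actHom_el, Gen.mk_el]

theorem exists_comp_formal_arrow (h : k + 1 = 1) (p : (Fin l → M.Ob) × M.Ob) :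
    ∃ φ : i.genObj a x p ⊗ A.Hom (single (cons x b (pos h))) c ⟶ i.NHom (Fin.append a b) c,
      ∀ (U : ∀ t, Elt (A.Hom (single (a t)) (i.obj (p.1 t)))) (m : Elt (M.Hom p.1 p.2))
        (v : Elt (A.Hom (single (i.obj p.2)) x)) (w : Elt (A.Hom (single (cons x b (pos h))) c)),
      (⟨_, φ ⋄ ((tensEl U ⊙ (m ⊙ v)) ⊙ w)⟩ : i.RawOp (l + k) c) =
        ((Gen.tt (fun t => ⟨a t, _, U t⟩) ⟨p.1, m⟩ ⟨_, _, v⟩ (fun _ => rfl) (fun _ => rfl)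
          rfl rfl : i.Gen a x).comp (Gen.bb h ⟨_, _, w⟩ rfl rfl : i.Gen (cons x b) c)).op := by
  refine ⟨spliceRight (A.post (single (i.obj p.2)) rfl c) ≫ i.ι a c p ≫
    i.actHom (finCongr (by omega)) (append_zero (by omega) a b), fun U m v w => ?_⟩
  refine (i.mk_comp_ap _ _ (spliceRight_ap _ _ _ _ _)).trans ((i.mk_comp_ap _ _ rfl).trans ?_)
  refine (mk_actHom_ap _ _ (Gen.tt (fun t => ⟨a t, _, U t⟩) ⟨p.1, m⟩
    ⟨_, _, A.post (single (i.obj p.2)) rfl c ⋄ (v ⊙ w)⟩ (fun _ => rfl) (fun _ => rfl) rfl rfl)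
      rfl).trans ?_
  exact tt_arrow_congr (fun _ => rfl) rfl (UArr.mk_comp v w)

theorem exists_comp_arrow_formal (h : l = 1) (p' : (Fin (k + 1) → M.Ob) × M.Ob) :
    ∃ φ : A.Hom (single (a (pos h))) x ⊗ i.genObj (cons x b) c p' ⟶ i.NHom (Fin.append a b) c,
      ∀ (w : Elt (A.Hom (single (a (pos h))) x))
        (U' : ∀ t, Elt (A.Hom (single (cons x b t)) (i.obj (p'.1 t)))) (m' : Elt (M.Hom p'.1 p'.2))
        (v' : Elt (A.Hom (single (i.obj p'.2)) c)),
      (⟨_, φ ⋄ (w ⊙ (tensEl U' ⊙ (m' ⊙ v')))⟩ : i.RawOp (l + k) c) =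
        ((Gen.bb h ⟨_, _, w⟩ rfl rfl : i.Gen a x).comp
          (Gen.tt (fun t => ⟨cons x b t, _, U' t⟩) ⟨p'.1, m'⟩ ⟨_, _, v'⟩ (fun _ => rfl)
            (fun _ => rfl) rfl rfl : i.Gen (cons x b) c)).op := by
  refine ⟨spliceLeft (unconsTens _) (A.post (single (a (pos h))) rfl (i.obj (p'.1 0)))
    (consTens fun t => A.Hom (single (cons (a (pos h)) b t)) (i.obj (p'.1 t))) ≫
      i.ι (cons (a (pos h)) b) c p' ≫
        i.actHom (oneAddEquiv h k) (cons_oneAddEquiv h a b), fun w U' m' v' => ?_⟩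
  have e : ∃ f : ∀ t, Elt (A.Hom (single (cons (a (pos h)) b t)) (i.obj (p'.1 t))),
      (consTens fun t => A.Hom (single (cons (a (pos h)) b t)) (i.obj (p'.1 t))) ⋄
        ((A.post (single (a (pos h))) rfl (i.obj (p'.1 0)) ⋄ (w ⊙ U' 0)) ⊙
          tensEl fun t => U' t.succ) = tensEl f ∧
      ∀ t, (⟨_, _, f t⟩ : UArr A) = (Fin.cons ((⟨_, _, w⟩ : UArr A).comp ⟨_, _, U' 0⟩ rfl)
        (fun t => ⟨cons x b t.succ, _, U' t.succ⟩) : Fin (k + 1) → UArr A) t :=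
    let f : ∀ t, Elt (A.Hom (single (cons (a (pos h)) b t)) (i.obj (p'.1 t))) :=
      Fin.cons (A.post (single (a (pos h))) rfl (i.obj (p'.1 0)) ⋄ (w ⊙ U' 0)) fun t => U' t.succ
    ⟨f, consTens_ap (fun t => A.Hom (single (cons (a (pos h)) b t)) (i.obj (p'.1 t))) f,
      Fin.cases (UArr.mk_comp w (U' 0)) fun t => rfl⟩
  obtain ⟨f, hf, hf'⟩ := e
  refine (i.mk_comp_ap _ _ ((spliceLeft_ap _ _ _ _ _ _ (U' 0) (tensEl fun t => U' t.succ)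
    (unconsTens_ap _ U')).trans (congrArg₂ Elt.tmul hf rfl))).trans
      ((i.mk_comp_ap _ _ rfl).trans ?_)
  refine (mk_actHom_ap _ _ (Gen.tt (fun t => ⟨_, _, f t⟩) ⟨p'.1, m'⟩ ⟨_, _, v'⟩ (fun _ => rfl)
    (fun _ => rfl) rfl rfl) rfl).trans ?_
  exact tt_arrow_congr (fun t => hf' _) rfl rfl

theorem exists_comp_arrow_arrow (h : l = 1) (h' : k + 1 = 1) :
    ∃ φ : A.Hom (single (a (pos h))) x ⊗ A.Hom (single (cons x b (pos h'))) c ⟶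
        i.NHom (Fin.append a b) c,
      ∀ (w : Elt (A.Hom (single (a (pos h))) x)) (w' : Elt (A.Hom (single (cons x b (pos h'))) c)),
      (⟨_, φ ⋄ (w ⊙ w')⟩ : i.RawOp (l + k) c) = ((Gen.bb h ⟨_, _, w⟩ rfl rfl : i.Gen a x).comp
          (Gen.bb h' ⟨_, _, w'⟩ rfl rfl : i.Gen (cons x b) c)).op := by
  refine ⟨A.post (single (a (pos h))) rfl c ≫ i.κ h a c ≫
    i.actHom (finCongr (by omega)) (append_zero (by omega) a b), fun w w' => ?_⟩
  refine (i.mk_comp_ap _ _ rfl).trans ((i.mk_comp_ap _ _ rfl).trans ?_)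
  refine (mk_actHom_ap _ _ (Gen.bb h ⟨_, _, A.post (single (a (pos h))) rfl c ⋄ (w ⊙ w')⟩
    rfl rfl) rfl).trans ?_
  exact i.bb_congr (UArr.mk_comp w w') _ _ _ _

theorem Gen.compat_comp (g : i.Gen a x) :
    i.Compat (fun g' : i.Gen (cons x b) c => (g.comp g').op) := by
  cases g with
  | tt U m v hb hU hv hd => exact compat_comp_tt U m v hb hU hv hd
  | bb h w hb hd => exact compat_comp_bb h w hb hd

theorem Gen.compat_comp_right (g' : i.Gen (cons x b) c) :
    i.Compat (fun g : i.Gen a x => (g.comp g').op) := by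
  cases g' with
  | tt U m v hb hU hv hd => exact compat_comp_right_tt U m v hb hU hv hd
  | bb h w hb hd => exact compat_comp_right_bb h w hb hd

theorem exists_comp_formal (p : (Fin l → M.Ob) × M.Ob) :
    ∃ φ : i.genObj a x p ⊗ i.NHom (cons x b) c ⟶ i.NHom (Fin.append a b) c,
      ∀ (U : ∀ t, Elt (A.Hom (single (a t)) (i.obj (p.1 t)))) (m : Elt (M.Hom p.1 p.2))
        (v : Elt (A.Hom (single (i.obj p.2)) x)) (g' : i.Gen (cons x b) c),
      (⟨_, φ ⋄ ((tensEl U ⊙ (m ⊙ v)) ⊙ g'.el)⟩ : i.RawOp (l + k) c) =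
        ((Gen.tt (fun t => ⟨a t, _, U t⟩) ⟨p.1, m⟩ ⟨_, _, v⟩ (fun _ => rfl) (fun _ => rfl)
          rfl rfl : i.Gen a x).comp g').op := by
  choose ψ hψ using fun h : k + 1 = 1 =>
    exists_comp_formal_arrow (i := i) (a := a) (x := x) (b := b) (c := c) h p
  obtain ⟨χ, hχ⟩ := i.exists_desc_right (ε := (∀ t, Elt (A.Hom (single (a t)) (i.obj (p.1 t)))) ×
      Elt (M.Hom p.1 p.2) × Elt (A.Hom (single (i.obj p.2)) x))
    (fun s => tensEl s.1 ⊙ (s.2.1 ⊙ s.2.2))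
    (((spans_tens fun t => spans_top _).tensor ((spans_top _).tensor (spans_top _))).mono (by
      rintro _ ⟨_, _, ⟨U, -, rfl⟩, ⟨m, v, -, -, rfl⟩, rfl⟩
      exact ⟨(U, m, v), rfl⟩))
    _ (rawOp_injective (Fin.append a b) c)
    (fun s g' => ((Gen.tt (fun t => ⟨a t, _, s.1 t⟩) ⟨p.1, s.2.1⟩ ⟨_, _, s.2.2⟩ (fun _ => rfl)
      (fun _ => rfl) rfl rfl : i.Gen a x).comp g').op)
    (fun s => Gen.compat_comp _) (i.compFormal a x b c p) ψ
    (fun s p' U' m' v' => compFormal_ap s.1 s.2.1 s.2.2 U' m' v')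
    (fun s h w => hψ h s.1 s.2.1 s.2.2 w)
  exact ⟨χ, fun U m v g' => hχ (U, m, v) g'⟩

theorem exists_comp_arrow (h : l = 1) :
    ∃ φ : A.Hom (single (a (pos h))) x ⊗ i.NHom (cons x b) c ⟶ i.NHom (Fin.append a b) c,
      ∀ (w : Elt (A.Hom (single (a (pos h))) x)) (g' : i.Gen (cons x b) c),
      (⟨_, φ ⋄ (w ⊙ g'.el)⟩ : i.RawOp (l + k) c) =
        ((Gen.bb h ⟨_, _, w⟩ rfl rfl : i.Gen a x).comp g').op := by
  choose φ hφ using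
    exists_comp_arrow_formal (i := i) (a := a) (x := x) (b := b) (c := c) h
  choose ψ hψ using fun h' : k + 1 = 1 =>
    exists_comp_arrow_arrow (i := i) (a := a) (x := x) (b := b) (c := c) h h'
  exact i.exists_desc_right (fun s => s) ((spans_top _).mono fun e _ => ⟨e, rfl⟩)
    _ (rawOp_injective (Fin.append a b) c)
    (fun s g' => ((Gen.bb h ⟨_, _, s⟩ rfl rfl : i.Gen a x).comp g').op)
    (fun s => Gen.compat_comp _) φ ψ
    (fun s p' U' m' v' => hφ p' s U' m' v') (fun s h' w => hψ h' s w)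

variable (i a x b c) in
theorem exists_comp :
    ∃ χ : i.NHom a x ⊗ i.NHom (cons x b) c ⟶ i.NHom (Fin.append a b) c,
      ∀ (g : i.Gen a x) (g' : i.Gen (cons x b) c), χ ⋄ (g.el ⊙ g'.el) = (g.comp g').el := by
  choose φ hφ using exists_comp_formal (i := i) (a := a) (x := x) (b := b) (c := c)
  choose ψ hψ using exists_comp_arrow (i := i) (a := a) (x := x) (b := b) (c := c)
  obtain ⟨χ, hχ⟩ := i.exists_desc_left (fun g' : i.Gen (cons x b) c => g'.el) i.spans_gen
    _ (rawOp_injective (Fin.append a b) c) (fun g' g => (g.comp g').op)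
    (fun g' => Gen.compat_comp_right g') φ ψ (fun g' p U m v => hφ p U m v g')
    (fun g' h w => hψ h w g')
  exact ⟨χ, fun g g' => rawOp_injective _ _ ((hχ g' g).trans (Gen.mk_el _).symm)⟩

variable (i a x b c) in
/-- Composition of the multimorphisms of the pushout. -/
def compHom : i.NHom a x ⊗ i.NHom (cons x b) c ⟶ i.NHom (Fin.append a b) c :=
  (i.exists_comp a x b c).choose

theorem compHom_el (g : i.Gen a x) (g' : i.Gen (cons x b) c) :
    i.compHom a x b c ⋄ (g.el ⊙ g'.el) = (g.comp g').el :=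
  (i.exists_comp a x b c).choose_spec g g'

end UnaryInclusion

@[simp] theorem oneAddEquiv_castAdd {l k : ℕ} (h : l = 1) (t : Fin l) :
    oneAddEquiv h k (Fin.castAdd k t) = 0 := by
  ext; simp; omega

@[simp] theorem oneAddEquiv_natAdd {l k : ℕ} (h : l = 1) (t : Fin k) :
    oneAddEquiv h k (Fin.natAdd l t) = t.succ := by
  ext; simp; omega

theorem consEquiv_oneAddEquiv {l' l k' k : ℕ} (h : l = 1) (h' : l' = 1) (σ : Fin l' ≃ Fin l)
    (τ : Fin k' ≃ Fin k) (t : Fin (l' + k')) :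
    consEquiv τ (oneAddEquiv h' k' t) = oneAddEquiv h k (appendEquiv σ τ t) := by
  refine Fin.addCases (fun t => ?_) (fun t => ?_) t
  · rw [appendEquiv_castAdd, oneAddEquiv_castAdd, oneAddEquiv_castAdd, consEquiv_zero]
  · rw [appendEquiv_natAdd, oneAddEquiv_natAdd, oneAddEquiv_natAdd, consEquiv_succ]

theorem appendEquiv_zero {l' l k' k : ℕ} (h : l + k = l) (h' : l' + k' = l') (σ : Fin l' ≃ Fin l)
    (τ : Fin k' ≃ Fin k) (t : Fin (l' + k')) :
    finCongr h (appendEquiv σ τ t) = σ (finCongr h' t) := by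
  refine Fin.addCases (fun t => ?_) (fun t => ?_) t
  · rw [appendEquiv_castAdd]; rfl
  · exact absurd t.isLt (by omega)

theorem append_comp_appendEquiv {α : Type*} {l' l k' k : ℕ} (σ : Fin l' ≃ Fin l)
    (τ : Fin k' ≃ Fin k) (U : Fin l → α) (U' : Fin (k + 1) → α) (t : Fin (l' + k')) :
    Fin.append (U ∘ σ) (Fin.tail (U' ∘ consEquiv τ)) t =
      Fin.append U (Fin.tail U') (appendEquiv σ τ t) := by
  refine Fin.addCases (fun t => ?_) (fun t => ?_) t
  · rw [appendEquiv_castAdd, Fin.append_left, Fin.append_left]; rfl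
  · rw [appendEquiv_natAdd, Fin.append_right, Fin.append_right]
    simp [Fin.tail]

theorem append_append_apply {α : Type*} {l k m : ℕ} (a : Fin l → α) (b : Fin k → α)
    (c : Fin m → α) (h : l + k + m = l + (k + m)) (t : Fin (l + k + m)) :
    Fin.append (Fin.append a b) c t = Fin.append a (Fin.append b c) (finCongr h t) := by
  rw [Fin.append_assoc]; rfl

theorem append_tail {α : Type*} {k m : ℕ} (U : Fin (k + 1) → α) (W : Fin m → α)
    (h : k + m + 1 = k + 1 + m) (t : Fin (k + m)) :
    Fin.append (Fin.tail U) W t = Fin.append U W (finCongr h t.succ) := by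
  refine Fin.addCases (fun t => ?_) (fun t => ?_) t
  · have : finCongr h (Fin.castAdd m t).succ = Fin.castAdd m t.succ := rfl
    rw [this, Fin.append_left, Fin.append_left]; rfl
  · have : finCongr h (Fin.natAdd k t).succ = Fin.natAdd (k + 1) t := by ext; simp; omega
    rw [this, Fin.append_right, Fin.append_right]

theorem cons_comp_oneAddEquiv {α : Type*} {l k : ℕ} (h : l = 1) (u : α) (W : Fin k → α) :
    (Fin.cons u W : Fin (k + 1) → α) ∘ oneAddEquiv h k = Fin.append (fun _ : Fin l => u) W :=
  funext fun t => (cons_oneAddEquiv h (fun _ => u) W t).symm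

theorem append_append_tail {α : Type*} {l k m : ℕ} (U : Fin l → α) (U' : Fin (k + 1) → α)
    (W : Fin m → α) (h : k + m + 1 = k + 1 + m) (h' : l + k + m = l + (k + m))
    (t : Fin (l + k + m)) :
    Fin.append (Fin.append U (Fin.tail U')) W t =
      Fin.append U (Fin.tail (Fin.append U' W ∘ finCongr h)) (finCongr h' t) := by
  have e : Fin.tail (Fin.append U' W ∘ finCongr h) = Fin.append (Fin.tail U') W :=
    funext fun t => (append_tail U' W h t).symm
  rw [e]
  exact append_append_apply _ _ _ _ _

theorem Op.comp_finCongr {P : SymMulticat.{v, u} V} {l l' k k' : ℕ} {x c : P.Ob} {hl : l' = l}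
    {hk : k' + 1 = k + 1} (hlk : l' + k' = l + k) {f : Op P.toSymMultigraph l x}
    {g : Op P.toSymMultigraph (k + 1) c} {f' : Op P.toSymMultigraph l' x}
    {g' : Op P.toSymMultigraph (k' + 1) c} (ef : f' = act (finCongr hl) f)
    (eg : g' = act (finCongr hk) g) (h : g.1 0 = x) (h' : g'.1 0 = x) :
    comp f' g' h' = act (finCongr hlk) (comp f g h) := by
  obtain rfl : k' = k := by omega
  subst hl ef eg
  rw [act_id (σ := finCongr hlk) (fun _ => rfl)]
  exact comp_congr (act_id (fun _ => rfl) _) (act_id (fun _ => rfl) _) _ _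

theorem Op.act_finCongr_self {P : SymMulticat.{v, u} V} {k : ℕ} {x : P.Ob} (h : k = k)
    (q : Op P.toSymMultigraph k x) : q = act (finCongr h) q :=
  (act_id (fun _ => rfl) q).symm

namespace UnaryInclusion

variable {M A : SymMulticat.{v, u} V} {i : UnaryInclusion M A}

variable (i) in
theorem exists_lift {x z : M.Ob} (f : UArr A) (hx : f.src = i.obj x) (hz : f.tgt = i.obj z) :
    ∃ g : UArr M, f = i.arr g ∧ g.src = x ∧ z = g.tgt :=
  ⟨i.lift f hx hz, (i.arr_lift f hx hz).symm, rfl, rfl⟩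

variable [HasColimits V]

namespace Gen

variable {l l' k k' m : ℕ} {a : Fin l → A.Ob} {a' : Fin l' → A.Ob} {x : A.Ob} {b : Fin k → A.Ob}
  {b' : Fin k' → A.Ob} {y z : A.Ob} {c : Fin m → A.Ob}

theorem act_comp_op (σ : Fin l' ≃ Fin l) (τ : Fin k' ≃ Fin k) (ha : ∀ t, a' t = a (σ t))
    (hb : ∀ t, cons x b' t = cons x b (consEquiv τ t))
    (hab : ∀ t, Fin.append a' b' t = Fin.append a b (appendEquiv σ τ t))
    (f : i.Gen a x) (g : i.Gen (cons x b) y) :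
    ((f.act σ ha).comp (g.act (consEquiv τ) hb)).op =
      ((f.comp g).act (appendEquiv σ τ) hab).op := by
  cases f with
  | tt U m v hUa hU hv hd =>
    cases g with
    | tt U' m' v' hUb' hU' hv' hd' =>
      refine tt_arrow_congr (append_comp_appendEquiv σ τ U U') ?_ rfl
      have hu : (U' 0).src = v.tgt := (hUb' 0).trans hd.symm
      obtain ⟨L, hL, hL₁, hL₂⟩ := i.exists_lift (v.comp (U' 0) hu) hv (hU' 0)
      have e := UArr.comp_congr (rfl : v = v) (congrArg U' (consEquiv_zero τ))
        (by rw [consEquiv_zero]; exact hu) hu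
      refine (mid_eq _ v _ _ _ _ _ L (e.trans hL) hL₁ (by
        rw [Op.act_fst, Function.comp, consEquiv_zero]; exact hL₂)).trans (Eq.trans ?_
        (congrArg (Op.act (appendEquiv σ τ)) (mid_eq _ v _ _ _ _ _ L hL hL₁ hL₂)).symm)
      have h0 : (Op.act (consEquiv τ) m').1 0 = L.tgt := by
        rw [Op.act_fst, Function.comp, consEquiv_zero]; exact hL₂
      rw [← Op.act_comp _ _ _ _ _ h0]
      exact Op.comp_congr (Op.act_post _ _ _ _) rfl _ _
    | bb h w hb' hd' =>
      have hk : k + 1 = k' + 1 := by simpa using (Fintype.card_congr τ).symm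
      refine tt_arrow_congr (fun t => ?_) ?_ rfl
      · exact congrArg U (appendEquiv_zero (by omega) (by omega) σ τ t).symm
      · rw [Op.act_act, Op.act_act]
        exact Op.act_congr (fun t => congrArg Fin.val
          (appendEquiv_zero (by omega) (by omega) σ τ t).symm) _
  | bb h w hwa hd =>
    have hl : l' = 1 := by rw [← h]; simpa using Fintype.card_congr σ
    cases g with
    | tt U' m' v' hUb' hU' hv' hd' =>
      have hu : (U' 0).src = w.tgt := (hUb' 0).trans hd.symm
      have hu' : (U' (consEquiv τ 0)).src = w.tgt := by rw [consEquiv_zero]; exact hu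
      refine tt_arrow_congr (fun t => ?_) ?_ rfl
      · have : ∀ s, (Fin.cons (w.comp (U' (consEquiv τ 0)) hu') (Fin.tail (U' ∘ consEquiv τ)) :
            Fin (k' + 1) → UArr A) s = (Fin.cons (w.comp (U' 0) hu) (Fin.tail U') :
              Fin (k + 1) → UArr A) (consEquiv τ s) := by
          refine Fin.cases ?_ (fun t => ?_)
          · refine Eq.trans (UArr.comp_congr rfl (congrArg U' (consEquiv_zero τ)) hu' hu) ?_
            rw [consEquiv_zero, Fin.cons_zero]
          · rw [consEquiv_succ, Fin.cons_succ, Fin.cons_succ]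
            simp [Fin.tail]
        exact (this _).trans (congrArg _ (consEquiv_oneAddEquiv h hl σ τ t))
      · rw [Op.act_act, Op.act_act]
        exact Op.act_congr (fun t => congrArg Fin.val (consEquiv_oneAddEquiv h hl σ τ t)) _
    | bb h' w' hb' hd' => exact i.bb_congr rfl _ _ _ _

theorem one_comp_op (ha : ∀ t, Fin.append (single x) b t = cons x b (finCongr (Nat.add_comm 1 k) t))
    (g : i.Gen (cons x b) y) :
    ((bb rfl (UArr.one A x) rfl rfl : i.Gen (single x) x).comp g).op =
      (g.act (finCongr (Nat.add_comm 1 k)) ha).op := by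
  cases g with
  | tt U' m' v' hUb' hU' hv' hd' =>
    refine tt_arrow_congr (fun t => ?_) rfl rfl
    have : ∀ s, (Fin.cons ((UArr.one A x).comp (U' 0) (hUb' 0)) (Fin.tail U') :
        Fin (k + 1) → UArr A) s = U' s := by
      refine Fin.cases ?_ (fun t => rfl)
      exact UArr.one_comp _ _
    exact this _
  | bb h' w' hb' hd' => exact i.bb_congr (UArr.one_comp w' _) _ _ _ _

theorem comp_one_op (hx : ∀ t, cons x nil t = single x (Equiv.refl (Fin 1) t))
    (ha : ∀ t, Fin.append a nil t = a (Equiv.refl (Fin l) t)) (f : i.Gen a x) :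
    (f.comp ((bb rfl (UArr.one A x) rfl rfl : i.Gen (single x) x).act (Equiv.refl _) hx)).op =
      (f.act (Equiv.refl (Fin l)) ha).op := by
  cases f with
  | tt U m v hUa hU hv hd =>
    refine tt_arrow_congr (fun t => rfl) ?_ (UArr.comp_one v _)
    exact Op.act_congr (fun _ => rfl) _
  | bb h w hwa hd => exact i.bb_congr (UArr.comp_one w _) _ _ _ _

end Gen

end UnaryInclusion

namespace UnaryInclusion

variable {M A : SymMulticat.{v, u} V} {i : UnaryInclusion M A}

variable [HasColimits V]

namespace Gen

variable {l k m : ℕ} {a : Fin l → A.Ob} {x : A.Ob} {y z : A.Ob}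

theorem _root_.SymMulti.append_append_zero {α : Type*} {l m : ℕ} (U : Fin l → α) (W : Fin m → α)
    (h : l + 0 = l) (h' : 0 + m = m) (h'' : l + 0 + m = l + (0 + m)) (t : Fin (l + 0 + m)) :
    Fin.append (U ∘ finCongr h) W t = Fin.append U (W ∘ finCongr h') (finCongr h'' t) := by
  refine Fin.addCases (fun t => ?_) (fun t => ?_) t
  · rw [Fin.append_left]
    exact (Fin.append_left U (W ∘ finCongr h') t).symm
  · rw [Fin.append_right]
    have : finCongr h'' (Fin.natAdd (l + 0) t) = Fin.natAdd l (finCongr h'.symm t) := rfl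
    rw [this, Fin.append_right]
    rfl

theorem assoc_bb_op {b : Fin 0 → A.Ob} {c : Fin m → A.Ob}
    (h₁ : ∀ t, cons x (Fin.append b c) t =
      Fin.append (cons x b) c (finCongr (Nat.succ_add 0 m).symm t))
    (h₂ : ∀ t, Fin.append (Fin.append a b) c t =
      Fin.append a (Fin.append b c) (finCongr (Nat.add_assoc l 0 m) t))
    (f : i.Gen a x) (hk : 0 + 1 = 1) (w : UArr A) (hwa : w.src = cons x b (pos hk))
    (hd : w.tgt = y) {y'' : M.Ob} (U'' : Fin (m + 1) → UArr A)
    (m'' : Op M.toSymMultigraph (m + 1) y'') (v'' : UArr A) (hb : ∀ t, (U'' t).src = cons y c t)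
    (hU : ∀ t, (U'' t).tgt = i.obj (m''.1 t)) (hv : v''.src = i.obj y'') (hz : v''.tgt = z) :
    ((f.comp (bb hk w hwa hd)).comp (tt U'' m'' v'' hb hU hv hz)).op =
      ((f.comp (((bb hk w hwa hd).comp (tt U'' m'' v'' hb hU hv hz)).act
        (finCongr (Nat.succ_add 0 m).symm) h₁)).act (finCongr (Nat.add_assoc l 0 m)) h₂).op := by
  have hu : (U'' 0).src = w.tgt := (hb 0).trans hd.symm
  have e0 : oneAddEquiv hk m (finCongr (Nat.succ_add 0 m).symm 0) = 0 := by ext; simp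
  have es : ∀ t : Fin (0 + m), oneAddEquiv hk m (finCongr (Nat.succ_add 0 m).symm t.succ) =
      (finCongr (Nat.zero_add m) t).succ := fun t => by ext; simp
  cases f with
  | tt U m₁ v hUa hU₁ hv₁ hd₁ =>
    have hw : w.src = v.tgt := hwa.trans hd₁.symm
    obtain ⟨L, hL, hL₁, hL₂⟩ := i.exists_lift ((v.comp w hw).comp (U'' 0) hu) hv₁ (hU 0)
    have e1 : (Op.act (finCongr (Nat.succ_add 0 m).symm) (Op.act (oneAddEquiv hk m) m'')).1 0 =
        L.tgt := (congrArg m''.1 e0).trans hL₂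
    have e2 : ((Fin.cons (w.comp (U'' 0) hu) (Fin.tail U'') : Fin (m + 1) → UArr A) ∘
        oneAddEquiv hk m) (finCongr (Nat.succ_add 0 m).symm 0) = w.comp (U'' 0) hu :=
      congrArg (Fin.cons (w.comp (U'' 0) hu) (Fin.tail U'') : Fin (m + 1) → UArr A) e0
    refine tt_arrow_congr (fun t => ?_) ?_ rfl
    · have ew : Fin.tail ((Fin.cons (w.comp (U'' 0) hu) (Fin.tail U'') ∘ oneAddEquiv hk m) ∘
          finCongr (Nat.succ_add 0 m).symm : Fin (0 + m + 1) → UArr A) =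
          Fin.tail U'' ∘ finCongr (Nat.zero_add m) :=
        funext fun s => congrArg (Fin.cons (w.comp (U'' 0) hu) (Fin.tail U'') :
          Fin (m + 1) → UArr A) (es s)
      refine (append_append_zero U (Fin.tail U'') _ (Nat.zero_add m) (Nat.add_assoc l 0 m)
        t).trans ?_
      rw [← ew]
      rfl
    · refine (mid_eq _ _ _ m'' _ _ _ L hL hL₁ hL₂).trans (Eq.trans ?_
        (congrArg (Op.act (finCongr (Nat.add_assoc l 0 _))) (mid_eq m₁ v _ _ _ _ _ L
          ((UArr.comp_congr rfl e2 _ _).trans ((UArr.comp_assoc v w (U'' 0) hw hu hu hw).symm.trans hL)) hL₁ e1)).symm)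
      refine Op.comp_finCongr (hk := by omega) (Nat.add_assoc l 0 m) (Op.act_post _ _ _ _) ?_ _ _
      rw [Op.act_act, Op.act_act]
      exact (Op.act_id (fun _ => rfl) _).symm
  | bb hl w' hwa' hd' =>
    refine tt_arrow_congr (fun t => ?_) ?_ rfl
    · have ew : ∀ s, (Fin.cons (w'.comp ((Fin.cons (w.comp (U'' 0) hu) (Fin.tail U'') :
          Fin (m + 1) → UArr A) (oneAddEquiv hk m (finCongr (Nat.succ_add 0 m).symm 0))) (by
            rw [e0]; exact hwa.trans hd'.symm))
          (Fin.tail ((Fin.cons (w.comp (U'' 0) hu) (Fin.tail U'') ∘ oneAddEquiv hk m) ∘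
          finCongr (Nat.succ_add 0 m).symm : Fin (0 + m + 1) → UArr A)) :
            Fin (0 + m + 1) → UArr A) s =
          (Fin.cons ((w'.comp w (hwa.trans hd'.symm)).comp (U'' 0) hu) (Fin.tail U'') :
            Fin (m + 1) → UArr A) (finCongr (by omega) s) := by
        refine Fin.cases ?_ (fun t => ?_)
        · have e1 : finCongr (by omega : 0 + m + 1 = m + 1) 0 = 0 := by ext; simp
          rw [e1]
          exact (UArr.comp_congr rfl (congrArg (Fin.cons (w.comp (U'' 0) hu) (Fin.tail U'') :
            Fin (m + 1) → UArr A) e0) _ (hwa.trans hd'.symm)).trans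
              (UArr.comp_assoc _ _ _ _ _ _ _).symm
        · exact congrArg (Fin.cons (w.comp (U'' 0) hu) (Fin.tail U'') :
            Fin (m + 1) → UArr A) (es t)
      exact (ew (oneAddEquiv hl (0 + m) (finCongr (Nat.add_assoc l 0 m) t))).symm
    · rw [Op.act_act, Op.act_act, Op.act_act]
      exact Op.act_congr (fun _ => rfl) _

theorem assoc_tt_bb_op {b : Fin k → A.Ob} {c : Fin 0 → A.Ob}
    (h₁ : ∀ t, cons x (Fin.append b c) t =
      Fin.append (cons x b) c (finCongr (Nat.succ_add k 0).symm t))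
    (h₂ : ∀ t, Fin.append (Fin.append a b) c t =
      Fin.append a (Fin.append b c) (finCongr (Nat.add_assoc l k 0) t))
    (f : i.Gen a x) {y' : M.Ob} (U' : Fin (k + 1) → UArr A)
    (m' : Op M.toSymMultigraph (k + 1) y') (v' : UArr A) (hb : ∀ t, (U' t).src = cons x b t)
    (hU : ∀ t, (U' t).tgt = i.obj (m'.1 t)) (hv : v'.src = i.obj y') (hy : v'.tgt = y)
    (hm : 0 + 1 = 1) (w : UArr A) (hw : w.src = cons y c (pos hm)) (hz : w.tgt = z) :
    ((f.comp (tt U' m' v' hb hU hv hy)).comp (bb hm w hw hz)).op =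
      ((f.comp (((tt U' m' v' hb hU hv hy).comp (bb hm w hw hz)).act
        (finCongr (Nat.succ_add k 0).symm) h₁)).act (finCongr (Nat.add_assoc l k 0)) h₂).op := by
  cases f with
  | tt U m v hUa hU₁ hv₁ hd =>
    have hu : (U' 0).src = v.tgt := (hb 0).trans hd.symm
    obtain ⟨L, hL, hL₁, hL₂⟩ := i.exists_lift (v.comp (U' 0) hu) hv₁ (hU 0)
    refine tt_arrow_congr (fun t => ?_) ?_ rfl
    · rfl
    · refine (congrArg (Op.act (finCongr _)) (mid_eq _ _ _ m' _ _ _ L hL hL₁ hL₂)).trans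
        (Eq.trans ?_
        (congrArg (Op.act (finCongr (Nat.add_assoc l k 0))) (mid_eq m v (U' 0)
          (Op.act (finCongr (Nat.succ_add k 0).symm) (Op.act (finCongr (Nat.add_zero (k+1))) m')) _ _ _ L
          hL hL₁ hL₂)).symm)
      have e3 : m' = Op.act (finCongr (Nat.succ_add k 0).symm)
          (Op.act (finCongr (Nat.add_zero (k+1))) m') := by
        rw [Op.act_act]
        exact (Op.act_id (fun _ => rfl) _).symm
      exact congrArg (Op.act (finCongr (Nat.add_assoc l k 0)))
        (Op.comp_congr (rfl : Op.post m L hL₁ = Op.post m L hL₁) e3 hL₂ hL₂)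
  | bb hl w hwa' hd' =>
    refine tt_arrow_congr (fun t => ?_) ?_ rfl
    · rfl
    · rw [Op.act_act, Op.act_act, Op.act_act, Op.act_act]
      exact Op.act_congr (fun _ => rfl) _

end Gen

end UnaryInclusion

@[simp] theorem swap_zero_one_succ_succ {m : ℕ} (j : Fin m) :
    Equiv.swap (0 : Fin (m + 1 + 1)) 1 j.succ.succ = j.succ.succ :=
  Equiv.swap_apply_of_ne_of_ne (Fin.succ_ne_zero _) (fun h => by
    have := congrArg Fin.val h
    simp at this)

theorem append_tail_frontEquiv {α : Type*} {l k m : ℕ} (U₁ : Fin l → α) (U₂ : Fin k → α)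
    (U : Fin (m + 1 + 1) → α) (t : Fin (l + (k + m))) :
    Fin.append U₁ (Fin.tail (Fin.append U₂ (Fin.tail (U ∘ Equiv.swap 0 1)) ∘ frontEquiv k m)) t =
      Fin.append U₂ (Fin.tail (Fin.append U₁ (Fin.tail U) ∘ frontEquiv l m))
        (blockEquiv l k m t) := by
  refine Fin.addCases (fun t => ?_) (fun t => Fin.addCases (fun t => ?_) (fun t => ?_) t) t
  · rw [Fin.append_left, blockEquiv_castAdd, Fin.append_right, Fin.tail, Function.comp,
      frontEquiv_succ_castAdd, Fin.append_left]
  · rw [Fin.append_right, blockEquiv_natAdd_castAdd, Fin.append_left, Fin.tail, Function.comp,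
      frontEquiv_succ_castAdd, Fin.append_left]
  · rw [Fin.append_right, blockEquiv_natAdd_natAdd, Fin.append_right, Fin.tail, Function.comp,
      frontEquiv_succ_natAdd, Fin.append_right, Fin.tail, Function.comp, swap_zero_one_succ_succ,
      Fin.tail, Function.comp, frontEquiv_succ_natAdd, Fin.append_right]
    rfl

theorem append_tail_frontEquiv_zero {α : Type*} {l m : ℕ} (U₁ : Fin l → α)
    (U : Fin (m + 1 + 1) → α) : Fin.append U₁ (Fin.tail U) (frontEquiv l m 0) = U 1 := by
  rw [frontEquiv_zero, Fin.append_right]; rfl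

theorem append_tail_swap_frontEquiv_zero {α : Type*} {k m : ℕ} (U₂ : Fin k → α)
    (U : Fin (m + 1 + 1) → α) :
    Fin.append U₂ (Fin.tail (U ∘ Equiv.swap 0 1)) (frontEquiv k m 0) = U 0 := by
  rw [append_tail_frontEquiv_zero, Function.comp, Equiv.swap_apply_right]

theorem frontEquiv_oneAddEquiv {l m : ℕ} (h : l = 1) (t : Fin (l + m + 1)) :
    oneAddEquiv h (m + 1) (frontEquiv l m t) = Equiv.swap 0 1 (consEquiv (oneAddEquiv h m) t) := by
  refine Fin.cases ?_ (fun t => Fin.addCases (fun t => ?_) (fun t => ?_) t) t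
  · rw [frontEquiv_zero, oneAddEquiv_natAdd, consEquiv_zero, Equiv.swap_apply_left]; rfl
  · rw [frontEquiv_succ_castAdd, oneAddEquiv_castAdd, consEquiv_succ, oneAddEquiv_castAdd]
    exact (Equiv.swap_apply_right _ _).symm
  · rw [frontEquiv_succ_natAdd, oneAddEquiv_natAdd, consEquiv_succ, oneAddEquiv_natAdd,
      swap_zero_one_succ_succ]

theorem swap_oneAddEquiv_frontEquiv {l m : ℕ} (h : l = 1) (t : Fin (l + m + 1)) :
    Equiv.swap 0 1 (oneAddEquiv h (m + 1) (frontEquiv l m t)) = consEquiv (oneAddEquiv h m) t := by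
  rw [frontEquiv_oneAddEquiv, Equiv.swap_apply_self]

theorem frontEquiv_oneAddEquiv_blockEquiv {l k m : ℕ} (h : k = 1) (t : Fin (l + (k + m))) :
    frontEquiv l m (oneAddEquiv h (l + m) (blockEquiv l k m t)) =
      appendEquiv (Equiv.refl (Fin l)) (oneAddEquiv h m) t := by
  refine Fin.addCases (fun t => ?_) (fun t => Fin.addCases (fun t => ?_) (fun t => ?_) t) t
  · rw [blockEquiv_castAdd, oneAddEquiv_natAdd, frontEquiv_succ_castAdd, appendEquiv_castAdd]
    rfl
  · rw [blockEquiv_natAdd_castAdd, oneAddEquiv_castAdd, frontEquiv_zero, appendEquiv_natAdd,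
      oneAddEquiv_castAdd]
  · rw [blockEquiv_natAdd_natAdd, oneAddEquiv_natAdd, frontEquiv_succ_natAdd, appendEquiv_natAdd,
      oneAddEquiv_natAdd]

theorem frontEquiv_oneAddEquiv_left {l k m : ℕ} (h : l = 1) (t : Fin (l + (k + m))) :
    frontEquiv k m (oneAddEquiv h (k + m) t) =
      appendEquiv (Equiv.refl (Fin k)) (oneAddEquiv h m) (blockEquiv l k m t) := by
  refine Fin.addCases (fun t => ?_) (fun t => Fin.addCases (fun t => ?_) (fun t => ?_) t) t
  · rw [blockEquiv_castAdd, oneAddEquiv_castAdd, appendEquiv_natAdd, frontEquiv_zero,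
      oneAddEquiv_castAdd]
  · rw [blockEquiv_natAdd_castAdd, oneAddEquiv_natAdd, frontEquiv_succ_castAdd,
      appendEquiv_castAdd]
    rfl
  · rw [blockEquiv_natAdd_natAdd, oneAddEquiv_natAdd, frontEquiv_succ_natAdd, appendEquiv_natAdd,
      oneAddEquiv_natAdd]

namespace UnaryInclusion

variable {M A : SymMulticat.{v, u} V} {i : UnaryInclusion M A}

variable [HasColimits V]

namespace Gen

variable {l k m : ℕ} {a : Fin l → A.Ob} {x : A.Ob} {b : Fin k → A.Ob} {y z : A.Ob}
  {c : Fin m → A.Ob}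

theorem assoc_op
    (h₁ : ∀ t, cons x (Fin.append b c) t =
      Fin.append (cons x b) c (finCongr (Nat.succ_add k m).symm t))
    (h₂ : ∀ t, Fin.append (Fin.append a b) c t =
      Fin.append a (Fin.append b c) (finCongr (Nat.add_assoc l k m) t))
    (f : i.Gen a x) (g : i.Gen (cons x b) y) (h : i.Gen (cons y c) z) :
    ((f.comp g).comp h).op = ((f.comp ((g.comp h).act (finCongr (Nat.succ_add k m).symm) h₁)).act
      (finCongr (Nat.add_assoc l k m)) h₂).op := by
  cases g with
  | bb hk w hwa hd =>
    obtain rfl : k = 0 := by omega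
    cases h with
    | tt U'' m'' v'' hUb'' hU'' hv'' hd'' => exact assoc_bb_op h₁ h₂ f hk w hwa hd _ _ _ _ _ _ _
    | bb hm w' hw' hd' =>
      obtain rfl : m = 0 := by omega
      cases f with
      | tt U m v hUa hU hv hd =>
        refine tt_arrow_congr (fun t => rfl) ?_ (UArr.comp_assoc _ _ _ _ _ _ _)
        rw [Op.act_act]
      | bb hl w' hwa' hd' => exact i.bb_congr (UArr.comp_assoc _ _ _ _ _ _ _) _ _ _ _
  | tt U' m' v' hUb' hU' hv' hd' =>
    cases h with
    | bb hm w' hw' hd' =>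
      obtain rfl : m = 0 := by omega
      exact assoc_tt_bb_op h₁ h₂ f _ _ _ _ _ _ _ _ _ _ _
    | tt U'' m'' v'' hUb'' hU'' hv'' hd'' =>
      have hu' : (U'' 0).src = v'.tgt := (hUb'' 0).trans hd'.symm
      obtain ⟨L', hL', hL₁', hL₂'⟩ := i.exists_lift (v'.comp (U'' 0) hu') hv' (hU'' 0)
      cases f with
      | tt U m v hUa hU hv hd =>
        have hu : (U' 0).src = v.tgt := (hUb' 0).trans hd.symm
        obtain ⟨L, hL, hL₁, hL₂⟩ := i.exists_lift (v.comp (U' 0) hu) hv (hU' 0)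
        refine tt_arrow_congr (append_append_tail U U' (Fin.tail U'') _ _) ?_ rfl
        have e0 : (Fin.append U' (Fin.tail U'') ∘ finCongr (Nat.succ_add k _).symm) 0 = U' 0 :=
          Fin.append_left U' _ 0
        have e1 : (Op.act (finCongr (Nat.succ_add k _).symm)
            (mid m' v' (U'' 0) m'' hu' hv' (hU'' 0))).1 0 = L.tgt :=
          (mid_fst m' v' (U'' 0) m'' hu' hv' (hU'' 0) (Fin.castAdd _ 0)).trans
            ((Fin.append_left _ _ _).trans hL₂)
        have e2 := mid_eq m' v' (U'' 0) m'' hu' hv' (hU'' 0) L' hL' hL₁' hL₂'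
        refine (mid_eq _ v' _ m'' _ _ _ L' hL' hL₁' hL₂').trans (Eq.trans ?_
          (congrArg (Op.act (finCongr (Nat.add_assoc l k _))) (mid_eq m v _ _ _ _ _ L
            ((UArr.comp_congr rfl e0 _ _).trans hL) hL₁ e1)).symm)
        refine (Op.comp_congr ((congrArg (fun q => Op.post q L' hL₁')
          (mid_eq m v _ m' _ _ _ L hL hL₁ hL₂)).trans
            (Op.post_comp (Op.post m L hL₁) m' L' hL₂ hL₁')) rfl _ hL₂').trans ?_
        refine (Op.assoc (Op.post m L hL₁) (Op.post m' L' hL₁') m'' hL₂ hL₂'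
          (by rw [e2] at e1; exact e1)).trans (congrArg _ ?_)
        exact Op.comp_congr rfl (congrArg _ e2.symm) _ _
      | bb hl w hwa hd =>
        have hu : (U' 0).src = w.tgt := (hUb' 0).trans hd.symm
        refine tt_arrow_congr (fun t => ?_) ?_ rfl
        · have e1 := append_append_tail (fun _ : Fin l => w.comp (U' 0) hu) U' (Fin.tail U'')
            (Nat.succ_add k _).symm (Nat.add_assoc l k _) t
          rw [← cons_comp_oneAddEquiv hl, ← cons_comp_oneAddEquiv hl] at e1
          exact e1
        · refine (mid_eq _ v' _ m'' _ _ _ L' hL' hL₁' hL₂').trans (Eq.trans ?_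
            (congrArg (fun q => Op.act (finCongr (Nat.add_assoc l k _)) (Op.act (oneAddEquiv hl _)
              (Op.act (finCongr (Nat.succ_add k _).symm) q)))
                (mid_eq _ v' _ m'' _ _ _ L' hL' hL₁' hL₂')).symm)
          rw [Op.act_act, Op.act_act]
          refine (Op.comp_finCongr (by omega) (Op.act_post _ _ _ _) (Op.act_finCongr_self rfl _)
            hL₂' hL₂').trans (Op.act_congr (fun _ => rfl) _)

theorem comp_comm_op
    (h₁ : ∀ t, cons y (cons x c) t = cons x (cons y c) (Equiv.swap 0 1 t))
    (h₂ : ∀ t, cons x (Fin.append b c) t = Fin.append b (cons x c) (frontEquiv k m t))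
    (h₃ : ∀ t, cons y (Fin.append a c) t = Fin.append a (cons y c) (frontEquiv l m t))
    (h₄ : ∀ t, Fin.append a (Fin.append b c) t =
      Fin.append b (Fin.append a c) (blockEquiv l k m t))
    (f : i.Gen a x) (g : i.Gen b y) (h : i.Gen (cons x (cons y c)) z) :
    (f.comp ((g.comp (h.act (Equiv.swap 0 1) h₁)).act (frontEquiv k m) h₂)).op =
      ((g.comp ((f.comp h).act (frontEquiv l m) h₃)).act (blockEquiv l k m) h₄).op := by
  cases h with
  | bb hm => exact absurd hm (by omega)
  | tt U q v hU hU' hv hz =>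
    have e01 : Equiv.swap (0 : Fin (m + 1 + 1)) 1 0 = 1 := Equiv.swap_apply_left _ _
    have e10 : Equiv.swap (0 : Fin (m + 1 + 1)) 1 (Fin.succ 0) = 0 := Equiv.swap_apply_right _ _
    cases f with
    | tt U₁ q₁ v₁ hU₁ hU₁' hv₁ hd₁ =>
      have hu₁ : (U 0).src = v₁.tgt := (hU 0).trans hd₁.symm
      obtain ⟨L, hL, hL₁, hL₂⟩ := i.exists_lift (v₁.comp (U 0) hu₁) hv₁ (hU' 0)
      cases g with
      | tt U₂ q₂ v₂ hU₂ hU₂' hv₂ hd₂ =>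
        have hu₂ : (U 1).src = v₂.tgt := (hU 1).trans hd₂.symm
        obtain ⟨K, hK, hK₁, hK₂⟩ := i.exists_lift (v₂.comp (U 1) hu₂) hv₂ (hU' 1)
        refine tt_arrow_congr (append_tail_frontEquiv U₁ U₂ U) ?_ rfl
        have a1 := append_tail_swap_frontEquiv_zero U₂ U
        have a3 := append_tail_frontEquiv_zero U₁ U
        have hs : (Op.act (Equiv.swap 0 1) q).1 0 = K.tgt := (congrArg q.1 e01).trans hK₂
        have e1 := mid_eq q₁ v₁ (U 0) q hu₁ hv₁ (hU' 0) L hL hL₁ hL₂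
        have e2 := mid_eq q₂ v₂ ((U ∘ Equiv.swap 0 1) 0) (Op.act (Equiv.swap 0 1) q)
          ((congrArg (fun t => (U t).src) e01).trans hu₂) hv₂ (hU' _) K
          ((UArr.comp_congr rfl (congrArg U e01) _ _).trans hK) hK₁ hs
        have c1 : (Op.act (frontEquiv k m) (mid q₂ v₂ ((U ∘ Equiv.swap 0 1) 0)
            (Op.act (Equiv.swap 0 1) q) ((congrArg (fun t => (U t).src) e01).trans hu₂) hv₂
              (hU' _))).1 0 = L.tgt :=
          (mid_fst _ _ _ _ _ _ _ _).trans
            ((append_tail_swap_frontEquiv_zero q₂.1 q.1).trans hL₂)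
        have c2 : (Op.act (frontEquiv l m) (mid q₁ v₁ (U 0) q hu₁ hv₁ (hU' 0))).1 0 = K.tgt :=
          (mid_fst _ _ _ _ _ _ _ _).trans ((append_tail_frontEquiv_zero q₁.1 q.1).trans hK₂)
        have d1 : (Op.act (frontEquiv k m)
            (Op.comp (Op.post q₂ K hK₁) (Op.act (Equiv.swap 0 1) q) hs)).1 0 = L.tgt := by
          rw [← e2]; exact c1
        have d2 : (Op.act (frontEquiv l m) (Op.comp (Op.post q₁ L hL₁) q hL₂)).1 0 = K.tgt := by
          rw [← e1]; exact c2
        refine (mid_eq q₁ v₁ _ _ _ _ _ L ((UArr.comp_congr rfl a1 _ _).trans hL) hL₁ c1).trans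
          (Eq.trans ?_ (congrArg (Op.act (blockEquiv l k m)) (mid_eq q₂ v₂ _ _ _ _ _ K
            ((UArr.comp_congr rfl a3 _ _).trans hK) hK₁ c2)).symm)
        refine (Op.comp_congr rfl (congrArg (Op.act (frontEquiv k m)) e2) c1 d1).trans
          ((Op.comp_comm (Op.post q₁ L hL₁) (Op.post q₂ K hK₁) q hL₂ hs d1 d2).trans
            (congrArg (Op.act (blockEquiv l k m))
              (Op.comp_congr rfl (congrArg (Op.act (frontEquiv l m)) e1) c2 d2)).symm)
      | bb hk w hw hd =>
        refine tt_arrow_congr (fun t => ?_) ?_ rfl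
        · have a3 := append_tail_frontEquiv_zero U₁ U
          have hu : (U 1).src = w.tgt := (hU 1).trans hd.symm
          have e1 := append_tail_frontEquiv U₁ (fun _ : Fin k => w.comp (U 1) hu) U t
          rw [← cons_comp_oneAddEquiv hk, ← cons_comp_oneAddEquiv hk] at e1
          refine Eq.trans ?_ (e1.trans ?_)
          · exact congrArg (fun u => Fin.append U₁ (Fin.tail (((Fin.cons u (Fin.tail
              (U ∘ Equiv.swap 0 1)) : Fin (m + 1 + 1) → UArr A) ∘ oneAddEquiv hk (m + 1)) ∘
                frontEquiv k m)) t) (UArr.comp_congr rfl (congrArg U e01) _ hu)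
          · exact (congrArg (fun u => ((Fin.cons u (Fin.tail
              (Fin.append U₁ (Fin.tail U) ∘ frontEquiv l m)) : Fin (l + m + 1) → UArr A) ∘
                oneAddEquiv hk (l + m)) (blockEquiv l k m t))
                  (UArr.comp_congr rfl a3 _ hu)).symm
        · have a1 : ((Fin.cons (w.comp ((U ∘ Equiv.swap 0 1) 0)
            ((congrArg (fun t => (U t).src) e01).trans ((hU 1).trans hd.symm))) (Fin.tail
              (U ∘ Equiv.swap 0 1)) : Fin (m + 1 + 1) → UArr A) ∘ oneAddEquiv hk (m + 1))
                (frontEquiv k m 0) = U 0 := by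
            rw [cons_comp_oneAddEquiv]
            exact append_tail_swap_frontEquiv_zero _ U
          have e3 : Op.act (frontEquiv k m) (Op.act (oneAddEquiv hk (m + 1))
              (Op.act (Equiv.swap 0 1) q)) = Op.act (consEquiv (oneAddEquiv hk m)) q := by
            rw [Op.act_act, Op.act_act]
            exact Op.act_congr (fun t => congrArg Fin.val (swap_oneAddEquiv_frontEquiv hk t)) _
          have c1 : (Op.act (consEquiv (oneAddEquiv hk m)) q).1 0 = L.tgt :=
            (congrArg q.1 (consEquiv_zero _)).trans hL₂
          have c2 := (congrArg (fun p : Op M.toSymMultigraph _ _ => p.1 0) e3).trans c1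
          refine (mid_eq q₁ v₁ _ _ _ _ _ L ((UArr.comp_congr rfl a1 _ _).trans hL) hL₁ c2).trans
            (Eq.trans ?_ (congrArg (fun p => Op.act (blockEquiv l k m)
              (Op.act (oneAddEquiv hk (l + m)) (Op.act (frontEquiv l m) p)))
                (mid_eq q₁ v₁ _ _ _ _ _ L hL hL₁ hL₂)).symm)
          refine (Op.comp_congr rfl e3 c2 c1).trans ((Op.comp_act_right _ _ _ hL₂ c1).trans ?_)
          rw [Op.act_act, Op.act_act]
          exact Op.act_congr
            (fun t => congrArg Fin.val (frontEquiv_oneAddEquiv_blockEquiv hk t).symm) _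
    | bb hl w hw hd =>
      cases g with
      | tt U₂ q₂ v₂ hU₂ hU₂' hv₂ hd₂ =>
        have hu₂ : (U 1).src = v₂.tgt := (hU 1).trans hd₂.symm
        obtain ⟨K, hK, hK₁, hK₂⟩ := i.exists_lift (v₂.comp (U 1) hu₂) hv₂ (hU' 1)
        refine tt_arrow_congr (fun t => ?_) ?_ rfl
        · have hu : (U 0).src = w.tgt := (hU 0).trans hd.symm
          have e1 := append_tail_frontEquiv (fun _ : Fin l => w.comp (U 0) hu) U₂ U t
          rw [← cons_comp_oneAddEquiv hl, ← cons_comp_oneAddEquiv hl] at e1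
          refine Eq.trans ?_ e1
          exact congrArg (fun u => ((Fin.cons u (Fin.tail
            (Fin.append U₂ (Fin.tail (U ∘ Equiv.swap 0 1)) ∘ frontEquiv k m)) :
              Fin (k + m + 1) → UArr A) ∘ oneAddEquiv hl (k + m)) t)
                (UArr.comp_congr rfl (append_tail_swap_frontEquiv_zero U₂ U) _ hu)
        · have a1 : ((Fin.cons (w.comp (U 0) ((hU 0).trans hd.symm)) (Fin.tail U) :
              Fin (m + 1 + 1) → UArr A) ∘ oneAddEquiv hl (m + 1)) (frontEquiv l m 0) = U 1 := by
            rw [cons_comp_oneAddEquiv]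
            exact append_tail_frontEquiv_zero _ U
          have hs : (Op.act (Equiv.swap 0 1) q).1 0 = K.tgt := (congrArg q.1 e01).trans hK₂
          have e3 : Op.act (frontEquiv l m) (Op.act (oneAddEquiv hl (m + 1)) q) =
              Op.act (consEquiv (oneAddEquiv hl m)) (Op.act (Equiv.swap 0 1) q) := by
            rw [Op.act_act, Op.act_act]
            exact Op.act_congr (fun t => congrArg Fin.val (frontEquiv_oneAddEquiv hl t)) _
          have c1 : (Op.act (consEquiv (oneAddEquiv hl m)) (Op.act (Equiv.swap 0 1) q)).1 0 =
              K.tgt := (congrArg (Op.act (Equiv.swap 0 1) q).1 (consEquiv_zero _)).trans hs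
          have c2 := (congrArg (fun p : Op M.toSymMultigraph _ _ => p.1 0) e3).trans c1
          refine (congrArg (fun p => Op.act (oneAddEquiv hl (k + m)) (Op.act (frontEquiv k m) p))
            (mid_eq q₂ v₂ _ _ _ _ _ K ((UArr.comp_congr rfl (congrArg U e01) _ _).trans hK)
              hK₁ hs)).trans (Eq.trans ?_ (congrArg (Op.act (blockEquiv l k m))
                (mid_eq q₂ v₂ _ _ _ _ _ K ((UArr.comp_congr rfl a1 _ _).trans hK) hK₁ c2)).symm)
          refine Eq.trans ?_ (congrArg (Op.act (blockEquiv l k m))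
            ((Op.comp_congr rfl e3 c2 c1).trans (Op.comp_act_right _ _ _ hs c1))).symm
          rw [Op.act_act, Op.act_act]
          exact Op.act_congr
            (fun t => congrArg Fin.val (frontEquiv_oneAddEquiv_left hl t)) _
      | bb hk w' hw' hd' =>
        refine tt_arrow_congr (fun t => ?_) ?_ rfl
        · have hu : (U 0).src = w.tgt := (hU 0).trans hd.symm
          have hu' : (U 1).src = w'.tgt := (hU 1).trans hd'.symm
          have e1 := append_tail_frontEquiv (fun _ : Fin l => w.comp (U 0) hu)
            (fun _ : Fin k => w'.comp (U 1) hu') U t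
          rw [← cons_comp_oneAddEquiv hl, ← cons_comp_oneAddEquiv hl, ← cons_comp_oneAddEquiv hk,
            ← cons_comp_oneAddEquiv hk] at e1
          have a0 : ∀ u : UArr A, ((Fin.cons u (Fin.tail (U ∘ Equiv.swap 0 1)) :
              Fin (m + 1 + 1) → UArr A) ∘ oneAddEquiv hk (m + 1)) (frontEquiv k m 0) = U 0 := by
            intro u
            rw [cons_comp_oneAddEquiv]
            exact append_tail_swap_frontEquiv_zero _ U
          have a1 : ∀ u : UArr A, ((Fin.cons u (Fin.tail U) :
              Fin (m + 1 + 1) → UArr A) ∘ oneAddEquiv hl (m + 1)) (frontEquiv l m 0) = U 1 := by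
            intro u
            rw [cons_comp_oneAddEquiv]
            exact append_tail_frontEquiv_zero _ U
          refine Eq.trans ?_ (e1.trans ?_)
          · exact congrArg₂ (fun u u' => ((Fin.cons u (Fin.tail (((Fin.cons u' (Fin.tail
              (U ∘ Equiv.swap 0 1)) : Fin (m + 1 + 1) → UArr A) ∘ oneAddEquiv hk (m + 1)) ∘
                frontEquiv k m)) : Fin (k + m + 1) → UArr A) ∘ oneAddEquiv hl (k + m)) t)
              (UArr.comp_congr rfl (a0 _) _ hu) (UArr.comp_congr rfl (congrArg U e01) _ hu')
          · exact (congrArg (fun u' => ((Fin.cons u' (Fin.tail (((Fin.cons (w.comp (U 0) hu)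
              (Fin.tail U) : Fin (m + 1 + 1) → UArr A) ∘ oneAddEquiv hl (m + 1)) ∘
                frontEquiv l m)) : Fin (l + m + 1) → UArr A) ∘ oneAddEquiv hk (l + m))
                  (blockEquiv l k m t)) (UArr.comp_congr rfl (a1 _) _ hu')).symm
        · rw [Op.act_act, Op.act_act, Op.act_act, Op.act_act, Op.act_act, Op.act_act]
          refine Op.act_congr (fun t => congrArg Fin.val ?_) _
          refine (congrArg (Equiv.swap 0 1) ((congrArg (oneAddEquiv hk (m + 1))
            (frontEquiv_oneAddEquiv_left hl t)))).trans ?_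
          refine Eq.trans ?_ (congrArg (oneAddEquiv hl (m + 1))
            (frontEquiv_oneAddEquiv_blockEquiv hk t)).symm
          refine Fin.addCases (fun t => ?_) (fun t => Fin.addCases (fun t => ?_) (fun t => ?_) t) t
          · rw [blockEquiv_castAdd, appendEquiv_natAdd, oneAddEquiv_castAdd, oneAddEquiv_natAdd,
              appendEquiv_castAdd, Equiv.refl_apply, oneAddEquiv_castAdd]
            exact e10
          · rw [blockEquiv_natAdd_castAdd, appendEquiv_castAdd, Equiv.refl_apply,
              oneAddEquiv_castAdd, appendEquiv_natAdd, oneAddEquiv_natAdd, oneAddEquiv_castAdd]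
            exact e01
          · rw [blockEquiv_natAdd_natAdd, appendEquiv_natAdd, oneAddEquiv_natAdd,
              oneAddEquiv_natAdd, appendEquiv_natAdd, oneAddEquiv_natAdd, oneAddEquiv_natAdd,
              swap_zero_one_succ_succ]

end Gen

end UnaryInclusion

namespace UnaryInclusion

variable {M A : SymMulticat.{v, u} V} (i : UnaryInclusion M A)

variable [HasColimits V] [MonoidalClosed V]

/-- The units of the pushout. -/
def oneHom (x : A.Ob) : 𝟙_ V ⟶ i.NHom (single x) x :=
  A.one x ≫ i.κ rfl (single x) x

/-- The unit, as a generator. -/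
def Gen.one (x : A.Ob) : i.Gen (single x) x :=
  Gen.bb rfl (UArr.one A x) rfl rfl

theorem oneHom_unit (x : A.Ob) : i.oneHom x ⋄ Elt.unit = (Gen.one i x).el :=
  comp_ap _ _ _

variable {l l' k k' m : ℕ} {a : Fin l → A.Ob} {a' : Fin l' → A.Ob} {x : A.Ob} {b : Fin k → A.Ob}
  {b' : Fin k' → A.Ob} {y z : A.Ob} {c : Fin m → A.Ob}

theorem act_compHom (σ : Fin l' ≃ Fin l) (τ : Fin k' ≃ Fin k) (ha : ∀ t, a' t = a (σ t))
    (hb : ∀ t, cons x b' t = cons x b (consEquiv τ t))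
    (hab : ∀ t, Fin.append a' b' t = Fin.append a b (appendEquiv σ τ t)) :
    (i.actHom σ ha ⊗ₘ i.actHom (consEquiv τ) hb) ≫ i.compHom a' x b' y =
      i.compHom a x b y ≫ i.actHom (appendEquiv σ τ) hab := by
  refine (i.spans_gen.tensor i.spans_gen).ext ?_
  rintro _ ⟨_, _, ⟨f, rfl⟩, ⟨g, rfl⟩, rfl⟩
  rw [comp_ap, comp_ap, tensorHom_ap, actHom_el, actHom_el, compHom_el, compHom_el, actHom_el]
  exact Gen.el_eq (Gen.act_comp_op σ τ ha hb hab f g)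

theorem one_compHom
    (ha : ∀ t, Fin.append (single x) b t = cons x b (finCongr (Nat.add_comm 1 k) t)) :
    i.oneHom x ▷ i.NHom (cons x b) y ≫ i.compHom (single x) x b y =
      (λ_ _).hom ≫ i.actHom (finCongr (Nat.add_comm 1 k)) ha := by
  refine (spans_unit.tensor i.spans_gen).ext ?_
  rintro _ ⟨_, _, rfl, ⟨g, rfl⟩, rfl⟩
  rw [comp_ap, comp_ap, whiskerRight_ap, leftUnitor_hom_ap, actHom_el, oneHom_unit, compHom_el]
  exact Gen.el_eq (Gen.one_comp_op ha g)

theorem compHom_one (hx : ∀ t, cons x nil t = single x (Equiv.refl (Fin 1) t))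
    (ha : ∀ t, Fin.append a nil t = a (Equiv.refl (Fin l) t)) :
    i.NHom a x ◁ (i.oneHom x ≫ i.actHom (Equiv.refl (Fin 1)) hx) ≫ i.compHom a x nil x =
      (ρ_ _).hom ≫ i.actHom (Equiv.refl (Fin l)) ha := by
  refine (i.spans_gen.tensor spans_unit).ext ?_
  rintro _ ⟨_, _, ⟨f, rfl⟩, rfl, rfl⟩
  rw [comp_ap, comp_ap, whiskerLeft_ap, comp_ap, rightUnitor_hom_ap, actHom_el, oneHom_unit,
    actHom_el]
  refine (i.compHom_el _ _).trans ?_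
  exact Gen.el_eq (Gen.comp_one_op hx ha f)

theorem assoc_compHom (h₁ : ∀ t, cons x (Fin.append b c) t =
      Fin.append (cons x b) c (finCongr (Nat.succ_add k m).symm t))
    (h₂ : ∀ t, Fin.append (Fin.append a b) c t =
      Fin.append a (Fin.append b c) (finCongr (Nat.add_assoc l k m) t)) :
    i.compHom a x b y ▷ i.NHom (cons y c) z ≫ i.compHom (Fin.append a b) y c z =
      (α_ _ _ _).hom ≫
        i.NHom a x ◁ (i.compHom (cons x b) y c z ≫
          i.actHom (finCongr (Nat.succ_add k m).symm) h₁) ≫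
        i.compHom a x (Fin.append b c) z ≫ i.actHom (finCongr (Nat.add_assoc l k m)) h₂ := by
  refine ((i.spans_gen.tensor i.spans_gen).tensor i.spans_gen).ext ?_
  rintro _ ⟨_, _, ⟨_, _, ⟨f, rfl⟩, ⟨g, rfl⟩, rfl⟩, ⟨h, rfl⟩, rfl⟩
  rw [comp_ap, comp_ap, comp_ap, comp_ap, whiskerRight_ap, associator_hom_ap, whiskerLeft_ap,
    comp_ap, compHom_el, compHom_el, compHom_el, actHom_el]
  refine Eq.trans ?_ (congrArg (_ ⋄ ·) (i.compHom_el _ _)).symm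
  rw [actHom_el]
  exact Gen.el_eq (Gen.assoc_op h₁ h₂ f g h)

theorem compHom_comm (h₁ : ∀ t, cons y (cons x c) t = cons x (cons y c) (Equiv.swap 0 1 t))
    (h₂ : ∀ t, cons x (Fin.append b c) t = Fin.append b (cons x c) (frontEquiv k m t))
    (h₃ : ∀ t, cons y (Fin.append a c) t = Fin.append a (cons y c) (frontEquiv l m t))
    (h₄ : ∀ t, Fin.append a (Fin.append b c) t =
      Fin.append b (Fin.append a c) (blockEquiv l k m t)) :
    i.NHom a x ◁ (i.NHom b y ◁ i.actHom (Equiv.swap 0 1) h₁ ≫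
        i.compHom b y (cons x c) z ≫ i.actHom (frontEquiv k m) h₂) ≫
      i.compHom a x (Fin.append b c) z =
    (α_ _ _ _).inv ≫ (β_ (i.NHom a x) (i.NHom b y)).hom ▷ _ ≫ (α_ _ _ _).hom ≫
      i.NHom b y ◁ (i.compHom a x (cons y c) z ≫ i.actHom (frontEquiv l m) h₃) ≫
      i.compHom b y (Fin.append a c) z ≫ i.actHom (blockEquiv l k m) h₄ := by
  refine (i.spans_gen.tensor (i.spans_gen.tensor i.spans_gen)).ext ?_
  rintro _ ⟨_, _, ⟨f, rfl⟩, ⟨_, _, ⟨g, rfl⟩, ⟨h, rfl⟩, rfl⟩, rfl⟩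
  simp only [comp_ap, associator_inv_ap, whiskerRight_ap, braiding_ap, associator_hom_ap,
    whiskerLeft_ap, actHom_el, compHom_el]
  exact Gen.el_eq (Gen.comp_comm_op h₁ h₂ h₃ h₄ f g h)

/-- The pushout of `A` and a multicategory `M` along the unary morphisms of `M`. -/
abbrev adjoin : SymMulticat.{v, u} V where
  toSymMultigraph := i.graph
  one := fun x => i.oneHom x
  comp := fun a x b c => i.compHom a x b c
  act_comp := fun σ τ _ _ _ _ _ _ ha hb => i.act_compHom σ τ ha _ _
  one_comp := fun _ _ _ => i.one_compHom _
  comp_one := fun _ _ => i.compHom_one _ _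
  assoc := fun _ _ _ _ _ _ => i.assoc_compHom _ _
  comp_comm := fun _ _ _ _ _ _ => i.compHom_comm _ _ _ _

end UnaryInclusion

namespace UnaryInclusion

variable {M A : SymMulticat.{v, u} V} (i : UnaryInclusion M A)

variable [HasColimits V] [MonoidalClosed V]

/-- The formal composite of `U₁, …, U_k`, `m` and `v`, as an operation of the pushout. -/
def ttOp {k : ℕ} {y : M.Ob} {d : A.Ob} (U : Fin k → UArr A) (m : Op M.toSymMultigraph k y)
    (v : UArr A) (hU : ∀ t, (U t).tgt = i.obj (m.1 t)) (hv : v.src = i.obj y) (hd : v.tgt = d) :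
    Op i.adjoin.toSymMultigraph k d :=
  i.tt U m v hU hv hd

/-- An arrow of `A`, as an arrow of the pushout. -/
def inr (w : UArr A) : UArr i.adjoin :=
  ⟨w.src, w.tgt, i.κ rfl (single w.src) w.tgt ⋄ w.el⟩

@[simp] theorem inr_src (w : UArr A) : (i.inr w).src = w.src := rfl
@[simp] theorem inr_tgt (w : UArr A) : (i.inr w).tgt = w.tgt := rfl

theorem inr_op (w : UArr A) : (i.inr w).op = i.bb rfl w rfl := rfl

variable {i}

theorem ttOp_congr {k : ℕ} {y : M.Ob} {d : A.Ob} {U U' : Fin k → UArr A}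
    {m m' : Op M.toSymMultigraph k y} {v v' : UArr A}
    {hU : ∀ t, (U t).tgt = i.obj (m.1 t)} {hv : v.src = i.obj y} {hd : v.tgt = d}
    {hU' : ∀ t, (U' t).tgt = i.obj (m'.1 t)} {hv' : v'.src = i.obj y} {hd' : v'.tgt = d}
    (eU : ∀ t, U t = U' t) (em : m = m') (ev : v = v') :
    i.ttOp U m v hU hv hd = i.ttOp U' m' v' hU' hv' hd' :=
  tt_arrow_congr eU em ev

@[simp] theorem ttOp_fst {k : ℕ} {y : M.Ob} {d : A.Ob} (U : Fin k → UArr A)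
    (m : Op M.toSymMultigraph k y) (v : UArr A) (hU : ∀ t, (U t).tgt = i.obj (m.1 t))
    (hv : v.src = i.obj y) (hd : v.tgt = d) (t : Fin k) :
    (i.ttOp U m v hU hv hd).1 t = (U t).src := rfl

theorem adjoin_one (x : A.Ob) : UArr.one i.adjoin x = i.inr (UArr.one A x) :=
  congrArg (UArr.mk (P := i.adjoin) x x) (comp_ap _ _ _)

theorem Gen.adjoin_act {k l : ℕ} {a : Fin l → A.Ob} {a' : Fin k → A.Ob} {d : A.Ob}
    (σ : Fin k ≃ Fin l) (h : ∀ t, a' t = a (σ t)) (g : i.Gen a d) :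
    Op.act (G := i.adjoin.toSymMultigraph) (y := d) σ g.op = (g.act σ h).op := by
  obtain rfl : a' = a ∘ σ := funext h
  rw [← Gen.mk_el, ← Gen.mk_el, ← actHom_el]
  rfl

theorem Gen.adjoin_comp {l k : ℕ} {a : Fin l → A.Ob} {x : A.Ob} {b : Fin k → A.Ob} {c : A.Ob}
    (f : i.Gen a x) (g : i.Gen (cons x b) c)
    (h : (g.op : Op i.adjoin.toSymMultigraph (k + 1) c).1 0 = x) :
    Op.comp (P := i.adjoin) (x := x) (c := c) f.op g.op h = (f.comp g).op := by
  have key : ∀ (p : Op i.adjoin.toSymMultigraph l x) (q : Op i.adjoin.toSymMultigraph (k + 1) c)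
      (hp : p = ⟨a, f.el⟩) (hq : q = ⟨cons x b, g.el⟩) (h' : q.1 0 = x),
      Op.comp p q h' = (⟨Fin.append a b, i.compHom a x b c ⋄ (f.el ⊙ g.el)⟩ :
        Op i.adjoin.toSymMultigraph (l + k) c) := by
    rintro _ _ rfl rfl h'
    exact (Op.mk_comp (P := i.adjoin) (x := x) (c := c) (a := a) (b := b) f.el g.el).symm
  refine (key _ _ f.mk_el.symm g.mk_el.symm h).trans ?_
  exact (congrArg (fun e => (⟨Fin.append a b, e⟩ : i.RawOp (l + k) c))
    (i.compHom_el f g)).trans (Gen.mk_el _)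

variable {k l : ℕ} {y : M.Ob} {d : A.Ob}

theorem act_ttOp (σ : Fin l ≃ Fin k) (U : Fin k → UArr A) (m : Op M.toSymMultigraph k y)
    (v : UArr A) (hU : ∀ t, (U t).tgt = i.obj (m.1 t)) (hv : v.src = i.obj y) (hd : v.tgt = d) :
    Op.act σ (i.ttOp U m v hU hv hd) =
      i.ttOp (U ∘ σ) (Op.act σ m) v (fun t => hU (σ t)) hv hd :=
  Gen.adjoin_act σ (fun _ => rfl) (Gen.tt U m v (fun _ => rfl) hU hv hd)

theorem comp_ttOp {y' : M.Ob} {x : A.Ob} (U : Fin l → UArr A) (m : Op M.toSymMultigraph l y)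
    (v : UArr A) (hU : ∀ t, (U t).tgt = i.obj (m.1 t)) (hv : v.src = i.obj y) (hx : v.tgt = x)
    (U' : Fin (k + 1) → UArr A) (m' : Op M.toSymMultigraph (k + 1) y')
    (v' : UArr A) (hU' : ∀ t, (U' t).tgt = i.obj (m'.1 t)) (hv' : v'.src = i.obj y')
    (hd : v'.tgt = d) (h : (i.ttOp U' m' v' hU' hv' hd).1 0 = x) (L : UArr M)
    (h₀ : (U' 0).src = v.tgt) (e : v.comp (U' 0) h₀ = i.arr L) (hL : L.src = y)
    (hL' : m'.1 0 = L.tgt) 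
    (hU'' : ∀ t, (Fin.append U (Fin.tail U') t).tgt =
      i.obj ((Op.comp (Op.post m L hL) m' hL').1 t)) :
    Op.comp (i.ttOp U m v hU hv hx) (i.ttOp U' m' v' hU' hv' hd) h =
      i.ttOp (Fin.append U (Fin.tail U')) (Op.comp (Op.post m L hL) m' hL') v' hU'' hv' hd := by
  subst hx
  have hb : ∀ t, (U' t).src = cons v.tgt (fun t => (U' t.succ).src) t := Fin.cases h₀ fun _ => rfl
  refine (Gen.adjoin_comp (Gen.tt U m v (fun _ => rfl) hU hv rfl)
    (Gen.tt U' m' v' hb hU' hv' hd) h).trans ?_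
  exact tt_arrow_congr (fun _ => rfl) (Gen.mid_eq m v (U' 0) m' _ hv _ L e hL hL') rfl

theorem post_ttOp (U : Fin k → UArr A) (m : Op M.toSymMultigraph k y) (v : UArr A)
    (hU : ∀ t, (U t).tgt = i.obj (m.1 t)) (hv : v.src = i.obj y) {x : A.Ob} (hx : v.tgt = x)
    (w : UArr A) (h : (i.inr w).src = x) (h' : w.src = v.tgt) :
    Op.post (i.ttOp U m v hU hv hx) (i.inr w) h =
      i.ttOp U m (v.comp w h') hU hv rfl := by
  subst hx
  have hb : w.src = cons v.tgt nil (pos (k := 0 + 1) rfl) := h'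
  refine (Gen.adjoin_comp (Gen.tt U m v (fun _ => rfl) hU hv rfl)
    (Gen.bb rfl w hb rfl) h).trans ?_
  exact tt_arrow_congr (fun _ => rfl) (Op.act_id (fun _ => rfl) m) rfl

theorem inr_comp (w w' : UArr A) (h : w'.src = w.tgt) (h' : (i.inr w').src = (i.inr w).tgt) :
    (i.inr w).comp (i.inr w') h' = i.inr (w.comp w' h) := by
  have hb : w'.src = cons w.tgt nil (pos (k := 0 + 1) rfl) := h
  have e := Gen.adjoin_comp (Gen.bb rfl w (b := single w.src) rfl rfl : i.Gen _ _)
    (Gen.bb rfl w' hb rfl) h'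
  exact (congrArg UArr.ofOp e).trans (UArr.ofOp_op (i.inr (w.comp w' h)))

theorem preZero_ttOp (u : UArr A) (U : Fin (k + 1) → UArr A) (m : Op M.toSymMultigraph (k + 1) y)
    (v : UArr A) (hU : ∀ t, (U t).tgt = i.obj (m.1 t)) (hv : v.src = i.obj y) (hd : v.tgt = d)
    (h : (i.ttOp U m v hU hv hd).1 0 = (i.inr u).tgt) (h' : (U 0).src = u.tgt)
    (hU' : ∀ t, ((Fin.cons (u.comp (U 0) h') (Fin.tail U) : Fin (k + 1) → UArr A) t).tgt =
      i.obj (m.1 t)) :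
    Op.preZero (i.inr u) (i.ttOp U m v hU hv hd) h =
      i.ttOp (Fin.cons (u.comp (U 0) h') (Fin.tail U) : Fin (k + 1) → UArr A) m v hU' hv hd := by
  have hb : ∀ t, (U t).src = cons u.tgt (fun t => (U t.succ).src) t := Fin.cases h' fun _ => rfl
  have e := Gen.adjoin_comp (Gen.bb rfl u (b := single u.src) rfl rfl : i.Gen _ _)
    (Gen.tt U m v hb hU hv hd) h
  refine (congrArg (Op.act (G := i.adjoin.toSymMultigraph) (y := d)
    (finCongr (Nat.add_comm k 1))) e).trans ?_
  refine (Gen.adjoin_act _ (fun _ => rfl) _).trans ?_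
  refine tt_arrow_congr (fun t => rfl) ?_ rfl
  rw [Op.act_act]
  exact Op.act_id (fun _ => rfl) m

theorem pre_ttOp (t : Fin k) (u : UArr A) (U : Fin k → UArr A) (m : Op M.toSymMultigraph k y)
    (v : UArr A) (hU : ∀ t, (U t).tgt = i.obj (m.1 t)) (hv : v.src = i.obj y) (hd : v.tgt = d)
    (h : (i.ttOp U m v hU hv hd).1 t = (i.inr u).tgt) (h' : (U t).src = u.tgt)
    (hU' : ∀ s, (Function.update U t (u.comp (U t) h') s).tgt = i.obj (m.1 s)) :
    Op.pre t (i.inr u) (i.ttOp U m v hU hv hd) h =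
      i.ttOp (Function.update U t (u.comp (U t) h')) m v hU' hv hd := by
  obtain ⟨n, τ, rfl⟩ := Op.exists_pos t
  refine (Op.pre_eq τ rfl _ _ _).trans ?_
  refine ((Op.act_eq_iff τ _ _).1 ?_).symm
  rw [act_ttOp]
  simp only [act_ttOp]
  refine Eq.symm ((preZero_ttOp u (U ∘ τ) (Op.act τ m) v _ hv hd _ h' ?_).trans ?_)
  · exact Fin.cases (hU (τ 0)) fun t => hU (τ t.succ)
  · refine ttOp_congr (Fin.cases ?_ fun s => ?_) rfl rfl
    · simp
    · simp [Fin.tail]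

theorem preAll_ttOp (F : Fin k → UArr A) (U : Fin k → UArr A) (m : Op M.toSymMultigraph k y)
    (v : UArr A) (hU : ∀ t, (U t).tgt = i.obj (m.1 t)) (hv : v.src = i.obj y) (hd : v.tgt = d)
    (h : ∀ t, (U t).src = (F t).tgt) (hU' : ∀ t, ((F t).comp (U t) (h t)).tgt = i.obj (m.1 t)) :
    Op.preAll (fun t => i.inr (F t)) (i.ttOp U m v hU hv hd) =
      i.ttOp (fun t => (F t).comp (U t) (h t)) m v hU' hv hd := by
  classical
  have key : ∀ L : List (Fin k), L.Nodup →
      Op.preList (fun t => i.inr (F t)) L (i.ttOp U m v hU hv hd) =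
        i.ttOp (fun t => if t ∈ L then (F t).comp (U t) (h t) else U t) m v
          (fun t => by split; exacts [hU t, hU t]) hv hd := by
    intro L hL
    induction L with
    | nil => exact ttOp_congr (fun t => by simp) rfl rfl
    | cons s L ih =>
      rw [List.nodup_cons] at hL
      rw [Op.preList_cons, ih hL.2]
      refine (Op.step_eq _ (?_)).trans ((pre_ttOp s (F s) _ m v _ hv hd _ ?_ ?_).trans ?_)
      · rw [ttOp_fst, if_neg hL.1]; exact h s
      · rw [if_neg hL.1]; exact h s
      · intro t
        rcases eq_or_ne t s with rfl | hts
        · rw [Function.update_self, UArr.comp_tgt, if_neg hL.1]; exact hU t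
        · rw [Function.update_of_ne hts]
          split
          exacts [hU t, hU t]
      · refine ttOp_congr (fun t => ?_) rfl rfl
        rcases eq_or_ne t s with rfl | hts
        · rw [Function.update_self, if_pos List.mem_cons_self]
          exact UArr.comp_congr rfl (if_neg hL.1) _ _
        · rw [Function.update_of_ne hts]
          simp [hts]
  refine (key _ (List.nodup_finRange k)).trans (ttOp_congr (fun t => ?_) rfl rfl)
  simp

end UnaryInclusion

/-- The tensor product of points. -/
def tensPoint : {s : ℕ} → {X : Fin s → V} → (∀ t, 𝟙_ V ⟶ X t) → (𝟙_ V ⟶ tens X)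
  | 0, _, _ => 𝟙 _
  | _ + 1, _, f => (λ_ _).inv ≫ (tensPoint (fun t => f (Fin.castSucc t)) ⊗ₘ f (Fin.last _))

theorem tensPoint_ap {s : ℕ} {X : Fin s → V} (f : ∀ t, 𝟙_ V ⟶ X t) :
    tensPoint f ⋄ Elt.unit = tensEl (fun t => f t ⋄ Elt.unit) := by
  induction s with
  | zero => exact id_ap _
  | succ s ih =>
    have e : (λ_ (𝟙_ V)).inv ⋄ (Elt.unit : Elt (𝟙_ V)) = Elt.unit ⊙ Elt.unit :=
      leftUnitor_inv_ap _
    refine (comp_ap _ _ _).trans ?_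
    rw [e]
    refine (tensorHom_ap _ _ _ _).trans ?_
    rw [ih]
    rfl

/-- A change of the codomain along an equality. -/
def Op.cod {G : SymMultigraph.{v, u} V} {k : ℕ} {x y : G.Ob} (h : x = y) (q : Op G k x) :
    Op G k y := h ▸ q

section Multifunctor

variable {P Q : SymMulticat.{v, u} V}

/-- A multifunctor may be constructed by its values on spanning sets of elements. -/
def Multifunctor.ofSpans (obj : P.Ob → Q.Ob)
    (map : ∀ {k : ℕ} (a : Fin k → P.Ob) (b : P.Ob), P.Hom a b ⟶ Q.Hom (obj ∘ a) (obj b))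
    [MonoidalClosed V]
    (S : ∀ {k : ℕ} (a : Fin k → P.Ob) (b : P.Ob), Elt (P.Hom a b) → Prop)
    (hS : ∀ {k : ℕ} (a : Fin k → P.Ob) (b : P.Ob), Spans (S a b))
    (hact : ∀ {k l : ℕ} (σ : Fin k ≃ Fin l) (a : Fin l → P.Ob) (b : P.Ob) (e : Elt (P.Hom a b)),
      S a b e → (⟨obj ∘ a ∘ σ, map (a ∘ σ) b ⋄ P.act σ (fun _ => rfl) ⋄ e⟩ :
        Op Q.toSymMultigraph k (obj b)) = Op.act σ ⟨obj ∘ a, map a b ⋄ e⟩)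
    (hone : ∀ x, (⟨single (obj x), map (single x) x ⋄ P.one x ⋄ Elt.unit⟩ :
      Op Q.toSymMultigraph 1 (obj x)) = Op.one Q (obj x))
    (hcomp : ∀ {l k : ℕ} (a : Fin l → P.Ob) (x : P.Ob) (b : Fin k → P.Ob) (c : P.Ob)
      (e : Elt (P.Hom a x)) (e' : Elt (P.Hom (cons x b) c)), S a x e → S (cons x b) c e' →
      (⟨obj ∘ Fin.append a b, map (Fin.append a b) c ⋄ P.comp a x b c ⋄ (e ⊙ e')⟩ :
        Op Q.toSymMultigraph (l + k) (obj c)) =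
        Op.comp ⟨obj ∘ a, map a x ⋄ e⟩ ⟨obj ∘ cons x b, map (cons x b) c ⋄ e'⟩ rfl) :
    SymMulticat.Multifunctor P Q where
  obj := obj
  map := map
  map_act := fun {k l} σ {a a' b} h => by
    obtain rfl : a' = a ∘ σ := funext h
    refine (hS a b).ext fun e he => ?_
    rw [comp_ap, comp_ap]
    exact Op.mk_inj (hact σ a b e he)
  map_one := fun x => by
    refine spans_unit.ext ?_
    rintro _ rfl
    rw [comp_ap]
    exact Op.mk_inj (hone x)
  map_comp := fun {l k} a x b c => by
    refine ((hS a x).tensor (hS (cons x b) c)).ext ?_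
    rintro _ ⟨e, e', he, he', rfl⟩
    rw [comp_ap, comp_ap, comp_ap, tensorHom_ap, comp_ap]
    refine Op.mk_inj (G := Q.toSymMultigraph) (a := Fin.append (obj ∘ a) (obj ∘ b)) ?_
    refine (Op.mk_cast _ _).trans ((hcomp a x b c e e' he he').trans ?_)
    refine Eq.trans ?_ (Op.mk_comp _ _).symm
    have e1 := Op.mk_cast (comp_cons obj x b) (map (cons x b) c ⋄ e')
    exact Op.comp_congr rfl e1.symm _ _

theorem Multifunctor.ext_of_spans {F G : SymMulticat.Multifunctor P Q}
    (S : ∀ {k : ℕ} (a : Fin k → P.Ob) (b : P.Ob), Elt (P.Hom a b) → Prop)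
    (hS : ∀ {k : ℕ} (a : Fin k → P.Ob) (b : P.Ob), Spans (S a b))
    (hobj : ∀ x, F.obj x = G.obj x)
    (hmap : ∀ {k : ℕ} (a : Fin k → P.Ob) (b : P.Ob) (e : Elt (P.Hom a b)), S a b e →
      Op.cod (hobj b) (Op.map F ⟨a, e⟩) = Op.map G ⟨a, e⟩) : F = G := by
  obtain ⟨obj, map, h1, h2, h3⟩ := F
  obtain ⟨obj', map', h1', h2', h3'⟩ := G
  obtain rfl : obj = obj' := funext hobj
  have e : @map = @map' := by
    funext k a b
    refine (hS a b).ext fun e he => ?_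
    exact Op.mk_inj (hmap a b e he)
  subst e
  rfl

theorem Multifunctor.ext_op {F G : SymMulticat.Multifunctor P Q} (hobj : ∀ x, F.obj x = G.obj x)
    (hmap : ∀ {k : ℕ} {b : P.Ob} (q : Op P.toSymMultigraph k b),
      Op.cod (hobj b) (Op.map F q) = Op.map G q) : F = G :=
  Multifunctor.ext_of_spans (fun _ _ _ => True) (fun _ _ => spans_top _) hobj
    fun a b e _ => hmap ⟨a, e⟩

end Multifunctor

namespace UnaryInclusion

variable {M A : SymMulticat.{v, u} V} (i : UnaryInclusion M A)

variable [HasColimits V] [MonoidalClosed V]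

/-- The inclusion of `M` into the pushout, on morphisms. -/
def inlMap {k : ℕ} (a : Fin k → M.Ob) (b : M.Ob) : M.Hom a b ⟶ i.NHom (i.obj ∘ a) (i.obj b) :=
  (λ_ _).inv ≫ tensPoint (fun t => A.one (i.obj (a t))) ▷ _ ≫
    _ ◁ ((ρ_ _).inv ≫ _ ◁ A.one (i.obj b)) ≫ i.ι (i.obj ∘ a) (i.obj b) (a, b)

/-- The image of an operation of `M` in the pushout. -/
def inlOp {k : ℕ} {b : M.Ob} (q : Op M.toSymMultigraph k b) :
    Op i.adjoin.toSymMultigraph k (i.obj b) :=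
  i.ttOp (fun t => UArr.one A (i.obj (q.1 t))) q (UArr.one A (i.obj b)) (fun _ => rfl) rfl rfl

theorem mk_inlMap {k : ℕ} (a : Fin k → M.Ob) (b : M.Ob) (e : Elt (M.Hom a b)) :
    (⟨i.obj ∘ a, i.inlMap a b ⋄ e⟩ : Op i.adjoin.toSymMultigraph k (i.obj b)) =
      i.inlOp ⟨a, e⟩ := by
  refine congrArg (Sigma.mk (i.obj ∘ a)) ?_
  rw [inlMap, comp_ap, comp_ap, comp_ap, leftUnitor_inv_ap, whiskerRight_ap, tensPoint_ap,
    whiskerLeft_ap, comp_ap, rightUnitor_inv_ap, whiskerLeft_ap]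
  rfl

theorem act_inlOp {k l : ℕ} {b : M.Ob} (σ : Fin k ≃ Fin l) (q : Op M.toSymMultigraph l b) :
    Op.act σ (i.inlOp q) = i.inlOp (Op.act σ q) :=
  act_ttOp _ _ _ _ _ _ _

theorem op_one_adjoin (x : A.Ob) : Op.one i.adjoin x = i.bb rfl (UArr.one A x) rfl :=
  congrArg (Sigma.mk (single x)) (comp_ap _ _ _)

theorem one_inlOp (x : M.Ob) : i.inlOp (Op.one M x) = Op.one i.adjoin (i.obj x) := by
  refine (i.tt_collapse rfl (fun _ => UArr.one A (i.obj x)) (Op.one M x) (UArr.one A (i.obj x))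
    (fun _ => rfl) rfl rfl ?_ ?_ rfl).trans ?_
  · rfl
  · rfl
  · refine Eq.trans ?_ (i.op_one_adjoin (i.obj x)).symm
    refine i.bb_congr ?_ _ _ _ _
    refine (UArr.comp_one _ _).trans ((UArr.one_comp _ rfl).trans ?_)
    refine (congrArg i.arr ?_).trans (i.arr_one x)
    exact (congrArg UArr.ofOp (Op.act_id (fun _ => rfl) _)).trans (UArr.ofOp_op (UArr.one M x))

theorem comp_inlOp {l k : ℕ} {x c : M.Ob} (p : Op M.toSymMultigraph l x)
    (q : Op M.toSymMultigraph (k + 1) c) (h : q.1 0 = x) (h' : (i.inlOp q).1 0 = i.obj x) :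
    Op.comp (i.inlOp p) (i.inlOp q) h' = i.inlOp (Op.comp p q h) := by
  subst h
  refine (comp_ttOp (x := i.obj (q.1 0)) _ p (UArr.one A (i.obj (q.1 0))) (fun _ => rfl) rfl rfl _ q
    (UArr.one A _) (fun _ => rfl) rfl rfl h' (UArr.one M (q.1 0)) rfl
    ((UArr.comp_one _ _).trans (i.arr_one _).symm) rfl rfl ?_).trans ?_
  · refine Fin.addCases (fun t => ?_) (fun t => ?_)
    · rw [Fin.append_left]
      refine congrArg i.obj ?_
      rw [Op.comp_fst, Fin.append_left]
      exact (Op.post_fst p _ _ t).symm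
    · rw [Fin.append_right]
      refine congrArg i.obj ?_
      rw [Op.comp_fst, Fin.append_right]; rfl
  · have e := Op.post_one p (x := q.1 0) rfl
    refine ttOp_congr (fun t => ?_) (Op.comp_congr e rfl _ _) rfl
    refine Fin.addCases (fun t => ?_) (fun t => ?_) t
    · rw [Fin.append_left, Op.comp_fst, Fin.append_left]
    · rw [Fin.append_right, Op.comp_fst, Fin.append_right]
      rfl

/-- The inclusion of `M` into the pushout. -/
def inl : M ⟶ i.adjoin :=
  Multifunctor.ofSpans i.obj (fun a b => i.inlMap a b) (fun _ _ _ => True) (fun _ _ => spans_top _)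
    (fun σ a b e _ => (i.mk_inlMap (a ∘ σ) b _).trans
      ((i.act_inlOp σ _).symm.trans (congrArg (Op.act σ) (i.mk_inlMap a b e)).symm))
    (fun x => (i.mk_inlMap _ _ _).trans (i.one_inlOp x))
    (fun a x b c e e' _ _ => by
      refine (i.mk_inlMap _ _ _).trans ?_
      refine Eq.trans ?_ (Op.comp_congr (i.mk_inlMap a x e) (i.mk_inlMap (cons x b) c e')
        rfl rfl).symm
      exact (congrArg i.inlOp (Op.mk_comp e e')).trans (i.comp_inlOp _ _ rfl _).symm)

@[simp] theorem inl_obj (x : M.Ob) : Multifunctor.obj i.inl x = i.obj x := rfl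

theorem map_inl {k : ℕ} {b : M.Ob} (q : Op M.toSymMultigraph k b) :
    Op.map i.inl q = i.inlOp q := i.mk_inlMap q.1 b q.2

/-- Every formal composite is a composite in the pushout. -/
theorem ttOp_eq {k : ℕ} {y : M.Ob} (U : Fin k → UArr A) (m : Op M.toSymMultigraph k y)
    (v : UArr A) (hU : ∀ t, (U t).tgt = i.obj (m.1 t)) (hv : v.src = i.obj y) :
    i.ttOp U m v hU hv rfl =
      Op.post (Op.preAll (fun t => i.inr (U t)) (Op.map i.inl m)) (i.inr v) hv := by
  have e : Op.preAll (fun t => i.inr (U t)) (Op.map i.inl m) =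
      i.ttOp U m (UArr.one A (i.obj y)) hU rfl rfl := by
    rw [map_inl]
    refine (preAll_ttOp U _ m _ _ rfl rfl (fun t => (hU t).symm) (fun _ => rfl)).trans ?_
    exact ttOp_congr (fun t => UArr.comp_one _ _) rfl rfl
  rw [e]
  refine Eq.trans ?_ (post_ttOp U m (UArr.one A (i.obj y)) hU rfl rfl v hv hv).symm
  exact ttOp_congr (fun _ => rfl) rfl (UArr.one_comp _ hv).symm

end UnaryInclusion

theorem Op.comp_post_congr {P : SymMulticat.{v, u} V} {l k : ℕ} {x c : P.Ob}
    (q : Op P.toSymMultigraph l x) (q' : Op P.toSymMultigraph (k + 1) c) {W W' : UArr P}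
    (e : W = W') (h : W.src = x) (h' : W'.src = x) (hq : q'.1 0 = W.tgt) (hq' : q'.1 0 = W'.tgt) :
    comp (post q W h) q' hq = comp (post q W' h') q' hq' := by
  subst e; rfl

theorem Op.preZero_preAll {P : SymMulticat.{v, u} V} {k : ℕ} {c : P.Ob} (f : UArr P)
    (F : Fin (k + 1) → UArr P) (q : Op P.toSymMultigraph (k + 1) c)
    (hq : ∀ t, q.1 t = (F t).tgt) (h : (F 0).src = f.tgt) (h' : (preAll F q).1 0 = f.tgt) :
    preZero f (preAll F q) h' =
      preAll (Fin.cons (f.comp (F 0) h) (Fin.tail F) : Fin (k + 1) → UArr P) q := by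
  rw [← preAll_cons_ones]
  have hF : ∀ t, (F t).src = ((Fin.cons f (fun t => UArr.one P ((preAll F q).1 t.succ)) :
      Fin (k + 1) → UArr P) t).tgt := Fin.cases h fun t => (preAll_fst F hq t.succ).symm
  rw [preAll_preAll _ _ hF _ hq]
  refine congrArg (fun W => preAll W q) (funext (Fin.cases rfl fun t => ?_))
  exact UArr.one_comp _ _

namespace UnaryInclusion

variable {M A P : SymMulticat.{v, u} V} {i : UnaryInclusion M A}
  {f : SymMulticat.Multifunctor A P} {h : SymMulticat.Multifunctor M P}

variable [HasColimits V]

/-- The value of a generator, for multifunctors `A ⟶ P` and `M ⟶ P`. -/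
def Gen.eval (hobj : ∀ x, h.obj x = f.obj (i.obj x)) {k : ℕ} {b : Fin k → A.Ob} {d : A.Ob} :
    i.Gen b d → Op P.toSymMultigraph k (f.obj d)
  | tt (y := y) U m v _ _ hv hd => Op.cod (congrArg f.obj hd)
      (Op.post (Op.preAll (fun t => (U t).map f) (Op.map h m)) (v.map f)
        ((congrArg f.obj hv).trans (hobj y).symm))
  | bb hk w _ hd => Op.cod (congrArg f.obj hd) (Op.act (finCongr hk) (w.map f).op)

variable (hobj : ∀ x, h.obj x = f.obj (i.obj x)) {k l : ℕ} {a : Fin l → A.Ob} {b : Fin k → A.Ob} {x d : A.Ob}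

theorem Gen.eval_rel (hmap : ∀ g : UArr M, g.map h = (i.arr g).map f) {y : M.Ob}
    (U : Fin k → UArr A) (F : Fin k → UArr M)
    (m : Op M.toSymMultigraph k y)
    (g : UArr M) (v : UArr A) (hUF : ∀ t, (i.arr (F t)).src = (U t).tgt)
    (hF : ∀ t, m.1 t = (F t).tgt) (hg : g.src = y) (hv : v.src = (i.arr g).tgt)
    (h₁ : (((i.arr g).comp v hv).map f).src = h.obj y) (h₂ : (v.map f).src = h.obj g.tgt) :
    Op.post (Op.preAll (fun t => ((U t).comp (i.arr (F t)) (hUF t)).map f) (Op.map h m))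
        (((i.arr g).comp v hv).map f) h₁ =
      Op.post (Op.preAll (fun t => (U t).map f) (Op.map h (Op.post (Op.preAll F m) g hg)))
        (v.map f) h₂ := by
  have hg' : (g.map h).src = h.obj y := congrArg h.obj hg
  have hgv : (v.map f).src = (g.map h).tgt := h₂
  have hUF' : ∀ t, ((i.arr (F t)).map f).src = ((U t).map f).tgt :=
    fun t => congrArg f.obj (hUF t)
  have hUF'' : ∀ t, ((F t).map h).src = ((U t).map f).tgt := fun t => by rw [hmap]; exact hUF' t
  have hv' : (v.map f).src = ((i.arr g).map f).tgt := congrArg f.obj hv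
  have e1 : Op.map h (Op.post (Op.preAll F m) g hg) =
      Op.preAll (fun t => (F t).map h) (Op.post (Op.map h m) (g.map h) hg') := by
    refine (Op.map_post h _ g hg hg').trans ?_
    simp only [Op.map_preAll F h m hF]
    exact Op.post_preAll _ _ _ _
  have e2 : ∀ t, ((U t).comp (i.arr (F t)) (hUF t)).map f =
      ((U t).map f).comp ((F t).map h) (hUF'' t) := fun t =>
    (UArr.map_comp f _ _ _ (hUF' t)).trans (UArr.comp_congr rfl (hmap _).symm _ _)
  have e3 : ((i.arr g).comp v hv).map f = (g.map h).comp (v.map f) hgv :=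
    (UArr.map_comp f _ _ _ hv').trans (UArr.comp_congr (hmap _).symm rfl _ _)
  have e4 : ∀ (W : UArr P) (hW : W.src = h.obj y) (hW' : W = (g.map h).comp (v.map f) hgv)
      (hx : W.tgt = f.obj v.tgt),
      Op.cod hx (Op.post (Op.map h m) W hW) =
        Op.post (Op.post (Op.map h m) (g.map h) hg') (v.map f) h₂ := by
    rintro _ hW rfl hx
    exact (Op.post_post _ _ _ _ _).symm
  have e5 := e4 (((i.arr g).comp v hv).map f) h₁ e3 rfl
  refine (Op.post_preAll _ _ _ _).trans (Eq.trans ?_ (congrArg (fun q =>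
    Op.post (Op.preAll (fun t => (U t).map f) q) (v.map f) h₂) e1).symm)
  refine (congrArg (Op.preAll _) e5).trans ?_
  refine Eq.trans ?_ ((Op.post_preAll (fun t => (U t).map f) _ _ h₂).trans
    (congrArg (Op.preAll fun t => (U t).map f)
      (Op.post_preAll (fun t => (F t).map h) _ _ h₂))).symm
  refine Eq.trans ?_ (Op.preAll_preAll _ _ hUF'' _ fun t => ?_).symm
  · exact congrArg (fun W => Op.preAll W _) (funext e2)
  · refine (Op.post_fst _ _ _ _).trans ((Op.post_fst _ _ _ _).trans ?_)
    exact congrArg h.obj (hF t)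

theorem Gen.eval_collapse (hmap : ∀ g : UArr M, g.map h = (i.arr g).map f)
    (U : Fin 1 → UArr A) (m : UArr M) (v : UArr A) (h₁ : (i.arr m).src = (U 0).tgt)
    (h₂ : v.src = ((U 0).comp (i.arr m) h₁).tgt) (h₃ : (v.map f).src = h.obj m.tgt) :
    Op.post (Op.preAll (fun t => (U t).map f) (Op.map h m.op)) (v.map f) h₃ =
      ((((U 0).comp (i.arr m) h₁).comp v h₂).map f).op := by
  have h₁' : ((i.arr m).map f).src = ((U 0).map f).tgt := congrArg f.obj h₁
  have h₁'' : (m.map h).src = ((U 0).map f).tgt := by rw [hmap]; exact h₁'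
  have h₂' : (v.map f).src = (((U 0).comp (i.arr m) h₁).map f).tgt := congrArg f.obj h₂
  have e1 : Op.preAll (fun t => (U t).map f) (Op.map h m.op) =
      (((U 0).map f).comp (m.map h) h₁'').op := by
    rw [← UArr.op_map]
    exact Op.preAll_op _ _ _
  have e2 : (((U 0).comp (i.arr m) h₁).comp v h₂).map f =
      ((((U 0).map f).comp (m.map h) h₁'')).comp (v.map f) h₃ :=
    (UArr.map_comp f _ _ _ h₂').trans (UArr.comp_congr
      ((UArr.map_comp f _ _ _ h₁').trans (UArr.comp_congr rfl (hmap _).symm _ _)) rfl _ _)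
  have key : ∀ (W : UArr P) (hW : W = ((((U 0).map f).comp (m.map h) h₁'')).comp (v.map f) h₃)
      (hx : W.tgt = f.obj v.tgt), Op.post (Op.preAll (fun t => (U t).map f) (Op.map h m.op))
        (v.map f) h₃ = Op.cod hx W.op := by
    rintro _ rfl hx
    simp only [e1]
    exact (UArr.op_comp _ _ _).symm
  exact key _ e2 rfl

theorem Gen.eval_act (σ : Fin k ≃ Fin l) {a' : Fin k → A.Ob} (h' : ∀ t, a' t = a (σ t))
    (g : i.Gen a d) : (g.act σ h').eval hobj = Op.act σ (g.eval hobj) := by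
  cases g with
  | tt U m v hb hU hv hd =>
    cases hd
    refine Eq.trans ?_ (Op.act_post σ (Op.preAll (fun t => (U t).map f) (Op.map h m)) (v.map f)
      ((congrArg f.obj hv).trans (hobj _).symm))
    refine congrArg (fun q => Op.post q (v.map f) _) ?_
    refine Eq.trans ?_ (Op.preAll_act σ _ _)
    exact congrArg (Op.preAll _) (Op.map_act h σ m)
  | bb hl w hb hd =>
    cases hd
    refine Eq.trans ?_ (Op.act_act _ _ _).symm
    exact Op.act_congr (fun t => by omega) _

theorem Gen.eval_comp (hmap : ∀ g : UArr M, g.map h = (i.arr g).map f)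
    (g : i.Gen a x) (g' : i.Gen (cons x b) d) (h' : (g'.eval hobj).1 0 = f.obj x) :
    (g.comp g').eval hobj = Op.comp (g.eval hobj) (g'.eval hobj) h' := by
  cases g with
  | tt U m v hb hU hv hd =>
    cases hd
    have hv₁ : (v.map f).src = h.obj _ := (congrArg f.obj hv).trans (hobj _).symm
    cases g' with
    | tt U' m' v' hb' hU' hv' hd' =>
      cases hd'
      have hu : (U' 0).src = v.tgt := hb' 0
      obtain ⟨L, hL, hL₁, hL₂⟩ := i.exists_lift (v.comp (U' 0) hu) hv (hU' 0)
      have hv₂ : (v'.map f).src = h.obj _ := (congrArg f.obj hv').trans (hobj _).symm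
      have hu' : ((U' 0).map f).src = (v.map f).tgt := congrArg f.obj hu
      have hm : (Op.map h m').1 0 = ((U' 0).map f).tgt :=
        (hobj _).trans (congrArg f.obj (hU' 0)).symm
      have hL' : L.map h = (v.map f).comp ((U' 0).map f) hu' :=
        (hmap L).trans ((congrArg (UArr.map f) hL).symm.trans (UArr.map_comp f _ _ _ hu'))
      have hL₁' : (L.map h).src = h.obj _ := congrArg h.obj hL₁
      have hm' : (Op.map h m').1 0 = (L.map h).tgt := congrArg h.obj hL₂
      have e1 : Op.map h (Op.comp (Op.post m L hL₁) m' hL₂) =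
          Op.comp (Op.post (Op.map h m) (L.map h) hL₁') (Op.map h m') hm' :=
        (Op.map_comp h _ _ hL₂ hm').trans (Op.comp_congr (Op.map_post h m L hL₁ hL₁') rfl _ _)
      have e2 := mid_eq m v (U' 0) m' hu hv (hU' 0) L hL hL₁ hL₂
      have eF : (fun t => (Fin.append U (Fin.tail U') t).map f) =
          Fin.append (fun t => (U t).map f) (Fin.tail fun t => (U' t).map f) :=
        funext fun t => append_fun (UArr.map f) (fun _ => rfl) (fun _ => rfl) t
      have h'' : (Op.preAll (fun t => (U' t).map f) (Op.map h m')).1 0 = (v.map f).tgt :=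
        (Op.preAll_fst _ (fun t => (hobj _).trans (congrArg f.obj (hU' t)).symm) 0).trans hu'
      have e3 : Op.comp (Op.post (Op.preAll (fun t => (U t).map f) (Op.map h m)) (v.map f) hv₁)
          (Op.preAll (fun t => (U' t).map f) (Op.map h m')) h'' =
          Op.preAll (Fin.append (fun t => (U t).map f) (Fin.tail fun t => (U' t).map f))
            (Op.comp (Op.post (Op.map h m) (L.map h) hL₁') (Op.map h m') hm') := by
        refine (Op.comp_congr (Op.post_preAll _ _ _ _) rfl h'' h'').trans ?_
        refine (Op.preAll_comp_preAll (fun t => (U t).map f) (fun t => (U' t).map f) _ _ hm hu'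
          h'').trans (congrArg (Op.preAll _) ?_)
        refine (Op.comp_congr (Op.post_post (Op.map h m) (v.map f) ((U' 0).map f) hv₁ hu') rfl
          hm hm).trans ?_
        exact Op.comp_post_congr _ _ hL'.symm _ _ _ _
      refine Eq.trans ?_ (Op.post_comp (Op.post (Op.preAll (fun t => (U t).map f) (Op.map h m))
        (v.map f) hv₁) (Op.preAll (fun t => (U' t).map f) (Op.map h m')) (v'.map f) h'' hv₂)
      refine congrArg (fun q => Op.post q (v'.map f) hv₂) (Eq.trans ?_ e3.symm)
      refine (congrArg (fun W => Op.preAll W _) eF).trans (congrArg (Op.preAll _) ?_)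
      exact (congrArg (Op.map h) e2).trans e1
    | bb hl w hb' hd' =>
      cases hd'
      obtain rfl : k = 0 := by omega
      have hw : (w.map f).src = (v.map f).tgt := congrArg f.obj (hb' : w.src = v.tgt)
      have hw' : ((v.comp w hb').map f) = (v.map f).comp (w.map f) hw := UArr.map_comp f _ _ _ hw
      have e1 : ∀ (W : UArr P) (hW : W.src = h.obj _) (e : W = (v.map f).comp (w.map f) hw)
          (hx : W.tgt = f.obj w.tgt) (X : Op P.toSymMultigraph l _),
          Op.cod hx (Op.post X W hW) = Op.post (Op.post X (v.map f) hv₁) (w.map f) hw := by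
        rintro _ hW rfl hx X
        exact (Op.post_post _ _ _ _ _).symm
      refine Eq.trans ?_ ((e1 ((v.comp w hb').map f) hv₁ hw' rfl
        (Op.preAll (fun t => (U t).map f) (Op.map h m))).trans ?_)
      · refine congrArg (fun q => Op.post q ((v.comp w hb').map f) hv₁) ?_
        refine (congrArg (Op.preAll _) (Op.map_act h _ m)).trans ?_
        refine (Op.preAll_act (finCongr _) (fun t => (U t).map f) (Op.map h m)).trans ?_
        exact Op.act_id (fun _ => rfl) _
      · exact Op.comp_congr rfl (Op.act_id (fun _ => rfl) _).symm hw h'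
  | bb hl w hb hd =>
    cases hl
    cases hd
    cases g' with
    | tt U' m' v' hb' hU' hv' hd' =>
      cases hd'
      have hv₂ : (v'.map f).src = h.obj _ := (congrArg f.obj hv').trans (hobj _).symm
      have hu : (U' 0).src = w.tgt := hb' 0
      have hu' : ((U' 0).map f).src = (w.map f).tgt := congrArg f.obj hu
      have hm : ∀ t, (Op.post (Op.map h m') (v'.map f) hv₂).1 t = ((U' t).map f).tgt :=
        fun t => (Op.post_fst _ _ _ _).trans ((hobj _).trans (congrArg f.obj (hU' t)).symm)
      have h'' : (Op.preAll (fun t => (U' t).map f) (Op.post (Op.map h m') (v'.map f) hv₂)).1 0 =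
          (w.map f).tgt := (Op.preAll_fst _ hm 0).trans hu'
      have eF : (fun t => ((Fin.cons (w.comp (U' 0) hu) (Fin.tail U') : Fin (k + 1) → UArr A)
          t).map f) = Fin.cons ((w.map f).comp ((U' 0).map f) hu')
            (Fin.tail fun t => (U' t).map f) :=
        funext (Fin.cases (UArr.map_comp f _ _ _ hu') fun _ => rfl)
      refine (Op.post_preAll _ _ _ hv₂).trans (Eq.trans ?_ (Op.comp_congr
        (Op.act_id (fun _ => rfl) (w.map f).op) (Op.post_preAll _ _ _ hv₂) h' h'').symm)
      refine Eq.trans ?_ ((Op.comp_op (w.map f) _ h'').trans (congrArg (Op.act _)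
        ((Op.preZero_preAll _ _ _ hm hu' h'').trans (congrArg (fun F => Op.preAll F _)
          eF.symm)))).symm
      refine Eq.trans ?_ (Op.preAll_act _ _ _)
      refine congrArg (Op.preAll _) ?_
      refine Eq.trans ?_ (Op.act_post _ (Op.map h m') (v'.map f) hv₂)
      exact congrArg (fun q => Op.post q (v'.map f) hv₂) (Op.map_act h _ m')
    | bb hl w' hb' hd' =>
      cases hd'
      obtain rfl : k = 0 := by omega
      have hw : (w'.map f).src = (w.map f).tgt := congrArg f.obj (hb' : w'.src = w.tgt)
      have e1 : ∀ (W : UArr P) (e : W = (w.map f).comp (w'.map f) hw)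
          (hx : W.tgt = f.obj w'.tgt),
          Op.cod hx W.op = Op.comp (k := 0) (w.map f).op (w'.map f).op hw := by
        rintro _ rfl hx
        exact UArr.op_comp _ _ _
      refine Eq.trans ?_ ((e1 _ (UArr.map_comp f w w' hb' hw) rfl).trans ?_)
      · exact Op.act_id (fun _ => rfl) _
      · exact Op.comp_congr (Op.act_id (fun _ => rfl) _).symm (Op.act_id (fun _ => rfl) _).symm
          hw h'

end UnaryInclusion

theorem op_mk_injective {G : SymMultigraph.{v, u} V} {k : ℕ} (a : Fin k → G.Ob) (b : G.Ob) :
    Function.Injective fun e : Elt (G.Hom a b) => (⟨a, e⟩ : Op G k b) :=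
  fun _ _ => Op.mk_inj

theorem UArr.mk_map {P Q : SymMulticat.{v, u} V} (f : SymMulticat.Multifunctor P Q) {x y : P.Ob}
    (e : Elt (P.Hom (single x) y)) : (⟨x, y, e⟩ : UArr P).map f =
      ⟨f.obj x, f.obj y, f.map (single x) y ⋄ e⟩ :=
  UArr.ofOp_op ⟨f.obj x, f.obj y, f.map (single x) y ⋄ e⟩

theorem Op.cod_post {P : SymMulticat.{v, u} V} {k : ℕ} {x : P.Ob}
    {q q' : Op P.toSymMultigraph k x} {W W' : UArr P} (eq : q = q') (e : W = W') (h : W.src = x)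
    (h' : W'.src = x) (hy : W.tgt = W'.tgt) : Op.cod hy (post q W h) = post q' W' h' := by
  subst e eq; rfl

theorem UArr.cod_op {P : SymMulticat.{v, u} V} {W W' : UArr P} (e : W = W')
    (h : W.tgt = W'.tgt) : Op.cod h W.op = W'.op := by
  subst e; rfl

theorem Op.cod_post_preAll_one {P : SymMulticat.{v, u} V} {k : ℕ} {x : P.Ob}
    (q : Op P.toSymMultigraph k x) (F : Fin k → UArr P) (hF : ∀ t, F t = UArr.one P (q.1 t))
    (W : UArr P) (hW : W = UArr.one P x) (h : W.src = x) (hy : W.tgt = x) :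
    Op.cod hy (post (preAll F q) W h) = q := by
  subst hW
  rw [preAll_one F q hF]
  exact post_one q rfl

theorem Op.map_map {P Q R : SymMulticat.{v, u} V} (F : P ⟶ Q) (G : Q ⟶ R) {k : ℕ} {y : P.Ob}
    (q : Op P.toSymMultigraph k y) : Op.map (F ≫ G) q = Op.map G (Op.map F q) :=
  congrArg (Sigma.mk _) (comp_ap _ _ _)

namespace UnaryInclusion

variable {M A P : SymMulticat.{v, u} V} {i : UnaryInclusion M A}
  {f : SymMulticat.Multifunctor A P} {h : SymMulticat.Multifunctor M P}

variable [HasColimits V]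

variable (hobj : ∀ x, h.obj x = f.obj (i.obj x)) {k l : ℕ} {b : Fin k → A.Ob} {d : A.Ob}

theorem compat_eval [MonoidalClosed V] (hmap : ∀ g : UArr M, g.map h = (i.arr g).map f) :
    i.Compat (fun g : i.Gen b d => g.eval hobj) where
  rel := fun U F m g v hUF hF hg hv hd h₁ h₂ h₂' h₃ _ _ => by
    cases hd
    exact Gen.eval_rel hmap U F m g v hUF hF hg hv ((congrArg f.obj h₂).trans (hobj _).symm)
      ((congrArg f.obj hv).trans (hobj _).symm)
  collapse := fun hk U m v hU hv hd h₁ h₂ hd' _ _ => by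
    cases hk
    cases hd
    have e : Op.act (finCongr (Eq.symm rfl)) m = m := Op.act_id (fun _ => rfl) m
    have e' : m = (UArr.ofOp (Op.act (finCongr (Eq.symm rfl)) m)).op := by
      rw [e, UArr.op_ofOp]
    refine Eq.trans ?_ ((Gen.eval_collapse hmap U _ v h₁ h₂
      ((congrArg f.obj hv).trans (hobj _).symm)).trans (Op.act_id (fun _ => rfl) _).symm)
    exact congrArg (fun q => Op.post (Op.preAll (fun t => (U t).map f) (Op.map h q)) (v.map f) _) e'

theorem exists_descHom [MonoidalClosed V] (hmap : ∀ g : UArr M, g.map h = (i.arr g).map f)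
    (b : Fin k → A.Ob) (d : A.Ob) :
    ∃ χ : i.NHom b d ⟶ P.Hom (f.obj ∘ b) (f.obj d), ∀ g : i.Gen b d,
      (⟨f.obj ∘ b, χ ⋄ g.el⟩ : Op P.toSymMultigraph k (f.obj d)) = g.eval hobj := by
  refine i.exists_desc_gen (fun e => (⟨f.obj ∘ b, e⟩ : Op P.toSymMultigraph k (f.obj d)))
    (op_mk_injective _ _) (fun g => g.eval hobj) (compat_eval hobj hmap)
    (fun p => (tensMap (fun t => f.map (single (b t)) (i.obj (p.1 t))) ⊗ₘ
      ((h.map p.1 p.2 ≫ P.cast (a' := f.obj ∘ i.obj ∘ p.1) fun t => (hobj (p.1 t)).symm) ⊗ₘ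
        f.map (single (i.obj p.2)) d)) ≫ (α_ _ _ _).inv ≫
      preHom (f.obj ∘ b) (f.obj ∘ i.obj ∘ p.1) (h.obj p.2) ▷ _ ≫
      P.post _ (hobj p.2) (f.obj d))
    (fun hk => f.map (single (b (pos hk))) d ≫ P.cast (a' := f.obj ∘ single (b (pos hk)))
      (fun t => rfl) ≫ P.act (finCongr hk) fun t => by
        subst hk
        exact congrArg (fun t => f.obj (b t)) (Subsingleton.elim (α := Fin 1) _ _)) ?_ ?_
  · intro p U m v
    rw [comp_ap, comp_ap, comp_ap, tensorHom_ap, tensorHom_ap, tensMap_ap, associator_inv_ap,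
      whiskerRight_ap]
    refine (Op.mk_post _ _ _).trans ?_
    refine Op.cod_post ?_ (UArr.mk_map f v).symm (hobj p.2).symm (hobj p.2).symm rfl
    rw [mk_preHom]
    refine congrArg₂ Op.preAll (funext fun t => (UArr.mk_map f (U t)).symm) ?_
    rw [comp_ap]
    exact Op.mk_cast _ _
  · intro hk w
    rw [comp_ap, comp_ap]
    subst hk
    refine (Op.mk_act (finCongr rfl) _ _).trans ?_
    refine congrArg (Op.act (finCongr rfl)) ?_
    refine (Op.mk_cast _ _).trans ?_
    exact UArr.cod_op (UArr.mk_map f (x := b (pos rfl)) (y := d) w).symm rfl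

/-- The multifunctor out of the pushout. -/
def descHom [MonoidalClosed V] (hmap : ∀ g : UArr M, g.map h = (i.arr g).map f)
    (b : Fin k → A.Ob) (d : A.Ob) : i.NHom b d ⟶ P.Hom (f.obj ∘ b) (f.obj d) :=
  (exists_descHom hobj hmap b d).choose

theorem descHom_el [MonoidalClosed V] (hmap : ∀ g : UArr M, g.map h = (i.arr g).map f)
    (g : i.Gen b d) :
    (⟨f.obj ∘ b, descHom hobj hmap b d ⋄ g.el⟩ : Op P.toSymMultigraph k (f.obj d)) =
      g.eval hobj := (exists_descHom hobj hmap b d).choose_spec g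

variable [MonoidalClosed V]

/-- The multifunctor out of the pushout. -/
def desc (hmap : ∀ g : UArr M, g.map h = (i.arr g).map f) : i.adjoin ⟶ P :=
  Multifunctor.ofSpans (P := i.adjoin) f.obj (fun b d => descHom hobj hmap b d)
    (fun b d e => ∃ g : i.Gen b d, e = g.el) (fun _ _ => i.spans_gen)
    (by
      rintro k l σ a b _ ⟨g, rfl⟩
      have e := actHom_el σ (fun _ => rfl) g
      refine (congrArg (fun e => (⟨f.obj ∘ a ∘ σ, descHom hobj hmap (a ∘ σ) b ⋄ e⟩ :
        Op P.toSymMultigraph k (f.obj b))) e).trans ?_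
      refine (descHom_el hobj hmap _).trans ((Gen.eval_act hobj σ _ g).trans ?_)
      exact congrArg (Op.act σ) (descHom_el hobj hmap g).symm)
    (fun x => by
      refine (congrArg (fun e => (⟨single (f.obj x), descHom hobj hmap (single x) x ⋄ e⟩ :
        Op P.toSymMultigraph 1 (f.obj x))) (i.oneHom_unit x)).trans ?_
      refine (descHom_el hobj hmap _).trans ?_
      refine (Op.act_id (fun _ => rfl) _).trans ?_
      exact UArr.cod_op (UArr.map_one f x) rfl)
    (by
      rintro l k a x b c _ _ ⟨g, rfl⟩ ⟨g', rfl⟩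
      refine (congrArg (fun e => (⟨f.obj ∘ Fin.append a b, descHom hobj hmap (Fin.append a b) c ⋄
        e⟩ : Op P.toSymMultigraph (l + k) (f.obj c))) (i.compHom_el g g')).trans ?_
      have hx : (g'.eval hobj).1 0 = f.obj x := by rw [← descHom_el hobj hmap]; rfl
      refine (descHom_el hobj hmap _).trans ((Gen.eval_comp hobj hmap g g' hx).trans ?_)
      exact Op.comp_congr (descHom_el hobj hmap g).symm (descHom_el hobj hmap g').symm _ _)

@[simp] theorem desc_obj (hmap : ∀ g : UArr M, g.map h = (i.arr g).map f) (x : A.Ob) :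
    Multifunctor.obj (desc hobj hmap) x = f.obj x := rfl

theorem map_desc (hmap : ∀ g : UArr M, g.map h = (i.arr g).map f) (g : i.Gen b d) :
    Op.map (P := i.adjoin) (y := d) (desc hobj hmap) g.op = g.eval hobj :=
  (congrArg (Op.map (P := i.adjoin) (y := d) (desc hobj hmap)) g.mk_el.symm).trans
    (descHom_el hobj hmap g)

theorem map_desc_inr (hmap : ∀ g : UArr M, g.map h = (i.arr g).map f) (w : UArr A) :
    (i.inr w).map (desc hobj hmap) = w.map f := by
  refine (congrArg UArr.ofOp ?_).trans (UArr.ofOp_op (w.map f))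
  exact (map_desc hobj hmap (Gen.bb (b := single w.src) rfl w rfl rfl)).trans (Op.act_id (fun _ => rfl) _)

theorem inl_desc (hmap : ∀ g : UArr M, g.map h = (i.arr g).map f) : i.inl ≫ desc hobj hmap = h := by
  refine Multifunctor.ext_op (fun x => (hobj x).symm) fun {k y} q => ?_
  have e : Op.map (i.inl ≫ desc hobj hmap) q = Gen.eval hobj (Gen.tt (i := i)
      (fun t => UArr.one A (i.obj (q.1 t))) q (UArr.one A (i.obj y)) (fun _ => rfl)
        (fun _ => rfl) rfl rfl) := by
    rw [Op.map_map, map_inl]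
    exact map_desc hobj hmap (b := fun t => i.obj (q.1 t)) (Gen.tt (i := i)
      (fun t => UArr.one A (i.obj (q.1 t))) q (UArr.one A (i.obj y)) (fun _ => rfl)
        (fun _ => rfl) rfl rfl)
  refine (congrArg (Op.cod (hobj y).symm) e).trans ?_
  refine Op.cod_post_preAll_one (Op.map h q) _ (fun t => ?_) _ ?_ (hobj y).symm _
  · exact (UArr.map_one f _).trans (congrArg (UArr.one P) (hobj (q.1 t)).symm)
  · exact (UArr.map_one f _).trans (congrArg (UArr.one P) (hobj y).symm)

theorem map_ttOp (F : i.adjoin ⟶ P) {y : M.Ob} (U : Fin k → UArr A)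
    (m : Op M.toSymMultigraph k y) (v : UArr A) (hU : ∀ t, (U t).tgt = i.obj (m.1 t))
    (hv : v.src = i.obj y)
    (hv' : ((i.inr v).map F).src = Multifunctor.obj (i.inl ≫ F) y) :
    Op.map F (i.ttOp U m v hU hv rfl) =
      Op.post (Op.preAll (fun t => (i.inr (U t)).map F) (Op.map (i.inl ≫ F) m))
        ((i.inr v).map F) hv' := by
  rw [ttOp_eq, Op.map_map]
  refine (Op.map_post F _ (i.inr v) hv hv').trans ?_
  refine congrArg (fun q => Op.post q ((i.inr v).map F) hv') ?_
  exact Op.map_preAll _ _ _ fun t => (hU t).symm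

/-- A multifunctor out of the pushout is determined by its restrictions. -/
theorem adjoin_hom_ext {F G : i.adjoin ⟶ P} (h₁ : ∀ w, (i.inr w).map F = (i.inr w).map G)
    (h₂ : i.inl ≫ F = i.inl ≫ G) : F = G := by
  have hobj : ∀ x, Multifunctor.obj F x = Multifunctor.obj G x := fun x =>
    congrArg UArr.src (h₁ (UArr.one A x))
  refine Multifunctor.ext_of_spans (fun b d e => ∃ g : i.Gen b d, e = g.el)
    (fun _ _ => i.spans_gen) hobj ?_
  rintro k b d _ ⟨g, rfl⟩
  cases g with
  | tt U m v hb hU hv hd =>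
    cases hd
    have e := (Gen.tt (i := i) U m v hb hU hv rfl).mk_el
    refine (congrArg (fun q => Op.cod (hobj v.tgt) (Op.map F q)) e).trans
      (Eq.trans ?_ (congrArg (Op.map G) e).symm)
    have hv₁ : ((i.inr v).map F).src = Multifunctor.obj (i.inl ≫ F) _ :=
      congrArg (Multifunctor.obj F) hv
    have hv₂ : ((i.inr v).map G).src = Multifunctor.obj (i.inl ≫ G) _ :=
      congrArg (Multifunctor.obj G) hv
    refine (congrArg (Op.cod (hobj v.tgt)) (map_ttOp F U m v hU hv hv₁)).trans
      (Eq.trans ?_ (map_ttOp G U m v hU hv hv₂).symm)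
    revert hv₁ hv₂
    rw [h₂]
    intro hv₁ hv₂
    refine Op.cod_post ?_ (h₁ v) _ _ _
    exact congrArg (fun W => Op.preAll W _) (funext fun t => h₁ (U t))
  | bb hk w hb hd =>
    cases hk
    cases hd
    have e : (⟨b, (Gen.bb (i := i) rfl w hb rfl).el⟩ : i.RawOp 1 w.tgt) = (i.inr w).op :=
      (Gen.bb (i := i) rfl w hb rfl).mk_el
    refine (congrArg (fun q => Op.cod (hobj w.tgt) (Op.map F q)) e).trans
      (Eq.trans ?_ (congrArg (Op.map G) e).symm)
    refine Eq.trans ?_ ((UArr.cod_op (h₁ w) (hobj w.tgt)).trans (UArr.op_map _ _))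
    exact congrArg (Op.cod (hobj w.tgt)) (UArr.op_map _ _).symm

end UnaryInclusion

theorem UArr.map_map {P Q R : SymMulticat.{v, u} V} (F : P ⟶ Q) (G : Q ⟶ R) (w : UArr P) :
    w.map (F ≫ G) = (w.map F).map G := by
  obtain ⟨x, y, e⟩ := w
  refine (UArr.mk_map (F ≫ G) e).trans (Eq.trans ?_ (congrArg (UArr.map G) (UArr.mk_map F e)).symm)
  refine Eq.trans ?_ (UArr.mk_map G _).symm
  exact congrArg (UArr.mk _ _) (comp_ap _ _ _)

namespace UnaryInclusion

variable {M A : SymMulticat.{v, u} V} (i : UnaryInclusion M A) [HasColimits V] [MonoidalClosed V]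

theorem map_inl_arr (w : UArr M) : w.map i.inl = i.inr (i.arr w) := by
  refine (congrArg UArr.ofOp ?_).trans (UArr.ofOp_op (i.inr (i.arr w)))
  refine (i.map_inl w.op).trans ?_
  refine (i.tt_collapse rfl (fun _ => UArr.one A (i.obj w.src)) w.op (UArr.one A (i.obj w.tgt))
    (fun _ => rfl) rfl rfl ?_ ?_ rfl).trans ?_
  · rfl
  · rfl
  · refine i.bb_congr (d := i.obj w.tgt) ?_ _ _ _ rfl
    refine (UArr.comp_one _ _).trans ((UArr.one_comp _ rfl).trans (congrArg i.arr ?_))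
    exact (congrArg UArr.ofOp (Op.act_id (fun _ => rfl) _)).trans (UArr.ofOp_op w)

end UnaryInclusion

section Free

variable [HasColimits V] [MonoidalClosed V] {C : Type v} [EnrichedCategory V C]

theorem E_post (x y z : C) : (E V C).post (single (x : (E V C).Ob)) (rfl : (y : (E V C).Ob) = y) z =
    eComp V x y z := by
  have h : (E V C).post (single (x : (E V C).Ob)) (rfl : (y : (E V C).Ob) = y) z =
    (EnrichedCategory.Hom x y : V) ◁ 𝟙 _ ≫ eComp V x y z ≫ 𝟙 _ := rfl
  rw [h, MonoidalCategory.whiskerLeft_id, Category.id_comp, Category.comp_id]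

/-- An element of a hom object, as an arrow of the free multicategory. -/
def freeArr (x y : C) (e : Elt (x ⟶[V] y)) : UArr (E V C) := ⟨x, y, e⟩

theorem freeArr_comp (x y z : C) (e : Elt (x ⟶[V] y)) (e' : Elt (y ⟶[V] z)) :
    freeArr x z (eComp V x y z ⋄ (e ⊙ e')) = (freeArr x y e).comp (freeArr y z e') rfl := by
  refine Eq.trans ?_ (UArr.mk_comp (P := E V C) (x := x) (y := y) (z := z) e e')
  exact congrArg (fun φ : (x ⟶[V] y) ⊗ (y ⟶[V] z) ⟶ (x ⟶[V] z) => freeArr x z (φ ⋄ (e ⊙ e')))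
    (E_post x y z).symm

theorem freeArr_desc {P : SymMulticat.{v, u} V} (F : EnrichedFunctor V C P.Und) {x y : C}
    (e : Elt (x ⟶[V] y)) : (freeArr x y e).map (SymMulticat.desc P F) =
      ⟨F.obj x, F.obj y, F.map x y ⋄ e⟩ := by
  refine (UArr.mk_map (SymMulticat.desc P F) (x := x) (y := y) e).trans
    (congrArg (UArr.mk _ _) ?_)
  refine congrArg (fun φ => φ ⋄ e) (?_ : descMap P F (single x) y = F.map x y)
  refine Eq.trans ?_ (Category.comp_id _)
  exact congrArg (F.map x y ≫ ·) (P.cast_refl _ _ _)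

theorem free_hom_ext {P : SymMulticat.{v, u} V} {F G : E V C ⟶ P}
    (h : ∀ w : UArr (E V C), w.map F = w.map G) : F = G := by
  have hobj : ∀ x : C, Multifunctor.obj F x = Multifunctor.obj G x := fun x =>
    congrArg UArr.src (h (UArr.one (E V C) x))
  refine Multifunctor.ext_of_spans (P := E V C) (fun {k} _ _ _ => k = 1) (fun {k} a b => ?_)
    hobj ?_
  · by_cases hk : k = 1
    · exact (spans_top _).mono fun _ _ => hk
    · exact fun _ _ φ ψ _ => (EHom_subsingleton (C := C) hk a b _).elim φ ψ
  · rintro k a b e rfl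
    obtain ⟨x, rfl⟩ : ∃ x, a = single x :=
      ⟨a 0, funext fun t => congrArg a (Subsingleton.elim t 0)⟩
    refine Eq.trans ?_ ((UArr.cod_op (h ⟨x, b, e⟩) (hobj b)).trans (UArr.op_map _ _))
    exact congrArg (Op.cod (hobj b)) (UArr.op_map F (⟨x, b, e⟩ : UArr (E V C))).symm

end Free

section FullFaithful

variable [HasColimits V] [MonoidalClosed V] {M : SymMulticat.{v, u} V} {B : Type v}
  [EnrichedCategory V B] {i : EnrichedFunctor V M.Und B}

/-- A full and faithful inclusion `M₁ ⟶ B`, as an inclusion of unary morphisms `M ⟶ E B`. -/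
def unaryInclusion (hi : SymMulticat.IsFullFaithfulInclusion i) : UnaryInclusion M (E V B) where
  obj := i.obj
  injective := hi.1
  map := fun x y => i.map x y
  isIso := fun x y => hi.2 x y
  map_one := fun x => i.map_id x
  map_comp := fun x y z => (i.map_comp x y z).trans
    (congrArg (fun φ => (i.map x y ⊗ₘ i.map y z) ≫ φ) (E_post _ _ _).symm)

variable (hi : SymMulticat.IsFullFaithfulInclusion i)

/-- The inclusion of `B` into the unary morphisms of the pushout. -/
def inrFunctor : EnrichedFunctor V B (unaryInclusion hi).adjoin.Und where
  obj := fun x => x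
  map := fun x y => (unaryInclusion hi).κ rfl (single x) y
  map_id := fun x => rfl
  map_comp := fun x y z => by
    refine ((spans_top _).tensor (spans_top _)).ext ?_
    rintro _ ⟨e, e', -, -, rfl⟩
    refine (comp_ap _ _ _).trans (Eq.trans ?_
      ((comp_ap _ _ _).trans (congrArg _ (tensorHom_ap _ _ _ _))).symm)
    have e₁ := (unaryInclusion hi).inr_comp (freeArr x y e) (freeArr y z e') rfl rfl
    have e₂ := UArr.mk_comp (P := (unaryInclusion hi).adjoin) (x := x) (y := y) (z := z)
      ((unaryInclusion hi).κ rfl (single x) y ⋄ e) ((unaryInclusion hi).κ rfl (single y) z ⋄ e')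
    have e₃ := congrArg (unaryInclusion hi).inr (freeArr_comp x y z e e')
    have e₄ := e₃.trans (e₁.symm.trans e₂.symm)
    injection e₄

/-- The map `E B ⟶ N` of the pushout. -/
def adjoinInr : E V B ⟶ (unaryInclusion hi).adjoin :=
  SymMulticat.desc _ (inrFunctor hi)

theorem map_adjoinInr (w : UArr (E V B)) : w.map (adjoinInr hi) = (unaryInclusion hi).inr w :=
  freeArr_desc (inrFunctor hi) w.el

theorem map_E_map (w : UArr (E V M.Und)) :
    w.map (E.map i) = (unaryInclusion hi).arr (w.map (counit M)) := by
  refine (freeArr_desc _ w.el).trans (Eq.trans ?_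
    (congrArg (unaryInclusion hi).arr (freeArr_desc (EnrichedFunctor.id V M.Und) w.el)).symm)
  refine congrArg (UArr.mk _ _) ?_
  refine (congrArg (fun φ => φ ⋄ w.el) (Category.comp_id (i.map w.src w.tgt))).trans ?_
  exact congrArg (i.map w.src w.tgt ⋄ ·) (id_ap w.el).symm

theorem exists_map_counit (w : UArr M) : ∃ w' : UArr (E V M.Und), w'.map (counit M) = w :=
  ⟨freeArr w.src w.tgt w.el, (freeArr_desc (EnrichedFunctor.id V M.Und) w.el).trans
    (congrArg (UArr.mk _ _) (id_ap w.el))⟩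

theorem adjoin_w : E.map i ≫ adjoinInr hi = counit M ≫ (unaryInclusion hi).inl := by
  refine free_hom_ext fun w => ?_
  rw [UArr.map_map, UArr.map_map, map_adjoinInr, map_E_map hi, UnaryInclusion.map_inl_arr]

theorem map_eq_of_w {P : SymMulticat.{v, u} V} {f : E V B ⟶ P} {h : M ⟶ P}
    (w : E.map i ≫ f = counit M ≫ h) (g : UArr M) :
    g.map h = ((unaryInclusion hi).arr g).map f := by
  obtain ⟨g', rfl⟩ := exists_map_counit g
  rw [← UArr.map_map, ← w, UArr.map_map, map_E_map hi]

theorem adjoin_isPushout :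
    IsPushout (E.map i) (counit M) (adjoinInr hi) (unaryInclusion hi).inl where
  w := adjoin_w hi
  isColimit' := ⟨PushoutCocone.IsColimit.mk _
    (fun s => (unaryInclusion hi).desc (f := s.inl) (h := s.inr)
      (fun x => (obj_eq s.inl s.inr s.condition x).symm) (map_eq_of_w hi s.condition))
    (fun s => free_hom_ext fun w => (UArr.map_map _ _ w).trans
      ((congrArg _ (map_adjoinInr hi w)).trans (UnaryInclusion.map_desc_inr _ _ w)))
    (fun s => UnaryInclusion.inl_desc _ _)
    (fun s m h₁ h₂ => UnaryInclusion.adjoin_hom_ext (fun w => by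
      refine Eq.trans ?_ (UnaryInclusion.map_desc_inr _ _ w).symm
      rw [← map_adjoinInr, ← UArr.map_map, h₁])
      (h₂.trans (UnaryInclusion.inl_desc _ _).symm))⟩

end FullFaithful

/-- The tensor product of one factor. -/
def singleTens (X : Fin 1 → V) : X 0 ⟶ tens X := (λ_ (X 0)).inv

theorem singleTens_ap (X : Fin 1 → V) (e : ∀ t, Elt (X t)) : singleTens X ⋄ e 0 = tensEl e :=
  leftUnitor_inv_ap _

/-- Insertion of two points on the right. -/
def tensPointRight {X Y P Q : V} (f : X ⟶ Y) (p : 𝟙_ V ⟶ P) (q : 𝟙_ V ⟶ Q) : X ⟶ Y ⊗ P ⊗ Q :=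
  (ρ_ _).inv ≫ (f ⊗ₘ ((ρ_ _).inv ≫ (p ⊗ₘ q)))

theorem tensPointRight_ap {X Y P Q : V} (f : X ⟶ Y) (p : 𝟙_ V ⟶ P) (q : 𝟙_ V ⟶ Q) (e : Elt X) :
    tensPointRight f p q ⋄ e = (f ⋄ e) ⊙ ((p ⋄ Elt.unit) ⊙ (q ⋄ Elt.unit)) := by
  rw [tensPointRight, comp_ap, rightUnitor_inv_ap, tensorHom_ap, comp_ap, rightUnitor_inv_ap,
    tensorHom_ap]

/-- Insertion of two points on the left. -/
def tensPointLeft {P Q : V} (p : 𝟙_ V ⟶ P) (q : 𝟙_ V ⟶ Q) (X : V) : X ⟶ P ⊗ Q ⊗ X :=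
  (λ_ _).inv ≫ (p ⊗ₘ ((λ_ _).inv ≫ q ▷ X))

theorem tensPointLeft_ap {P Q X : V} (p : 𝟙_ V ⟶ P) (q : 𝟙_ V ⟶ Q) (e : Elt X) :
    tensPointLeft p q X ⋄ e = (p ⋄ Elt.unit) ⊙ ((q ⋄ Elt.unit) ⊙ e) := by
  rw [tensPointLeft, comp_ap, leftUnitor_inv_ap, tensorHom_ap, comp_ap, leftUnitor_inv_ap,
    whiskerRight_ap]

namespace UnaryInclusion

variable {M A : SymMulticat.{v, u} V} {i : UnaryInclusion M A} [HasColimits V]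

variable {k : ℕ} {b : Fin k → A.Ob} {d : A.Ob} {α : Type*} {Φ : i.Gen b d → α}

theorem Balanced.pre (hΦ : i.Balanced Φ) {y : M.Ob} (U : Fin k → UArr A) (F : Fin k → UArr M)
    (m : Op M.toSymMultigraph k y) (v : UArr A) (hUF : ∀ t, (i.arr (F t)).src = (U t).tgt)
    (hF : ∀ t, m.1 t = (F t).tgt) (hv : v.src = i.obj y) (hd : v.tgt = d)
    (h₁ : ∀ t, ((U t).comp (i.arr (F t)) (hUF t)).tgt = i.obj (m.1 t))
    (h₃ : ∀ t, (U t).tgt = i.obj ((Op.preAll F m).1 t))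
    (hb : ∀ t, (U t).src = b t) (hb' : ∀ t, ((U t).comp (i.arr (F t)) (hUF t)).src = b t) :
    Φ (Gen.tt (fun t => (U t).comp (i.arr (F t)) (hUF t)) m v hb' h₁ hv hd) =
      Φ (Gen.tt U (Op.preAll F m) v hb h₃ hv hd) := by
  have e : ((i.arr (UArr.one M y)).comp v hv) = v := by
    have := UArr.one_comp v hv
    simpa only [arr_one] using this
  have e' := Op.post_one (Op.preAll F m) rfl
  have h := hΦ.rel U F m (UArr.one M y) v hUF hF rfl hv hd h₁ rfl hd (by rwa [e']) hb hb'
  exact (congrArg Φ (Gen.tt_congr rfl rfl e.symm _ _ _ _ _ _ _ _)).trans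
    (h.trans (congrArg Φ (Gen.tt_congr rfl e' rfl _ _ _ _ _ _ _ _)))

theorem Balanced.post (hΦ : i.Balanced Φ) {y : M.Ob} (U : Fin k → UArr A)
    (m : Op M.toSymMultigraph k y) (f : UArr M)
    (v : UArr A) (hf : f.src = y) (hv : v.src = (i.arr f).tgt) (hd : v.tgt = d)
    (h₁ : ∀ t, (U t).tgt = i.obj (m.1 t)) (h₂ : ((i.arr f).comp v hv).src = i.obj y)
    (h₂' : ((i.arr f).comp v hv).tgt = d)
    (h₃ : ∀ t, (U t).tgt = i.obj ((Op.post m f hf).1 t)) (hb : ∀ t, (U t).src = b t) :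
    Φ (Gen.tt U m ((i.arr f).comp v hv) hb h₁ h₂ h₂') = Φ (Gen.tt U (Op.post m f hf) v hb h₃ hv hd) := by
  have e : ∀ t, (U t).comp (i.arr (UArr.one M (m.1 t))) (h₁ t).symm = U t := fun t => by
    simp only [arr_one]
    exact UArr.comp_one _ _
  have e' : Op.preAll (fun t => UArr.one M (m.1 t)) m = m := Op.preAll_one _ _ fun _ => rfl
  have h := hΦ.rel U (fun t => UArr.one M (m.1 t)) m f v (fun t => (h₁ t).symm) (fun t => rfl)
    hf hv hd (fun t => rfl) h₂ h₂' (by simpa only [e'] using h₃) hb hb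
  refine (congrArg Φ (Gen.tt_congr (funext fun t => (e t).symm) rfl rfl _ _ _ _ _ _ _ _)).trans
    (h.trans (congrArg Φ (Gen.tt_congr rfl ?_ rfl _ _ _ _ _ _ _ _)))
  simp only [e']

/-- A function on formal composites with target in `M`, extended to all generators. -/
def Gen.extendTgt (c : M.Ob) {b : Fin 1 → A.Ob} (Φ : i.Gen b (i.obj c) → α) :
    i.Gen b (i.obj c) → α
  | tt U m v hb hU hv hd => Φ (tt U m v hb hU hv hd)
  | bb h w hb hd => Φ (tt (fun _ => w) (Op.one M c) (UArr.one A (i.obj c))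
      (fun t => hb.trans (congrArg b (Subsingleton.elim _ _))) (fun _ => hd) rfl rfl)

/-- A function on formal composites with source in `M`, extended to all generators. -/
def Gen.extendSrc (x : M.Ob) (Φ : i.Gen (single (i.obj x)) d → α) :
    i.Gen (single (i.obj x)) d → α
  | tt U m v hb hU hv hd => Φ (tt U m v hb hU hv hd)
  | bb h w hb hd => Φ (tt (fun _ => UArr.one A (i.obj x)) (Op.one M x) w
      (fun _ => rfl) (fun _ => rfl) hb hd)

theorem _root_.SymMulti.Op.exists_arrow {P : SymMulticat.{v, u} V} {y : P.Ob}
    (m : Op P.toSymMultigraph 1 y) : ∃ (n : UArr P) (h : n.tgt = y), m = Op.cod h n.op :=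
  ⟨UArr.ofOp m, rfl, (UArr.op_ofOp m).symm⟩

theorem _root_.SymMulti.UArr.ofOp_act_op {P : SymMulticat.{v, u} V} (n : UArr P) (h : 1 = 1) :
    UArr.ofOp (Op.act (finCongr h) n.op) = n :=
  (congrArg UArr.ofOp (Op.act_id (fun _ => rfl) _)).trans (UArr.ofOp_op n)

theorem Balanced.extendTgt {c : M.Ob} {b : Fin 1 → A.Ob} {Φ : i.Gen b (i.obj c) → α}
    (hΦ : i.Balanced Φ) : i.Compat (Gen.extendTgt c Φ) where
  rel := hΦ.rel
  collapse := fun {y} h U m v hU hv hd h₁ h₂ hd' hb hb' => by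
    obtain ⟨g, rfl⟩ : ∃ g : UArr M, v = i.arr g := ⟨i.lift v hv hd, (i.arr_lift v hv hd).symm⟩
    obtain ⟨n, rfl, rfl⟩ := m.exists_arrow
    have hg : g.src = n.tgt := i.injective hv
    obtain rfl : g.tgt = c := i.injective hd
    have hn : ∀ t, (i.arr n).src = (U t).tgt := fun t => (hU t).symm
    have eU : ∀ t : Fin 1, ((U (pos h)).comp (i.arr (UArr.ofOp
        (Op.act (finCongr h.symm) n.op))) h₁).comp (i.arr g) h₂ =
        (U t).comp (i.arr (n.comp g hg)) (hn t) := by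
      intro t
      obtain rfl : t = pos h := Subsingleton.elim _ _
      refine (UArr.comp_congr (UArr.comp_congr rfl (congrArg i.arr (n.ofOp_act_op _)) h₁ (hn _))
        rfl h₂ hv).trans ?_
      refine (UArr.comp_assoc (U (pos h)) (i.arr n) (i.arr g) (hn _) hv hv (hn _)).trans ?_
      exact UArr.comp_congr rfl (i.arr_comp n g hg hv).symm _ _
    have e₁ : Op.preAll (fun _ : Fin 1 => n.comp g hg) (Op.one M g.tgt) = Op.post n.op g hg := by
      refine (Op.preAll_op _ (UArr.one M g.tgt) rfl).trans ?_
      refine Eq.trans ?_ (UArr.op_comp n g hg)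
      exact UArr.cod_op (UArr.comp_one (n.comp g hg) rfl) rfl
    have e₂ : i.arr g = (i.arr g).comp (UArr.one A (i.obj g.tgt)) rfl := (UArr.comp_one _ _).symm
    refine (congrArg Φ (Gen.tt_congr rfl rfl e₂ _ _ _ _ _ hU hv rfl)).trans
      ((hΦ.post U n.op g (UArr.one A (i.obj g.tgt)) hg rfl rfl hU hv rfl (fun t => by
        rw [Op.post_fst]; exact hU t) hb).trans (Eq.symm ?_))
    refine (congrArg Φ (Gen.tt_congr (funext eU) rfl rfl _ _ _ _ _ _ rfl rfl)).trans
      ((hΦ.pre U (fun _ => n.comp g hg) (Op.one M g.tgt) (UArr.one A (i.obj g.tgt))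
        hn (fun _ => rfl) rfl rfl (fun _ => rfl) (fun t => by
          rw [e₁, Op.post_fst]; exact hU t) hb hb).trans ?_)
    exact congrArg Φ (Gen.tt_congr rfl e₁ rfl _ _ _ _ _ _ _ _)

theorem Balanced.extendSrc {x : M.Ob} {Φ : i.Gen (single (i.obj x)) d → α}
    (hΦ : i.Balanced Φ) : i.Compat (Gen.extendSrc x Φ) where
  rel := hΦ.rel
  collapse := fun {y} h U m v hU hv hd h₁ h₂ hd' hb hb' => by
    obtain ⟨g, hg⟩ : ∃ g : UArr M, U 0 = i.arr g :=
      ⟨i.lift (U 0) (hb 0) (hU 0), (i.arr_lift _ (hb 0) (hU 0)).symm⟩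
    obtain rfl : U = fun _ => i.arr g := funext fun t => by
      obtain rfl : t = 0 := Subsingleton.elim _ _
      exact hg
    obtain ⟨n, rfl, rfl⟩ := m.exists_arrow
    obtain rfl : g.src = x := i.injective (hb 0)
    have hn : n.src = g.tgt := i.injective (hU 0).symm
    have hn' : (i.arr n).src = (i.arr g).tgt := congrArg i.obj hn
    have e₁ : Op.post (Op.one M g.src) (g.comp n hn) rfl = Op.preAll (fun _ : Fin 1 => g) n.op := by
      refine (UArr.op_comp (UArr.one M g.src) (g.comp n hn) rfl).symm.trans
        (Eq.trans ?_ (Op.preAll_op (fun _ : Fin 1 => g) n hn).symm)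
      exact UArr.cod_op (UArr.one_comp (g.comp n hn) rfl) rfl
    have eU : (fun t : Fin 1 => i.arr g) = fun t : Fin 1 =>
        (UArr.one A (i.obj g.src)).comp (i.arr g) rfl :=
      funext fun _ => (UArr.one_comp _ rfl).symm
    have ev : ((i.arr g).comp (i.arr (UArr.ofOp (Op.act (finCongr h.symm) n.op))) h₁).comp v h₂ =
        (i.arr (g.comp n hn)).comp v hv := by
      refine UArr.comp_congr ?_ rfl _ _
      exact (UArr.comp_congr rfl (congrArg i.arr (n.ofOp_act_op _)) h₁ hn').trans
        (i.arr_comp g n hn hn').symm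
    refine (congrArg Φ (Gen.tt_congr eU rfl rfl _ _ _ _ _ hU hv hd)).trans
      ((hΦ.pre (fun _ => UArr.one A (i.obj g.src)) (fun _ => g) n.op v (fun _ => rfl)
        (fun _ => hn) hv hd hU
        (fun t => congrArg i.obj (Op.preAll_fst (fun _ => g) (q := n.op) (fun _ => hn) t).symm)
        (fun _ => rfl) hb).trans (Eq.symm ?_))
    refine (congrArg Φ (Gen.tt_congr rfl rfl ev _ _ _ _ _ (fun _ => rfl) rfl hd)).trans
      ((hΦ.post (fun _ => UArr.one A (i.obj g.src)) (Op.one M g.src)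
        (g.comp n hn) v rfl hv hd (fun _ => rfl) rfl hd (fun t => by
          rw [e₁]
          exact congrArg i.obj (Op.preAll_fst (fun _ => g) (q := n.op) (fun _ => hn) t).symm)
        (fun _ => rfl)).trans ?_)
    exact congrArg Φ (Gen.tt_congr rfl e₁ rfl _ _ _ _ _ _ _ _)

/-- Unless a unary morphism between objects outside `M` is concerned, the formal composites
suffice. -/
theorem exists_desc_tt [MonoidalClosed V]
    (hk : ∀ h : k = 1, (∃ c, i.obj c = d) ∨ ∃ x, i.obj x = b (pos h)) {Z : V}
    (c : Elt Z → α) (hc : Function.Injective c) (hΦ : i.Balanced Φ)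
    (φ : ∀ p, i.genObj b d p ⟶ Z)
    (hφ : ∀ p (U : ∀ t, Elt (A.Hom (single (b t)) (i.obj (p.1 t)))) (m : Elt (M.Hom p.1 p.2))
      (v : Elt (A.Hom (single (i.obj p.2)) d)), c (φ p ⋄ (tensEl U ⊙ (m ⊙ v))) =
        Φ (Gen.tt (fun t => ⟨b t, _, U t⟩) ⟨p.1, m⟩ ⟨_, d, v⟩ (fun _ => rfl) (fun _ => rfl)
          rfl rfl)) :
    ∃ χ : i.NHom b d ⟶ Z, ∀ {y : M.Ob} (U : Fin k → UArr A) (m : Op M.toSymMultigraph k y)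
      (v : UArr A) hb hU hv hd, c (χ ⋄ (Gen.tt U m v hb hU hv hd : i.Gen b d).el) =
        Φ (Gen.tt U m v hb hU hv hd) := by
  by_cases h1 : k = 1
  · subst h1
    obtain ⟨y, rfl⟩ | ⟨x, hx⟩ := hk rfl
    · obtain ⟨x, rfl⟩ : ∃ x, b = single x := ⟨b 0, funext fun t => congrArg b (Subsingleton.elim t 0)⟩
      obtain ⟨χ, hχ⟩ := i.exists_desc_gen c hc (Gen.extendTgt y Φ) hΦ.extendTgt φ
        (fun h => tensPointRight (singleTens fun t : Fin 1 => A.Hom (single (single x t)) (i.obj y))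
          (M.one y) (A.one (i.obj y)) ≫ φ (single y, y)) hφ (fun h w => by
            refine Eq.trans (congrArg c ?_) (hφ (single y, y) (fun t => w) (M.one y ⋄ Elt.unit)
              (A.one (i.obj y) ⋄ Elt.unit))
            refine (comp_ap _ _ _).trans (congrArg _ ?_)
            refine (tensPointRight_ap _ _ _ _).trans ?_
            rw [singleTens_ap _ fun t : Fin 1 => w])
      exact ⟨χ, fun U m v hb hU hv hd => hχ (Gen.tt U m v hb hU hv hd)⟩
    · obtain rfl : b = single (i.obj x) := funext fun t =>
        (congrArg b (Subsingleton.elim t _)).trans hx.symm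
      obtain ⟨χ, hχ⟩ := i.exists_desc_gen c hc (Gen.extendSrc x Φ) hΦ.extendSrc φ
        (fun h => tensPointLeft (tensPoint fun t : Fin 1 => A.one (i.obj x)) (M.one x) _ ≫
          φ (single x, x)) hφ (fun h w => by
            refine Eq.trans (congrArg c ?_) (hφ (single x, x) (fun t => A.one (i.obj x) ⋄ Elt.unit)
              (M.one x ⋄ Elt.unit) w)
            refine (comp_ap _ _ _).trans (congrArg _ ?_)
            refine (tensPointLeft_ap _ _ _).trans ?_
            rw [tensPoint_ap])
      exact ⟨χ, fun U m v hb hU hv hd => hχ (Gen.tt U m v hb hU hv hd)⟩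
  · obtain ⟨χ, hχ⟩ := i.exists_desc_gen c hc Φ ⟨hΦ, fun h => absurd h h1⟩ φ
      (fun h => absurd h h1) hφ (fun h => absurd h h1)
    exact ⟨χ, fun U m v hb hU hv hd => hχ (Gen.tt U m v hb hU hv hd)⟩

theorem spans_tt [MonoidalClosed V]
    (hk : ∀ h : k = 1, (∃ c, i.obj c = d) ∨ ∃ x, i.obj x = b (pos h)) :
    Spans (fun e : Elt (i.NHom b d) => ∃ (y : M.Ob) (U : Fin k → UArr A)
      (m : Op M.toSymMultigraph k y) (v : UArr A) (hb : _) (hU : _) (hv : _) (hd : _),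
      e = (Gen.tt U m v hb hU hv hd : i.Gen b d).el) := by
  refine i.spans_gen.mono ?_
  rintro _ ⟨g, rfl⟩
  cases g with
  | tt U m v hb hU hv hd => exact ⟨_, U, m, v, hb, hU, hv, hd, rfl⟩
  | bb h w hb hd =>
    obtain rfl : k = 1 := h
    have ho : ∀ x : M.Ob, i.arr (UArr.ofOp (Op.act (finCongr (Eq.symm rfl)) (Op.one M x))) =
        UArr.one A (i.obj x) := fun x =>
      (congrArg i.arr ((UArr.one M x).ofOp_act_op rfl)).trans (i.arr_one x)
    obtain ⟨y, rfl⟩ | ⟨x, hx⟩ := hk rfl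
    · refine ⟨y, fun _ => w, Op.one M y, UArr.one A (i.obj y), fun t =>
        hb.trans (congrArg b (Subsingleton.elim _ _)), fun _ => hd, rfl, rfl, Gen.el_eq ?_⟩
      refine ((i.tt_collapse rfl (fun _ => w) (Op.one M y) (UArr.one A (i.obj y)) (fun _ => hd)
        rfl rfl hd.symm rfl rfl).trans ?_).symm
      refine i.bb_congr (d := i.obj y) ?_ rfl rfl rfl hd
      refine (UArr.comp_one _ _).trans ?_
      exact (UArr.comp_congr rfl (ho y) hd.symm hd.symm).trans (UArr.comp_one _ hd.symm)
    · have hw : w.src = i.obj x := hb.trans hx.symm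
      refine ⟨x, fun _ => UArr.one A (i.obj x), Op.one M x, w, fun t =>
        hx.trans (congrArg b (Subsingleton.elim _ _)), fun _ => rfl, hw, hd, Gen.el_eq ?_⟩
      refine ((i.tt_collapse rfl (fun _ => UArr.one A (i.obj x)) (Op.one M x) w (fun _ => rfl)
        hw hd rfl hw hd).trans ?_).symm
      have e := (UArr.comp_congr ((UArr.comp_congr (f := UArr.one A (i.obj x)) rfl (ho x) rfl
        rfl).trans (UArr.comp_one _ rfl)) (g := w) rfl hw hw).trans (UArr.one_comp w hw)
      exact i.bb_congr (d := d) e rfl rfl hd hd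

end UnaryInclusion

section Positions

variable {α : Type*} {β : Type*} {s r k : ℕ} (σ : Fin k ≃ Fin (s + r))

theorem forall_positions {p : Fin k → Prop} (h : ∀ t : Fin s, p (σ.symm (Fin.castAdd r t)))
    (h' : ∀ t : Fin r, p (σ.symm (Fin.natAdd s t))) (t : Fin k) : p t := by
  have key : ∀ t, p (σ.symm t) := fun t => Fin.addCases h h' t
  simpa using key (σ t)

theorem append_symm_left (f : Fin s → α) (g : Fin r → α) (t : Fin s) :
    (Fin.append f g ∘ σ) (σ.symm (Fin.castAdd r t)) = f t := by simp

theorem append_symm_right (f : Fin s → α) (g : Fin r → α) (t : Fin r) :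
    (Fin.append f g ∘ σ) (σ.symm (Fin.natAdd s t)) = g t := by simp

theorem append_addFlip (f : Fin s → α) (g : Fin r → α) (t : Fin k) :
    (Fin.append g f ∘ σ.trans finAddFlip) t = (Fin.append f g ∘ σ) t :=
  forall_positions σ (p := fun t =>
    (Fin.append g f ∘ σ.trans finAddFlip) t = (Fin.append f g ∘ σ) t)
    (fun t => by simp) (fun t => by simp) t

end Positions

/-- Composition in the middle of a tensor product. -/
def spliceMid {T S R N N' W : V} (f : T ⟶ S ⊗ R) (g : R ⊗ N ⟶ N') : T ⊗ N ⊗ W ⟶ (S ⊗ N') ⊗ W :=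
  (f ▷ _ ≫ (α_ _ _ _).hom ≫ S ◁ ((α_ _ _ _).inv ≫ g ▷ W)) ≫ (α_ _ _ _).inv

theorem spliceMid_ap {T S R N N' W : V} (f : T ⟶ S ⊗ R) (g : R ⊗ N ⟶ N') (t : Elt T) (n : Elt N)
    (w : Elt W) {s : Elt S} {r : Elt R} (h : f ⋄ t = s ⊙ r) :
    spliceMid f g ⋄ (t ⊙ (n ⊙ w)) = (s ⊙ (g ⋄ (r ⊙ n))) ⊙ w := by
  simp [spliceMid, h]

/-- Separation of the positions of a tensor product. -/
def splitTens {s r k : ℕ} (σ : Fin k ≃ Fin (s + r)) (X : Fin k → V) {Y : Fin s → V} {Z : Fin r → V}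
    (f : ∀ t, X (σ.symm (Fin.castAdd r t)) ⟶ Y t) (g : ∀ t, X (σ.symm (Fin.natAdd s t)) ⟶ Z t) :
    tens X ⟶ tens Y ⊗ tens Z :=
  permTens σ.symm X ≫ inv (appendTens fun t => X (σ.symm t)) ≫ (tensMap f ⊗ₘ tensMap g)

theorem splitTens_ap {s r k : ℕ} (σ : Fin k ≃ Fin (s + r)) (X : Fin k → V) {Y : Fin s → V}
    {Z : Fin r → V} (f : ∀ t, X (σ.symm (Fin.castAdd r t)) ⟶ Y t)
    (g : ∀ t, X (σ.symm (Fin.natAdd s t)) ⟶ Z t) (e : ∀ t, Elt (X t)) :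
    splitTens σ X f g ⋄ tensEl e = tensEl (fun t => f t ⋄ e _) ⊙ tensEl (fun t => g t ⋄ e _) := by
  rw [splitTens, comp_ap, permTens_ap, comp_ap]
  rw [inv_appendTens_ap (fun t => X (σ.symm t)) fun t => e (σ.symm t), tensorHom_ap, tensMap_ap,
    tensMap_ap]

namespace UnaryInclusion

variable {M A : SymMulticat.{v, u} V} (i : UnaryInclusion M A)

variable [HasColimits V] (q : A.Ob) {s r k : ℕ} (σ : Fin k ≃ Fin (s + r)) (a : Fin r → M.Ob)

/-- The tuple `(q, …, q, a₁, …, a_r) ∘ σ`. -/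
abbrev qTuple : Fin k → A.Ob := Fin.append (fun _ : Fin s => q) (i.obj ∘ a) ∘ σ

/-- `⨂ₜ A(q, x_t) ⊗ M((x, a) ∘ σ; y)` -/
abbrev qObj (x : Fin s → M.Ob) (y : M.Ob) : V :=
  tens (fun t => A.Hom (single q) (i.obj (x t))) ⊗ M.Hom (Fin.append x a ∘ σ) y

/-- Arrows at the positions of `q`, extended by units. -/
abbrev qArrows (U : Fin s → UArr A) : Fin k → UArr A :=
  Fin.append U (fun t => UArr.one A (i.obj (a t))) ∘ σ

variable {q σ a} {d : A.Ob}

theorem qArrows_src {U : Fin s → UArr A} (h : ∀ t, (U t).src = q) (t : Fin k) :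
    (i.qArrows σ a U t).src = i.qTuple q σ a t :=
  append_fun UArr.src (U' := fun t => UArr.one A (i.obj (a t))) h (fun _ => rfl) (σ t)

theorem qArrows_tgt {U : Fin s → UArr A} {x : Fin s → M.Ob} (h : ∀ t, (U t).tgt = i.obj (x t))
    {y : M.Ob} {m : Op M.toSymMultigraph k y} (hm : ∀ t, (Fin.append x a ∘ σ) t = m.1 t)
    (t : Fin k) : (i.qArrows σ a U t).tgt = i.obj (m.1 t) :=
  (append_fun UArr.tgt (U' := fun t => UArr.one A (i.obj (a t))) (a := i.obj ∘ x)
    (a' := i.obj ∘ a) h (fun _ => rfl) (σ t)).trans ((append_fun i.obj (fun _ => rfl) (fun _ => rfl)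
      (σ t)).symm.trans (congrArg i.obj (hm t)))

variable {i}

/-- A formal composite with units at the positions of the objects of `M`. -/
def qGen {x : Fin s → M.Ob} {y : M.Ob} (U : Fin s → UArr A) (m : Op M.toSymMultigraph k y)
    (v : UArr A) (hs : ∀ t, (U t).src = q) (ht : ∀ t, (U t).tgt = i.obj (x t))
    (hm : ∀ t, (Fin.append x a ∘ σ) t = m.1 t) (hv : v.src = i.obj y) (hd : v.tgt = d) :
    i.Gen (i.qTuple q σ a) d :=
  Gen.tt (i.qArrows σ a U) m v (i.qArrows_src hs) (i.qArrows_tgt ht hm) hv hd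

section Values

variable {Z : V} (φ : ∀ (x : Fin s → M.Ob) (y : M.Ob),
  i.qObj q σ a x y ⊗ A.Hom (single (i.obj y)) d ⟶ Z)

/-- Dinaturality. -/
def QBalanced : Prop :=
  ∀ (x x' : Fin s → M.Ob) (y y' : M.Ob) (U : ∀ t, Elt (A.Hom (single q) (i.obj (x t))))
    (F : ∀ t, Elt (M.Hom (single (x t)) (x' t))) (m : Elt (M.Hom (Fin.append x' a ∘ σ) y))
    (g : Elt (M.Hom (single y) y')) (v : Elt (A.Hom (single (i.obj y')) d)),
    φ x' y ⋄ ((tensEl (X := fun t => A.Hom (single q) (i.obj (x' t)))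
        (fun t => A.post (single q) rfl (i.obj (x' t)) ⋄ (U t ⊙ (i.map _ _ ⋄ F t))) ⊙ m) ⊙
      (A.post (single (i.obj y)) rfl d ⋄ ((i.map _ _ ⋄ g) ⊙ v))) =
    φ x y' ⋄ ((tensEl U ⊙ (M.post _ rfl y' ⋄ ((M.pre σ x x' a y ⋄ (tensEl F ⊙ m)) ⊙ g))) ⊙ v)

/-- The value of a dinatural family at arrows. -/
def qVal {x : Fin s → M.Ob} {y : M.Ob} (U : Fin s → UArr A) (m : Op M.toSymMultigraph k y)
    (v : UArr A) (hs : ∀ t, (U t).src = q) (ht : ∀ t, (U t).tgt = i.obj (x t))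
    (hm : ∀ t, (Fin.append x a ∘ σ) t = m.1 t) (hv : v.src = i.obj y) (hd : v.tgt = d) : Elt Z :=
  φ x y ⋄ ((tensEl (X := fun t => A.Hom (single q) (i.obj (x t)))
    (fun t => (U t).elt (hs t) (ht t)) ⊙ m.elt hm) ⊙ v.elt hv hd)

variable {φ}

theorem qVal_congr {x x' : Fin s → M.Ob} {y : M.Ob} {U U' : Fin s → UArr A}
    {m m' : Op M.toSymMultigraph k y} {v v' : UArr A} (ex : x = x') (eU : ∀ t, U t = U' t)
    (em : m = m') (ev : v = v') (hs : ∀ t, (U t).src = q) (ht : ∀ t, (U t).tgt = i.obj (x t))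
    (hm : ∀ t, (Fin.append x a ∘ σ) t = m.1 t) (hv : v.src = i.obj y) (hd : v.tgt = d)
    (hs' : ∀ t, (U' t).src = q) (ht' : ∀ t, (U' t).tgt = i.obj (x' t))
    (hm' : ∀ t, (Fin.append x' a ∘ σ) t = m'.1 t) (hv' : v'.src = i.obj y) (hd' : v'.tgt = d) :
    qVal φ U m v hs ht hm hv hd = qVal φ U' m' v' hs' ht' hm' hv' hd' := by
  obtain rfl : U = U' := funext eU
  subst ex em ev; rfl

theorem qVal_mk {x : Fin s → M.Ob} {y : M.Ob} (U : ∀ t, Elt (A.Hom (single q) (i.obj (x t))))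
    (m : Elt (M.Hom (Fin.append x a ∘ σ) y)) (v : Elt (A.Hom (single (i.obj y)) d)) :
    qVal φ (fun t => ⟨q, i.obj (x t), U t⟩) ⟨_, m⟩ ⟨i.obj y, d, v⟩ (fun _ => rfl) (fun _ => rfl)
      (fun _ => rfl) rfl rfl = φ x y ⋄ ((tensEl U ⊙ m) ⊙ v) :=
  congrArg (fun m => φ x y ⋄ ((tensEl U ⊙ m) ⊙ v)) (Op.elt_mk m _)

/-- Arrows of `M` at the positions of `q`, extended by units. -/
abbrev qArrowsM (a : Fin r → M.Ob) (σ : Fin k ≃ Fin (s + r)) (F : Fin s → UArr M) :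
    Fin k → UArr M :=
  Fin.append F (fun t => UArr.one M (a t)) ∘ σ

theorem qVal_rel (hφ : QBalanced φ) {x x' : Fin s → M.Ob} {y : M.Ob} (U : Fin s → UArr A)
    (F : Fin s → UArr M) (m : Op M.toSymMultigraph k y) (g : UArr M) (v : UArr A)
    (hs : ∀ t, (U t).src = q) (hF : ∀ t, (F t).src = x t) (hF' : ∀ t, (F t).tgt = x' t)
    (hUF : ∀ t, (i.arr (F t)).src = (U t).tgt) (hm : ∀ t, (Fin.append x' a ∘ σ) t = m.1 t)
    (hg : g.src = y) (hv : v.src = (i.arr g).tgt) (hd : v.tgt = d)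
    (hs' : ∀ t, ((U t).comp (i.arr (F t)) (hUF t)).src = q)
    (ht' : ∀ t, ((U t).comp (i.arr (F t)) (hUF t)).tgt = i.obj (x' t))
    (hv' : ((i.arr g).comp v hv).src = i.obj y) (hd' : ((i.arr g).comp v hv).tgt = d)
    (ht : ∀ t, (U t).tgt = i.obj (x t))
    (hm' : ∀ t, (Fin.append x a ∘ σ) t =
      (Op.post (Op.preAll (qArrowsM a σ F) m) g hg).1 t) :
    qVal φ (fun t => (U t).comp (i.arr (F t)) (hUF t)) m ((i.arr g).comp v hv) hs' ht' hm hv' hd' =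
      qVal φ U (Op.post (Op.preAll (qArrowsM a σ F) m) g hg) v hs ht hm' hv hd := by
  obtain ⟨m₁, m⟩ := m
  obtain rfl : Fin.append x' a ∘ σ = m₁ := funext hm
  obtain ⟨y₀, y', g⟩ := g
  obtain rfl : y₀ = y := hg
  obtain ⟨v, rfl⟩ := v.exists_src_tgt hv hd
  obtain ⟨U, rfl⟩ : ∃ U' : ∀ t, Elt (A.Hom (single q) (i.obj (x t))),
      U = fun t => ⟨q, i.obj (x t), U' t⟩ :=
    ⟨fun t => (U t).elt (hs t) (ht t), funext fun t => ((U t).mk_elt _ _).symm⟩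
  obtain ⟨F, rfl⟩ : ∃ F' : ∀ t, Elt (M.Hom (single (x t)) (x' t)),
      F = fun t => ⟨x t, x' t, F' t⟩ :=
    ⟨fun t => (F t).elt (hF t) (hF' t), funext fun t => ((F t).mk_elt _ _).symm⟩
  have e := hφ x x' y₀ y' U F m g v
  replace e := (qVal_mk (φ := φ) _ _ _).trans (e.trans (qVal_mk (φ := φ) (x := x) U _ v).symm)
  refine (qVal_congr rfl (fun t => ?_) rfl ?_ _ _ _ _ _ _ _ _ _ _).trans
    (e.trans (qVal_congr rfl (fun t => rfl) ?_ rfl _ _ _ _ _ _ _ _ _ _))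
  · exact (UArr.mk_comp (U t) (i.map _ _ ⋄ F t)).symm
  · exact (UArr.mk_comp (i.map _ _ ⋄ g) v).symm
  · refine (Op.mk_post rfl _ _).trans ?_
    refine (congrArg (fun n => Op.post n (⟨y₀, y', g⟩ : UArr M) rfl) (Op.mk_preMany σ F m
      (Fin.append (fun t => ⟨x t, x' t, F t⟩) fun t => UArr.one M (a t)) (fun t => ?_)
      fun t => ?_)).trans rfl
    · exact Fin.append_left _ _ _
    · exact Fin.append_right _ _ _

end Values

end UnaryInclusion

namespace UnaryInclusion

variable {M A : SymMulticat.{v, u} V} {i : UnaryInclusion M A}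

variable [HasColimits V] {q : A.Ob} {s r k : ℕ} {σ : Fin k ≃ Fin (s + r)} {a : Fin r → M.Ob}
  {d : A.Ob} {y : M.Ob}

/-- The arrows of `M` at the positions of the objects of `M`, extended by units. -/
def qFill (U : Fin k → UArr A) (m : Op M.toSymMultigraph k y)
    (hb : ∀ t, (U t).src = i.qTuple q σ a t) (hU : ∀ t, (U t).tgt = i.obj (m.1 t)) :
    Fin k → UArr M :=
  Fin.append (fun t : Fin s => UArr.one M (m.1 (σ.symm (Fin.castAdd r t))))
    (fun t : Fin r => i.lift (x := a t) (U (σ.symm (Fin.natAdd s t)))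
      ((hb _).trans (append_symm_right σ _ _ t)) (hU _)) ∘ σ

section Fill

variable (U : Fin k → UArr A) (m : Op M.toSymMultigraph k y)
  (hb : ∀ t, (U t).src = i.qTuple q σ a t) (hU : ∀ t, (U t).tgt = i.obj (m.1 t))

theorem qFill_left (t : Fin s) : qFill U m hb hU (σ.symm (Fin.castAdd r t)) =
    UArr.one M (m.1 (σ.symm (Fin.castAdd r t))) := append_symm_left σ _ _ t

theorem qFill_right (t : Fin r) : qFill U m hb hU (σ.symm (Fin.natAdd s t)) =
    i.lift (x := a t) (U (σ.symm (Fin.natAdd s t)))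
      ((hb _).trans (append_symm_right σ _ _ t)) (hU _) := append_symm_right σ _ _ t

theorem arr_qFill_right (t : Fin r) : i.arr (qFill U m hb hU (σ.symm (Fin.natAdd s t))) =
    U (σ.symm (Fin.natAdd s t)) :=
  (congrArg i.arr (qFill_right U m hb hU t)).trans (i.arr_lift _ _ _)

theorem qFill_tgt : ∀ t, m.1 t = (qFill U m hb hU t).tgt :=
  forall_positions σ (fun t => (congrArg UArr.tgt (qFill_left U m hb hU t)).symm)
    fun t => (congrArg UArr.tgt (qFill_right U m hb hU t)).symm

theorem qFill_src : ∀ t, (Fin.append (fun t => m.1 (σ.symm (Fin.castAdd r t))) a ∘ σ) t =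
    (qFill U m hb hU t).src :=
  forall_positions σ
    (fun t => (append_symm_left σ _ _ t).trans (congrArg UArr.src (qFill_left U m hb hU t)).symm)
    fun t => (append_symm_right σ _ _ t).trans
      (congrArg UArr.src (qFill_right U m hb hU t)).symm

theorem preAll_qFill_fst (t : Fin k) :
    (Fin.append (fun t => m.1 (σ.symm (Fin.castAdd r t))) a ∘ σ) t =
      (Op.preAll (qFill U m hb hU) m).1 t :=
  (qFill_src U m hb hU t).trans (Op.preAll_fst _ (qFill_tgt U m hb hU) t).symm

end Fill

variable {Z : V} {φ : ∀ (x : Fin s → M.Ob) (y : M.Ob),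
  i.qObj q σ a x y ⊗ A.Hom (single (i.obj y)) d ⟶ Z}

variable (φ) in
/-- The value of a dinatural family at a generator; there is none at the arrows of `A`. -/
def qValue : i.Gen (i.qTuple q σ a) d → Option (Elt Z)
  | Gen.tt U m v hb hU hv hd => some (qVal φ (x := fun t => m.1 (σ.symm (Fin.castAdd r t)))
      (fun t => U (σ.symm (Fin.castAdd r t))) (Op.preAll (qFill U m hb hU) m) v
      (fun t => (hb _).trans (append_symm_left σ _ _ t)) (fun t => hU _)
      (preAll_qFill_fst U m hb hU) hv hd)
  | Gen.bb _ _ _ _ => none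

theorem qArrowsM_left (F : Fin s → UArr M) (t : Fin s) :
    qArrowsM a σ F (σ.symm (Fin.castAdd r t)) = F t := append_symm_left σ _ _ t

theorem qArrowsM_right (F : Fin s → UArr M) (t : Fin r) :
    qArrowsM a σ F (σ.symm (Fin.natAdd s t)) = UArr.one M (a t) := append_symm_right σ _ _ t

theorem qFill_comp (U : Fin k → UArr A) (F : Fin k → UArr M) (m : Op M.toSymMultigraph k y)
    (hUF : ∀ t, (i.arr (F t)).src = (U t).tgt) (hF : ∀ t, m.1 t = (F t).tgt)
    (hb : ∀ t, (U t).src = i.qTuple q σ a t)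
    (hb' : ∀ t, ((U t).comp (i.arr (F t)) (hUF t)).src = i.qTuple q σ a t)
    (hU' : ∀ t, ((U t).comp (i.arr (F t)) (hUF t)).tgt = i.obj (m.1 t))
    {y' : M.Ob} (m' : Op M.toSymMultigraph k y') (hU : ∀ t, (U t).tgt = i.obj (m'.1 t))
    (hm' : ∀ t, m'.1 t = (F t).src) :
    Op.preAll (qArrowsM a σ fun t => F (σ.symm (Fin.castAdd r t)))
        (Op.preAll (qFill (fun t => (U t).comp (i.arr (F t)) (hUF t)) m hb' hU') m) =
      Op.preAll (qFill U m' hb hU) (Op.preAll F m) := by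
  have h₁ : ∀ t, (qFill (fun t => (U t).comp (i.arr (F t)) (hUF t)) m hb' hU' t).src =
      (qArrowsM a σ (fun t => F (σ.symm (Fin.castAdd r t))) t).tgt := by
    refine forall_positions σ (fun t => ?_) fun t => ?_
    · refine (congrArg UArr.src (qFill_left _ m hb' hU' t)).trans ?_
      exact (hF _).trans (congrArg UArr.tgt (qArrowsM_left (a := a) (σ := σ) (fun t => F (σ.symm (Fin.castAdd r t))) t)).symm
    · refine (congrArg UArr.src (qFill_right _ m hb' hU' t)).trans ?_
      exact (congrArg UArr.tgt (qArrowsM_right (a := a) (σ := σ) (fun t => F (σ.symm (Fin.castAdd r t))) t)).symm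
  have h₂ : ∀ t, (F t).src = (qFill U m' hb hU t).tgt := fun t =>
    (hm' t).symm.trans (qFill_tgt U m' hb hU t)
  rw [Op.preAll_preAll _ _ h₁ _ (qFill_tgt _ _ _ _), Op.preAll_preAll _ _ h₂ _ hF]
  refine congrArg (fun W => Op.preAll W m) (funext ?_)
  refine forall_positions σ (fun t => ?_) fun t => ?_
  · refine (UArr.comp_congr (qArrowsM_left (a := a) (σ := σ) (fun t => F (σ.symm (Fin.castAdd r t))) t)
      (qFill_left _ m hb' hU' t) (h₁ _) (hF _)).trans ?_
    refine (UArr.comp_one _ (hF _)).trans ?_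
    refine Eq.trans ?_ (UArr.comp_congr (qFill_left U m' hb hU t) rfl (h₂ _) (hm' _).symm).symm
    exact (UArr.one_comp _ (hm' _).symm).symm
  · refine (UArr.comp_congr (qArrowsM_right (a := a) (σ := σ) (fun t => F (σ.symm (Fin.castAdd r t))) t) rfl
      (h₁ _) (congrArg UArr.src (qFill_right _ m hb' hU' t))).trans ?_
    refine (UArr.one_comp _ (congrArg UArr.src (qFill_right _ m hb' hU' t))).trans ?_
    refine i.arr_injective ((arr_qFill_right _ m hb' hU' t).trans ?_)
    refine Eq.trans ?_ (i.arr_comp _ _ _ (congrArg i.obj (h₂ _))).symm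
    exact UArr.comp_congr (arr_qFill_right U m' hb hU t).symm rfl _ _

theorem qValue_balanced (hφ : QBalanced φ) : i.Balanced (qValue φ) where
  rel := fun {y} U F m g v hUF hF hg hv hd h₁ h₂ h₂' h₃ hb hb' => by
    have hm : ∀ t, (Op.post (Op.preAll F m) g hg).1 t = (F t).src := fun t =>
      (Op.post_fst _ _ _ _).trans (Op.preAll_fst _ hF t)
    refine congrArg some ?_
    have e : Op.post (Op.preAll (qArrowsM a σ fun t => F (σ.symm (Fin.castAdd r t)))
        (Op.preAll (qFill (fun t => (U t).comp (i.arr (F t)) (hUF t)) m hb' h₁) m)) g hg =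
        Op.preAll (qFill U _ hb h₃) (Op.post (Op.preAll F m) g hg) := by
      rw [qFill_comp U F m hUF hF hb hb' h₁ (Op.post (Op.preAll F m) g hg) h₃ hm]
      exact Op.post_preAll _ _ _ _
    have hx : (fun t : Fin s => (F (σ.symm (Fin.castAdd r t))).src) = fun t =>
      (Op.post (Op.preAll F m) g hg).1 (σ.symm (Fin.castAdd r t)) := funext fun t => (hm _).symm
    refine (qVal_rel hφ (fun t => U (σ.symm (Fin.castAdd r t)))
      (fun t => F (σ.symm (Fin.castAdd r t))) _ g v
      (fun t => (hb _).trans (append_symm_left σ _ _ t)) (fun t => rfl) (fun t => (hF _).symm)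
      (fun t => hUF _) _ hg hv hd _ _ _ _ (fun t => (hUF _).symm) ?_).trans
      (qVal_congr hx (fun t => rfl) e rfl _ _ _ _ _ _ _ _ _ _)
    intro t
    rw [e, hx]
    exact preAll_qFill_fst U _ hb h₃ t

end UnaryInclusion

/-- The identification of the hom objects for equal sources. -/
def srcCast (P : SymMulticat.{v, u} V) {x x' y : P.Ob} (h : x' = x) :
    P.Hom (single x') y ⟶ P.Hom (single x) y := P.cast fun _ => h.symm

theorem srcCast_ap {P : SymMulticat.{v, u} V} {x x' y : P.Ob} (h : x' = x)
    (e : Elt (P.Hom (single x') y)) : srcCast P h ⋄ e = UArr.elt ⟨x', y, e⟩ h rfl := by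
  subst h
  exact (congrArg (· ⋄ e) (P.cast_refl _ _ _)).trans (id_ap e)

namespace UnaryInclusion

variable {M A : SymMulticat.{v, u} V} {i : UnaryInclusion M A}

variable [HasColimits V] {q : A.Ob} {s r k : ℕ} {σ : Fin k ≃ Fin (s + r)} {a : Fin r → M.Ob}
  {d : A.Ob} {y : M.Ob}

theorem qTuple_left (t : Fin s) : i.qTuple q σ a (σ.symm (Fin.castAdd r t)) = q :=
  append_symm_left σ _ _ t

theorem qTuple_right (t : Fin r) : i.qTuple q σ a (σ.symm (Fin.natAdd s t)) = i.obj (a t) :=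
  append_symm_right σ _ _ t

theorem qArrows_left (U : Fin s → UArr A) (t : Fin s) :
    i.qArrows σ a U (σ.symm (Fin.castAdd r t)) = U t := append_symm_left σ _ _ t

theorem qArrows_right (U : Fin s → UArr A) (t : Fin r) :
    i.qArrows σ a U (σ.symm (Fin.natAdd s t)) = UArr.one A (i.obj (a t)) :=
  append_symm_right σ _ _ t

/-- Composition at the positions of the objects of `M`. -/
def preRight (σ : Fin k ≃ Fin (s + r)) (a : Fin r → M.Ob) (x : Fin k → M.Ob) (y : M.Ob) :
    tens (fun t : Fin r => M.Hom (single (a t)) (x (σ.symm (Fin.natAdd s t)))) ⊗ M.Hom x y ⟶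
      M.Hom (Fin.append (fun t : Fin s => x (σ.symm (Fin.castAdd r t))) a ∘ σ) y :=
  _ ◁ M.cast (forall_positions σ
      (fun t => (append_addFlip σ _ _ _).trans (append_symm_left σ _ _ t))
      fun t => (append_addFlip σ _ _ _).trans (append_symm_right σ _ _ t)) ≫
    M.pre (σ.trans finAddFlip) a (fun t => x (σ.symm (Fin.natAdd s t)))
      (fun t => x (σ.symm (Fin.castAdd r t))) y ≫
    M.cast fun t => (append_addFlip σ _ _ t).symm

theorem mk_preRight (x : Fin k → M.Ob)
    (f : ∀ t : Fin r, Elt (M.Hom (single (a t)) (x (σ.symm (Fin.natAdd s t)))))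
    (m : Elt (M.Hom x y)) :
    (⟨_, preRight σ a x y ⋄ (tensEl f ⊙ m)⟩ : Op M.toSymMultigraph k y) =
      Op.preAll (Fin.append (fun t : Fin s => UArr.one M (x (σ.symm (Fin.castAdd r t))))
        (fun t : Fin r => ⟨a t, _, f t⟩) ∘ σ) ⟨x, m⟩ := by
  have e := Op.mk_preMany (P := M) (c := y) (σ.trans finAddFlip) (x := a)
    (y := fun t => x (σ.symm (Fin.natAdd s t))) (a := fun t => x (σ.symm (Fin.castAdd r t))) f
    (M.cast (forall_positions σ
      (fun t => (append_addFlip σ _ _ _).trans (append_symm_left σ _ _ t))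
      fun t => (append_addFlip σ _ _ _).trans (append_symm_right σ _ _ t)) ⋄ m)
    (Fin.append (fun t : Fin r => ⟨a t, _, f t⟩)
      (fun t : Fin s => UArr.one M (x (σ.symm (Fin.castAdd r t)))))
    (fun t => Fin.append_left _ _ _) (fun t => Fin.append_right _ _ _)
  unfold preRight
  rw [comp_ap, whiskerLeft_ap, comp_ap]
  refine (Op.mk_cast _ _).trans (e.trans ?_)
  rw [Op.mk_cast]
  exact congrArg (fun F => Op.preAll F _) (funext fun t => append_addFlip σ _ _ t)

/-- Separation of the inputs `q` from the other inputs. -/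
def genToQ (i : UnaryInclusion M A) (q : A.Ob) (σ : Fin k ≃ Fin (s + r)) (a : Fin r → M.Ob)
    (d : A.Ob) (p : (Fin k → M.Ob) × M.Ob) :
    i.genObj (i.qTuple q σ a) d p ⟶
      i.qObj q σ a (fun t : Fin s => p.1 (σ.symm (Fin.castAdd r t))) p.2 ⊗
        A.Hom (single (i.obj p.2)) d :=
  spliceMid (splitTens σ (fun t => A.Hom (single (i.qTuple q σ a t)) (i.obj (p.1 t)))
    (fun t => srcCast A (append_symm_left σ _ _ t))
    (fun t => srcCast A (append_symm_right σ _ _ t) ≫ i.inv (a t) (p.1 (σ.symm (Fin.natAdd s t)))))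
    (preRight σ a p.1 p.2)

theorem genToQ_ap {Z : V} (φ : ∀ (x : Fin s → M.Ob) (y : M.Ob),
      i.qObj q σ a x y ⊗ A.Hom (single (i.obj y)) d ⟶ Z) (p : (Fin k → M.Ob) × M.Ob)
    (U : ∀ t, Elt (A.Hom (single (i.qTuple q σ a t)) (i.obj (p.1 t)))) (m : Elt (M.Hom p.1 p.2))
    (v : Elt (A.Hom (single (i.obj p.2)) d)) :
    some (φ _ p.2 ⋄ (genToQ i q σ a d p ⋄ (tensEl U ⊙ (m ⊙ v)))) =
      qValue φ (Gen.tt (fun t => ⟨i.qTuple q σ a t, _, U t⟩) ⟨p.1, m⟩ ⟨_, d, v⟩ (fun _ => rfl)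
        (fun _ => rfl) rfl rfl) := by
  refine congrArg some (congrArg (φ _ p.2 ⋄ ·) ?_)
  have h : splitTens σ (fun t => A.Hom (single (i.qTuple q σ a t)) (i.obj (p.1 t)))
      (fun t => srcCast A (append_symm_left σ _ _ t))
      (fun t => srcCast A (append_symm_right σ _ _ t) ≫
        i.inv (a t) (p.1 (σ.symm (Fin.natAdd s t)))) ⋄ tensEl U =
      tensEl (X := fun t : Fin s => A.Hom (single q) (i.obj (p.1 (σ.symm (Fin.castAdd r t)))))
        (fun t => UArr.elt ⟨_, _, U (σ.symm (Fin.castAdd r t))⟩ (qTuple_left t) rfl) ⊙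
      tensEl (X := fun t : Fin r => M.Hom (single (a t)) (p.1 (σ.symm (Fin.natAdd s t))))
        (fun t => i.inv (a t) (p.1 (σ.symm (Fin.natAdd s t))) ⋄
          UArr.elt ⟨_, _, U (σ.symm (Fin.natAdd s t))⟩ (qTuple_right t) rfl) := by
    refine (splitTens_ap _ _ _ _ _).trans (congrArg₂ (· ⊙ ·) ?_ ?_)
    · exact congrArg tensEl (funext fun t => srcCast_ap _ _)
    · refine congrArg tensEl (funext fun t => (comp_ap _ _ _).trans ?_)
      exact congrArg (i.inv _ _ ⋄ ·) (srcCast_ap _ _)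
  refine (spliceMid_ap _ _ _ _ _ h).trans (congrArg (· ⊙ v) (congrArg (_ ⊙ ·) ?_))
  refine Op.mk_inj ((mk_preRight _ _ _).trans (Eq.trans ?_ (Op.mk_elt _ _).symm))
  rfl

variable [MonoidalClosed V]

/-- Away from the unary morphisms between objects outside `M`, maps out of a hom object of the
pushout are dinatural families. -/
theorem exists_desc_q
    (hk : ∀ h : k = 1, (∃ c, i.obj c = d) ∨ ∃ x, i.obj x = i.qTuple q σ a (pos h)) {Z : V}
    {φ : ∀ (x : Fin s → M.Ob) (y : M.Ob), i.qObj q σ a x y ⊗ A.Hom (single (i.obj y)) d ⟶ Z}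
    (hφ : QBalanced φ) :
    ∃ χ : i.NHom (i.qTuple q σ a) d ⟶ Z, ∀ (x : Fin s → M.Ob) (y : M.Ob)
      (U : ∀ t, Elt (A.Hom (single q) (i.obj (x t)))) (m : Elt (M.Hom (Fin.append x a ∘ σ) y))
      (v : Elt (A.Hom (single (i.obj y)) d)),
      χ ⋄ (qGen (i := i) (fun t => ⟨q, i.obj (x t), U t⟩) ⟨_, m⟩ ⟨i.obj y, d, v⟩ (fun _ => rfl)
        (fun _ => rfl) (fun _ => rfl) rfl rfl).el = φ x y ⋄ ((tensEl U ⊙ m) ⊙ v) := by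
  obtain ⟨χ, hχ⟩ := exists_desc_tt hk some (Option.some_injective _) (qValue_balanced hφ)
    (fun p => genToQ i q σ a d p ≫ φ _ p.2) (fun p U m v =>
      (congrArg some (comp_ap _ _ _)).trans (genToQ_ap φ p U m v))
  refine ⟨χ, fun x y U m v => ?_⟩
  refine Option.some_injective _ ((hχ _ _ _ _ _ _ _).trans (congrArg some ?_))
  refine Eq.trans ?_ (qVal_mk U m v)
  refine qVal_congr (funext fun t => append_symm_left σ _ _ t)
    (fun t => append_symm_left σ _ _ t) ?_ rfl _ _ _ _ _ _ _ _ _ _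
  refine Op.preAll_one _ _ (forall_positions σ (fun t => qFill_left _ _ _ _ t) fun t => ?_)
  refine (qFill_right _ _ _ _ t).trans (i.arr_injective ?_)
  refine (i.arr_lift _ _ _).trans ((append_symm_right σ _ _ t).trans ?_)
  refine Eq.trans ?_ (i.arr_one _).symm
  exact congrArg (UArr.one A) (congrArg i.obj (append_symm_right σ x a t).symm)

/-- The canonical generators, for given objects. -/
theorem spans_q
    (hk : ∀ h : k = 1, (∃ c, i.obj c = d) ∨ ∃ x, i.obj x = i.qTuple q σ a (pos h)) :
    Spans (fun e : Elt (i.NHom (i.qTuple q σ a) d) => ∃ (x : Fin s → M.Ob) (y : M.Ob)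
      (U : ∀ t, Elt (A.Hom (single q) (i.obj (x t)))) (m : Elt (M.Hom (Fin.append x a ∘ σ) y))
      (v : Elt (A.Hom (single (i.obj y)) d)),
      e = (qGen (i := i) (fun t => ⟨q, i.obj (x t), U t⟩) ⟨_, m⟩ ⟨i.obj y, d, v⟩ (fun _ => rfl)
        (fun _ => rfl) (fun _ => rfl) rfl rfl).el) := by
  refine (spans_tt hk).mono ?_
  rintro _ ⟨y, U, m, v, hb, hU, hv, hd, rfl⟩
  have hs : ∀ t : Fin s, (U (σ.symm (Fin.castAdd r t))).src = q := fun t =>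
    (hb _).trans (append_symm_left σ _ _ t)
  refine ⟨fun t => m.1 (σ.symm (Fin.castAdd r t)), y, fun t => (U _).elt (hs t) (hU _),
    (Op.preAll (qFill U m hb hU) m).elt (preAll_qFill_fst U m hb hU), v.elt hv hd, Gen.el_eq ?_⟩
  let W : Fin s → UArr A := fun t =>
    ⟨q, i.obj (m.1 (σ.symm (Fin.castAdd r t))), (U _).elt (hs t) (hU _)⟩
  have hUF : ∀ t, (i.arr (qFill U m hb hU t)).src =
      (i.qArrows σ a W t).tgt := by
    refine forall_positions σ (fun t => ?_) fun t => ?_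
    · exact (congrArg (fun f => (i.arr f).src) (qFill_left U m hb hU t)).trans
        (congrArg UArr.tgt (qArrows_left (i := i) (a := a) W t)).symm
    · exact (congrArg (fun f => (i.arr f).src) (qFill_right U m hb hU t)).trans
        (congrArg UArr.tgt (qArrows_right (i := i) (a := a) W t)).symm
  have e₂ : U = fun t => (i.qArrows σ a W t).comp (i.arr (qFill U m hb hU t)) (hUF t) := by
    refine funext (forall_positions σ (fun t => ?_) fun t => ?_)
    · refine Eq.trans ?_ (UArr.comp_congr (qArrows_left (i := i) (a := a) W t)
        ((congrArg i.arr (qFill_left U m hb hU t)).trans (i.arr_one _)) (hUF _) rfl).symm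
      refine Eq.trans ?_ (UArr.comp_one _ rfl).symm
      exact (UArr.mk_elt _ (hs t) (hU _)).symm
    · refine Eq.trans ?_ (UArr.comp_congr (qArrows_right (i := i) (a := a) W t)
        (arr_qFill_right U m hb hU t) (hUF _) ((hb _).trans (qTuple_right t))).symm
      exact (UArr.one_comp _ _).symm
  have hU' : ∀ t, (i.qArrows σ a W t).tgt = i.obj ((Op.preAll (qFill U m hb hU) m).1 t) :=
    fun t => (hUF t).symm.trans (congrArg i.obj (Op.preAll_fst _ (qFill_tgt U m hb hU) t).symm)
  refine (i.tt_congr e₂ rfl rfl _ _ _ (fun t => congrArg i.obj (qFill_tgt U m hb hU t).symm) hv hd).trans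
    ((i.tt_pre _ (qFill U m hb hU) m v hUF (qFill_tgt U m hb hU) hv hd _ hU').trans
      (i.tt_congr rfl (Op.mk_elt _ _).symm (UArr.mk_elt v hv hd).symm _ _ _ _ _ _))

end UnaryInclusion

theorem post_one_ap {P : SymMulticat.{v, u} V} {l : ℕ} (a : Fin l → P.Ob) (x : P.Ob)
    (m : Elt (P.Hom a x)) : P.post a rfl x ⋄ (m ⊙ (P.one x ⋄ Elt.unit)) = m := by
  refine Op.mk_inj ((Op.mk_post rfl m (P.one x ⋄ Elt.unit)).trans ?_)
  exact Op.post_one _ rfl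

theorem one_post_ap {P : SymMulticat.{v, u} V} (x z : P.Ob) (m : Elt (P.Hom (single x) z)) :
    P.post (single x) rfl z ⋄ ((P.one x ⋄ Elt.unit) ⊙ m) = m := by
  have := congrArg (· ⋄ (Elt.unit ⊙ m)) (P.one_post x z)
  simpa using this

theorem pre_one_ap {P : SymMulticat.{v, u} V} {s r k : ℕ} (σ : Fin k ≃ Fin (s + r))
    (x : Fin s → P.Ob) (a : Fin r → P.Ob) (y : P.Ob) (m : Elt (P.Hom (Fin.append x a ∘ σ) y)) :
    P.pre σ x x a y ⋄ (tensEl (X := fun t => P.Hom (single (x t)) (x t))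
      (fun t => P.one (x t) ⋄ Elt.unit) ⊙ m) = m := by
  refine Op.mk_inj ((Op.mk_preMany σ _ m (Fin.append (fun t => UArr.one P (x t))
    fun t => UArr.one P (a t)) (fun t => Fin.append_left _ _ _)
    fun t => Fin.append_right _ _ _).trans ?_)
  refine Op.preAll_one _ _ (forall_positions σ (fun t => ?_) fun t => ?_)
  · exact (append_symm_left σ _ _ t).trans (congrArg (UArr.one P) (append_symm_left σ x a t).symm)
  · exact (append_symm_right σ _ _ t).trans (congrArg (UArr.one P) (append_symm_right σ x a t).symm)

theorem pre_post_ap {P : SymMulticat.{v, u} V} {s r k : ℕ} (σ : Fin k ≃ Fin (s + r))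
    {x x' : Fin s → P.Ob} (a : Fin r → P.Ob) {y z : P.Ob}
    (F : ∀ t, Elt (P.Hom (single (x t)) (x' t))) (m : Elt (P.Hom (Fin.append x' a ∘ σ) y))
    (g : Elt (P.Hom (single y) z)) :
    P.pre σ x x' a z ⋄ (tensEl F ⊙ (P.post _ rfl z ⋄ (m ⊙ g))) =
      P.post _ rfl z ⋄ ((P.pre σ x x' a y ⋄ (tensEl F ⊙ m)) ⊙ g) := by
  have h : ∀ {y : P.Ob} (m : Elt (P.Hom (Fin.append x' a ∘ σ) y)), _ := fun m =>
    Op.mk_preMany σ F m (Fin.append (fun t => ⟨x t, x' t, F t⟩)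
      fun t => UArr.one P (a t)) (fun t => Fin.append_left _ _ _) fun t => Fin.append_right _ _ _
  refine Op.mk_inj ((h _).trans ?_)
  rw [Op.mk_post, Op.mk_post, h m]
  exact (Op.post_preAll _ _ _ _).symm

theorem post_post_ap {P : SymMulticat.{v, u} V} {l : ℕ} (a : Fin l → P.Ob) {x y z : P.Ob}
    (m : Elt (P.Hom a x)) (f : Elt (P.Hom (single x) y)) (g : Elt (P.Hom (single y) z)) :
    P.post a rfl z ⋄ ((P.post a rfl y ⋄ (m ⊙ f)) ⊙ g) =
      P.post a rfl z ⋄ (m ⊙ (P.post (single x) rfl z ⋄ (f ⊙ g))) := by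
  refine Op.mk_inj ?_
  rw [Op.mk_post, Op.mk_post, Op.mk_post]
  have h : ∀ (w : UArr P) (hw : ⟨x, z, P.post (single x) rfl z ⋄ (f ⊙ g)⟩ = w) (hz : w.tgt = z)
      (hx : w.src = x), Op.cod hz (Op.post ⟨a, m⟩ w hx) = Op.post ⟨a, m⟩
        ⟨x, z, P.post (single x) rfl z ⋄ (f ⊙ g)⟩ rfl := by
    rintro _ rfl _ _; rfl
  exact (Op.post_post _ _ _ rfl rfl).trans (h _ (UArr.mk_comp f g) rfl rfl)

namespace UnaryInclusion

variable {M A : SymMulticat.{v, u} V} {i : UnaryInclusion M A}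

variable [HasColimits V] {q : A.Ob} {s r k : ℕ} {σ : Fin k ≃ Fin (s + r)} {a : Fin r → M.Ob}
  {d : A.Ob}

/-- The class of `(U, m, v)` in the pushout. -/
def qEl (i : UnaryInclusion M A) (σ : Fin k ≃ Fin (s + r)) {x : Fin s → M.Ob} {y : M.Ob}
    (U : ∀ t, Elt (A.Hom (single q) (i.obj (x t)))) (m : Elt (M.Hom (Fin.append x a ∘ σ) y))
    (v : Elt (A.Hom (single (i.obj y)) d)) : Elt (i.NHom (i.qTuple q σ a) d) :=
  (qGen (i := i) (fun t => ⟨q, i.obj (x t), U t⟩) ⟨_, m⟩ ⟨i.obj y, d, v⟩ (fun _ => rfl)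
    (fun _ => rfl) (fun _ => rfl) rfl rfl).el

theorem qEl_rel {x x' : Fin s → M.Ob} {y y' : M.Ob}
    (U : ∀ t, Elt (A.Hom (single q) (i.obj (x t))))
    (F : ∀ t, Elt (M.Hom (single (x t)) (x' t))) (m : Elt (M.Hom (Fin.append x' a ∘ σ) y))
    (g : Elt (M.Hom (single y) y')) (v : Elt (A.Hom (single (i.obj y')) d)) :
    i.qEl σ (x := x') (fun t => A.post (single q) rfl (i.obj (x' t)) ⋄ (U t ⊙ (i.map _ _ ⋄ F t))) m
      (A.post (single (i.obj y)) rfl d ⋄ ((i.map _ _ ⋄ g) ⊙ v)) =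
    i.qEl σ U (M.post _ rfl y' ⋄ ((M.pre σ x x' a y ⋄ (tensEl F ⊙ m)) ⊙ g)) v := by
  let U' : Fin s → UArr A := fun t => ⟨q, i.obj (x t), U t⟩
  let F' : Fin s → UArr M := fun t => ⟨x t, x' t, F t⟩
  let g' : UArr M := ⟨y, y', g⟩
  let v' : UArr A := ⟨i.obj y', d, v⟩
  refine Gen.el_eq ?_
  have hUF : ∀ t, (i.arr (qArrowsM a σ F' t)).src = (i.qArrows σ a U' t).tgt := by
    refine forall_positions σ (fun t => ?_) fun t => ?_
    · exact (congrArg (fun f => (i.arr f).src) (qArrowsM_left (a := a) F' t)).trans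
        (congrArg UArr.tgt (qArrows_left (i := i) (a := a) U' t)).symm
    · exact (congrArg (fun f => (i.arr f).src) (qArrowsM_right (a := a) F' t)).trans
        (congrArg UArr.tgt (qArrows_right (i := i) (a := a) U' t)).symm
  have hF : ∀ t, (Fin.append x' a ∘ σ) t = (qArrowsM a σ F' t).tgt := by
    refine forall_positions σ (fun t => ?_) fun t => ?_
    · exact (append_symm_left σ _ _ t).trans
        (congrArg UArr.tgt (qArrowsM_left (a := a) F' t)).symm
    · exact (append_symm_right σ _ _ t).trans
        (congrArg UArr.tgt (qArrowsM_right (a := a) F' t)).symm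
  have eU : i.qArrows σ a (fun t => (⟨q, i.obj (x' t), A.post (single q) rfl (i.obj (x' t)) ⋄
      (U t ⊙ (i.map _ _ ⋄ F t))⟩ : UArr A)) =
      fun t => (i.qArrows σ a U' t).comp (i.arr (qArrowsM a σ F' t)) (hUF t) := by
    refine funext (forall_positions σ (fun t => ?_) fun t => ?_)
    · refine (qArrows_left _ t).trans (Eq.trans ?_ (UArr.comp_congr
        (qArrows_left (i := i) (a := a) U' t)
        (congrArg i.arr (qArrowsM_left (a := a) F' t)) (hUF _) rfl).symm)
      exact UArr.mk_comp (U t) (i.map _ _ ⋄ F t)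
    · refine (qArrows_right _ t).trans (Eq.trans ?_ (UArr.comp_congr
        (qArrows_right (i := i) (a := a) U' t)
        ((congrArg i.arr (qArrowsM_right (a := a) F' t)).trans (i.arr_one _)) (hUF _) rfl).symm)
      exact (UArr.comp_one _ _).symm
  have ev : (⟨i.obj y, d, A.post (single (i.obj y)) rfl d ⋄ ((i.map _ _ ⋄ g) ⊙ v)⟩ : UArr A) =
      (i.arr g').comp v' rfl := UArr.mk_comp _ _
  have em : (⟨Fin.append x a ∘ σ, M.post _ rfl y' ⋄ ((M.pre σ x x' a y ⋄ (tensEl F ⊙ m)) ⊙ g)⟩ :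
      Op M.toSymMultigraph k y') = Op.post (Op.preAll (qArrowsM a σ F') ⟨_, m⟩) g' rfl := by
    refine (Op.mk_post _ _ _).trans ?_
    exact congrArg (fun n => Op.post n g' rfl) (Op.mk_preMany σ F m
      (Fin.append F' fun t => UArr.one M (a t)) (fun t => Fin.append_left _ _ _)
      fun t => Fin.append_right _ _ _)
  have h₁ : ∀ t, ((i.qArrows σ a U' t).comp (i.arr (qArrowsM a σ F' t)) (hUF t)).tgt =
      i.obj ((Fin.append x' a ∘ σ) t) := fun t => congrArg i.obj (hF t).symm
  have h₃ : ∀ t, (i.qArrows σ a U' t).tgt =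
      i.obj ((Op.post (Op.preAll (qArrowsM a σ F') ⟨Fin.append x' a ∘ σ, m⟩) g' rfl).1 t) :=
    fun t => (hUF t).symm.trans (congrArg i.obj
      ((Op.post_fst _ _ _ _).trans (Op.preAll_fst _ hF t)).symm)
  exact (i.tt_congr eU rfl ev _ _ _ h₁ rfl rfl).trans
    ((i.tt_rel (i.qArrows σ a U') (qArrowsM a σ F') ⟨_, m⟩ g' v' hUF hF rfl rfl rfl h₁ rfl rfl
      h₃).trans (i.tt_congr rfl em.symm rfl _ _ _ _ _ _))

theorem qEl_pre {x x' : Fin s → M.Ob} {y : M.Ob}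
    (U : ∀ t, Elt (A.Hom (single q) (i.obj (x t))))
    (F : ∀ t, Elt (M.Hom (single (x t)) (x' t))) (m : Elt (M.Hom (Fin.append x' a ∘ σ) y))
    (v : Elt (A.Hom (single (i.obj y)) d)) :
    i.qEl σ (x := x') (fun t => A.post (single q) rfl (i.obj (x' t)) ⋄ (U t ⊙ (i.map _ _ ⋄ F t))) m
      v = i.qEl σ U (M.pre σ x x' a y ⋄ (tensEl F ⊙ m)) v := by
  have h := qEl_rel U F m (M.one y ⋄ Elt.unit) v
  rwa [post_one_ap, ← comp_ap, i.map_one, one_post_ap] at h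

theorem qEl_post {x : Fin s → M.Ob} {y y' : M.Ob}
    (U : ∀ t, Elt (A.Hom (single q) (i.obj (x t)))) (m : Elt (M.Hom (Fin.append x a ∘ σ) y))
    (g : Elt (M.Hom (single y) y')) (v : Elt (A.Hom (single (i.obj y')) d)) :
    i.qEl σ U m (A.post (single (i.obj y)) rfl d ⋄ ((i.map _ _ ⋄ g) ⊙ v)) =
      i.qEl σ U (M.post _ rfl y' ⋄ (m ⊙ g)) v := by
  have h := qEl_rel U (fun t => M.one (x t) ⋄ Elt.unit) m g v
  rw [pre_one_ap] at h
  refine Eq.trans ?_ h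
  refine congrArg (fun U => i.qEl σ U m _) (funext fun t => ?_)
  rw [← comp_ap, i.map_one, post_one_ap]

/-- Dinaturality, for a target in `M`. -/
def QBalancedTgt {Z : V} {c : M.Ob} (φ : ∀ x : Fin s → M.Ob, i.qObj q σ a x c ⟶ Z) : Prop :=
  ∀ (x x' : Fin s → M.Ob) (U : ∀ t, Elt (A.Hom (single q) (i.obj (x t))))
    (F : ∀ t, Elt (M.Hom (single (x t)) (x' t))) (m : Elt (M.Hom (Fin.append x' a ∘ σ) c)),
    φ x' ⋄ (tensEl (X := fun t => A.Hom (single q) (i.obj (x' t)))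
        (fun t => A.post (single q) rfl (i.obj (x' t)) ⋄ (U t ⊙ (i.map _ _ ⋄ F t))) ⊙ m) =
      φ x ⋄ (tensEl U ⊙ (M.pre σ x x' a c ⋄ (tensEl F ⊙ m)))

/-- A dinatural family with target in `M`, extended along the arrows with target in `M`. -/
def extendTgt {Z : V} {c : M.Ob} (φ : ∀ x : Fin s → M.Ob, i.qObj q σ a x c ⟶ Z)
    (x : Fin s → M.Ob) (y : M.Ob) :
    i.qObj q σ a x y ⊗ A.Hom (single (i.obj y)) (i.obj c) ⟶ Z :=
  (α_ _ _ _).hom ≫ _ ◁ (_ ◁ i.inv y c ≫ M.post _ rfl c) ≫ φ x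

theorem extendTgt_ap {Z : V} {c : M.Ob} (φ : ∀ x : Fin s → M.Ob, i.qObj q σ a x c ⟶ Z)
    {x : Fin s → M.Ob} {y : M.Ob} (U : ∀ t, Elt (A.Hom (single q) (i.obj (x t))))
    (m : Elt (M.Hom (Fin.append x a ∘ σ) y)) (g : Elt (M.Hom (single y) c)) :
    extendTgt φ x y ⋄ ((tensEl U ⊙ m) ⊙ (i.map y c ⋄ g)) =
      φ x ⋄ (tensEl U ⊙ (M.post _ rfl c ⋄ (m ⊙ g))) := by
  have h : i.inv y c ⋄ (i.map y c ⋄ g) = g := by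
    refine (comp_ap _ _ _).symm.trans ?_
    have := i.isIso y c
    rw [show i.map y c ≫ i.inv y c = 𝟙 _ from IsIso.hom_inv_id _, id_ap]
  simp [extendTgt, h]

theorem QBalancedTgt.extend {Z : V} {c : M.Ob} {φ : ∀ x : Fin s → M.Ob, i.qObj q σ a x c ⟶ Z}
    (hφ : QBalancedTgt φ) : QBalanced (extendTgt φ) := by
  intro x x' y y' U F m g v
  obtain ⟨v, rfl⟩ : ∃ v', v = i.map y' c ⋄ v' := ⟨i.inv y' c ⋄ v, (i.map_inv_ap _ _ _).symm⟩
  have h : A.post (single (i.obj y)) rfl (i.obj c) ⋄ ((i.map y y' ⋄ g) ⊙ (i.map y' c ⋄ v)) =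
      i.map y c ⋄ (M.post (single y) rfl c ⋄ (g ⊙ v)) := by
    rw [← comp_ap, i.map_comp, comp_ap, tensorHom_ap]
  rw [h, extendTgt_ap, extendTgt_ap, hφ, pre_post_ap, post_post_ap]

variable [MonoidalClosed V]

theorem exists_desc_qEl
    (hk : ∀ h : k = 1, (∃ c, i.obj c = d) ∨ ∃ x, i.obj x = i.qTuple q σ a (pos h)) {Z : V}
    {φ : ∀ (x : Fin s → M.Ob) (y : M.Ob), i.qObj q σ a x y ⊗ A.Hom (single (i.obj y)) d ⟶ Z}
    (hφ : QBalanced φ) :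
    ∃ χ : i.NHom (i.qTuple q σ a) d ⟶ Z, ∀ (x : Fin s → M.Ob) (y : M.Ob)
      (U : ∀ t, Elt (A.Hom (single q) (i.obj (x t)))) (m : Elt (M.Hom (Fin.append x a ∘ σ) y))
      (v : Elt (A.Hom (single (i.obj y)) d)),
      χ ⋄ i.qEl σ U m v = φ x y ⋄ ((tensEl U ⊙ m) ⊙ v) :=
  exists_desc_q hk hφ

theorem hom_ext_qEl
    (hk : ∀ h : k = 1, (∃ c, i.obj c = d) ∨ ∃ x, i.obj x = i.qTuple q σ a (pos h)) {Z : V}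
    {χ χ' : i.NHom (i.qTuple q σ a) d ⟶ Z}
    (h : ∀ (x : Fin s → M.Ob) (y : M.Ob) (U : ∀ t, Elt (A.Hom (single q) (i.obj (x t))))
      (m : Elt (M.Hom (Fin.append x a ∘ σ) y)) (v : Elt (A.Hom (single (i.obj y)) d)),
      χ ⋄ i.qEl σ U m v = χ' ⋄ i.qEl σ U m v) : χ = χ' := by
  refine (spans_q hk).ext ?_
  rintro _ ⟨x, y, U, m, v, rfl⟩
  exact h x y U m v

variable {c : M.Ob}

theorem exists_desc_qEl_tgt {Z : V} {φ : ∀ x : Fin s → M.Ob, i.qObj q σ a x c ⟶ Z}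
    (hφ : QBalancedTgt φ) :
    ∃ χ : i.NHom (i.qTuple q σ a) (i.obj c) ⟶ Z, ∀ (x : Fin s → M.Ob)
      (U : ∀ t, Elt (A.Hom (single q) (i.obj (x t)))) (m : Elt (M.Hom (Fin.append x a ∘ σ) c)),
      χ ⋄ i.qEl σ U m (A.one (i.obj c) ⋄ Elt.unit) = φ x ⋄ (tensEl U ⊙ m) := by
  obtain ⟨χ, hχ⟩ := exists_desc_qEl (fun _ => Or.inl ⟨c, rfl⟩) hφ.extend
  refine ⟨χ, fun x U m => (hχ x c U m _).trans ?_⟩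
  rw [← i.map_one, comp_ap, extendTgt_ap, post_one_ap]

theorem hom_ext_qEl_tgt {Z : V} {χ χ' : i.NHom (i.qTuple q σ a) (i.obj c) ⟶ Z}
    (h : ∀ (x : Fin s → M.Ob) (U : ∀ t, Elt (A.Hom (single q) (i.obj (x t))))
      (m : Elt (M.Hom (Fin.append x a ∘ σ) c)), χ ⋄ i.qEl σ U m (A.one (i.obj c) ⋄ Elt.unit) =
        χ' ⋄ i.qEl σ U m (A.one (i.obj c) ⋄ Elt.unit)) : χ = χ' := by
  refine hom_ext_qEl (fun _ => Or.inl ⟨c, rfl⟩) fun x y U m v => ?_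
  obtain ⟨g, rfl⟩ : ∃ g, v = i.map y c ⋄ g := ⟨i.inv y c ⋄ v, (i.map_inv_ap _ _ _).symm⟩
  have e := qEl_post U m g (A.one (i.obj c) ⋄ Elt.unit)
  rw [post_one_ap] at e
  rw [e]
  exact h x U _

end UnaryInclusion

open UnaryInclusion

section CoendElements

variable [HasColimits V] [MonoidalClosed V] {M : SymMulticat.{v, u} V} {B : Type v}
  [EnrichedCategory V B] {i : EnrichedFunctor V M.Und B}
  (hi : SymMulticat.IsFullFaithfulInclusion i) {q : B} {s r k : ℕ} {σ : Fin k ≃ Fin (s + r)}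
  {a : Fin r → M.Ob}

theorem coendFst_ap {c : M.Ob} {x x' : Fin s → M.Ob} (U : ∀ t, Elt (q ⟶[V] i.obj (x t)))
    (F : ∀ t, Elt (M.Hom (single (x t)) (x' t))) (m : Elt (M.Hom (Fin.append x' a ∘ σ) c)) :
    coendFst i q σ a c x x' ⋄ (tensEl (fun t => U t ⊙ F t) ⊙ m) =
      tensEl (X := fun t => (q ⟶[V] i.obj (x' t)))
        (fun t => eComp V q (i.obj (x t)) (i.obj (x' t)) ⋄ (U t ⊙ (i.map (x t) (x' t) ⋄ F t))) ⊙
        m := by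
  refine (whiskerRight_ap _ _ _).trans (congrArg (· ⊙ m) ?_)
  refine (tensMap_ap _ _).trans (congrArg tensEl (funext fun t => ?_))
  exact (comp_ap _ _ _).trans (congrArg _ (whiskerLeft_ap _ _ _))

theorem coendSnd_ap {c : M.Ob} {x x' : Fin s → M.Ob} (U : ∀ t, Elt (q ⟶[V] i.obj (x t)))
    (F : ∀ t, Elt (M.Hom (single (x t)) (x' t))) (m : Elt (M.Hom (Fin.append x' a ∘ σ) c)) :
    coendSnd i q σ a c x x' ⋄ (tensEl (fun t => U t ⊙ F t) ⊙ m) =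
      tensEl U ⊙ (M.pre σ x x' a c ⋄ (tensEl F ⊙ m)) := by
  unfold coendSnd
  refine (comp_ap _ _ _).trans ?_
  refine (congrArg (_ ⋄ ·) ((whiskerRight_ap _ _ _).trans
    (congrArg (· ⊙ m) (tensShuffle_ap U F)))).trans ?_
  refine (comp_ap _ _ _).trans ((congrArg (_ ⋄ ·) (associator_hom_ap _ _ _)).trans ?_)
  exact whiskerLeft_ap _ _ _

theorem spans_coendRel (c : M.Ob) (x x' : Fin s → M.Ob) :
    Spans (fun e : Elt (coendRel i q σ a c x x') =>
      ∃ (U : ∀ t, Elt (q ⟶[V] i.obj (x t))) (F : ∀ t, Elt (M.Hom (single (x t)) (x' t)))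
        (m : Elt (M.Hom (Fin.append x' a ∘ σ) c)), e = tensEl (fun t => U t ⊙ F t) ⊙ m) := by
  refine ((spans_tens fun t => (spans_top _).tensor (spans_top _)).tensor (spans_top _)).mono ?_
  rintro _ ⟨_, m, ⟨f, hf, rfl⟩, -, rfl⟩
  choose U F hU hF hUF using hf
  exact ⟨U, F, m, congrArg (fun f => tensEl f ⊙ m) (funext hUF)⟩

theorem spans_coendObj (c : M.Ob) (x : Fin s → M.Ob) :
    Spans (fun e : Elt (coendObj i q σ a c x) => ∃ (U : ∀ t, Elt (q ⟶[V] i.obj (x t)))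
      (m : Elt (M.Hom (Fin.append x a ∘ σ) c)), e = tensEl U ⊙ m) := by
  refine ((spans_tens fun t => spans_top _).tensor (spans_top _)).mono ?_
  rintro _ ⟨_, m, ⟨U, -, rfl⟩, -, rfl⟩
  exact ⟨U, m, rfl⟩

variable {P : V}

/-- Dinatural families out of the diagram of the coend with target in `M`. -/
theorem coendDiagram_rel_iff {c : M.Ob} (φ : ∀ x, (coendDiagram i q σ a c).right x ⟶ P) :
    (∀ p, (coendDiagram i q σ a c).fst p ≫ φ p.2 = (coendDiagram i q σ a c).snd p ≫ φ p.1) ↔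
      QBalancedTgt (i := unaryInclusion hi) (q := q) (σ := σ) (a := a) φ := by
  have e : ∀ (x x' : Fin s → M.Ob) (U : ∀ t, Elt (q ⟶[V] i.obj (x t)))
      (F : ∀ t, Elt (M.Hom (single (x t)) (x' t))),
      (fun t => (E V B).post (single q) rfl (i.obj (x' t)) ⋄ (U t ⊙ (i.map _ _ ⋄ F t))) =
      fun t => eComp V q (i.obj (x t)) (i.obj (x' t)) ⋄ (U t ⊙ (i.map (x t) (x' t) ⋄ F t)) :=
    fun x x' U F => funext fun t => congrArg (· ⋄ (U t ⊙ (i.map (x t) (x' t) ⋄ F t)))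
      (E_post _ _ _)
  constructor
  · intro h x x' U F m
    have h' := congrArg (· ⋄ (tensEl (fun t => U t ⊙ F t) ⊙ m)) (h (x, x'))
    refine Eq.trans ?_ ((comp_ap _ _ _).symm.trans (h'.trans ((comp_ap _ _ _).trans
      (congrArg _ (coendSnd_ap U F m)))))
    exact congrArg (φ x' ⋄ ·) ((congrArg (fun f => tensEl f ⊙ m) (e x x' U F)).trans
      (coendFst_ap U F m).symm)
  · rintro h ⟨x, x'⟩
    refine (spans_coendRel c x x').ext ?_
    rintro _ ⟨U, F, m, rfl⟩
    refine (comp_ap _ _ _).trans (Eq.trans (Eq.trans ?_ (h x x' U F m)) (Eq.trans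
      (congrArg (φ x ⋄ ·) (coendSnd_ap U F m).symm) (comp_ap _ _ _).symm))
    exact congrArg (φ x' ⋄ ·) ((coendFst_ap U F m).trans
      (congrArg (fun f => tensEl f ⊙ m) (e x x' U F)).symm)

/-- Dinatural families out of the diagram of the coend with target `q`. -/
theorem coendDiagram'_rel_iff (φ : ∀ p, (coendDiagram' i q σ a).right p ⟶ P) :
    (∀ p, (coendDiagram' i q σ a).fst p ≫ φ (p.2.1, p.1.2) =
        (coendDiagram' i q σ a).snd p ≫ φ (p.1.1, p.2.2)) ↔
      QBalanced (i := unaryInclusion hi) (q := q) (σ := σ) (a := a) (d := q)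
        fun x y => φ (x, y) := by
  have e : ∀ (x x' : Fin s → M.Ob) (U : ∀ t, Elt (q ⟶[V] i.obj (x t)))
      (F : ∀ t, Elt (M.Hom (single (x t)) (x' t))),
      (fun t => (E V B).post (single q) rfl (i.obj (x' t)) ⋄ (U t ⊙ (i.map _ _ ⋄ F t))) =
      fun t => eComp V q (i.obj (x t)) (i.obj (x' t)) ⋄ (U t ⊙ (i.map (x t) (x' t) ⋄ F t)) :=
    fun x x' U F => funext fun t => congrArg (· ⋄ (U t ⊙ (i.map (x t) (x' t) ⋄ F t)))
      (E_post _ _ _)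
  have e' : ∀ (y y' : M.Ob) (g : Elt (M.Hom (single y) y')) (v : Elt (i.obj y' ⟶[V] q)),
      (E V B).post (single (i.obj y)) rfl q ⋄ ((i.map y y' ⋄ g) ⊙ v) =
      eComp V (i.obj y) (i.obj y') q ⋄ ((i.map y y' ⋄ g) ⊙ v) := fun y y' g v =>
    congrArg (· ⋄ ((i.map y y' ⋄ g) ⊙ v)) (E_post _ _ _)
  have h₁ : ∀ (x x' : Fin s → M.Ob) (y y' : M.Ob) (U : ∀ t, Elt (q ⟶[V] i.obj (x t)))
      (F : ∀ t, Elt (M.Hom (single (x t)) (x' t))) (m : Elt (M.Hom (Fin.append x' a ∘ σ) y))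
      (g : Elt (M.Hom (single y) y')) (v : Elt (i.obj y' ⟶[V] q)),
      (coendDiagram' i q σ a).fst ((x, y), (x', y')) ⋄
        ((tensEl (fun t => U t ⊙ F t) ⊙ m) ⊙ (g ⊙ v)) =
      (tensEl (X := fun t => (q ⟶[V] i.obj (x' t)))
        (fun t => (E V B).post (single q) rfl (i.obj (x' t)) ⋄ (U t ⊙ (i.map _ _ ⋄ F t))) ⊙ m) ⊙
        ((E V B).post (single (i.obj y)) rfl q ⋄ ((i.map y y' ⋄ g) ⊙ v)) := by
    intro x x' y y' U F m g v
    refine (tensorHom_ap _ _ _ _).trans (congrArg₂ (· ⊙ ·) ?_ ?_)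
    · exact (coendFst_ap U F m).trans (congrArg (fun f => tensEl f ⊙ m) (e x x' U F)).symm
    · refine Eq.trans ?_ (e' y y' g v).symm
      exact (comp_ap _ _ _).trans (congrArg _ (whiskerRight_ap _ _ _))
  have h₂ : ∀ (x x' : Fin s → M.Ob) (y y' : M.Ob) (U : ∀ t, Elt (q ⟶[V] i.obj (x t)))
      (F : ∀ t, Elt (M.Hom (single (x t)) (x' t))) (m : Elt (M.Hom (Fin.append x' a ∘ σ) y))
      (g : Elt (M.Hom (single y) y')) (v : Elt (i.obj y' ⟶[V] q)),
      (coendDiagram' i q σ a).snd ((x, y), (x', y')) ⋄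
        ((tensEl (fun t => U t ⊙ F t) ⊙ m) ⊙ (g ⊙ v)) =
      (tensEl U ⊙ (M.post _ rfl y' ⋄ ((M.pre σ x x' a y ⋄ (tensEl F ⊙ m)) ⊙ g))) ⊙ v := by
    intro x x' y y' U F m g v
    refine (comp_ap _ _ _).trans ((congrArg (_ ⋄ ·) ((whiskerRight_ap _ _ _).trans
      (congrArg (· ⊙ (g ⊙ v)) (coendSnd_ap U F m)))).trans ?_)
    refine (comp_ap _ _ _).trans ((congrArg (_ ⋄ ·) (associator_inv_ap _ _ _)).trans ?_)
    refine (whiskerRight_ap _ _ _).trans (congrArg (· ⊙ v) ?_)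
    refine (comp_ap _ _ _).trans ((congrArg (_ ⋄ ·) (associator_hom_ap _ _ _)).trans ?_)
    exact whiskerLeft_ap _ _ _
  constructor
  · intro h x x' y y' U F m g v
    have h' := congrArg (· ⋄ ((tensEl (fun t => U t ⊙ F t) ⊙ m) ⊙ (g ⊙ v))) (h ((x, y), (x', y')))
    exact (congrArg (φ (x', y) ⋄ ·) (h₁ x x' y y' U F m g v).symm).trans ((comp_ap _ _ _).symm.trans
      (h'.trans ((comp_ap _ _ _).trans (congrArg (φ (x, y') ⋄ ·) (h₂ x x' y y' U F m g v)))))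
  · rintro h ⟨⟨x, y⟩, ⟨x', y'⟩⟩
    refine ((spans_coendRel y x x').tensor ((spans_top _).tensor (spans_top _))).ext ?_
    rintro _ ⟨_, _, ⟨U, F, m, rfl⟩, ⟨g, v, -, -, rfl⟩, rfl⟩
    refine (comp_ap _ _ _).trans ((congrArg (φ (x', y) ⋄ ·) (h₁ x x' y y' U F m g v)).trans ?_)
    exact (h x x' y y' U F m g v).trans ((congrArg (φ (x, y') ⋄ ·)
      (h₂ x x' y y' U F m g v).symm).trans (comp_ap _ _ _).symm)

theorem isCoend_coendDiagram {c : M.Ob}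
    (Θ : (unaryInclusion hi).NHom ((unaryInclusion hi).qTuple q σ a) (i.obj c) ⟶ P) [IsIso Θ]
    (π : ∀ x, (coendDiagram i q σ a c).right x ⟶ P)
    (hπ : ∀ (x : Fin s → M.Ob) (U : ∀ t, Elt (q ⟶[V] i.obj (x t)))
      (m : Elt (M.Hom (Fin.append x a ∘ σ) c)), π x ⋄ (tensEl U ⊙ m) =
        Θ ⋄ qEl (A := E V B) (d := i.obj c) (unaryInclusion hi) σ U m
          ((E V B).one (i.obj c) ⋄ Elt.unit)) :
    IsCoend (coendDiagram i q σ a c) π := by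
  have hrel := (coendDiagram_rel_iff hi π).2 fun x x' U F m =>
    (hπ _ _ _).trans ((congrArg (Θ ⋄ ·) (qEl_pre (A := E V B) U F m _)).trans (hπ _ _ _).symm)
  have hχ : ∀ {Z : V} (φ : ∀ x, (coendDiagram i q σ a c).right x ⟶ Z),
      (∀ p, (coendDiagram i q σ a c).fst p ≫ φ p.2 = (coendDiagram i q σ a c).snd p ≫ φ p.1) →
      ∃ χ : P ⟶ Z, ∀ x, π x ≫ χ = φ x := by
    intro Z φ hφ
    obtain ⟨χ, hχ⟩ := exists_desc_qEl_tgt ((coendDiagram_rel_iff hi φ).1 hφ)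
    refine ⟨inv Θ ≫ χ, fun x => (spans_coendObj c x).ext ?_⟩
    rintro _ ⟨U, m, rfl⟩
    refine (comp_ap _ _ _).trans ((congrArg (_ ⋄ ·) (hπ x U m)).trans ((comp_ap _ _ _).symm.trans ?_))
    refine (congrArg (· ⋄ _) (IsIso.hom_inv_id_assoc Θ χ)).trans ?_
    exact hχ x U m
  have hext : ∀ {Z : V} {χ χ' : P ⟶ Z}, (∀ x, π x ≫ χ = π x ≫ χ') → χ = χ' := by
    intro Z χ χ' h
    refine (cancel_epi Θ).1 (hom_ext_qEl_tgt fun x U m => ?_)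
    have e : ∀ χ : P ⟶ Z, (Θ ≫ χ) ⋄ qEl (A := E V B) (d := i.obj c) (unaryInclusion hi) σ U m
          ((E V B).one (i.obj c) ⋄ Elt.unit) = (π x ≫ χ) ⋄ (tensEl U ⊙ m) := fun χ =>
      (comp_ap _ _ _).trans ((congrArg (χ ⋄ ·) (hπ x U m).symm).trans (comp_ap _ _ _).symm)
    exact (e χ).trans ((congrArg (· ⋄ _) (h x)).trans (e χ').symm)
  refine ⟨hrel, ⟨Multicofork.IsColimit.mk _
    (fun K => (hχ K.π K.condition).choose) (fun K => (hχ K.π K.condition).choose_spec)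
    (fun K χ h => hext fun x => (h x).trans ((hχ K.π K.condition).choose_spec x).symm)⟩⟩

theorem isCoend_coendDiagram' (hks : ¬(k = 1 ∧ s = 1))
    (Θ : (unaryInclusion hi).NHom ((unaryInclusion hi).qTuple q σ a) q ⟶ P) [IsIso Θ]
    (π : ∀ p, (coendDiagram' i q σ a).right p ⟶ P)
    (hπ : ∀ (x : Fin s → M.Ob) (y : M.Ob) (U : ∀ t, Elt (q ⟶[V] i.obj (x t)))
      (m : Elt (M.Hom (Fin.append x a ∘ σ) y)) (v : Elt (i.obj y ⟶[V] q)),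
      π (x, y) ⋄ ((tensEl U ⊙ m) ⊙ v) =
        Θ ⋄ qEl (A := E V B) (d := q) (unaryInclusion hi) σ U m v) :
    IsCoend (coendDiagram' i q σ a) π := by
  have hk : ∀ h : k = 1, (∃ c', (unaryInclusion hi).obj c' = q) ∨
      ∃ x, (unaryInclusion hi).obj x = (unaryInclusion hi).qTuple q σ a (pos h) := by
    intro h
    have hsr : k = s + r := by simpa using Fintype.card_congr σ
    have hs : s = 0 := by
      by_contra h0
      exact hks ⟨h, by omega⟩
    have hr : r = 1 := by omega
    subst hs hr
    refine Or.inr ⟨a 0, ?_⟩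
    have : σ.symm (Fin.natAdd 0 0) = pos h := by
      subst h; exact Subsingleton.elim _ _
    rw [← this]
    exact (qTuple_right (i := unaryInclusion hi) (a := a) 0).symm
  have hrel := (coendDiagram'_rel_iff hi π).2 fun x x' y y' U F m g v =>
    (hπ _ _ _ _ _).trans ((congrArg (Θ ⋄ ·) (qEl_rel (A := E V B) U F m g v)).trans
      (hπ _ _ _ _ _).symm)
  have hχ : ∀ {Z : V} (φ : ∀ p, (coendDiagram' i q σ a).right p ⟶ Z),
      (∀ p, (coendDiagram' i q σ a).fst p ≫ φ (p.2.1, p.1.2) =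
        (coendDiagram' i q σ a).snd p ≫ φ (p.1.1, p.2.2)) →
      ∃ χ : P ⟶ Z, ∀ p, π p ≫ χ = φ p := by
    intro Z φ hφ
    obtain ⟨χ, hχ⟩ := exists_desc_qEl hk ((coendDiagram'_rel_iff hi φ).1 hφ)
    refine ⟨inv Θ ≫ χ, fun p => ?_⟩
    obtain ⟨x, y⟩ := p
    refine ((spans_coendObj y x).tensor (spans_top _)).ext ?_
    rintro _ ⟨_, v, ⟨U, m, rfl⟩, -, rfl⟩
    refine (comp_ap _ _ _).trans ((congrArg (_ ⋄ ·) (hπ x y U m v)).trans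
      ((comp_ap _ _ _).symm.trans ?_))
    refine (congrArg (· ⋄ _) (IsIso.hom_inv_id_assoc Θ χ)).trans ?_
    exact hχ x y U m v
  have hext : ∀ {Z : V} {χ χ' : P ⟶ Z}, (∀ p, π p ≫ χ = π p ≫ χ') → χ = χ' := by
    intro Z χ χ' h
    refine (cancel_epi Θ).1 (hom_ext_qEl hk fun x y U m v => ?_)
    have e : ∀ χ : P ⟶ Z, (Θ ≫ χ) ⋄ qEl (A := E V B) (d := q) (unaryInclusion hi) σ U m v =
        (π (x, y) ≫ χ) ⋄ ((tensEl U ⊙ m) ⊙ v) := fun χ =>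
      (comp_ap _ _ _).trans ((congrArg (χ ⋄ ·) (hπ x y U m v).symm).trans (comp_ap _ _ _).symm)
    exact (e χ).trans ((congrArg (· ⋄ _) (h (x, y))).trans (e χ').symm)
  refine ⟨hrel, ⟨Multicofork.IsColimit.mk _
    (fun K => (hχ K.π K.condition).choose) (fun K => (hχ K.π K.condition).choose_spec)
    (fun K χ h => hext fun p => (h p).trans ((hχ K.π K.condition).choose_spec p).symm)⟩⟩

end CoendElements

theorem isIso_cast (P : SymMulticat.{v, u} V) {k : ℕ} {a a' : Fin k → P.Ob} {b : P.Ob}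
    (h : ∀ t, a' t = a t) : IsIso (P.cast (b := b) h) :=
  ⟨P.cast fun t => (h t).symm, (P.cast_trans _ _).trans (P.cast_refl _ _ _),
    (P.cast_trans _ _).trans (P.cast_refl _ _ _)⟩

theorem UArr.comp_comp_comp_mid {P : SymMulticat.{v, u} V} (w f n g v : UArr P) (h₁ : f.src = w.tgt)
    (h₂ : n.src = f.tgt) (h₃ : g.src = n.tgt) (h₄ : v.src = g.tgt) :
    ((w.comp f h₁).comp n h₂).comp (g.comp v h₄) h₃ =
      (w.comp ((f.comp n h₂).comp g h₃) h₁).comp v h₄ := by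
  refine (UArr.comp_assoc ((w.comp f h₁).comp n h₂) g v h₃ h₄ h₄ h₃).symm.trans (UArr.comp_congr ?_ rfl _ _)
  refine (UArr.comp_congr (UArr.comp_assoc w f n h₁ h₂ h₂ h₁) rfl _ h₃).trans ?_
  exact UArr.comp_assoc w (f.comp n h₂) g h₁ h₃ h₃ h₁

section Isomorphisms

variable {P Q : SymMulticat.{v, u} V}

theorem isIso_map_of_eq_id {H : P ⟶ P} (h : H = 𝟙 P) {k : ℕ} (a : Fin k → P.Ob) (b : P.Ob) :
    IsIso (Multifunctor.map H a b) := by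
  subst h
  exact (inferInstance : IsIso (𝟙 (P.Hom a b)))

theorem isIso_map (F : P ⟶ Q) [IsIso F] {k : ℕ} (a : Fin k → P.Ob) (b : P.Ob) :
    IsIso (Multifunctor.map F a b) := by
  have h₁ : IsIso (Multifunctor.map F a b ≫ Multifunctor.map (inv F) (Multifunctor.obj F ∘ a)
      (Multifunctor.obj F b)) := isIso_map_of_eq_id (IsIso.hom_inv_id F) a b
  have h₂ : IsIso (Multifunctor.map (inv F) (Multifunctor.obj F ∘ a) (Multifunctor.obj F b) ≫
      Multifunctor.map F (Multifunctor.obj (inv F) ∘ (Multifunctor.obj F ∘ a))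
        (Multifunctor.obj (inv F) (Multifunctor.obj F b))) :=
    isIso_map_of_eq_id (IsIso.inv_hom_id F) (Multifunctor.obj F ∘ a) (Multifunctor.obj F b)
  generalize Multifunctor.map (inv F) (Multifunctor.obj F ∘ a) (Multifunctor.obj F b) = g at h₁ h₂
  generalize Multifunctor.map F (Multifunctor.obj (inv F) ∘ (Multifunctor.obj F ∘ a))
    (Multifunctor.obj (inv F) (Multifunctor.obj F b)) = f' at h₂
  have : IsIso g := by
    have : Mono g := mono_of_mono g f'
    have : IsSplitEpi g := ⟨⟨⟨inv (Multifunctor.map F a b ≫ g) ≫ Multifunctor.map F a b, by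
      rw [Category.assoc, IsIso.inv_hom_id]⟩⟩⟩
    exact isIso_of_mono_of_isSplitEpi g
  exact IsIso.of_isIso_comp_right _ g

theorem bijective_obj (F : P ⟶ Q) [IsIso F] : Function.Bijective (Multifunctor.obj F) :=
  Function.bijective_iff_has_inverse.2 ⟨Multifunctor.obj (inv F),
    fun x => congrFun (congrArg Multifunctor.obj (IsIso.hom_inv_id F)) x,
    fun x => congrFun (congrArg Multifunctor.obj (IsIso.inv_hom_id F)) x⟩

end Isomorphisms

namespace UnaryInclusion

variable {M A : SymMulticat.{v, u} V} {i : UnaryInclusion M A} [HasColimits V] [MonoidalClosed V]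
  {d : A.Ob}

theorem mk_qEl {q : A.Ob} {s r k : ℕ} {σ : Fin k ≃ Fin (s + r)} {a : Fin r → M.Ob}
    {x : Fin s → M.Ob} {y : M.Ob} (U : ∀ t, Elt (A.Hom (single q) (i.obj (x t))))
    (m : Elt (M.Hom (Fin.append x a ∘ σ) y)) (v : Elt (A.Hom (single (i.obj y)) d)) :
    (⟨i.qTuple q σ a, i.qEl σ U m v⟩ : i.RawOp k d) =
      i.ttOp (i.qArrows σ a fun t => ⟨q, i.obj (x t), U t⟩) ⟨_, m⟩ ⟨i.obj y, d, v⟩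
        (i.qArrows_tgt (fun _ => rfl) fun _ => rfl) rfl rfl :=
  Gen.mk_el _

/-- The arrow of `A` given by a generator of a unary hom object. -/
def Gen.toArr {b : Fin 1 → A.Ob} : i.Gen b d → UArr A
  | tt U m v hb hU hv hd => ((U (pos rfl)).comp (i.arr (UArr.ofOp (Op.act (finCongr rfl) m)))
      (hU _).symm).comp v hv
  | bb _ w _ _ => w

theorem compat_toArr {b : Fin 1 → A.Ob} : i.Compat (Gen.toArr : i.Gen b d → UArr A) where
  rel := fun {y} U F m g v hUF hF hg hv hd h₁ h₂ h₂' h₃ _ _ => by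
    obtain ⟨n, rfl, rfl⟩ := m.exists_arrow
    have hn : n.src = (F (pos rfl)).tgt := hF _
    have e₁ : UArr.ofOp (Op.act (finCongr rfl) (Op.post (Op.preAll F n.op) g hg)) =
        ((F (pos rfl)).comp n hn).comp g hg := by
      have e : Op.post (Op.preAll F n.op) g hg = (((F (pos rfl)).comp n hn).comp g hg).op :=
        (congrArg (fun w => Op.post w g hg) (Op.preAll_op F n hn)).trans
          (UArr.op_comp ((F (pos rfl)).comp n hn) g hg).symm
      exact (congrArg (fun w => UArr.ofOp (Op.act (finCongr rfl) w)) e).trans (UArr.ofOp_act_op _ _)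
    have e₂ : UArr.ofOp (Op.act (finCongr rfl) n.op) = n := UArr.ofOp_act_op _ _
    have a₁ : (i.arr n).src = ((U (pos rfl)).comp (i.arr (F (pos rfl))) (hUF _)).tgt :=
      congrArg i.obj hn
    have a₂ : ((i.arr g).comp v hv).src = (i.arr n).tgt := congrArg i.obj hg
    have a₃ : (i.arr (F (pos rfl))).src = (U (pos rfl)).tgt := hUF _
    have a₄ : (i.arr n).src = (i.arr (F (pos rfl))).tgt := congrArg i.obj hn
    have a₅ : (i.arr g).src = (i.arr n).tgt := congrArg i.obj hg
    refine (UArr.comp_congr (UArr.comp_congr rfl (congrArg i.arr e₂) _ a₁) rfl _ a₂).trans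
      (Eq.trans ?_ (UArr.comp_congr (UArr.comp_congr rfl (congrArg i.arr e₁) _ a₃) rfl _ hv).symm)
    have b₁ : i.arr (((F (pos rfl)).comp n hn).comp g hg) =
        ((i.arr (F (pos rfl))).comp (i.arr n) a₄).comp (i.arr g) a₅ :=
      (i.arr_comp ((F (pos rfl)).comp n hn) g hg a₅).trans (UArr.comp_congr (i.arr_comp _ n hn a₄) rfl _ _)
    refine Eq.trans ?_ (UArr.comp_congr (UArr.comp_congr rfl b₁.symm a₃ _) rfl hv _)
    exact UArr.comp_comp_comp_mid _ _ _ _ _ a₃ a₄ a₅ hv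
  collapse := fun h U m v hU hv hd h₁ h₂ hd' hb hb' => rfl

theorem isIso_κ (b : Fin 1 → A.Ob) (d : A.Ob) : IsIso (i.κ rfl b d) := by
  let c : Elt (A.Hom (single (b (pos rfl))) d) → UArr A := fun e => ⟨b (pos rfl), d, e⟩
  have hc : Function.Injective c := fun e e' h => by injection h
  obtain ⟨χ, hχ⟩ := i.exists_desc_gen c hc Gen.toArr compat_toArr (fun p => i.collapse rfl b d p)
    (fun _ => 𝟙 _) (fun p U m v => i.collapse_ap rfl U m v) (fun _ w => congrArg c (id_ap w))
  have hχ' : ∀ w : Elt (A.Hom (single (b (pos rfl))) d), χ ⋄ (i.κ rfl b d ⋄ w) = w := fun w =>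
    hc (hχ (Gen.bb rfl ⟨_, d, w⟩ rfl rfl))
  refine ⟨χ, (spans_top _).ext fun w _ => ?_, i.spans_gen.ext ?_⟩
  · rw [comp_ap, hχ', id_ap]
  · rintro _ ⟨g, rfl⟩
    obtain ⟨w, hw⟩ : ∃ w, g.el = i.κ rfl b d ⋄ w := by
      cases g with
      | tt U m v hb hU hv hd =>
        refine ⟨UArr.elt (((U (pos rfl)).comp (i.arr (UArr.ofOp (Op.act (finCongr rfl) m)))
          (hU _).symm).comp v hv) (hb _) hd, ?_⟩
        exact Gen.el_eq (g' := Gen.bb rfl (((U (pos rfl)).comp (i.arr (UArr.ofOp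
            (Op.act (finCongr rfl) m))) (hU _).symm).comp v hv) (hb _) hd)
          (i.tt_collapse rfl U m v hU hv hd (hU _).symm hv hd)
      | bb h w hb hd => exact ⟨w.elt hb hd, rfl⟩
    rw [hw, id_ap, comp_ap, hχ']

/-- The inclusion of `M` into the pushout is full and faithful. -/
theorem isIso_inl {k : ℕ} (a : Fin k → M.Ob) (c : M.Ob) :
    IsIso (Multifunctor.map i.inl a c) := by
  let σ : Fin k ≃ Fin (0 + k) := finCongr (Nat.zero_add k).symm
  have hσ : ∀ {α : Type v} (x : Fin 0 → α) (a : Fin k → α) (t : Fin k),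
      (Fin.append x a ∘ σ) t = a t := fun x a t => by
    have : σ t = Fin.natAdd 0 t := Fin.ext (by simp [σ])
    rw [Function.comp, this, Fin.append_right]
  let T : Fin k → A.Ob := i.qTuple (i.obj c) σ a
  have hT : ∀ t, T t = (i.obj ∘ a) t := fun t => hσ _ _ t
  let φ : ∀ x : Fin 0 → M.Ob, i.qObj (i.obj c) σ a x c ⟶ M.Hom a c := fun x =>
    (λ_ _).hom ≫ M.cast fun t => (hσ x a t).symm
  have hφ : ∀ (x : Fin 0 → M.Ob) (U : ∀ t, Elt (A.Hom (single (i.obj c)) (i.obj (x t))))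
      (m : Elt (M.Hom (Fin.append x a ∘ σ) c)),
      (⟨a, φ x ⋄ (tensEl U ⊙ m)⟩ : Op M.toSymMultigraph k c) = ⟨_, m⟩ := by
    intro x U m
    refine Eq.trans (congrArg (Sigma.mk a) ?_) (Op.mk_cast (fun t => (hσ x a t).symm) m)
    exact (comp_ap _ _ _).trans (congrArg (_ ⋄ ·) (leftUnitor_hom_ap m))
  have hb : QBalancedTgt φ := by
    intro x x' U F m
    refine Op.mk_inj ((hφ _ _ _).trans (Eq.trans ?_ (hφ _ _ _).symm))
    obtain rfl : x = x' := Subsingleton.elim _ _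
    obtain rfl : F = fun t => M.one (x t) ⋄ Elt.unit := funext fun t => t.elim0
    rw [pre_one_ap]
  obtain ⟨χ, hχ⟩ := exists_desc_qEl_tgt hb
  let ψ : M.Hom a c ⟶ i.NHom T (i.obj c) := Multifunctor.map i.inl a c ≫ i.adjoin.cast hT
  have hψ : ∀ (x : Fin 0 → M.Ob) (U : ∀ t, Elt (A.Hom (single (i.obj c)) (i.obj (x t))))
      (m : Elt (M.Hom (Fin.append x a ∘ σ) c)),
      ψ ⋄ (φ x ⋄ (tensEl U ⊙ m)) = i.qEl σ U m (A.one (i.obj c) ⋄ Elt.unit) := by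
    intro x U m
    refine Op.mk_inj (G := i.adjoin.toSymMultigraph) (a := T) ?_
    refine (congrArg (fun e => (⟨T, e⟩ : Op i.adjoin.toSymMultigraph k (i.obj c)))
      (comp_ap (Multifunctor.map i.inl a c) (i.adjoin.cast hT) _)).trans ((Op.mk_cast (G := i.adjoin.toSymMultigraph)
        (y := i.obj c) hT (Multifunctor.map i.inl a c ⋄ (φ x ⋄ (tensEl U ⊙ m)))).trans ?_)
    refine (congrArg (Op.map i.inl) (hφ x U m)).trans ((i.map_inl _).trans ?_)
    refine Eq.trans ?_ (mk_qEl U m _).symm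
    refine i.tt_congr (funext (forall_positions σ (fun t => t.elim0) fun t => ?_)) rfl rfl _ _ _ _ _ _
    refine Eq.trans ?_ (qArrows_right _ t).symm
    exact congrArg (fun x => UArr.one A (i.obj x)) (append_symm_right σ x a t)
  have h₁ : ψ ≫ χ = 𝟙 _ := by
    refine (spans_top _).ext fun m _ => ?_
    obtain ⟨m, rfl⟩ : ∃ m', m = φ nil ⋄ (tensEl (X := fun t : Fin 0 =>
        A.Hom (single (i.obj c)) (i.obj (nil t))) (fun t => t.elim0) ⊙ m') :=
      ⟨M.cast (hσ nil a) ⋄ m, (Op.mk_inj ((hφ _ _ _).trans (Op.mk_cast _ _))).symm⟩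
    exact (comp_ap _ _ _).trans ((congrArg (χ ⋄ ·) (hψ _ _ _)).trans
      ((hχ _ _ _).trans (id_ap _).symm))
  have h₂ : χ ≫ ψ = 𝟙 _ := hom_ext_qEl_tgt fun x U m =>
    (comp_ap _ _ _).trans ((congrArg (ψ ⋄ ·) (hχ x U m)).trans ((hψ x U m).trans (id_ap _).symm))
  have : IsIso ψ := ⟨χ, h₁, h₂⟩
  exact @IsIso.of_isIso_comp_right _ _ _ _ _ _ _ (isIso_cast i.adjoin (b := i.obj c) hT) this

end UnaryInclusion

theorem Op.cod_post_congr {P : SymMulticat.{v, u} V} {l : ℕ} {x : P.Ob}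
    {p p' : Op P.toSymMultigraph l x} {w w' : UArr P} (hp : p = p') (hw : w = w') (h : w.src = x)
    (h' : w'.src = x) (ht : w.tgt = w'.tgt) : Op.cod ht (Op.post p w h) = Op.post p' w' h' := by
  subst hp hw; rfl

section CanonicalMaps

variable [HasInitial V] [MonoidalClosed V] {M N : SymMulticat.{v, u} V} {B : Type v}
  [EnrichedCategory V B] {i : EnrichedFunctor V M.Und B} (g : E V B ⟶ N) (j : M ⟶ N)
  (w : E.map i ≫ g = counit M ≫ j) {q : B} {s r k : ℕ} {σ : Fin k ≃ Fin (s + r)}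
  {a : Fin r → M.Ob}

theorem coendπ_ap {c : M.Ob} {x : Fin s → M.Ob} (U : ∀ t, Elt (q ⟶[V] i.obj (x t)))
    (m : Elt (M.Hom (Fin.append x a ∘ σ) c))
    (h : ∀ l, (Fin.append (fun t => Multifunctor.obj g (i.obj (x t))) (Multifunctor.obj j ∘ a) ∘ σ)
      l = (Multifunctor.obj j ∘ Fin.append x a ∘ σ) l) :
    coendπ q σ a g j w c x ⋄ (tensEl U ⊙ m) =
      N.pre σ (fun _ => Multifunctor.obj g q) (fun t => Multifunctor.obj g (i.obj (x t)))
        (Multifunctor.obj j ∘ a) (Multifunctor.obj j c) ⋄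
      (tensEl (fun t => unary g q (i.obj (x t)) ⋄ U t) ⊙
        (N.cast h ⋄ (Multifunctor.map j (Fin.append x a ∘ σ) c ⋄ m))) := by
  refine (comp_ap _ _ _).trans (congrArg (ap _) ((tensorHom_ap _ _ _ _).trans ?_))
  exact congrArg₂ (· ⊙ ·) (tensMap_ap _ _) (comp_ap _ _ _)

theorem coendπ'_ap {p : (Fin s → M.Ob) × M.Ob} (e : Elt (coendObj i q σ a p.2 p.1))
    (v : Elt (i.obj p.2 ⟶[V] q)) : coendπ' q σ a g j w p ⋄ (e ⊙ v) =
      N.post _ (obj_eq g j w p.2).symm (Multifunctor.obj g q) ⋄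
        ((coendπ q σ a g j w p.2 p.1 ⋄ e) ⊙ (unary g (i.obj p.2) q ⋄ v)) :=
  (comp_ap _ _ _).trans (congrArg (ap _) (tensorHom_ap _ _ _ _))

end CanonicalMaps

section Transport

variable [HasColimits V] [MonoidalClosed V] {M N : SymMulticat.{v, u} V} {B : Type v}
  [EnrichedCategory V B] {i : EnrichedFunctor V M.Und B}
  (hi : SymMulticat.IsFullFaithfulInclusion i) (F : (unaryInclusion hi).adjoin ⟶ N)
  {q : B} {s r k : ℕ} {σ : Fin k ≃ Fin (s + r)} {a : Fin r → M.Ob}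

theorem map_inr_mk {b b' : B} (e : Elt (b ⟶[V] b')) :
    ((unaryInclusion hi).inr ⟨b, b', e⟩).map F =
      ⟨Multifunctor.obj (adjoinInr hi ≫ F) b, Multifunctor.obj (adjoinInr hi ≫ F) b',
        unary (adjoinInr hi ≫ F) b b' ⋄ e⟩ := by
  refine (congrArg (UArr.map F) (map_adjoinInr hi (freeArr b b' e)).symm).trans ?_
  refine (UArr.map_map _ _ _).symm.trans ?_
  exact UArr.mk_map (adjoinInr hi ≫ F) (x := b) (y := b') e

theorem mk_coendπ (w : E.map i ≫ adjoinInr hi ≫ F = counit M ≫ (unaryInclusion hi).inl ≫ F)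
    {c : M.Ob} {x : Fin s → M.Ob} (U : ∀ t, Elt (q ⟶[V] i.obj (x t)))
    (m : Elt (M.Hom (Fin.append x a ∘ σ) c)) :
    (⟨_, coendπ q σ a (adjoinInr hi ≫ F) ((unaryInclusion hi).inl ≫ F) w c x ⋄ (tensEl U ⊙ m)⟩ :
        Op N.toSymMultigraph k (Multifunctor.obj ((unaryInclusion hi).inl ≫ F) c)) =
      Op.preAll (fun t => ((unaryInclusion hi).inr ((unaryInclusion hi).qArrows σ a
        (fun t => (⟨q, i.obj (x t), U t⟩ : UArr (E V B))) t)).map F)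
        (Op.map ((unaryInclusion hi).inl ≫ F) ⟨_, m⟩) := by
  have h : ∀ l, (Fin.append (fun t => Multifunctor.obj (adjoinInr hi ≫ F) (i.obj (x t)))
      (Multifunctor.obj ((unaryInclusion hi).inl ≫ F) ∘ a) ∘ σ) l =
      (Multifunctor.obj ((unaryInclusion hi).inl ≫ F) ∘ Fin.append x a ∘ σ) l := fun l =>
    comp_append (Multifunctor.obj ((unaryInclusion hi).inl ≫ F)) x a (σ l)
  have e := coendπ_ap (adjoinInr hi ≫ F) ((unaryInclusion hi).inl ≫ F) w U m h
  refine (congrArg (fun e => (⟨_, e⟩ : Op N.toSymMultigraph k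
    (Multifunctor.obj ((unaryInclusion hi).inl ≫ F) c))) e).trans ?_
  refine (Op.mk_preMany σ _ _ (Fin.append
    (fun t => (⟨_, _, unary (adjoinInr hi ≫ F) q (i.obj (x t)) ⋄ U t⟩ : UArr N))
    fun t => UArr.one N (Multifunctor.obj ((unaryInclusion hi).inl ≫ F) (a t)))
    (fun t => Fin.append_left _ _ _) fun t => Fin.append_right _ _ _).trans ?_
  refine (congrArg (Op.preAll _) (Op.mk_cast _ _)).trans ?_
  refine congrArg (fun W => Op.preAll W _) (funext (forall_positions σ (fun t => ?_) fun t => ?_))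
  · refine (append_symm_left σ _ _ t).trans (Eq.trans ?_ (congrArg (fun w =>
      ((unaryInclusion hi).inr w).map F) (qArrows_left _ t)).symm)
    exact (map_inr_mk hi F (U t)).symm
  · refine (append_symm_right σ _ _ t).trans (Eq.trans ?_ (congrArg (fun w =>
      ((unaryInclusion hi).inr w).map F) (qArrows_right _ t)).symm)
    refine Eq.trans ?_ (map_inr_mk hi F _).symm
    refine congrArg (UArr.mk _ _) ((congrArg (· ⋄ Elt.unit)
      (Multifunctor.map_one (adjoinInr hi ≫ F) (i.obj (a t)))).symm.trans (comp_ap _ _ _))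

theorem obj_comp_qTuple (t : Fin k) : insertQ q σ a (adjoinInr hi ≫ F)
    ((unaryInclusion hi).inl ≫ F) t =
      (Multifunctor.obj F ∘ (unaryInclusion hi).qTuple q σ a) t := by
  refine forall_positions σ (p := fun t => insertQ q σ a (adjoinInr hi ≫ F)
    ((unaryInclusion hi).inl ≫ F) t = (Multifunctor.obj F ∘ (unaryInclusion hi).qTuple q σ a) t)
    (fun t => ?_) (fun t => ?_) t
  · refine (append_symm_left σ _ _ t).trans ?_
    exact (congrArg (Multifunctor.obj F) (qTuple_left (i := unaryInclusion hi) (a := a) t)).symm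
  · refine (append_symm_right σ _ _ t).trans ?_
    exact (congrArg (Multifunctor.obj F) (qTuple_right (i := unaryInclusion hi) (q := q) t)).symm

/-- The comparison of the hom objects. -/
def homComparison (q : B) (σ : Fin k ≃ Fin (s + r)) (a : Fin r → M.Ob) (d : B) :
    (unaryInclusion hi).NHom ((unaryInclusion hi).qTuple q σ a) d ⟶
      N.Hom (insertQ q σ a (adjoinInr hi ≫ F) ((unaryInclusion hi).inl ≫ F))
        (Multifunctor.obj F d) :=
  Multifunctor.map F ((unaryInclusion hi).qTuple q σ a) d ≫ N.cast (obj_comp_qTuple hi F)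

instance [IsIso F] (d : B) : IsIso (homComparison hi F q σ a d) :=
  @IsIso.comp_isIso _ _ _ _ _ _ _ (isIso_map F _ _) (isIso_cast N _)

theorem mk_homComparison {d : B} {x : Fin s → M.Ob} {y : M.Ob}
    (U : ∀ t, Elt (q ⟶[V] i.obj (x t))) (m : Elt (M.Hom (Fin.append x a ∘ σ) y))
    (v : Elt (i.obj y ⟶[V] d)) :
    (⟨_, homComparison hi F q σ a d ⋄ qEl (A := E V B) (d := d) (unaryInclusion hi) σ U m v⟩ :
        Op N.toSymMultigraph k (Multifunctor.obj F d)) =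
      Op.post (Op.preAll (fun t => ((unaryInclusion hi).inr ((unaryInclusion hi).qArrows σ a
        (fun t => (⟨q, i.obj (x t), U t⟩ : UArr (E V B))) t)).map F)
        (Op.map ((unaryInclusion hi).inl ≫ F) ⟨_, m⟩))
        (((unaryInclusion hi).inr ⟨i.obj y, d, v⟩).map F) rfl := by
  refine (congrArg (fun e => (⟨_, e⟩ : Op N.toSymMultigraph k (Multifunctor.obj F d)))
    (comp_ap (Multifunctor.map F ((unaryInclusion hi).qTuple q σ a) d)
      (N.cast (obj_comp_qTuple hi F)) _)).trans ((Op.mk_cast (G := N.toSymMultigraph)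
        (y := Multifunctor.obj F d) (obj_comp_qTuple hi F) _).trans ?_)
  refine (congrArg (Op.map F) (mk_qEl (A := E V B) (i := unaryInclusion hi) U m v)).trans ?_
  exact map_ttOp (i := unaryInclusion hi) F _ _ (⟨i.obj y, d, v⟩ : UArr (E V B)) _ rfl rfl

variable [IsIso F]
  (w : E.map i ≫ adjoinInr hi ≫ F = counit M ≫ (unaryInclusion hi).inl ≫ F)

theorem isCoend_coendπ (c : M.Ob) : IsCoend (coendDiagram i q σ a c)
    (coendπ q σ a (adjoinInr hi ≫ F) ((unaryInclusion hi).inl ≫ F) w c) := by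
  refine isCoend_coendDiagram hi (homComparison hi F q σ a (i.obj c)) _ fun x U m => ?_
  refine Op.mk_inj ((mk_coendπ hi F w U m).trans (Eq.trans ?_
    (mk_homComparison hi F U m _).symm))
  have e : ((unaryInclusion hi).inr ⟨i.obj c, i.obj c, (E V B).one (i.obj c) ⋄ Elt.unit⟩).map F =
      UArr.one N (Multifunctor.obj ((unaryInclusion hi).inl ≫ F) c) :=
    (map_inr_mk hi F _).trans (congrArg (UArr.mk _ _) ((comp_ap _ _ _).symm.trans
      (congrArg (· ⋄ Elt.unit) (Multifunctor.map_one (adjoinInr hi ≫ F) (i.obj c)))))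
  exact (Op.post_one _ rfl).symm.trans (Op.cod_post_congr rfl e.symm rfl rfl rfl)

theorem isCoend_coendπ' (hks : ¬(k = 1 ∧ s = 1)) : IsCoend (coendDiagram' i q σ a)
    (coendπ' q σ a (adjoinInr hi ≫ F) ((unaryInclusion hi).inl ≫ F) w) := by
  refine isCoend_coendDiagram' hi hks (homComparison hi F q σ a q) _ fun x y U m v => ?_
  refine Op.mk_inj (Eq.trans ?_ (mk_homComparison hi F U m v).symm)
  refine (congrArg (fun e => (⟨_, e⟩ : Op N.toSymMultigraph k (Multifunctor.obj F q)))
    (coendπ'_ap (adjoinInr hi ≫ F) ((unaryInclusion hi).inl ≫ F) w (p := (x, y))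
      (tensEl U ⊙ m) v)).trans ?_
  refine (Op.mk_post (obj_eq _ _ w y).symm _ _).trans ?_
  exact Op.cod_post_congr (mk_coendπ hi F w U m) (map_inr_mk hi F v).symm _ rfl rfl

theorem isIso_unary_adjoinInr (b b' : B) : IsIso (unary (adjoinInr hi ≫ F) b b') := by
  have h : unary (adjoinInr hi) b b' = (unaryInclusion hi).κ rfl (single b) b' := by
    refine (spans_top _).ext fun e _ => ?_
    have h₁ := (UArr.mk_map (adjoinInr hi) (x := b) (y := b') e).symm.trans
      (map_adjoinInr hi (freeArr b b' e))
    injection h₁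
  have h₁ : IsIso (unary (adjoinInr hi) b b') := by
    rw [h]; exact isIso_κ (i := unaryInclusion hi) _ _
  exact @IsIso.comp_isIso _ _ _ _ _ _ _ h₁ (isIso_map F _ _)

theorem isFullFaithfulInclusion_inl :
    Multifunctor.IsFullFaithfulInclusion ((unaryInclusion hi).inl ≫ F) :=
  ⟨(bijective_obj F).1.comp hi.1, fun k a b =>
    @IsIso.comp_isIso _ _ _ _ _ _ _ (isIso_inl a b) (isIso_map F _ _)⟩

end Transport

end SymMulti

end

theorem lemma4p9 {V : Type u} [Category.{v} V] [MonoidalCategory V] [SymmetricCategory V]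
    [MonoidalClosed V] [HasColimits V]
    (M : SymMulticat.{v, u} V) (B : Type v) [EnrichedCategory V B]
    (i : EnrichedFunctor V M.Und B) (hi : SymMulticat.IsFullFaithfulInclusion i)
    (q : B) (hq : ∀ x : M.Ob, i.obj x ≠ q) (hB : ∀ b : B, b = q ∨ ∃ x : M.Ob, i.obj x = b) :
    HasPushout (SymMulticat.E.map i) (SymMulticat.counit M) ∧
    ∀ (N : SymMulticat.{v, u} V) (g : SymMulticat.E V B ⟶ N) (j : M ⟶ N)
      (sq : IsPushout (SymMulticat.E.map i) (SymMulticat.counit M) g j),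
      -- `M ⟶ N` is a full and faithful inclusion
      SymMulticat.Multifunctor.IsFullFaithfulInclusion j ∧
      -- the objects of `N` are those of `B`, that is, those of `M` and `q`
      Function.Bijective g.obj ∧
      -- unary morphisms `q ⟶ q`
      IsIso (SymMulticat.unary g q q) ∧
      -- morphisms with target in `M` and with `s` inputs equal to `q`, at any positions
      (∀ (s r k : ℕ) (σ : Fin k ≃ Fin (s + r)) (a : Fin r → M.Ob) (c : M.Ob),
        SymMulticat.IsCoend (SymMulticat.coendDiagram i q σ a c)
          (SymMulticat.coendπ q σ a g j sq.w c)) ∧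
      -- morphisms with target `q` and with `s` inputs equal to `q`, at any positions
      (∀ (s r k : ℕ) (σ : Fin k ≃ Fin (s + r)) (a : Fin r → M.Ob), ¬ (k = 1 ∧ s = 1) →
        SymMulticat.IsCoend (SymMulticat.coendDiagram' i q σ a)
          (SymMulticat.coendπ' q σ a g j sq.w)) := by
  refine ⟨(adjoin_isPushout hi).hasPushout, fun N g j sq => ?_⟩
  obtain ⟨e, rfl, rfl⟩ : ∃ e : (unaryInclusion hi).adjoin ≅ N,
      adjoinInr hi ≫ e.hom = g ∧ (unaryInclusion hi).inl ≫ e.hom = j :=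
    ⟨(adjoin_isPushout hi).isoIsPushout _ _ sq, (adjoin_isPushout hi).inl_isoIsPushout_hom _ _ sq,
      (adjoin_isPushout hi).inr_isoIsPushout_hom _ _ sq⟩
  exact ⟨isFullFaithfulInclusion_inl hi e.hom, bijective_obj e.hom,
    isIso_unary_adjoinInr hi e.hom q q, fun s r k σ a c => isCoend_coendπ hi e.hom sq.w c,
    fun s r k σ a hks => isCoend_coendπ' hi e.hom sq.w hks⟩
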